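/- **Theorem.** Let $\mathcal R$ be a commutative ring and let $f\in\mathcal R[x_1,\dots,x_n]$, $n\ge 1$, be given by a division-free straight-line program (SLP) with $L\ge 1$ instructions (each an addition, subtraction or multiplication of two operands, which are constants of $\mathcal R$, inputs or earlier results; the last result is $f$). Let $T\ge 1$ and $D\ge 2$ be integers such that $f$ has at most $T$ terms and $D>\deg f$ (total degree). Then the deterministic algorithm MPolySI described below, on input the SLP, $T$ and $D$, returns the list of all terms of $f$, each exactly once, using $$O^\sim\big(Ln^2T^2\log^2D+LnT\log^3D\big)\ \text{ ring operations in }\mathcal R\quad\text{and}\quad O^\sim\big(nT^2\log D+nT\log^2D\big)\ \text{ bit operations.}$$ Here a cost is $O^\sim(g)$ if it is at most $C\,g\,\log^k(g+2)$ with absolute constants $C,k$ (independent of $\mathcal R,n,L,T,D$ and $f$); $\log D$ is to base $2$. *Notation.* $a \bmod b\in\{0,\dots,b-1\}$ is the remainder; $\#g$ is the number of terms of $g$. For a polynomial $g$ in $n$ variables, $g^{\rm mod}_{(D,p)}=g(x,x^D,\dots,x^{D^{n-1}})\bmod (x^p-1)$ (for $n=1$: $g \bmod (x^p-1)$); $g_{(D,p)}$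 is the image of $g$ under $x_i\mapsto x^{D^{i-1}\bmod p}$ for all $i$; and $g_{(D,p,k)}$ is its image under $x_k\mapsto x^{(D^{k-1}\bmod p)+p}$, $x_i\mapsto x^{D^{i-1}\bmod p}$ ($i\ne k$). For $n,T,D$ put $N_1=\max\{1,\lceil n(T-1)\log D\rceil\}$ (with $T-1$ replaced by $0$ if $T=0$), $N_2=\lceil nT\log D\rceil$, $N=\max\{4N_1,N_1+N_2-1\}$. *Term test.* Given images $f_j$ modulo $x^{p_j}-1$ of a polynomial, a candidate term $u$ is accepted if $\#(f_j-u^{\rm mod}_{(D,p_j)})<\#f_j$ for at least $N_2$ of the indices $j\le N_1+N_2-1$. *UIPoly* (input: a univariate $g$ that can be probed modulo $x^q-1$, and bounds $T\ge\# g$, $D>\deg g$). Let $p_1,\dots,p_N$ be the first $N$ primes (with $n=1$ in $N_1,N_2,N$), $K$ the least number with $p_1\cdots p_K\ge D$, $f_j=g\bmod (x^{p_j}-1)$, $h=0$. While some $f_j$, $j\le N$, is nonzero: take the first $j_0$ for which $\#f_{j_0}$ is maximal and let $p=p_{j_0}$; probe $g_k=(g-h)\bmod(x^{pp_k}-1)$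 for $k\le K$; for every term $ax^d$ of $f_{j_0}$ such that for each $k$ the terms of $g_k$ with exponent $\equiv d \pmod p$ are just one term $ax^{b_k}$, let $\beta$ be the solution of $\beta\equiv b_k \pmod {p_k}$, $k\le K$, with $0\le\beta<p_1\cdots p_K$, and if $\beta<D$ make $ax^\beta$ a candidate; let $s$ be the sum of the accepted candidates (each counted once); replace $h$ by $h+s$, $f_j$ by $f_j-s\bmod(x^{p_j}-1)$, $T$ by $T-\#s$, and $N_1,N_2,N$ accordingly. Return $h$. *MPolySI.* Let $p_1,\dots,p_N$ be the first $N$ primes. If $p_N\ge D^n$, probe $f^{\rm mod}_{(D,p_N)}$, and read off the exponent vector of each term as the $D$-adic digits of its exponent. Otherwise probe $f_j=f^{\rm mod}_{(D,p_j)}$ for $j\le N$ and put $h=0$. While some $f_j$, $j\le N$, is nonzero: take the first $j_0$ with $\#f_{j_0}$ maximal and let $p=p_{j_0}$; let $k_0$ be such that $D^{k_0-2}<p\le D^{k_0-1}$; compute $F=(f-h)_{(D,p)}$ and $G_k=(f-h)_{(D,p,k)}$, $k_0\le k\le n$, by UIPoly with term bound $T$ and degree bounds $Dp$ and $2Dp$.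 For every term $ax^d$ of $f_{j_0}$ such that the terms of $F$, and those of each $G_k$, with exponent $\equiv d\pmod p$ are just one term $ax^u$, respectively $ax^{b_k}$, put $e_k=(b_k-u)/p$ for $k\ge k_0$; if these are integers in $[0,D)$ and $u-\sum_{k\ge k_0}e_k(D^{k-1}\bmod p)$ has a $D$-adic expansion $e_1+e_2D+\dots+e_{k_0-1}D^{k_0-2}$, then $ax_1^{e_1}\cdots x_n^{e_n}$ is a candidate. Let $s$ be the sum of the accepted candidates; replace $h$ by $h+s$, $f_j$ by $f_j-s^{\rm mod}_{(D,p_j)}$, $T$ by $T-\#s$, and $N_1,N_2,N$ accordingly. Return $h$. *Cost.* Additions, subtractions, multiplications and equality tests in $\mathcal R$ are ring operations. A probe of $f$ modulo $x^q-1$ executes the SLP in $\mathcal R[x]/(x^q-1)$; its ring operations are $n$ for setting up the inputs $x^{a_1},\dots,x^{a_n}$, $q$ for each addition or subtraction of the SLP, for each multiplication the least size of a straight-line program (with $1$ as the only constant) that multiplies two general elements of $\mathbb Z[a_0,\dots,a_{q-1},b_0,\dots,b_{q-1}][x]/(x^q-1)$, and $q$ zero tests; its bit operations are the lengths of its parameters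 and of the list of terms that it returns. All other work is on integers and on sparse polynomials: an addition, subtraction or comparison of integers of total binary length $s$ is charged $s$ bit operations, a multiplication or division with remainder $s\log^2 s$ (up to the rounding of the logarithm), and an access to a coefficient of a sparse polynomial the length of the exponent. The first $N$ primes are computed by a sieve, and residues modulo many primes by remainder trees. -/

import Mathlib

namespace SparseInterp

/-! ## Computations with a cost -/

/-- The result of a computation, together with the number `ring` of ring operations in the
coefficient ring and the number `bits` of bit operations that were spent on it. -/
structure Cost (α : Type*) where
  val : α
  ring : ℕ
  bits : ℕ

namespace Cost

/-- A value that is already there. -/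
def ret {α : Type*} (a : α) : Cost α := ⟨a, 0, 0⟩

/-- Sequential composition: the costs add up. -/
def bind {α β : Type*} (x : Cost α) (f : α → Cost β) : Cost β :=
  ⟨(f x.val).val, x.ring + (f x.val).ring, x.bits + (f x.val).bits⟩

/-- Run `f` on the entries of a list, from left to right. One bit operation per entry is charged
for walking along the list. -/
def map {α β : Type*} (f : α → Cost β) : List α → Cost (List β)
  | [] => ⟨[], 0, 1⟩
  | a :: l => (f a).bind fun b => (map f l).bind fun bs => ⟨b :: bs, 0, 1⟩

/-- The same with an abort: as soon as one entry gives `none`, the result is `none`. -/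
def mapOption {α β : Type*} (f : α → Cost (Option β)) : List α → Cost (Option (List β))
  | [] => ⟨some [], 0, 1⟩
  | a :: l => (f a).bind fun
    | none => ⟨none, 0, 1⟩
    | some b => (mapOption f l).bind fun
      | none => ⟨none, 0, 1⟩
      | some bs => ⟨some (b :: bs), 0, 1⟩

/-- A `for` loop over a list with a state. -/
def fold {α β : Type*} (f : β → α → Cost β) : β → List α → Cost β
  | b, [] => ⟨b, 0, 1⟩
  | b, a :: l => (f b a).bind fun c => (fold f c l).bind fun d => ⟨d, 0, 1⟩

end Cost

open Cost

/-! ## Integer arithmetic, charged by the length of the operands -/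

/-- Binary length of a natural number (at least one). -/
def len (a : ℕ) : ℕ := Nat.size a + 1

/-- Charge for one addition, subtraction or comparison: linear in the length of the operands. -/
def linBits (a b : ℕ) : ℕ := len a + len b

/-- Charge for one multiplication, division or remainder on operands of total length `s`:
`s * (log s) ^ 2`. -/
def mulBits (a b : ℕ) : ℕ := (len a + len b) * Nat.size (len a + len b) ^ 2

def addN (a b : ℕ) : Cost ℕ := ⟨a + b, 0, linBits a b⟩
def subN (a b : ℕ) : Cost ℕ := ⟨a - b, 0, linBits a b⟩
def leN (a b : ℕ) : Cost Bool := ⟨decide (a ≤ b), 0, linBits a b⟩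
def mulN (a b : ℕ) : Cost ℕ := ⟨a * b, 0, mulBits a b⟩
def divN (a b : ℕ) : Cost ℕ := ⟨a / b, 0, mulBits a b⟩
def modN (a b : ℕ) : Cost ℕ := ⟨a % b, 0, mulBits a b⟩

/-- The first `m` entries of a list. -/
def takeN {α : Type*} (m : ℕ) (l : List α) : Cost (List α) := ⟨l.take m, 0, l.length + len m⟩

/-- The power `D ^ m`, by repeated squaring. -/
def powN (D m : ℕ) : Cost ℕ :=
  if h : m = 0 then ⟨1, 0, 1⟩
  else (powN D (m / 2)).bind fun r => (mulN r r).bind fun s =>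
    if m % 2 = 0 then ⟨s, 0, len m⟩ else (mulN s D).bind fun v => ⟨v, 0, len m⟩
termination_by m
decreasing_by omega

/-- The integer `⌈m * log₂ D⌉`, as the rounded up binary logarithm of `D ^ m`. -/
def ceilMulLog (m D : ℕ) : Cost ℕ :=
  (powN D m).bind fun P => ⟨Nat.clog 2 P, 0, len P⟩

/-- The numbers `N₁ = max {1, ⌈n (T - 1) log₂ D⌉}`, `N₂ = ⌈n T log₂ D⌉` and
`N = max {4 N₁, N₁ + N₂ - 1}`. -/
def bounds (n T D : ℕ) : Cost (ℕ × ℕ × ℕ) :=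
  (mulN n (T - 1)).bind fun m₁ => (mulN n T).bind fun m₂ =>
  (ceilMulLog m₁ D).bind fun l₁ => (ceilMulLog m₂ D).bind fun N₂ =>
    ⟨(max 1 l₁, N₂, max (4 * max 1 l₁) (max 1 l₁ + N₂ - 1)), 0, 8 * (len l₁ + len N₂ + len T)⟩

/-- Sieve of Eratosthenes: the increasing list of the primes up to `B`. Every `i * j ≤ B` with
`2 ≤ i, j` is crossed out. -/
def sieve (B : ℕ) : Cost (List ℕ) :=
  (fold (fun (s : Finset ℕ) i => (divN B i).bind fun c =>
      fold (fun s j => (mulN i j).bind fun m => ⟨insert m s, 0, len m⟩) s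
        (List.range' 2 (c - 1)))
    ∅ (List.range' 2 (B - 1))).bind fun s =>
  ⟨(List.range' 2 (B - 1)).filter fun i => i ∉ s, 0, (B + 1) * len B⟩

/-- Sieve with a doubling bound, until `N` primes have been found. -/
def sieveFrom (N : ℕ) : ℕ → ℕ → Cost (List ℕ)
  | 0, _ => ret []
  | fuel + 1, B => (sieve B).bind fun ps =>
      if N ≤ ps.length then takeN N ps
      else (mulN 2 B).bind fun B₂ => sieveFrom N fuel B₂

/-- The first `N` primes. -/
def firstPrimes (N : ℕ) : Cost (List ℕ) := sieveFrom N (N + 1) 2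

/-- The shortest prefix `p₁, …, p_K` of a list of moduli with `M * p₁ ⋯ p_K ≥ D`. -/
def prefixTo (D : ℕ) : ℕ → List ℕ → Cost (List ℕ)
  | _, [] => ret []
  | M, p :: ps => (leN D M).bind fun done =>
      if done then ret []
      else (mulN M p).bind fun M₁ => (prefixTo D M₁ ps).bind fun qs => ⟨p :: qs, 0, 1⟩

/-- Product of a list of numbers, by halving the list. -/
def prodTree (ms : List ℕ) : Cost ℕ :=
  if h : ms.length ≤ 1 then ⟨ms.headD 1, 0, 1⟩
  else
    (prodTree (ms.take (ms.length / 2))).bind fun a =>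
    (prodTree (ms.drop (ms.length / 2))).bind fun b =>
    (mulN a b).bind fun c => ⟨c, 0, ms.length⟩
termination_by ms.length
decreasing_by all_goals (simp only [List.length_take, List.length_drop]; omega)

/-- The residues of `x` modulo all entries of a list, by a remainder tree. -/
def multiMod (x : ℕ) (ms : List ℕ) : Cost (List ℕ) :=
  if h : ms.length ≤ 1 then map (fun m => modN x m) ms
  else
    (prodTree (ms.take (ms.length / 2))).bind fun a => (modN x a).bind fun y =>
    (prodTree (ms.drop (ms.length / 2))).bind fun b => (modN x b).bind fun z =>
    (multiMod y (ms.take (ms.length / 2))).bind fun r =>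
    (multiMod z (ms.drop (ms.length / 2))).bind fun s => ⟨r ++ s, 0, ms.length⟩
termination_by ms.length
decreasing_by all_goals (simp only [List.length_take, List.length_drop]; omega)

/-- The pair of `e₁ + e₂ D + ⋯ + e_m D ^ (m - 1)` and `D ^ m`, by halving the list of digits. -/
def evalDigits (D : ℕ) (es : List ℕ) : Cost (ℕ × ℕ) :=
  if h : es.length ≤ 1 then ⟨(es.headD 0, if es.length = 0 then 1 else D), 0, 1⟩
  else
    (evalDigits D (es.take (es.length / 2))).bind fun a =>
    (evalDigits D (es.drop (es.length / 2))).bind fun b =>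
    (mulN a.2 b.1).bind fun v => (addN a.1 v).bind fun w => (mulN a.2 b.2).bind fun P =>
      ⟨(w, P), 0, es.length⟩
termination_by es.length
decreasing_by all_goals (simp only [List.length_take, List.length_drop]; omega)

/-- The `m` lowest `D`-adic digits of `d` (lowest digit first), and what is left of `d`. -/
def digitsN (D : ℕ) : ℕ → ℕ → Cost (List ℕ × ℕ)
  | 0, d => ret ([], d)
  | m + 1, d => (modN d D).bind fun r => (divN d D).bind fun q =>
      (digitsN D m q).bind fun s => ⟨(r :: s.1, s.2), 0, 1⟩

/-- The list of the residues of `w, w D, w D ^ 2, …` (`m` entries) modulo `p`. -/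
def powersMod (D p : ℕ) : ℕ → ℕ → Cost (List ℕ)
  | 0, _ => ret []
  | m + 1, w => (modN w p).bind fun r => (mulN r D).bind fun v =>
      (powersMod D p m v).bind fun rs => ⟨r :: rs, 0, 1⟩

/-- The least `κ` with `p ≤ D ^ κ` (search starts at `κ` with `M = D ^ κ`). -/
def findExp (D p : ℕ) : ℕ → ℕ → ℕ → Cost ℕ
  | 0, _, κ => ret κ
  | fuel + 1, M, κ => (leN p M).bind fun done =>
      if done then ret κ else (mulN M D).bind fun M₁ => findExp D p fuel M₁ (κ + 1)

/-- `∑ aᵢ bᵢ`. -/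
def dotN (as bs : List ℕ) : Cost ℕ :=
  fold (fun s (ab : ℕ × ℕ) => (mulN ab.1 ab.2).bind fun m => addN s m) 0 (as.zip bs)

/-- A solution `t < p` of `r + s t ≡ e` modulo `p`, by search (`0` if there is none). -/
def solveMod (r s e p : ℕ) : Cost ℕ :=
  fold (fun t₀ t => (mulN s t).bind fun m => (addN r m).bind fun v => (modN v p).bind fun w =>
    ⟨if w = e then t else t₀, 0, linBits w e⟩) 0 (List.range p)

/-- Chinese remaindering: the list holds pairs (residue, modulus), with coprime moduli. -/
def chineseRem (rs : List (ℕ × ℕ)) : Cost ℕ :=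
  (fold (fun (st : ℕ × ℕ) (ep : ℕ × ℕ) =>
      (modN st.1 ep.2).bind fun r => (modN st.2 ep.2).bind fun s =>
      (solveMod r s ep.1 ep.2).bind fun t => (mulN st.2 t).bind fun m =>
      (addN st.1 m).bind fun x => (mulN st.2 ep.2).bind fun M => ret (x, M))
    (0, 1) rs).bind fun st => ret st.1

/-! ## Straight-line programs -/

/-- An operand of an instruction: a constant, an input, or the result of the instruction with the
given number (counted from `0`). -/
inductive Operand (K σ : Type*) where
  | const (c : K)
  | input (i : σ)
  | prev (j : ℕ)

inductive ArithOp where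
  | add
  | sub
  | mul

structure Instr (K σ : Type*) where
  op : ArithOp
  lhs : Operand K σ
  rhs : Operand K σ

/-- A (division-free) straight-line program with constants in `K` and inputs indexed by `σ`. Its
size is the number of its instructions. -/
abbrev SLP (K σ : Type*) := List (Instr K σ)

/-- Value of an operand, given the constants, the inputs and the results so far. A reference to an
instruction that has not been executed yet counts as `0`. -/
def Operand.eval {K σ A : Type*} [Zero A] (κ : K → A) (x : σ → A) (vals : List A) :
    Operand K σ → A
  | .const c => κ c
  | .input i => x i
  | .prev j => vals.getD j 0

def ArithOp.eval {A : Type*} [Ring A] : ArithOp → A → A → A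
  | .add, a, b => a + b
  | .sub, a, b => a - b
  | .mul, a, b => a * b

/-- The results of all instructions in a ring `A`; `red` is applied to the result of each
instruction (`id`, or reduction modulo an ideal). -/
def SLP.run {K σ A : Type*} [Ring A] (red : A → A) (κ : K → A) (x : σ → A) (Γ : SLP K σ) :
    List A :=
  Γ.foldl (fun vals g =>
    vals ++ [red (g.op.eval (g.lhs.eval κ x vals) (g.rhs.eval κ x vals))]) []

noncomputable section

open Polynomial
open scoped Classical

/-- The polynomial computed by a straight-line program: the result of its last instruction. -/
def SLP.poly {R σ : Type*} [CommRing R] (Γ : SLP R σ) : MvPolynomial σ R :=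
  (Γ.run id MvPolynomial.C MvPolynomial.X).getLastD 0

/-- The straight-line program `Γ`, without constants other than `1`, computes the product of
`∑ aᵢ xⁱ` and `∑ bᵢ xⁱ` modulo `x ^ q - 1` for indeterminate `aᵢ`, `bᵢ` (hence in every
commutative ring): the `k`-th coefficient is the result of instruction number `out k`. -/
def ComputesCyclicProduct (q : ℕ) (Γ : SLP Unit (Fin q ⊕ Fin q)) (out : Fin q → ℕ) : Prop :=
  ∀ k : Fin q,
    (Γ.run (A := MvPolynomial (Fin q ⊕ Fin q) ℤ) id (fun _ => 1) MvPolynomial.X).getD (out k) 0 =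
      ∑ i : Fin q, ∑ j : Fin q,
        if (i.val + j.val) % q = k.val then
          MvPolynomial.X (Sum.inl i) * MvPolynomial.X (Sum.inr j) else 0

/-- The number of ring operations for one multiplication in `R[x] / (x ^ q - 1)`: the least size
of a straight-line program that computes the coefficients of the product. -/
def cyclicMulCost (q : ℕ) : ℕ :=
  sInf {s | ∃ (Γ : SLP Unit (Fin q ⊕ Fin q)) (out : Fin q → ℕ),
    ComputesCyclicProduct q Γ out ∧ Γ.length = s}

/-- The number of ring operations for one instruction, executed in `R[x] / (x ^ q - 1)`. -/
def ArithOp.cyclicCost (q : ℕ) : ArithOp → ℕ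
  | .add => q
  | .sub => q
  | .mul => cyclicMulCost q

variable {R : Type*} [CommRing R] {n : ℕ}

/-- Reduction modulo `x ^ q - 1`. -/
def redMod (q : ℕ) (g : R[X]) : R[X] := g %ₘ (X ^ q - 1)

/-! ## Sparse univariate polynomials

They are stored by their nonzero terms, so that a coefficient is found or changed at a cost
given by the length of the exponent, and with their number of terms. -/

/-- Charge for writing down the terms of `g`. -/
def termBits (g : R[X]) : ℕ := 1 + ∑ e ∈ g.support, (len e + 1)

/-- One probe: `f (x ^ a₀, …, x ^ aₙ₋₁) mod (x ^ q - 1)`, obtained by executing the program of `f`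
in `R[x] / (x ^ q - 1)`. The ring operations are those for setting up the `n` inputs,
those of all instructions, and a test for zero of each of the `q` coefficients of the result. -/
def probe (Γ : SLP R (Fin n)) (a : Fin n → ℕ) (q : ℕ) : Cost R[X] :=
  let g : R[X] := (Γ.run (redMod q) C fun i => redMod q (X ^ a i)).getLastD 0
  ⟨g, n + (Γ.map fun s => s.op.cyclicCost q).sum + q, len q + termBits g⟩

/-- Probe of `f (x, x ^ D, …, x ^ (D ^ (n - 1))) mod (x ^ p - 1)`. -/
def probeMod (Γ : SLP R (Fin n)) (D p : ℕ) : Cost R[X] :=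
  (probe Γ (fun i => D ^ i.val) p).bind fun g => ⟨g, 0, len D⟩

/-- Probe modulo `x ^ q - 1` of the substitution `xᵢ ↦ x ^ (D ^ (i - 1) mod p)`. -/
def probeSub (Γ : SLP R (Fin n)) (D p q : ℕ) : Cost R[X] :=
  (probe Γ (fun i => D ^ i.val % p) q).bind fun g => ⟨g, 0, len D + len p⟩

/-- Probe modulo `x ^ q - 1` of the same substitution with `p` added to the exponent for the
variable with index `k` (counted from `0`). -/
def probeSubAt (Γ : SLP R (Fin n)) (D p k q : ℕ) : Cost R[X] :=
  (probe Γ (fun i => if i.val = k then D ^ i.val % p + p else D ^ i.val % p) q).bind fun g =>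
    ⟨g, 0, len D + len p + len k⟩

/-- The number of terms of `g`. -/
def numTerms (g : R[X]) : Cost ℕ := ⟨g.support.card, 0, len g.support.card⟩

/-- The list of the terms of `g`, as pairs (exponent, coefficient), with increasing exponents. -/
def termList (g : R[X]) : Cost (List (ℕ × R)) :=
  ⟨(g.support.sort (· ≤ ·)).map fun e => (e, g.coeff e), 0, termBits g⟩

/-- `g - c x ^ e`: one subtraction and one test for zero. -/
def subTerm (g : R[X]) (e : ℕ) (c : R) : Cost R[X] := ⟨g - monomial e c, 2, len e⟩

/-- Does `g - c x ^ e` have fewer terms than `g`? One subtraction and one test for zero. -/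
def dropsTerm (g : R[X]) (e : ℕ) (c : R) : Cost Bool :=
  ⟨decide ((g - monomial e c).support.card < g.support.card), 2, len e⟩

/-- `g - ∑ c x ^ (e mod q)`, the sum being over the pairs `(e, c)` in the list. -/
def subTermsMod (q : ℕ) (g : R[X]) (h : List (ℕ × R)) : Cost R[X] :=
  fold (fun g (t : ℕ × R) => (modN t.1 q).bind fun e => subTerm g e t.2) g h

/-- Subtract the image of the term `c x ^ E` modulo `x ^ pⱼ - 1` from `fⱼ`, for all `j`. -/
def subFromAll (ps : List ℕ) (fs : List R[X]) (t : ℕ × R) : Cost (List R[X]) :=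
  (multiMod t.1 ps).bind fun es =>
  map (fun (ge : R[X] × ℕ) => subTerm ge.1 ge.2 t.2) (fs.zip es)

/-- The number of `j` such that subtracting the image of `c x ^ E` modulo `x ^ pⱼ - 1` lowers the
number of terms of `fⱼ`. -/
def countDrops (ps : List ℕ) (fs : List R[X]) (t : ℕ × R) : Cost ℕ :=
  (multiMod t.1 ps).bind fun es =>
  fold (fun m (ge : R[X] × ℕ) => (dropsTerm ge.1 ge.2 t.2).bind fun b =>
    if b then addN m 1 else ret m) 0 (fs.zip es)

/-- The first pair `(pⱼ, fⱼ)` for which the number of terms of `fⱼ` is maximal, and this number;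
it is `(_, 0, 0)` if all `fⱼ` are zero. -/
def firstMax (ps : List ℕ) (fs : List R[X]) : Cost (ℕ × R[X] × ℕ) :=
  fold (fun (best : ℕ × R[X] × ℕ) (pg : ℕ × R[X]) => (numTerms pg.2).bind fun m =>
    (leN m best.2.2).bind fun b => if b then ret best else ret (pg.1, pg.2, m))
    (1, 0, 0) (ps.zip fs)

/-- Sort terms by their exponents modulo `p`: the result maps `d` to the list of the terms whose
exponent is congruent to `d`. -/
def classes (p : ℕ) (F : List (ℕ × R)) : Cost (ℕ → List (ℕ × R)) :=
  ⟨fun d => F.filter fun t => t.1 % p = d, 0, 1 + (F.map fun t => mulBits t.1 p + len t.1).sum⟩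

/-- If the class of `d` consists of one term, with coefficient `a`, then the exponent of it. -/
def single (B : ℕ → List (ℕ × R)) (d : ℕ) (a : R) : Cost (Option ℕ) :=
  ⟨match B d with
    | [t] => if t.2 = a then some t.1 else none
    | _ => none, 1, len d⟩

/-! ## The univariate algorithm -/

/-- Algorithm `UTerms`: candidates for the terms of a univariate polynomial of degree less than
`D`, from its image `g` modulo `x ^ p - 1` and its images `gs` modulo `x ^ (p pₖ) - 1`, where
`p₁, p₂, …` are the entries of `ks`. -/
def uTerms (g : R[X]) (gs : List R[X]) (p : ℕ) (ks : List ℕ) (D : ℕ) : Cost (List (ℕ × R)) :=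
  (map (fun g => (termList g).bind fun F => classes p F) gs).bind fun Bs =>
  (termList g).bind fun ts =>
  fold (fun U (t : ℕ × R) =>
    (mapOption (fun (Bk : (ℕ → List (ℕ × R)) × ℕ) => (single Bk.1 t.1 t.2).bind fun
        | none => ret none
        | some b => (modN b Bk.2).bind fun e => ret (some (e, Bk.2))) (Bs.zip ks)).bind fun
      | none => ret U
      | some rs => (chineseRem rs).bind fun β => (leN D β).bind fun big =>
          if big then ret U else ⟨U ++ [(β, t.2)], 0, len β⟩) [] ts

/-- Pick those candidates `c x ^ E` that lower the number of terms for at least `N₂` of the given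
primes. A monomial that has been picked already is passed over: the candidates form a set. -/
def pickU (ps : List ℕ) (fs : List R[X]) (N₂ : ℕ) (U : List (ℕ × R)) : Cost (List (ℕ × R)) :=
  fold (fun s (t : ℕ × R) =>
    if t.1 ∈ s.map Prod.fst then ⟨s, 0, len t.1⟩
    else (countDrops ps fs t).bind fun m => (leN N₂ m).bind fun b =>
      if b then ⟨s ++ [t], 0, len t.1⟩ else ⟨s, 0, len t.1⟩) [] U

/-- The `while` loop of `UIPoly`, executed at most `fuel` times. `P q` probes a polynomial
modulo `x ^ q - 1`, the list `h₀` is a polynomial to be subtracted from it, `h` lists the terms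
that have been found; `fs` are the images of what is left, modulo `x ^ p - 1` for the `p` in
`ps`. -/
def uiLoop (P : ℕ → Cost R[X]) (h₀ : List (ℕ × R)) (D : ℕ) (ks ps : List ℕ) :
    ℕ → ℕ → List R[X] → List (ℕ × R) → Cost (List (ℕ × R))
  | 0, _, _, h => ret h
  | fuel + 1, T, fs, h =>
    (bounds 1 T D).bind fun N =>
    (takeN N.2.2 fs).bind fun fs => (takeN N.2.2 ps).bind fun ps =>
    (firstMax ps fs).bind fun best =>
    if best.2.2 = 0 then ret h
    else
      (map (fun r => (mulN best.1 r).bind fun q => (P q).bind fun g =>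
        subTermsMod q g (h₀ ++ h)) ks).bind fun gs =>
      (uTerms best.2.1 gs best.1 ks D).bind fun U =>
      (takeN (N.1 + N.2.1 - 1) fs).bind fun fs₁ => (takeN (N.1 + N.2.1 - 1) ps).bind fun ps₁ =>
      (pickU ps₁ fs₁ N.2.1 U).bind fun s =>
      (subN T s.length).bind fun T₁ =>
      (fold (subFromAll ps) fs s).bind fun fs₂ =>
      uiLoop P h₀ D ks ps fuel T₁ fs₂ (h ++ s)

/-- Algorithm `UIPoly`: the terms of the univariate polynomial `g - h₀`, with at most `T` terms
and degree less than `D`, where `P q` probes `g` modulo `x ^ q - 1` and `h₀` is a list of terms. -/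
def uiPoly (P : ℕ → Cost R[X]) (h₀ : List (ℕ × R)) (T D : ℕ) : Cost (List (ℕ × R)) :=
  (bounds 1 T D).bind fun N =>
  (firstPrimes N.2.2).bind fun ps =>
  (prefixTo D 1 ps).bind fun ks =>
  (map P ps).bind fun fs₀ =>
  (fold (subFromAll ps) fs₀ h₀).bind fun fs =>
  uiLoop P h₀ D ks ps T T fs []

/-! ## The multivariate algorithm

A term `c x₁ ^ e₁ ⋯ xₙ ^ eₙ` is stored as the pair `([e₁, …, eₙ], c)`. -/

/-- Algorithm `MTerms`: candidates for the terms of a multivariate polynomial with exponents less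
than `D`, from its image `g` under `xᵢ ↦ x ^ (D ^ (i - 1))` modulo `x ^ p - 1`, its image `F` under
`xᵢ ↦ x ^ (D ^ (i - 1) mod p)`, and its images `Fs` under the modified substitutions for the
variables number `κ + 1, …, n`, where `κ` is least with `p ≤ D ^ κ`; `ws` is the list of the
`D ^ (i - 1) mod p`. -/
def mTerms (g : R[X]) (F : List (ℕ × R)) (Fs : List (List (ℕ × R))) (p D κ : ℕ) (ws : List ℕ) :
    Cost (List (List ℕ × R)) :=
  (classes p F).bind fun B => (map (classes p) Fs).bind fun Bs =>
  (termList g).bind fun ts =>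
  fold (fun S (t : ℕ × R) => (single B t.1 t.2).bind fun
    | none => ret S
    | some u =>
      (mapOption (fun B₁ => (single B₁ t.1 t.2).bind fun
          | none => ret none
          | some b => (leN u b).bind fun le => (subN b u).bind fun v =>
              (modN v p).bind fun r => (divN v p).bind fun e => (leN D e).bind fun big =>
              if le = true ∧ r = 0 ∧ big = false then ret (some e) else ret none) Bs).bind fun
        | none => ret S
        | some es => (dotN es (ws.drop κ)).bind fun v => (leN v u).bind fun le =>
            (subN u v).bind fun b => (digitsN D κ b).bind fun low =>
            if le = true ∧ low.2 = 0 then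
              ⟨S ++ [(low.1 ++ es, t.2)], 0, (low.1.map len).sum + (es.map len).sum + 1⟩
            else ret S) [] ts

/-- Exponent of the image of a term under `xᵢ ↦ x ^ (D ^ (i - 1))`. -/
def kronTerm (D : ℕ) (t : List ℕ × R) : Cost (ℕ × R) :=
  (evalDigits D t.1).bind fun E => ret (E.1, t.2)

/-- Pick those candidates that lower the number of terms for at least `N₂` of the given primes. -/
def pickM (D : ℕ) (ps : List ℕ) (fs : List R[X]) (N₂ : ℕ) (M : List (List ℕ × R)) :
    Cost (List (List ℕ × R)) :=
  fold (fun s (t : List ℕ × R) => (kronTerm D t).bind fun E =>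
    (countDrops ps fs E).bind fun m => (leN N₂ m).bind fun b =>
      if b then ⟨s ++ [t], 0, (t.1.map len).sum + 1⟩ else ret s) [] M

/-- The `while` loop of `MPolySI`, executed at most `fuel` times; `h` lists the terms of `f` that
have been found, `fs` are the images of `f - h` modulo `x ^ p - 1` for the `p` in `ps`. -/
def mLoop (Γ : SLP R (Fin n)) (D : ℕ) (ps : List ℕ) :
    ℕ → ℕ → List R[X] → List (List ℕ × R) → Cost (List (List ℕ × R))
  | 0, _, _, h => ret h
  | fuel + 1, T, fs, h =>
    (bounds n T D).bind fun N =>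
    (takeN N.2.2 fs).bind fun fs => (takeN N.2.2 ps).bind fun ps =>
    (firstMax ps fs).bind fun best =>
    if best.2.2 = 0 then ret h
    else
      let p := best.1
      (powersMod D p n 1).bind fun ws =>
      (findExp D p n 1 0).bind fun κ =>
      (mulN D p).bind fun Dp => (mulN 2 Dp).bind fun Dp₂ =>
      (map (fun (t : List ℕ × R) => (dotN t.1 ws).bind fun E => ret (E, t)) h).bind fun hE =>
      (uiPoly (probeSub Γ D p) (hE.map fun t => (t.1, t.2.2)) T Dp).bind fun F =>
      (map (fun k =>
        (map (fun (t : ℕ × (List ℕ × R)) => (mulN p (t.2.1.getD k 0)).bind fun v =>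
          (addN t.1 v).bind fun E => ⟨(E, t.2.2), 0, len k⟩) hE).bind fun hk =>
        uiPoly (probeSubAt Γ D p k) hk T Dp₂) (List.range' κ (n - κ))).bind fun Fs =>
      (mTerms best.2.1 F Fs p D κ ws).bind fun M =>
      (takeN (N.1 + N.2.1 - 1) fs).bind fun fs₁ => (takeN (N.1 + N.2.1 - 1) ps).bind fun ps₁ =>
      (pickM D ps₁ fs₁ N.2.1 M).bind fun s =>
      (subN T s.length).bind fun T₁ =>
      (map (kronTerm D) s).bind fun sE =>
      (fold (subFromAll ps) fs sE).bind fun fs₂ =>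
      mLoop Γ D ps fuel T₁ fs₂ (h ++ s)

/-- Algorithm `MPolySI`: the list of the terms of the polynomial `f` computed by the straight-line
program `Γ`, for a bound `T` for the number of terms of `f` and a bound `D` such that
`D > deg f`. -/
def mPolySI (Γ : SLP R (Fin n)) (T D : ℕ) : Cost (List (List ℕ × R)) :=
  (bounds n T D).bind fun N =>
  (firstPrimes N.2.2).bind fun ps =>
  (powN D n).bind fun Dn =>
  (leN Dn (ps.getLastD 0)).bind fun big =>
  if big then
    (probeMod Γ D (ps.getLastD 0)).bind fun g => (termList g).bind fun ts =>
    map (fun (t : ℕ × R) => (digitsN D n t.1).bind fun es => ret (es.1, t.2)) ts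
  else
    (map (probeMod Γ D) ps).bind fun fs => mLoop Γ D ps T T fs []

/-- The list is the sparse form of `f`: it contains every term of `f` exactly once, as a pair of
the list of the `n` exponents and the coefficient, and nothing else. -/
def IsSparseForm (h : List (List ℕ × R)) (f : MvPolynomial (Fin n) R) : Prop :=
  h.Perm (f.support.toList.map fun m => (List.ofFn fun i => m i, f.coeff m))

/-- `L n² T² log² D + L n T log³ D`, with binary logarithms. -/
def ringBound (L n T D : ℕ) : ℝ :=
  L * n ^ 2 * T ^ 2 * Real.logb 2 D ^ 2 + L * n * T * Real.logb 2 D ^ 3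

/-- `n T² log D + n T log² D`, with binary logarithms. -/
def bitBound (n T D : ℕ) : ℝ :=
  n * T ^ 2 * Real.logb 2 D + n * T * Real.logb 2 D ^ 2

end

end SparseInterp

/-! Why the answer is correct. Everything is read off from one univariate polynomial, the Kronecker
image `kron D f`. As all exponents of f are below D, the exponents `e < D ^ n` of this image
correspond to the monomials of f through their D-adic digits, and every image that the algorithm
probes arises from it by moving each monomial e to another exponent (`subst_eq_push_kron`,
`redMod_eq_push`). Subtracting terms that have been found commutes with such moves
(`push_sub_listPoly`), so each round only concerns the remainder r of the Kronecker image.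

Two exponents below M collide modulo a prime p exactly if p divides their difference. The primes
modulo which E collides with one of at most T other exponents therefore all divide one positive
number below `M ^ T`, and there are fewer than N of them as soon as `M ^ T ≤ 2 ^ N`
(`card_collision_lt`). This has three consequences. A term of r is alone in its residue class modulo
all but at most N₁ - 1 primes. By double counting, some prime among 4 N₁ of them preserves three
quarters of the terms (`exists_prime_many_terms`); the same then holds for the prime whose image has
most terms, and at least half of the terms are alone modulo that prime
(`card_le_two_mul_card_loneSet`). Finally, the term test on N₁ + N₂ - 1 primes accepts precisely the
terms of r (`term_test_iff`).

A term alone modulo p remains the only member of its class in every image that preserves exponents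
modulo p, and so it can be reconstructed: by Chinese remaindering from the images modulo p pₖ in one
variable (`uTerms_sat`), and in several variables by comparing the exponent u in F with u + p eₖ in
Gₖ, the low digits being left over once the high ones are subtracted (`mTerms_sat`). Classes with
collisions may yield wrong candidates, but the test rejects those. Each round thus removes at least
half of the remaining terms, and a logarithmic number of rounds suffices.

Why it is fast. Let l be of the order of log (n T log D) plus a large constant, and Λ = len D + 3 l.
All logarithmic factors and constants are swallowed by powers of l. By a Chebyshev bound the m-th
prime is at most (m + 1) l. With W = n T Λ, the initial images cost O(W) probes of modulus O(W l),
hence about L W² ring operations. A round calls the univariate algorithm at most n + 1 times. One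
call makes O(T Λ) probes of modulus O(T Λ l) and, in each of its rounds, at most Λ probes of modulus
O(T Λ · Λ l²), so that it costs about L (T² Λ² + T Λ³) ring and T Λ (T + Λ) bit operations. Adding
up gives both bounds (`MContext.mPolySI_sat`).

This rests on quasi-linear multiplication modulo x^q - 1 over an arbitrary commutative ring. In the
manner of Schönhage and of Cantor and Kaltofen, recursive Fourier transforms of radix p whose roots
of unity are powers of x give p^κ times the product without any division (`Gen.mulStep`). This is
done for p = 2 and p = 3, and a Bézout relation between the two powers isolates the product
(`Gen.cyclicConvolution`). -/

namespace CyclicMul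

open SparseInterp hiding single

/-! ### Ring operations as derivations between sets of ring elements -/

section Generation

/-- With `s` ring operations one can get from the elements of `X` and `1` to elements among which
are those of `Y`. -/
inductive Gen {B : Type*} [CommRing B] : ℕ → Set B → Set B → Prop
  | base {X Y : Set B} : Y ⊆ insert 1 X → Gen 0 X Y
  | step {s : ℕ} {X Y : Set B} (o : ArithOp) (u v : B) : u ∈ insert 1 X → v ∈ insert 1 X →
      Gen s (insert (o.eval u v) X) Y → Gen (s + 1) X Y

namespace Gen

variable {B : Type*} [CommRing B] {X X' Y Y' Z : Set B} {s s' t : ℕ}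

theorem mono_left (h : Gen s X Y) (hX : X ⊆ X') : Gen s X' Y := by
  induction h generalizing X' with
  | base h => exact .base (h.trans (Set.insert_subset_insert hX))
  | step o u v hu hv _ ih =>
    exact .step o u v (Set.insert_subset_insert hX hu) (Set.insert_subset_insert hX hv)
      (ih (Set.insert_subset_insert hX))

theorem mono_right (h : Gen s X Y) (hY : Y' ⊆ Y) : Gen s X Y' := by
  induction h with
  | base h => exact .base (hY.trans h)
  | step o u v hu hv _ ih => exact .step o u v hu hv (ih hY)

theorem succ (h : Gen s X Y) : Gen (s + 1) X Y :=
  .step .add 1 1 (by simp) (by simp) (h.mono_left (Set.subset_insert _ _))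

theorem mono_steps (h : Gen s X Y) (hs : s ≤ s') : Gen s' X Y := by
  induction hs with
  | refl => exact h
  | step _ ih => exact ih.succ

theorem of_subset (h : Y ⊆ X) : Gen s X Y :=
  mono_steps (.base (h.trans (Set.subset_insert _ _))) (Nat.zero_le _)

/-- Computed elements are never discarded, so a second derivation may start from everything known
after the first, and the results of both remain available. -/
theorem trans (h : Gen s X Y) (h' : Gen t (X ∪ Y) Z) : Gen (s + t) X (Y ∪ Z) := by
  induction h with
  | base h =>
    rw [Nat.zero_add]
    rename_i X Y
    -- Without any step `Y` may still contain the free constant 1, so `X ∪ Y` can exceed `X`. The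
    -- induction on the second derivation therefore allows every starting set inside `insert 1 X`.
    have key : ∀ {t : ℕ} {W Z : Set B}, Gen t W Z → ∀ X, W ⊆ insert 1 X → ∀ Y, Y ⊆ insert 1 X →
        Gen t X (Y ∪ Z) := by
      intro t W Z h
      induction h with
      | base h =>
        intro X hX Y hY
        exact .base (Set.union_subset hY (h.trans (Set.insert_subset (by simp) hX)))
      | step o u v hu hv _ ih =>
        intro X hX Y hY
        refine .step o u v (Set.insert_subset (by simp) hX hu) (Set.insert_subset (by simp) hX hv)
          (ih _ ?_ _ ?_)
        · refine Set.insert_subset (by simp) (hX.trans ?_)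
          exact Set.insert_subset_insert (Set.subset_insert _ _)
        · exact hY.trans (Set.insert_subset_insert (Set.subset_insert _ _))
    exact key h' X (Set.union_subset (Set.subset_insert _ _) h) Y h
  | step o u v hu hv _ ih =>
    rw [Nat.add_right_comm]
    exact .step o u v hu hv (ih (h'.mono_left
      (Set.union_subset_union_left _ (Set.subset_insert _ _))))

/-- Composition, forgetting the intermediate results. -/
theorem comp (h : Gen s X Y) (h' : Gen t (X ∪ Y) Z) : Gen (s + t) X Z :=
  (h.trans h').mono_right Set.subset_union_right

theorem union (h : Gen s X Y) (h' : Gen t X Z) : Gen (s + t) X (Y ∪ Z) :=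
  h.trans (h'.mono_left Set.subset_union_left)

theorem biUnion {ι : Type*} (I : Finset ι) (Y : ι → Set B) {c : ℕ}
    (h : ∀ i ∈ I, Gen c X (Y i)) : Gen (I.card * c) X (⋃ i ∈ I, Y i) := by
  classical
  induction I using Finset.induction_on with
  | empty => exact of_subset (by simp)
  | insert a I ha ih =>
    rw [Finset.card_insert_of_notMem ha, Nat.succ_mul, Nat.add_comm, Finset.set_biUnion_insert]
    exact (h a (by simp)).union (ih fun i hi => h i (by simp [hi]))

theorem op (o : ArithOp) {u v : B} (hu : u ∈ X) (hv : v ∈ X) : Gen 1 X {o.eval u v} :=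
  .step o u v (by simp [hu]) (by simp [hv]) (.base (by simp))

theorem add {u v : B} (hu : u ∈ X) (hv : v ∈ X) : Gen 1 X {u + v} := op .add hu hv
theorem sub {u v : B} (hu : u ∈ X) (hv : v ∈ X) : Gen 1 X {u - v} := op .sub hu hv
theorem mul {u v : B} (hu : u ∈ X) (hv : v ∈ X) : Gen 1 X {u * v} := op .mul hu hv

theorem zero : Gen 1 X {0} :=
  .step .sub 1 1 (by simp) (by simp) (.base (by simp [ArithOp.eval]))

/-- Horner's rule in base 2: one doubling and at most one addition of 1 for each binary digit. The
extra operation produces 0 as 1 - 1. -/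
theorem natCast (m : ℕ) : Gen (2 * Nat.size m + 1) X {(m : B)} := by
  induction m using Nat.strong_induction_on with
  | _ m ih =>
    rcases Nat.eq_zero_or_pos m with rfl | hm
    · simpa using zero (X := X)
    have hs : Nat.size (m / 2) + 1 ≤ Nat.size m := by
      have h1 : 0 < Nat.size m := Nat.size_pos.2 hm
      have : Nat.size (m / 2) ≤ Nat.size m - 1 := by
        rw [Nat.size_le]
        have := Nat.lt_size_self m
        rw [Nat.div_lt_iff_lt_mul (by norm_num), ← pow_succ]
        rwa [Nat.sub_add_cancel h1]
      omega
    have h := ih (m / 2) (by omega)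
    have hd : Gen 1 (X ∪ {((m / 2 : ℕ) : B)}) {((m / 2 : ℕ) : B) + ((m / 2 : ℕ) : B)} :=
      add (by simp) (by simp)
    have h2 := h.comp hd
    rcases Nat.mod_two_eq_zero_or_one m with h0 | h1
    · refine (h2.mono_right ?_).mono_steps (by omega)
      rw [Set.singleton_subset_iff, Set.mem_singleton_iff, ← Nat.cast_add]
      congr 1; omega
    · have h3 : Gen 1 (X ∪ {((m / 2 : ℕ) : B) + ((m / 2 : ℕ) : B)})
          {((m / 2 : ℕ) : B) + ((m / 2 : ℕ) : B) + 1} :=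
        .step .add (((m / 2 : ℕ) : B) + ((m / 2 : ℕ) : B)) 1 (by simp) (by simp)
          (.base (by simp [ArithOp.eval]))
      refine ((h2.comp h3).mono_right ?_).mono_steps (by omega)
      rw [Set.singleton_subset_iff, Set.mem_singleton_iff]
      have : m = m / 2 + m / 2 + 1 := by omega
      conv_lhs => rw [this]
      push_cast; rfl

end Gen

open AddMonoidAlgebra

/-! ### Arithmetic in B[x] / (x^M - 1) and the fast Fourier transform -/

section Algebra

variable {B : Type*} [CommRing B] {M : ℕ} {X : Set B}

/-- The coefficients of an element of `B[x] / (x ^ M - 1)`. -/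
def coeffs (a : AddMonoidAlgebra B (ZMod M)) : Set B := Set.range fun g => a.coeff g

theorem mem_coeffs (a : AddMonoidAlgebra B (ZMod M)) (g : ZMod M) : a.coeff g ∈ coeffs a :=
  ⟨g, rfl⟩

/-- Multiplication by a power of x only permutes the coefficients. This is what makes the twiddle
factors of the Fourier transform free of charge. -/
theorem coeffs_single_mul (g : ZMod M) (a : AddMonoidAlgebra B (ZMod M)) :
    coeffs (single g 1 * a) ⊆ coeffs a := by
  rintro _ ⟨h, rfl⟩
  simp only [coeff_single_mul_apply, one_mul]
  exact mem_coeffs _ _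

theorem single_one_pow (g : ZMod M) (i : ℕ) :
    (single g 1 : AddMonoidAlgebra B (ZMod M)) ^ i = single (i • g) 1 := by
  rw [single_pow, one_pow]

theorem coeffs_single_pow_mul (g : ZMod M) (i : ℕ) (a : AddMonoidAlgebra B (ZMod M)) :
    coeffs ((single g 1) ^ i * a) ⊆ coeffs a := by
  rw [single_one_pow]; exact coeffs_single_mul _ _

/-- Adding up monomials costs one operation for each of them. -/
theorem Gen.sumSingle {ι : Type*} (I : Finset ι) (g : ι → ZMod M) (b : ι → B)
    (h : ∀ i ∈ I, b i ∈ X) : Gen (I.card + 1) X (coeffs (∑ i ∈ I, single (g i) (b i))) := by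
  classical
  induction I using Finset.induction_on with
  | empty =>
    refine (Gen.zero.mono_right ?_).mono_steps (by omega)
    rintro _ ⟨g, rfl⟩; simp
  | insert a I ha ih =>
    rw [Finset.sum_insert ha, Finset.card_insert_of_notMem ha]
    have h1 := ih fun i hi => h i (by simp [hi])
    set S := ∑ i ∈ I, single (g i) (b i) with hS
    have h2 : Gen 1 (X ∪ coeffs S) {b a + S.coeff (g a)} :=
      Gen.add (Or.inl (h a (by simp))) (Or.inr (mem_coeffs _ _))
    refine ((h1.trans h2).mono_right ?_).mono_steps (by omega)
    rintro _ ⟨k, rfl⟩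
    simp only [coeff_add, coeff_single, Finsupp.add_apply]
    by_cases hk : g a = k
    · subst hk; simp
    · left
      rw [Finsupp.single_apply, if_neg hk, zero_add]
      exact mem_coeffs _ _

variable [NeZero M]

theorem Gen.ofCoeffs {c : ℕ} (a : AddMonoidAlgebra B (ZMod M))
    (h : ∀ g, Gen c X {a.coeff g}) : Gen (M * c) X (coeffs a) := by
  have := Gen.biUnion (X := X) (Finset.univ : Finset (ZMod M)) (fun g => {a.coeff g})
    (fun g _ => h g)
  rw [Finset.card_univ, ZMod.card] at this
  refine this.mono_right ?_
  rintro _ ⟨g, rfl⟩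
  simp

theorem Gen.algAdd {a b : AddMonoidAlgebra B (ZMod M)} (ha : coeffs a ⊆ X) (hb : coeffs b ⊆ X) :
    Gen M X (coeffs (a + b)) := by
  have := Gen.ofCoeffs (X := X) (c := 1) (a + b) fun g =>
    Gen.add (ha (mem_coeffs a g)) (hb (mem_coeffs b g))
  rwa [mul_one] at this

theorem Gen.algSub {a b : AddMonoidAlgebra B (ZMod M)} (ha : coeffs a ⊆ X) (hb : coeffs b ⊆ X) :
    Gen M X (coeffs (a - b)) := by
  have := Gen.ofCoeffs (X := X) (c := 1) (a - b) fun g =>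
    Gen.sub (ha (mem_coeffs a g)) (hb (mem_coeffs b g))
  rwa [mul_one] at this

theorem Gen.algSum (n : ℕ) (f : ℕ → AddMonoidAlgebra B (ZMod M))
    (h : ∀ i < n, coeffs (f i) ⊆ X) : Gen (n * M + 1) X (coeffs (∑ i ∈ Finset.range n, f i)) := by
  induction n with
  | zero =>
    refine (Gen.zero.mono_right ?_).mono_steps (by omega)
    rintro _ ⟨g, rfl⟩; simp
  | succ n ih =>
    rw [Finset.sum_range_succ]
    have h1 := ih fun i hi => h i (by omega)
    have h2 : Gen M (X ∪ coeffs (∑ i ∈ Finset.range n, f i))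
        (coeffs (∑ i ∈ Finset.range n, f i + f n)) :=
      Gen.algAdd Set.subset_union_right ((h n (by omega)).trans Set.subset_union_left)
    exact (h1.comp h2).mono_steps (by rw [Nat.succ_mul]; omega)

theorem sum_range_mul {A : Type*} [AddCommMonoid A] (p m : ℕ) (f : ℕ → A) :
    ∑ l ∈ Finset.range (p * m), f l =
      ∑ r ∈ Finset.range p, ∑ l ∈ Finset.range m, f (p * l + r) := by
  induction m with
  | zero => simp
  | succ m ih =>
    rw [Nat.mul_succ, Finset.sum_range_add, ih, ← Finset.sum_add_distrib]
    refine Finset.sum_congr rfl fun r _ => ?_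
    rw [Finset.sum_range_succ]

/-- The radix `p` fast Fourier transform, with a power of `x` as root of unity. -/
theorem Gen.fft (p : ℕ) (hp : 0 < p) (j : ℕ) (g : ZMod M) (hg : (p ^ j) • g = 0)
    (v : ℕ → AddMonoidAlgebra B (ZMod M)) (hv : ∀ l < p ^ j, coeffs (v l) ⊆ X) :
    Gen (j * (p ^ j * ((p + 1) * M))) X
      (⋃ i, coeffs (∑ l ∈ Finset.range (p ^ j), (single g 1) ^ (i * l) * v l)) := by
  induction j generalizing g v with
  | zero =>
    refine of_subset ?_
    simp only [pow_zero, Finset.range_one, Finset.sum_singleton, mul_zero, one_mul]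
    simpa using hv 0 (by simp)
  | succ j ih =>
    have ihr : ∀ r ∈ Finset.range p, Gen (j * (p ^ j * ((p + 1) * M))) X
        (⋃ i, coeffs (∑ l ∈ Finset.range (p ^ j), (single (p • g) 1) ^ (i * l) * v (p * l + r))) := by
      intro r hr
      refine ih (p • g) ?_ (fun l => v (p * l + r)) fun l hl => hv _ ?_
      · rw [← mul_smul, ← pow_succ]; exact hg
      · have := Finset.mem_range.1 hr
        calc p * l + r < p * l + p := by omega
          _ = p * (l + 1) := by ring
          _ ≤ p * p ^ j := Nat.mul_le_mul_left _ hl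
          _ = p ^ (j + 1) := by ring
    have h1 := Gen.biUnion (Finset.range p) _ ihr
    set W := ⋃ r ∈ Finset.range p, ⋃ i, coeffs (∑ l ∈ Finset.range (p ^ j),
      (single (p • g) (1 : B)) ^ (i * l) * v (p * l + r)) with hW
    have h2 : ∀ i ∈ Finset.range (p ^ (j + 1)), Gen (p * M + 1) (X ∪ W)
        (coeffs (∑ l ∈ Finset.range (p ^ (j + 1)), (single g 1) ^ (i * l) * v l)) := by
      intro i _
      -- Decimation: writing the summation index as p l + r, the inner sums are transforms of length
      -- p^j with respect to the p-th power of the root of unity.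
      have he : ∑ l ∈ Finset.range (p ^ (j + 1)), (single g (1 : B)) ^ (i * l) * v l =
          ∑ r ∈ Finset.range p, (single g (1 : B)) ^ (i * r) * ∑ l ∈ Finset.range (p ^ j),
            (single (p • g) (1 : B)) ^ (i * l) * v (p * l + r) := by
        rw [pow_succ', sum_range_mul]
        refine Finset.sum_congr rfl fun r _ => ?_
        rw [Finset.mul_sum]
        refine Finset.sum_congr rfl fun l _ => ?_
        rw [← mul_assoc, ← single_one_pow, ← pow_mul, ← pow_add]
        congr 2; ring
      rw [he]
      refine Gen.algSum p _ fun r hr => ?_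
      refine (coeffs_single_pow_mul _ _ _).trans (Set.Subset.trans ?_ Set.subset_union_right)
      refine Set.Subset.trans ?_ (Set.subset_biUnion_of_mem (Finset.mem_range.2 hr))
      exact Set.subset_iUnion (fun i => coeffs (∑ l ∈ Finset.range (p ^ j),
        (single (p • g) (1 : B)) ^ (i * l) * v (p * l + r))) i
    have h3 := h1.comp (Gen.biUnion (Finset.range (p ^ (j + 1))) _ h2)
    refine (h3.mono_right ?_).mono_steps ?_
    -- The outputs are indexed by all natural numbers i, but the transform is periodic in i with
    -- period p^(j + 1), so finitely many of them have been computed.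
    · refine Set.iUnion_subset fun i => ?_
      have hi : i % p ^ (j + 1) ∈ Finset.range (p ^ (j + 1)) :=
        Finset.mem_range.2 (Nat.mod_lt _ (by positivity))
      refine Set.Subset.trans ?_ (Set.subset_biUnion_of_mem (u := fun i =>
        coeffs (∑ l ∈ Finset.range (p ^ (j + 1)), (single g 1) ^ (i * l) * v l)) hi)
      refine Eq.subset ?_
      congr 1
      refine Finset.sum_congr rfl fun l _ => ?_
      congr 1
      have h1 : (single g (1 : B)) ^ p ^ (j + 1) = 1 := by
        rw [single_one_pow, hg, AddMonoidAlgebra.one_def]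
      conv_lhs => rw [← Nat.mod_add_div i (p ^ (j + 1)), add_mul, pow_add, mul_assoc, pow_mul _ (p ^ (j+1)), h1,
        one_pow, mul_one]
    · rw [Finset.card_range, Finset.card_range]
      -- This pays for the one operation in `Gen.algSum` that creates the zero of an empty sum.
      have : 1 ≤ M := Nat.one_le_iff_ne_zero.2 (NeZero.ne M)
      calc p * (j * (p ^ j * ((p + 1) * M))) + p ^ (j + 1) * (p * M + 1)
          ≤ p * (j * (p ^ j * ((p + 1) * M))) + p ^ (j + 1) * (p * M + M) := by gcongr
        _ = (j + 1) * (p ^ (j + 1) * ((p + 1) * M)) := by ring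

end Algebra

end Generation

end CyclicMul

namespace CyclicMul

open SparseInterp hiding single
open AddMonoidAlgebra

/-! ### One level of the recursive multiplication modulo x^(p^k) - 1 -/

section Recursion

open Polynomial (aeval)

/-- Every nonzero subgroup of a cyclic group of order p^(m + 1) contains the subgroup of order p.
Explicitly, the gcd of e with p^(m + 1) is p^v with v ≤ m, and Bézout's identity expresses it as a
multiple of e. -/
theorem exists_nsmul_eq {p m : ℕ} (hp : p.Prime) (e : ZMod (p ^ (m + 1))) (he : e ≠ 0) :
    ∃ x : ℕ, x • e = ((p ^ m : ℕ) : ZMod (p ^ (m + 1))) := by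
  have : NeZero (p ^ (m + 1)) := ⟨pow_ne_zero _ hp.ne_zero⟩
  obtain ⟨v, hv, hg⟩ := (Nat.dvd_prime_pow hp).1 (Nat.gcd_dvd_right e.val (p ^ (m + 1)))
  have hv' : v ≤ m := by
    by_contra hc
    have hvm : v = m + 1 := by omega
    have h1 : p ^ v ∣ e.val := hg ▸ Nat.gcd_dvd_left _ _
    rw [hvm] at h1
    have h2 := ZMod.val_lt e
    have h3 : e.val = 0 := Nat.eq_zero_of_dvd_of_lt h1 h2
    exact he ((ZMod.val_eq_zero e).1 h3)
  have hb := Nat.gcd_eq_gcd_ab e.val (p ^ (m + 1))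
  refine ⟨((Nat.gcdA e.val (p ^ (m + 1)) : ZMod (p ^ (m + 1))) * (p ^ (m - v) : ℕ)).val, ?_⟩
  rw [nsmul_eq_mul, ZMod.natCast_zmod_val]
  have h4 : ((e.val.gcd (p ^ (m + 1)) : ℤ) : ZMod (p ^ (m + 1))) =
      e * (Nat.gcdA e.val (p ^ (m + 1)) : ZMod (p ^ (m + 1))) := by
    rw [hb]; push_cast
    rw [ZMod.natCast_zmod_val]
    have : ((p : ZMod (p ^ (m + 1))) ^ (m + 1)) = 0 := by
      have := ZMod.natCast_self (p ^ (m + 1)); push_cast at this; exact this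
    rw [this]; ring
  rw [hg] at h4
  have h5 : p ^ m = p ^ v * p ^ (m - v) := by rw [← pow_add]; congr 1; omega
  rw [h5, Nat.cast_mul]
  have h4' : ((p ^ v : ℕ) : ZMod (p ^ (m + 1))) =
      e * (Nat.gcdA e.val (p ^ (m + 1)) : ZMod (p ^ (m + 1))) := by exact_mod_cast h4
  rw [h4']; ring

variable {B : Type*} [CommRing B]

/-- Multiplication by `1 - x ^ (p ^ m)` makes `x` a principal root of unity of order
`p ^ (m + 1)`. -/
theorem one_sub_mul_geom_sum {p m : ℕ} (hp : p.Prime) (e : ZMod (p ^ (m + 1))) (he : e ≠ 0) :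
    (1 - single ((p ^ m : ℕ) : ZMod (p ^ (m + 1))) (1 : B)) *
      ∑ i ∈ Finset.range (p ^ (m + 1)), (single e 1) ^ i = 0 := by
  obtain ⟨x, hx⟩ := exists_nsmul_eq hp e he
  rw [← hx, ← single_one_pow]
  -- With ζ = x^e the first factor is 1 - ζ^x, a multiple of 1 - ζ; and 1 - ζ times the geometric
  -- sum telescopes to 1 - ζ^(p^(m + 1)) = 0.
  obtain ⟨c, hc⟩ := sub_dvd_pow_sub_pow (1 : AddMonoidAlgebra B (ZMod (p ^ (m + 1)))) (single e 1) x
  rw [one_pow] at hc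
  rw [hc, mul_right_comm]
  have h1 : (single e (1 : B)) ^ (p ^ (m + 1)) = 1 := by
    rw [single_one_pow, nsmul_eq_mul, ZMod.natCast_self, zero_mul, AddMonoidAlgebra.one_def]
  have h2 := mul_neg_geom_sum (single e (1 : B)) (p ^ (m + 1))
  rw [h2, h1, sub_self, zero_mul]

/-- Evaluation of a bivariate polynomial. -/
noncomputable def evalTwo {A : Type*} [CommRing A] [Algebra B A] (y z : A) :
    Polynomial (Polynomial B) →+* A :=
  Polynomial.eval₂RingHom (aeval y).toRingHom z

theorem evalTwo_eq_sum {A : Type*} [CommRing A] [Algebra B A] (y z : A) {n : ℕ}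
    {P : Polynomial (Polynomial B)} (hP : P.natDegree < n) :
    evalTwo y z P = ∑ l ∈ Finset.range n, z ^ l * aeval y (P.coeff l) := by
  rw [evalTwo, Polynomial.coe_eval₂RingHom, Polynomial.eval₂_eq_sum_range' _ hP]
  exact Finset.sum_congr rfl fun l _ => mul_comm _ _

theorem aeval_single {M : ℕ} (g : ZMod M) {n : ℕ} {P : Polynomial B} (hP : P.natDegree < n) :
    aeval (single g (1 : B)) P = ∑ i ∈ Finset.range n, single (i • g) (P.coeff i) := by
  rw [Polynomial.aeval_eq_sum_range' hP]
  refine Finset.sum_congr rfl fun i _ => ?_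
  rw [single_one_pow, AddMonoidAlgebra.smul_single, smul_eq_mul, mul_one]

theorem coeff_aeval_single {M : ℕ} [NeZero M] {P : Polynomial B} (hP : P.natDegree < M)
    (g : ZMod M) : (aeval (single (1 : ZMod M) (1 : B)) P).coeff g = P.coeff g.val := by
  rw [aeval_single _ hP, AddMonoidAlgebra.coeff_sum, Finsupp.finsetSum_apply,
    Finset.sum_eq_single g.val]
  · simp
  · intro i hi hne
    rw [AddMonoidAlgebra.coeff_single, Finsupp.single_apply, if_neg]
    rintro rfl
    apply hne
    rw [nsmul_eq_mul, mul_one, ZMod.val_natCast, Nat.mod_eq_of_lt (Finset.mem_range.1 hi)]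
  · intro h
    exact absurd (Finset.mem_range.2 (ZMod.val_lt g)) h

/-- The bivariate polynomial that turns into `a` under `Y ↦ x`, `Z ↦ x ^ t`. -/
noncomputable def lift {M : ℕ} (s t : ℕ) (a : AddMonoidAlgebra B (ZMod M)) :
    Polynomial (Polynomial B) :=
  ∑ l ∈ Finset.range s, Polynomial.monomial l
    (∑ i ∈ Finset.range t, Polynomial.monomial i (a.coeff ((t * l + i : ℕ) : ZMod M)))

section Lift

variable {M s t : ℕ} (a : AddMonoidAlgebra B (ZMod M))

theorem lift_coeff (l : ℕ) : (lift s t a).coeff l = if l < s then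
    ∑ i ∈ Finset.range t, Polynomial.monomial i (a.coeff ((t * l + i : ℕ) : ZMod M)) else 0 := by
  rw [lift, Polynomial.finsetSum_coeff]
  simp only [Polynomial.coeff_monomial, Finset.sum_ite_eq', Finset.mem_range]

theorem lift_coeff_coeff (l i : ℕ) : ((lift s t a).coeff l).coeff i =
    if l < s ∧ i < t then a.coeff ((t * l + i : ℕ) : ZMod M) else 0 := by
  rw [lift_coeff]
  by_cases hl : l < s
  · rw [if_pos hl, Polynomial.finsetSum_coeff]
    simp only [Polynomial.coeff_monomial, Finset.sum_ite_eq', Finset.mem_range, hl, true_and]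
  · simp [hl]

theorem natDegree_lift : (lift s t a).natDegree ≤ s - 1 := by
  rw [Polynomial.natDegree_le_iff_coeff_eq_zero]
  intro l hl
  rw [lift_coeff, if_neg (by omega)]

theorem natDegree_lift_coeff (l : ℕ) : ((lift s t a).coeff l).natDegree ≤ t - 1 := by
  rw [Polynomial.natDegree_le_iff_coeff_eq_zero]
  intro i hi
  rw [lift_coeff_coeff, if_neg (by omega)]

theorem evalTwo_lift (hM : s * t = M) (hs : 0 < s) (ht : 0 < t) :
    evalTwo (single (1 : ZMod M) (1 : B)) (single (1 : ZMod M) (1 : B) ^ t) (lift s t a) = a := by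
  have hM0 : NeZero M := ⟨by rw [← hM]; positivity⟩
  rw [evalTwo_eq_sum (n := s) _ _ (by have := natDegree_lift (s := s) (t := t) a; omega)]
  have h1 : ∀ l ∈ Finset.range s, (single (1 : ZMod M) (1 : B) ^ t) ^ l *
      aeval (single (1 : ZMod M) (1 : B)) ((lift s t a).coeff l) =
      ∑ i ∈ Finset.range t, single ((t * l + i : ℕ) : ZMod M) (a.coeff ((t * l + i : ℕ) : ZMod M)) := by
    intro l hl
    rw [aeval_single (n := t) _ (by have := natDegree_lift_coeff (s := s) (t := t) a l; omega),
      ← pow_mul, single_one_pow, Finset.mul_sum]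
    refine Finset.sum_congr rfl fun i hi => ?_
    rw [lift_coeff_coeff, if_pos ⟨Finset.mem_range.1 hl, Finset.mem_range.1 hi⟩,
      AddMonoidAlgebra.single_mul_single, one_mul]
    congr 1
    simp
  rw [Finset.sum_congr rfl h1]
  have h2 := sum_range_mul t s fun j => single (j : ZMod M) (a.coeff (j : ZMod M))
  rw [Finset.sum_comm, ← h2, mul_comm t s, hM]
  ext g
  rw [AddMonoidAlgebra.coeff_sum, Finsupp.finsetSum_apply, Finset.sum_eq_single g.val]
  · simp
  · intro i hi hne
    rw [AddMonoidAlgebra.coeff_single, Finsupp.single_apply, if_neg]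
    rintro rfl
    apply hne
    rw [ZMod.val_natCast, Nat.mod_eq_of_lt (Finset.mem_range.1 hi)]
  · intro h
    exact absurd (Finset.mem_range.2 (ZMod.val_lt g)) h

end Lift

theorem natDegree_coeff_mul_le {P Q : Polynomial (Polynomial B)} {t : ℕ}
    (hP : ∀ l, (P.coeff l).natDegree ≤ t) (hQ : ∀ l, (Q.coeff l).natDegree ≤ t) (l : ℕ) :
    ((P * Q).coeff l).natDegree ≤ 2 * t := by
  rw [Polynomial.coeff_mul]
  refine Polynomial.natDegree_sum_le_of_forall_le _ _ fun x _ => ?_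
  refine Polynomial.natDegree_mul_le.trans ?_
  have := hP x.1; have := hQ x.2; omega

/-- Orthogonality of the powers of x: for l ≠ k the geometric sum of x^(l - k) is killed by the
factor 1 - x^(p^m), and for l = k it equals p^(m + 1). That number need not be invertible in `B`, so
it stays as a factor. -/
theorem inverse_dft {p m : ℕ} (hp : p.Prime) {P : Polynomial (Polynomial B)}
    (hP : P.natDegree < p ^ (m + 1)) {k : ℕ} (hk : k < p ^ (m + 1)) :
    (1 - single ((p ^ m : ℕ) : ZMod (p ^ (m + 1))) (1 : B)) *
      ∑ i ∈ Finset.range (p ^ (m + 1)), (single (-1 : ZMod (p ^ (m + 1))) 1) ^ (k * i) *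
        evalTwo (single (1 : ZMod (p ^ (m + 1))) (1 : B)) (single 1 1 ^ i) P =
    (p ^ (m + 1)) • ((1 - single ((p ^ m : ℕ) : ZMod (p ^ (m + 1))) (1 : B)) *
      aeval (single (1 : ZMod (p ^ (m + 1))) (1 : B)) (P.coeff k)) := by
  have : NeZero (p ^ (m + 1)) := ⟨pow_ne_zero _ hp.ne_zero⟩
  have h1 : ∀ i ∈ Finset.range (p ^ (m + 1)), (single (-1 : ZMod (p ^ (m + 1))) (1 : B)) ^ (k * i) *
        evalTwo (single (1 : ZMod (p ^ (m + 1))) (1 : B)) (single 1 1 ^ i) P =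
      ∑ l ∈ Finset.range (p ^ (m + 1)), (single ((l : ZMod (p ^ (m + 1))) - k) 1) ^ i *
        aeval (single (1 : ZMod (p ^ (m + 1))) (1 : B)) (P.coeff l) := by
    intro i _
    rw [evalTwo_eq_sum _ _ hP, Finset.mul_sum]
    refine Finset.sum_congr rfl fun l _ => ?_
    rw [← mul_assoc]
    congr 1
    rw [← pow_mul, single_one_pow, single_one_pow, single_one_pow,
      AddMonoidAlgebra.single_mul_single, one_mul]
    congr 1
    simp only [nsmul_eq_mul]; push_cast; ring
  rw [Finset.sum_congr rfl h1, Finset.sum_comm, Finset.mul_sum,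
    Finset.sum_eq_single_of_mem k (Finset.mem_range.2 hk)]
  · rw [sub_self]
    have : ∀ i ∈ Finset.range (p ^ (m + 1)), (single (0 : ZMod (p ^ (m + 1))) (1 : B)) ^ i *
        aeval (single (1 : ZMod (p ^ (m + 1))) (1 : B)) (P.coeff k) =
        aeval (single (1 : ZMod (p ^ (m + 1))) (1 : B)) (P.coeff k) := by
      intro i _
      rw [← AddMonoidAlgebra.one_def, one_pow, one_mul]
    rw [Finset.sum_congr rfl this, Finset.sum_const, Finset.card_range, mul_smul_comm]
  · intro l hl hne
    rw [← Finset.sum_mul, ← mul_assoc, one_sub_mul_geom_sum hp, zero_mul]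
    intro h0
    apply hne
    have h2 : (l : ZMod (p ^ (m + 1))) = k := sub_eq_zero.1 h0
    rw [ZMod.natCast_eq_natCast_iff'] at h2
    rwa [Nat.mod_eq_of_lt (Finset.mem_range.1 hl), Nat.mod_eq_of_lt hk] at h2

/-- The factor 1 - x^(p^m) loses no information on a polynomial of low degree: the shifted copy
occupies exponents from p^m up to less than 2 p^m ≤ p^(m + 1), away from the exponents below d. -/
theorem coeff_one_sub_mul {p m : ℕ} (hp : p.Prime) {P : Polynomial B} {d : ℕ}
    (hP : P.natDegree < d) (hd : d ≤ p ^ m) {i : ℕ} (hi : i < d) :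
    ((1 - single ((p ^ m : ℕ) : ZMod (p ^ (m + 1))) (1 : B)) *
      aeval (single (1 : ZMod (p ^ (m + 1))) (1 : B)) P).coeff (i : ZMod (p ^ (m + 1))) =
      P.coeff i := by
  have : NeZero (p ^ (m + 1)) := ⟨pow_ne_zero _ hp.ne_zero⟩
  have h2 : 2 * p ^ m ≤ p ^ (m + 1) := by
    rw [pow_succ']; exact Nat.mul_le_mul_right _ hp.two_le
  have hM : P.natDegree < p ^ (m + 1) := by omega
  rw [sub_mul, one_mul, AddMonoidAlgebra.coeff_sub, Finsupp.sub_apply, coeff_single_mul_apply,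
    coeff_aeval_single hM, coeff_aeval_single hM, ZMod.val_natCast, Nat.mod_eq_of_lt (by omega)]
  have : (-((p ^ m : ℕ) : ZMod (p ^ (m + 1))) + (i : ZMod (p ^ (m + 1)))) =
      ((p ^ (m + 1) - p ^ m + i : ℕ) : ZMod (p ^ (m + 1))) := by
    rw [Nat.cast_add, Nat.cast_sub (by omega), ZMod.natCast_self]; ring
  rw [this, ZMod.val_natCast, Nat.mod_eq_of_lt (by omega),
    Polynomial.coeff_eq_zero_of_natDegree_lt (n := p ^ (m + 1) - p ^ m + i) (by omega)]
  ring

/-- Factors of length p^(r + h) become polynomials in Z of degree below p^r whose coefficients are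
polynomials in Y of degree below p^h. Working modulo Y^(p^(h + 2)) - 1 does not wrap around, and Y
supplies roots of unity of order p^(h + 2), more than the Z-degree of the product. Two forward
transforms, p^(h + 2) recursive products and one inverse transform suffice; the inverse transform
contributes the new factor p^(h + 2). -/
theorem Gen.mulStep {p : ℕ} (hp : p.Prime) (h r w κ : ℕ) (hr : r ≤ h)
    (rec : ∀ (X : Set B) (a b : AddMonoidAlgebra B (ZMod (p ^ (h + 2)))), coeffs a ⊆ X →
      coeffs b ⊆ X → Gen w X (coeffs (p ^ κ • (a * b))))
    (X : Set B) (a b : AddMonoidAlgebra B (ZMod (p ^ (r + h)))) (ha : coeffs a ⊆ X)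
    (hb : coeffs b ⊆ X) :
    Gen (p ^ (h + 2) * w + 3 * ((h + 2) * (p ^ (h + 2) * ((p + 1) * p ^ (h + 2)))) +
      2 * p ^ r * p ^ (h + 2) + (2 * p ^ r * (2 * p ^ h) + 2)) X
      (coeffs (p ^ (κ + (h + 2)) • (a * b))) := by
  have h0 : ∀ n, NeZero (p ^ n) := fun n => ⟨pow_ne_zero _ hp.ne_zero⟩
  set M := p ^ (h + 2) with hM
  set s := p ^ r with hs
  set t := p ^ h with ht
  have hs0 : 0 < s := Nat.pos_of_ne_zero (h0 r).1
  have ht0 : 0 < t := Nat.pos_of_ne_zero (h0 h).1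
  have hst : s ≤ t := Nat.pow_le_pow_right hp.pos hr
  have h2t : 2 * t ≤ p ^ (h + 1) := by
    rw [pow_succ']; exact Nat.mul_le_mul_right _ hp.two_le
  have h2M : 2 * p ^ (h + 1) ≤ M := by
    rw [hM, pow_succ' p (h + 1)]; exact Nat.mul_le_mul_right _ hp.two_le
  have hst' : s * t = p ^ (r + h) := by rw [pow_add]
  set P := lift s t a with hP
  set Q := lift s t b with hQ
  have dP : P.natDegree ≤ s - 1 := natDegree_lift a
  have dQ : Q.natDegree ≤ s - 1 := natDegree_lift b
  have dP' : ∀ l, (P.coeff l).natDegree ≤ t - 1 := natDegree_lift_coeff a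
  have dQ' : ∀ l, (Q.coeff l).natDegree ≤ t - 1 := natDegree_lift_coeff b
  have dPQ : (P * Q).natDegree < 2 * s := by
    have := Polynomial.natDegree_mul_le (p := P) (q := Q); omega
  have dPQ' : ∀ l, ((P * Q).coeff l).natDegree < 2 * t := fun l => by
    have := natDegree_coeff_mul_le dP' dQ' l; omega
  set y : AddMonoidAlgebra B (ZMod M) := single 1 1 with hy
  -- the constant zero
  have g0 : Gen 1 X {0} := Gen.zero
  have hcoef : ∀ c : AddMonoidAlgebra B (ZMod (p ^ (r + h))), coeffs c ⊆ X →
      ∀ l, coeffs (aeval y ((lift s t c).coeff l)) ⊆ X ∪ {0} := by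
    rintro c hc l _ ⟨g, rfl⟩
    have := natDegree_lift_coeff (s := s) (t := t) c l
    simp only [hy]
    rw [coeff_aeval_single (by omega), lift_coeff_coeff]
    split_ifs
    · exact Or.inl (hc (mem_coeffs _ _))
    · exact Or.inr rfl
  -- forward transforms
  have fwd : ∀ c : AddMonoidAlgebra B (ZMod (p ^ (r + h))), coeffs c ⊆ X →
      Gen ((h + 2) * (M * ((p + 1) * M))) (X ∪ {0})
        (⋃ i : ℕ, coeffs (evalTwo y (y ^ i) (lift s t c))) := by
    intro c hc
    have := Gen.fft (X := X ∪ {0}) p hp.pos (h + 2) (1 : ZMod M)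
      (by rw [nsmul_eq_mul, ← hM, ZMod.natCast_self, zero_mul])
      (fun l => aeval y ((lift s t c).coeff l)) (fun l _ => hcoef c hc l)
    refine this.mono_right (Set.iUnion_mono fun i => Eq.subset ?_)
    rw [evalTwo_eq_sum (n := M) _ _ (by have := natDegree_lift (s := s) (t := t) c; omega)]
    congr 1
    refine Finset.sum_congr rfl fun l _ => ?_
    rw [← pow_mul]
  have g1 := g0.comp ((fwd a ha).union (fwd b hb))
  set V := (⋃ i : ℕ, coeffs (evalTwo y (y ^ i) (lift s t a))) ∪
    (⋃ i : ℕ, coeffs (evalTwo y (y ^ i) (lift s t b))) with hV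
  -- pointwise products
  have g2 : Gen (M * w) (X ∪ V) (⋃ i ∈ Finset.range M,
      coeffs (p ^ κ • evalTwo y (y ^ i) (P * Q))) := by
    have := Gen.biUnion (X := X ∪ V) (Finset.range M)
      (fun i => coeffs (p ^ κ • evalTwo y (y ^ i) (P * Q))) (c := w) fun i _ => by
        rw [map_mul]
        refine rec _ _ _ ?_ ?_
        · exact Set.Subset.trans (Set.Subset.trans (Set.subset_iUnion
            (fun i : ℕ => coeffs (evalTwo y (y ^ i) P)) i) Set.subset_union_left)
            Set.subset_union_right
        · exact Set.Subset.trans (Set.Subset.trans (Set.subset_iUnion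
            (fun i : ℕ => coeffs (evalTwo y (y ^ i) Q)) i) Set.subset_union_right)
            Set.subset_union_right
    rwa [Finset.card_range] at this
  have g3 := g1.comp g2
  set W := ⋃ i ∈ Finset.range M, coeffs (p ^ κ • evalTwo y (y ^ i) (P * Q)) with hW
  -- inverse transform
  have g4 := Gen.fft (X := X ∪ W) p hp.pos (h + 2) (-1 : ZMod M)
      (by rw [nsmul_eq_mul, ← hM, ZMod.natCast_self, zero_mul])
      (fun i => p ^ κ • evalTwo y (y ^ i) (P * Q)) (fun i hi => by
        refine Set.Subset.trans ?_ Set.subset_union_right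
        exact Set.subset_biUnion_of_mem (u := fun i => coeffs (p ^ κ • evalTwo y (y ^ i) (P * Q)))
          (Finset.mem_coe.2 (Finset.mem_range.2 hi)))
  rw [← hM] at g4
  have g5 := g3.comp g4
  set U : ℕ → AddMonoidAlgebra B (ZMod M) := fun k => ∑ i ∈ Finset.range M,
    (single (-1 : ZMod M) 1) ^ (k * i) * (p ^ κ • evalTwo y (y ^ i) (P * Q)) with hU
  set u : AddMonoidAlgebra B (ZMod M) := single ((p ^ (h + 1) : ℕ) : ZMod M) (1 : B) with hu
  -- multiplication by `1 - x ^ (M / p)`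
  have g6 : Gen (2 * s * M) (X ∪ ⋃ k, coeffs (U k)) (⋃ k ∈ Finset.range (2 * s),
      coeffs (U k - u * U k)) := by
    have := Gen.biUnion (X := X ∪ ⋃ k, coeffs (U k)) (Finset.range (2 * s))
      (fun k => coeffs (U k - u * U k)) (c := M) fun k _ => by
        have hk : coeffs (U k) ⊆ X ∪ ⋃ k, coeffs (U k) :=
          (Set.subset_iUnion (fun k => coeffs (U k)) k).trans Set.subset_union_right
        exact Gen.algSub hk ((coeffs_single_mul _ _).trans hk)
    rwa [Finset.card_range] at this
  have g7 := g5.comp g6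
  have hval : ∀ k < 2 * s, U k - u * U k =
      (p ^ (κ + (h + 2))) • ((1 - u) * aeval y ((P * Q).coeff k)) := by
    intro k hk
    have := inverse_dft hp (m := h + 1) (P := P * Q) (k := k)
      (by show _ < M; omega) (by show _ < M; omega)
    rw [pow_add, mul_smul, ← this, ← one_sub_mul, ← mul_smul_comm, hU, Finset.smul_sum]
    simp only [mul_smul_comm]
    rfl
  set Y := ⋃ k ∈ Finset.range (2 * s), coeffs (U k - u * U k) with hY
  -- assembling the result
  have g8 := Gen.sumSingle (X := X ∪ Y) (Finset.range (2 * s) ×ˢ Finset.range (2 * t))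
    (fun x => ((t * x.1 + x.2 : ℕ) : ZMod (p ^ (r + h))))
    (fun x => p ^ (κ + (h + 2)) • ((P * Q).coeff x.1).coeff x.2) (by
      rintro ⟨k, i⟩ hx
      rw [Finset.mem_product, Finset.mem_range, Finset.mem_range] at hx
      right
      refine Set.mem_biUnion (Finset.mem_coe.2 (Finset.mem_range.2 hx.1)) ?_
      rw [hval k hx.1]
      have := coeff_one_sub_mul hp (m := h + 1) (P := (P * Q).coeff k) (dPQ' k) h2t hx.2
      simp only
      rw [← this]
      refine ⟨(i : ZMod M), ?_⟩
      simp only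
      rw [AddMonoidAlgebra.coeff_smul, Finsupp.smul_apply])
  refine ((g7.comp g8).mono_right (Eq.subset ?_)).mono_steps ?_
  · congr 1
    have hab : a * b = evalTwo (single (1 : ZMod (p ^ (r + h))) (1 : B))
        (single (1 : ZMod (p ^ (r + h))) (1 : B) ^ t) (P * Q) := by
      rw [map_mul, hP, hQ, evalTwo_lift a hst' hs0 ht0, evalTwo_lift b hst' hs0 ht0]
    rw [hab, evalTwo_eq_sum _ _ dPQ, Finset.sum_product, Finset.smul_sum]
    refine Finset.sum_congr rfl fun k _ => ?_
    rw [aeval_single _ (dPQ' k), ← pow_mul, single_one_pow, Finset.mul_sum, Finset.smul_sum]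
    refine Finset.sum_congr rfl fun i _ => ?_
    rw [AddMonoidAlgebra.single_mul_single, one_mul, AddMonoidAlgebra.smul_single]
    congr 1
    simp
  · rw [Finset.card_product, Finset.card_range, Finset.card_range]
    omega

end Recursion

end CyclicMul

namespace CyclicMul

open SparseInterp hiding single
open AddMonoidAlgebra

/-! ### Solving the recursion: products up to a power of p -/

section Multiplication

variable {B : Type*} [CommRing B]

theorem eq_sum_single {M : ℕ} [NeZero M] (a : AddMonoidAlgebra B (ZMod M)) :
    a = ∑ g, single g (a.coeff g) := by
  ext h
  rw [AddMonoidAlgebra.coeff_sum, Finsupp.finsetSum_apply, Finset.sum_eq_single h]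
  · simp
  · intro g _ hne
    rw [AddMonoidAlgebra.coeff_single, Finsupp.single_apply, if_neg hne]
  · simp

theorem Gen.naiveMul {M : ℕ} [NeZero M] {X : Set B} (a b : AddMonoidAlgebra B (ZMod M))
    (ha : coeffs a ⊆ X) (hb : coeffs b ⊆ X) : Gen (3 * M ^ 2) X (coeffs (a * b)) := by
  have h1 := Gen.biUnion (X := X) (Finset.univ : Finset (ZMod M × ZMod M))
    (fun x => {a.coeff x.1 * b.coeff x.2})
    fun x _ => Gen.mul (ha (mem_coeffs a x.1)) (hb (mem_coeffs b x.2))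
  have h2 := Gen.sumSingle (X := X ∪ ⋃ x ∈ (Finset.univ : Finset (ZMod M × ZMod M)),
    {a.coeff x.1 * b.coeff x.2}) (Finset.univ : Finset (ZMod M × ZMod M)) (fun x => x.1 + x.2)
    (fun x => a.coeff x.1 * b.coeff x.2) (by
      intro x _
      right
      simp only [Finset.mem_univ, Set.iUnion_true, Set.mem_iUnion, Set.mem_singleton_iff]
      exact ⟨x, rfl⟩)
  refine ((h1.comp h2).mono_right (Eq.subset ?_)).mono_steps ?_
  · congr 1
    conv_lhs => rw [eq_sum_single a, eq_sum_single b, Finset.sum_mul_sum]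
    rw [← Finset.univ_product_univ, Finset.sum_product]
    simp only [AddMonoidAlgebra.single_mul_single]
  · have : 1 ≤ M := Nat.one_le_iff_ne_zero.2 (NeZero.ne M)
    simp only [Finset.card_univ, Fintype.card_prod, ZMod.card]
    nlinarith

/-- The two factors p^(h + 2) multiply to at most 3^5 p^(r + h), so the logarithmic factor has to
shrink by 2 · 243 = 486, half of the budget being reserved for the transforms. For r + h ≥ 13 one
has h + 3 ≤ 5/7 (r + h + 1), with equality possible at 13, and (7/5)^19 exceeds 486; this explains
the exponent 19. -/
theorem recursion_bound {p : ℕ} (hp2 : 2 ≤ p) (hp3 : p ≤ 3) {h r C : ℕ} (hrh : r ≤ h)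
    (hhr : h ≤ r + 1) (hk : 13 ≤ r + h) (hC : 10000 ≤ C) :
    p ^ (h + 2) * (C * (p ^ (h + 2) * (h + 3) ^ 19)) +
      3 * ((h + 2) * (p ^ (h + 2) * ((p + 1) * p ^ (h + 2)))) +
      2 * p ^ r * p ^ (h + 2) + (2 * p ^ r * (2 * p ^ h) + 2) ≤
      C * (p ^ (r + h) * (r + h + 1) ^ 19) := by
  set P := p ^ (r + h) with hP
  have hP1 : 1 ≤ P := Nat.one_le_pow _ _ (by omega)
  have e1 : p ^ (h + 2) * p ^ (h + 2) ≤ 243 * P := by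
    rw [← pow_add]
    calc p ^ (h + 2 + (h + 2)) ≤ p ^ (5 + (r + h)) := Nat.pow_le_pow_right (by omega) (by omega)
      _ = p ^ 5 * P := pow_add _ _ _
      _ ≤ 3 ^ 5 * P := by gcongr
      _ = 243 * P := by norm_num
  have e2 : p ^ r * p ^ (h + 2) ≤ 9 * P := by
    rw [← pow_add]
    calc p ^ (r + (h + 2)) = p ^ 2 * P := by rw [hP, ← pow_add]; congr 1; ring
      _ ≤ 3 ^ 2 * P := by gcongr
      _ = 9 * P := by norm_num
  have e3 : p ^ r * p ^ h = P := (pow_add _ _ _).symm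
  set k := r + h with hkdef
  have e4 : 486 * (h + 3) ^ 19 ≤ (k + 1) ^ 19 := by
    have h7 : 7 * (h + 3) ≤ 5 * (k + 1) := by omega
    have h8 : 7 ^ 19 * (486 * (h + 3) ^ 19) ≤ 7 ^ 19 * (k + 1) ^ 19 := by
      calc 7 ^ 19 * (486 * (h + 3) ^ 19) = 486 * (7 * (h + 3)) ^ 19 := by rw [mul_pow]; ring
        _ ≤ 486 * (5 * (k + 1)) ^ 19 := by gcongr
        _ = (486 * 5 ^ 19) * (k + 1) ^ 19 := by rw [mul_pow]; ring
        _ ≤ 7 ^ 19 * (k + 1) ^ 19 := by gcongr; norm_num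
    exact Nat.le_of_mul_le_mul_left h8 (by positivity)
  have e5 : k + 1 ≤ (k + 1) ^ 19 := Nat.le_self_pow (by norm_num) _
  set E := (k + 1) ^ 19 with hE
  set F := (h + 3) ^ 19 with hF
  set Q := p ^ (h + 2) with hQ
  have t1 : 2 * (Q * (C * (Q * F))) ≤ C * (P * E) := by
    calc 2 * (Q * (C * (Q * F))) = 2 * C * ((Q * Q) * F) := by ring
      _ ≤ 2 * C * ((243 * P) * F) := by gcongr
      _ = C * (P * (486 * F)) := by ring
      _ ≤ C * (P * E) := by gcongr
  have t2 : 3 * ((h + 2) * (Q * ((p + 1) * Q))) ≤ 2916 * (P * E) := by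
    calc 3 * ((h + 2) * (Q * ((p + 1) * Q))) = 3 * (h + 2) * (p + 1) * (Q * Q) := by ring
      _ ≤ 3 * E * (3 + 1) * (243 * P) := by gcongr; omega
      _ = 2916 * (P * E) := by ring
  have t3 : P ≤ P * E := Nat.le_mul_of_pos_right _ (by omega)
  have t4 : 10000 * (P * E) ≤ C * (P * E) := by gcongr
  have t5 : 2 * p ^ r * Q ≤ 18 * P := by nlinarith
  have t6 : 2 * p ^ r * (2 * p ^ h) = 4 * P := by rw [← e3]; ring
  omega

/-- Multiplication in `B[x] / (x ^ (p ^ k) - 1)`, up to a power of `p`. -/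
theorem Gen.primePowMul {p : ℕ} (hp : p.Prime) (hp3 : p ≤ 3) {C : ℕ} (hC : 1594323 ≤ C) (k : ℕ) :
    ∃ κ ≤ 4 * k, ∀ (X : Set B) (a b : AddMonoidAlgebra B (ZMod (p ^ k))), coeffs a ⊆ X →
      coeffs b ⊆ X → Gen (C * (p ^ k * (k + 1) ^ 19)) X (coeffs (p ^ κ • (a * b))) := by
  induction k using Nat.strong_induction_on with
  | _ k ih =>
    rcases Nat.lt_or_ge k 13 with hk | hk
    · refine ⟨0, Nat.zero_le _, fun X a b ha hb => ?_⟩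
      have : NeZero (p ^ k) := ⟨pow_ne_zero _ hp.ne_zero⟩
      rw [pow_zero, one_smul]
      refine (Gen.naiveMul a b ha hb).mono_steps ?_
      have h0 : p ^ k ≤ 3 ^ 12 :=
        (Nat.pow_le_pow_left hp3 _).trans (Nat.pow_le_pow_right (by norm_num) (by omega))
      -- Small cases are multiplied naively with 3 p^(2k) operations; 3 · 3^12 = 3^13 = 1594323 is
      -- the source of the lower bound on `C`.
      have h1 : 3 * p ^ k ≤ C := by omega
      calc 3 * (p ^ k) ^ 2 = 3 * (p ^ k) * (p ^ k) := by ring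
        _ ≤ C * (p ^ k) := Nat.mul_le_mul_right _ h1
        _ ≤ C * (p ^ k * (k + 1) ^ 19) :=
          Nat.mul_le_mul_left _ (Nat.le_mul_of_pos_right _ (by positivity))
    · obtain ⟨r, h, rfl, hrh, hhr⟩ : ∃ r h, k = r + h ∧ r ≤ h ∧ h ≤ r + 1 :=
        ⟨k / 2, k - k / 2, by omega, by omega, by omega⟩
      obtain ⟨κ, hκ, rec⟩ := ih (h + 2) (by omega)
      refine ⟨κ + (h + 2), by omega, fun X a b ha hb => ?_⟩
      exact (Gen.mulStep hp h r _ κ hrh rec X a b ha hb).mono_steps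
        (recursion_bound hp.two_le hp3 hrh hhr hk (by omega))

/-- Multiplication of polynomials, up to a power of `p`. -/
theorem Gen.polyMul {p : ℕ} (hp : p.Prime) (hp3 : p ≤ 3) {C : ℕ} (hC : 1594323 ≤ C) (k : ℕ) :
    ∃ κ ≤ 4 * k, ∀ (X : Set B) (P Q : Polynomial B) (q : ℕ), P.natDegree < q → Q.natDegree < q →
      2 * q ≤ p ^ k → (∀ i < q, P.coeff i ∈ X) → (∀ i < q, Q.coeff i ∈ X) → 0 ∈ X →
      Gen (C * (p ^ k * (k + 1) ^ 19)) X (Set.range fun i => p ^ κ • (P * Q).coeff i) := by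
  obtain ⟨κ, hκ, h⟩ := Gen.primePowMul (B := B) hp hp3 hC k
  generalize C * (p ^ k * (k + 1) ^ 19) = W at h ⊢
  refine ⟨κ, hκ, fun X P Q q hP hQ hq hPX hQX h0 => ?_⟩
  have : NeZero (p ^ k) := ⟨pow_ne_zero _ hp.ne_zero⟩
  have key : ∀ P : Polynomial B, P.natDegree < q → (∀ i < q, P.coeff i ∈ X) →
      coeffs (Polynomial.aeval (single (1 : ZMod (p ^ k)) (1 : B)) P) ⊆ X := by
    rintro P hP hPX _ ⟨g, rfl⟩
    simp only
    rw [coeff_aeval_single (by omega)]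
    by_cases hg : g.val < q
    · exact hPX _ hg
    · rw [Polynomial.coeff_eq_zero_of_natDegree_lt (by omega)]; exact h0
  have h1 := h (insert 0 X) _ _ ((key P hP hPX).trans (Set.subset_insert _ _))
    ((key Q hQ hQX).trans (Set.subset_insert _ _))
  have hPQ : (P * Q).natDegree < p ^ k := by
    have := Polynomial.natDegree_mul_le (p := P) (q := Q); omega
  rw [Set.insert_eq_of_mem h0, ← map_mul] at h1
  have h2 := h1.trans (t := 0) (Z := {0}) (Gen.of_subset (by simp [h0]))
  rw [Nat.add_zero] at h2
  refine h2.mono_right ?_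
  rintro _ ⟨i, rfl⟩
  by_cases hi : i < p ^ k
  · left
    refine ⟨(i : ZMod (p ^ k)), ?_⟩
    simp only
    rw [AddMonoidAlgebra.coeff_smul, Finsupp.smul_apply, coeff_aeval_single hPQ, ZMod.val_natCast,
      Nat.mod_eq_of_lt hi]
  · right
    simp only
    rw [Polynomial.coeff_eq_zero_of_natDegree_lt (by omega), smul_zero]
    rfl

end Multiplication

end CyclicMul

namespace CyclicMul

open SparseInterp hiding single

/-! ### Division-free cyclic convolution, and its straight-line program -/

section Program

/-- The bounds keep the binary lengths of the two multipliers logarithmic, so that they can be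
generated cheaply from the constant 1. Natural numbers are used, hence the sign is placed on the
right. -/
theorem exists_bezout (a b : ℕ) : ∃ u w, u * 2 ^ a = 1 + w * 3 ^ b ∧ u ≤ 3 ^ b ∧ w ≤ 2 ^ a := by
  rcases Nat.eq_zero_or_pos b with rfl | hb
  · have : 1 ≤ 2 ^ a := Nat.one_le_two_pow
    exact ⟨1, 2 ^ a - 1, by omega, by simp, by omega⟩
  · obtain ⟨m, hm, h⟩ := Nat.exists_mul_mod_eq_one_of_coprime (n := 2 ^ a) (k := 3 ^ b)
      (Nat.Coprime.pow _ _ (by norm_num)) (Nat.one_lt_pow (by omega) (by norm_num))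
    refine ⟨m, 2 ^ a * m / 3 ^ b, ?_, hm.le, ?_⟩
    · have := Nat.mod_add_div (2 ^ a * m) (3 ^ b)
      rw [h, mul_comm (3 ^ b)] at this
      rw [this, mul_comm]
    · refine Nat.div_le_of_le_mul ?_
      rw [mul_comm]; exact Nat.mul_le_mul_right _ hm.le

/-- The ordinary product has degree below 2 q, so exactly the coefficients k and k + q are folded
onto k. -/
theorem coeff_fold {B : Type*} [CommRing B] {q : ℕ} (x y : Fin q → B) (k : Fin q) :
    (∑ i : Fin q, ∑ j : Fin q, if (i.val + j.val) % q = k.val then x i * y j else 0) =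
      ((∑ i : Fin q, Polynomial.monomial i.val (x i)) *
        (∑ i : Fin q, Polynomial.monomial i.val (y i))).coeff k +
      ((∑ i : Fin q, Polynomial.monomial i.val (x i)) *
        (∑ i : Fin q, Polynomial.monomial i.val (y i))).coeff (k + q) := by
  rw [Finset.sum_mul_sum]
  simp only [Polynomial.monomial_mul_monomial, Polynomial.finsetSum_coeff,
    Polynomial.coeff_monomial]
  rw [← Finset.sum_add_distrib]
  refine Finset.sum_congr rfl fun i _ => ?_
  rw [← Finset.sum_add_distrib]
  refine Finset.sum_congr rfl fun j _ => ?_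
  have hi := i.2; have hj := j.2; have hk := k.2
  rcases Nat.lt_or_ge (i.val + j.val) q with h | h
  · rw [Nat.mod_eq_of_lt h, if_neg (c := i.val + j.val = k.val + q) (by omega), add_zero]
  · rw [Nat.mod_eq_sub_mod h, Nat.mod_eq_of_lt (by omega),
      if_neg (c := i.val + j.val = k.val) (by omega), zero_add]
    congr 1
    apply propext; omega

/-- The cost of a quasi-linear division-free cyclic convolution. -/
theorem Gen.cyclicConvolution {B : Type*} [CommRing B] {C : ℕ} (hC : 1594323 ≤ C) (q : ℕ)
    (hq : 0 < q) {W : ℕ} (hW : q * (Nat.size q + 3) ^ 19 ≤ W) (x y : Fin q → B) :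
    Gen (100 * C * W) (Set.range x ∪ Set.range y)
      (Set.range fun k : Fin q => ∑ i : Fin q, ∑ j : Fin q,
        if (i.val + j.val) % q = k.val then x i * y j else 0) := by
  set X := Set.range x ∪ Set.range y with hX
  set P : Polynomial B := ∑ i : Fin q, Polynomial.monomial i.val (x i) with hP
  set Q : Polynomial B := ∑ i : Fin q, Polynomial.monomial i.val (y i) with hQ
  have hdeg : ∀ z : Fin q → B, (∑ i : Fin q, Polynomial.monomial i.val (z i)).natDegree < q := by
    intro z
    have : (∑ i : Fin q, Polynomial.monomial i.val (z i)).natDegree ≤ q - 1 :=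
      Polynomial.natDegree_sum_le_of_forall_le _ _ fun i _ =>
        (Polynomial.natDegree_monomial_le _).trans (by have := i.2; omega)
    omega
  have hco : ∀ (z : Fin q → B) (i) (hi : i < q),
      (∑ i : Fin q, Polynomial.monomial i.val (z i)).coeff i = z ⟨i, hi⟩ := by
    intro z i hi
    rw [Polynomial.finsetSum_coeff, Finset.sum_eq_single ⟨i, hi⟩]
    · simp
    · intro j _ hj
      rw [Polynomial.coeff_monomial, if_neg]
      rintro rfl; exact hj rfl
    · simp
  have hsz : 2 * q ≤ 2 ^ (Nat.size q + 1) := by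
    rw [pow_succ']; exact Nat.mul_le_mul_left 2 (Nat.lt_size_self q).le
  have main : ∀ p : ℕ, p.Prime → p ≤ 3 → ∃ κ ≤ 4 * (Nat.size q + 1),
      Gen (6 * C * W) (X ∪ {0})
        (Set.range fun i => p ^ κ • (P * Q).coeff i) := by
    intro p hp hp3
    have hk1 : 2 * q ≤ p ^ Nat.clog p (2 * q) := Nat.le_pow_clog hp.one_lt _
    have hk2 : p ^ Nat.clog p (2 * q) ≤ 6 * q := by
      have h1 : p ^ (Nat.clog p (2 * q) - 1) < 2 * q :=
        Nat.pow_pred_clog_lt_self hp.one_lt (by omega)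
      have h2 : 0 < Nat.clog p (2 * q) := Nat.clog_pos hp.one_lt (by omega)
      calc p ^ Nat.clog p (2 * q) = p * p ^ (Nat.clog p (2 * q) - 1) := by
            rw [← pow_succ']; congr 1; omega
        _ ≤ 3 * (2 * q) := by gcongr
        _ = 6 * q := by ring
    have hk3 : Nat.clog p (2 * q) ≤ Nat.size q + 1 := by
      rw [Nat.clog_le_iff_le_pow hp.one_lt]
      exact hsz.trans (Nat.pow_le_pow_left hp.two_le _)
    obtain ⟨κ, hκ, h⟩ := Gen.polyMul (B := B) hp hp3 hC (Nat.clog p (2 * q))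
    refine ⟨κ, hκ.trans (Nat.mul_le_mul_left 4 hk3),
      (h (X ∪ {0}) P Q q (hdeg x) (hdeg y) hk1 ?_ ?_ (by simp)).mono_steps ?_⟩
    · intro i hi
      rw [hP, hco x i hi]; exact Or.inl (Or.inl ⟨_, rfl⟩)
    · intro i hi
      rw [hQ, hco y i hi]; exact Or.inl (Or.inr ⟨_, rfl⟩)
    · calc C * (p ^ Nat.clog p (2 * q) * (Nat.clog p (2 * q) + 1) ^ 19)
          ≤ C * ((6 * q) * (Nat.size q + 3) ^ 19) := Nat.mul_le_mul_left _
            (Nat.mul_le_mul hk2 (Nat.pow_le_pow_left (by omega) 19))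
        _ = 6 * C * (q * (Nat.size q + 3) ^ 19) := by ring
        _ ≤ 6 * C * W := Nat.mul_le_mul_left _ hW
  obtain ⟨a, ha, h2⟩ := main 2 Nat.prime_two (by norm_num)
  obtain ⟨b, hb, h3⟩ := main 3 Nat.prime_three le_rfl
  -- From 2^a P Q and 3^b P Q the product is recovered as u (2^a P Q) - w (3^b P Q), without
  -- division in the ring.
  obtain ⟨u, w, huw, hu, hw⟩ := exists_bezout a b
  have hW1 : Nat.size q + 3 ≤ W :=
    ((Nat.le_self_pow (by norm_num) _).trans (Nat.le_mul_of_pos_left _ hq)).trans hW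
  have hW2 : q ≤ W := (Nat.le_mul_of_pos_right _ (by positivity)).trans hW
  clear hW
  have hsu : Nat.size u ≤ 2 * b + 1 := by
    rw [Nat.size_le]
    calc u ≤ 3 ^ b := hu
      _ ≤ 4 ^ b := Nat.pow_le_pow_left (by norm_num) _
      _ = 2 ^ (2 * b) := by rw [pow_mul]; norm_num
      _ < 2 ^ (2 * b + 1) := Nat.pow_lt_pow_right (by norm_num) (by omega)
  have hsw : Nat.size w ≤ a + 1 := by
    rw [Nat.size_le]
    exact lt_of_le_of_lt hw (Nat.pow_lt_pow_right (by norm_num) (by omega))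
  have g1 := (Gen.zero (X := X)).comp ((h2.union h3).union
    ((Gen.natCast u).union (Gen.natCast w)))
  set V := ((Set.range fun i => 2 ^ a • (P * Q).coeff i) ∪
    (Set.range fun i => 3 ^ b • (P * Q).coeff i)) ∪ ({(u : B)} ∪ {(w : B)}) with hV
  have hcoef : ∀ i ∈ Finset.range (2 * q), Gen 3 (X ∪ V) {(P * Q).coeff i} := by
    intro i _
    have k1 : Gen 1 (X ∪ V) {(u : B) * (2 ^ a • (P * Q).coeff i)} :=
      Gen.mul (by simp [hV]) (Or.inr (Or.inl (Or.inl ⟨i, rfl⟩)))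
    have k2 : Gen 1 (X ∪ V) {(w : B) * (3 ^ b • (P * Q).coeff i)} :=
      Gen.mul (by simp [hV]) (Or.inr (Or.inl (Or.inr ⟨i, rfl⟩)))
    have k3 : Gen 1 (X ∪ V ∪ ({(u : B) * (2 ^ a • (P * Q).coeff i)} ∪
        {(w : B) * (3 ^ b • (P * Q).coeff i)}))
        {(u : B) * (2 ^ a • (P * Q).coeff i) - (w : B) * (3 ^ b • (P * Q).coeff i)} :=
      Gen.sub (by simp) (by simp)
    refine ((k1.union k2).comp k3).mono_right ?_
    rw [Set.singleton_subset_iff, Set.mem_singleton_iff]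
    have hB : (u : B) * 2 ^ a = 1 + w * 3 ^ b := by exact_mod_cast congrArg (Nat.cast (R := B)) huw
    simp only [nsmul_eq_mul]
    push_cast
    linear_combination -((P * Q).coeff i) * hB
  have g2 := g1.comp (Gen.biUnion _ _ hcoef)
  rw [Finset.card_range] at g2
  have g3 := g2.comp (Gen.biUnion (X := X ∪ ⋃ i ∈ Finset.range (2 * q), {(P * Q).coeff i})
    (Finset.univ : Finset (Fin q)) (fun k => {(P * Q).coeff k.val + (P * Q).coeff (k.val + q)})
    (c := 1) fun k _ => by
      have hk := k.2
      refine Gen.add (Or.inr ?_) (Or.inr ?_)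
      · exact Set.mem_biUnion (Finset.mem_coe.2 (Finset.mem_range.2 (by omega))) rfl
      · exact Set.mem_biUnion (Finset.mem_coe.2 (Finset.mem_range.2 (by omega))) rfl)
  refine (g3.mono_right ?_).mono_steps ?_
  · rintro _ ⟨k, rfl⟩
    simp only [Finset.mem_univ, Set.iUnion_true, Set.mem_iUnion, Set.mem_singleton_iff]
    exact ⟨k, coeff_fold x y k⟩
  · rw [Finset.card_univ, Fintype.card_fin]
    have hC' : 100 * W ≤ C * W := Nat.mul_le_mul_right _ (by omega)
    rw [mul_assoc 100, mul_assoc 6]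
    omega

section Conversion

variable {A σ : Type*} [CommRing A] (x : σ → A)

/-- The results of a program whose only constant is `1`. -/
def results (Γ : SLP Unit σ) : List A := Γ.run id (fun _ => 1) x

theorem results_append (Γ : SLP Unit σ) (g : Instr Unit σ) : results x (Γ ++ [g]) = results x Γ ++
    [g.op.eval (g.lhs.eval (fun _ => 1) x (results x Γ)) (g.rhs.eval (fun _ => 1) x (results x Γ))] := by
  simp [results, SLP.run, List.foldl_append]

theorem length_results (Γ : SLP Unit σ) : (results x Γ).length = Γ.length := by
  induction Γ using List.reverseRecOn with
  | nil => rfl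
  | append_singleton Γ g ih => rw [results_append, List.length_append, ih]; simp

/-- The element `a` is known after executing `Γ`. -/
def Known (Γ : SLP Unit σ) (a : A) : Prop :=
  ∃ o : Operand Unit σ, ∀ l, o.eval (fun _ => 1) x (results x Γ ++ l) = a

variable {x}

theorem Known.append {Γ : SLP Unit σ} {a : A} (h : Known x Γ a) (g : Instr Unit σ) :
    Known x (Γ ++ [g]) a := by
  obtain ⟨o, ho⟩ := h
  exact ⟨o, fun l => by rw [results_append, List.append_assoc]; exact ho _⟩

theorem Known.one (Γ : SLP Unit σ) : Known x Γ 1 := ⟨.const (), fun _ => rfl⟩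

theorem Known.input (Γ : SLP Unit σ) (i : σ) : Known x Γ (x i) := ⟨.input i, fun _ => rfl⟩

/-- Each known element is named by an operand whose value is stable under appending instructions, so
a derivation step turns into one appended instruction. -/
theorem Gen.exists_slp {s : ℕ} {X Y : Set A} (h : Gen s X Y) (Γ : SLP Unit σ)
    (hX : ∀ a ∈ X, Known x Γ a) :
    ∃ Γ' : SLP Unit σ, Γ'.length = Γ.length + s ∧ ∀ a ∈ Y, Known x Γ' a := by
  induction h generalizing Γ with
  | base h =>
    refine ⟨Γ, rfl, fun a ha => ?_⟩
    rcases h ha with rfl | ha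
    · exact Known.one Γ
    · exact hX a ha
  | @step s X Y o u v hu hv _ ih =>
    have key : ∀ a ∈ insert 1 X, Known x Γ a := by
      rintro a (rfl | ha)
      · exact Known.one Γ
      · exact hX a ha
    obtain ⟨ou, hou⟩ := key u hu
    obtain ⟨ov, hov⟩ := key v hv
    obtain ⟨Γ', hl, h'⟩ := ih (Γ ++ [⟨o, ou, ov⟩]) (by
      rintro a (rfl | ha)
      · refine ⟨.prev Γ.length, fun l => ?_⟩
        have h1 := hou []
        have h2 := hov []
        rw [List.append_nil] at h1 h2
        rw [results_append, h1, h2, Operand.eval, ← length_results x Γ]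
        simp
      · exact (hX a ha).append _)
    exact ⟨Γ', by rw [hl]; simp; omega, h'⟩

/-- An output has to be the result of an instruction, while a known element may be an input or the
constant 1. Multiplying by 1 copies each of the q outputs to a definite position. -/
theorem exists_slp_outputs (Γ : SLP Unit σ) {q : ℕ} (y : Fin q → A) (hy : ∀ k, Known x Γ (y k)) :
    ∃ Γ' : SLP Unit σ, Γ'.length = Γ.length + q ∧
      ∀ k : Fin q, (results x Γ').getD (Γ.length + k.val) 0 = y k := by
  choose o ho using hy
  have key : ∀ l : List (Fin q),
      results x (Γ ++ l.map fun k => ⟨.mul, o k, .const ()⟩) = results x Γ ++ l.map y := by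
    intro l
    induction l using List.reverseRecOn with
    | nil => simp
    | append_singleton l k ih =>
      rw [List.map_append, ← List.append_assoc, List.map_singleton, results_append, ih, ho]
      simp [ArithOp.eval, Operand.eval]
  refine ⟨Γ ++ (List.finRange q).map fun k => ⟨.mul, o k, .const ()⟩, by simp, fun k => ?_⟩
  rw [key, ← length_results x Γ]
  simp [List.getD_eq_getElem?_getD]

end Conversion

/-- Multiplication in `R[x] / (x ^ q - 1)` takes quasi-linearly many ring operations. -/
theorem cyclicMulCost_le {C : ℕ} (hC : 1594323 ≤ C) {q : ℕ} (hq : 0 < q) {W : ℕ}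
    (hW : q * (Nat.size q + 3) ^ 19 ≤ W) : cyclicMulCost q ≤ 101 * C * W := by
  have h := Gen.cyclicConvolution hC q hq hW
    (fun i => (MvPolynomial.X (Sum.inl i) : MvPolynomial (Fin q ⊕ Fin q) ℤ))
    (fun i => MvPolynomial.X (Sum.inr i))
  obtain ⟨Γ, hΓ, hk⟩ := h.exists_slp (x := MvPolynomial.X) [] (by
    rintro a (⟨i, rfl⟩ | ⟨i, rfl⟩)
    · exact Known.input _ (Sum.inl i)
    · exact Known.input _ (Sum.inr i))
  obtain ⟨Γ', hΓ', hout⟩ := exists_slp_outputs Γ _ fun k => hk _ ⟨k, rfl⟩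
  have hmem : cyclicMulCost q ≤ Γ'.length :=
    Nat.sInf_le ⟨Γ', fun k => Γ.length + k.val, fun k => hout k, rfl⟩
  rw [hΓ', hΓ, List.length_nil, zero_add] at hmem
  refine hmem.trans ?_
  have h1 : q ≤ W := (Nat.le_mul_of_pos_right _ (by positivity)).trans hW
  clear hW
  have h2 : 1 * W ≤ C * W := Nat.mul_le_mul_right _ (by omega)
  rw [mul_assoc, mul_assoc]
  omega

end Program

end CyclicMul

namespace SparseInterp

open Cost

/-! ### A calculus for values and costs -/

/-- The value of `x` satisfies `P`, and `x` takes at most `r` ring and `b` bit operations. -/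
def Cost.Sat {α : Type*} (x : Cost α) (P : α → Prop) (r b : ℕ) : Prop :=
  P x.val ∧ x.ring ≤ r ∧ x.bits ≤ b

namespace Cost.Sat

variable {α β : Type*} {x : Cost α} {P Q : α → Prop} {r r' b b' : ℕ}

theorem mono (h : x.Sat P r b) (hP : ∀ a, P a → Q a) (hr : r ≤ r') (hb : b ≤ b') :
    x.Sat Q r' b' := ⟨hP _ h.1, h.2.1.trans hr, h.2.2.trans hb⟩

theorem mono_cost (h : x.Sat P r b) (hr : r ≤ r') (hb : b ≤ b') : x.Sat P r' b' :=
  h.mono (fun _ => id) hr hb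

theorem mono_val (h : x.Sat P r b) (hP : ∀ a, P a → Q a) : x.Sat Q r b :=
  h.mono hP le_rfl le_rfl

theorem mk {a : α} (h : P a) : Sat ⟨a, r, b⟩ P r b := ⟨h, le_rfl, le_rfl⟩

theorem mk' {a : α} (h : P a) (hr : r ≤ r') (hb : b ≤ b') : Sat ⟨a, r, b⟩ P r' b' := ⟨h, hr, hb⟩

theorem ret {a : α} (h : P a) : Sat (Cost.ret a) P 0 0 := ⟨h, le_rfl, le_rfl⟩

theorem bind {f : α → Cost β} {Q : β → Prop} (hx : x.Sat P r b)
    (hf : ∀ a, P a → (f a).Sat Q r' b') : (x.bind f).Sat Q (r + r') (b + b') :=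
  ⟨(hf _ hx.1).1, Nat.add_le_add hx.2.1 (hf _ hx.1).2.1, Nat.add_le_add hx.2.2 (hf _ hx.1).2.2⟩

theorem bind_eq {f : α → Cost β} {Q : β → Prop} {a : α} (hx : x.Sat (· = a) r b)
    (hf : (f a).Sat Q r' b') : (x.bind f).Sat Q (r + r') (b + b') :=
  hx.bind fun _ h => h ▸ hf

theorem map {f : α → Cost β} {l : List α} {P : α → β → Prop} {r b : α → ℕ}
    (h : ∀ a ∈ l, (f a).Sat (P a) (r a) (b a)) :
    (Cost.map f l).Sat (fun bs => List.Forall₂ P l bs) (l.map r).sum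
      ((l.map b).sum + l.length + 1) := by
  induction l with
  | nil => exact ⟨.nil, le_rfl, le_rfl⟩
  | cons a l ih =>
    refine ((h a (by simp)).bind fun c hc => (ih fun a ha => h a (by simp [ha])).bind
      fun cs hcs => mk (P := fun bs => List.Forall₂ P (a :: l) bs) (List.Forall₂.cons hc hcs)).mono_cost
      ?_ ?_ <;> simp only [List.map_cons, List.sum_cons, List.length_cons] <;> omega

theorem map_eq {f : α → Cost β} {l : List α} {g : α → β} {r b : α → ℕ}
    (h : ∀ a ∈ l, (f a).Sat (· = g a) (r a) (b a)) :
    (Cost.map f l).Sat (· = l.map g) (l.map r).sum ((l.map b).sum + l.length + 1) := by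
  refine (map (P := fun a c => c = g a) h).mono_val fun bs hbs => ?_
  induction hbs with
  | nil => rfl
  | cons h1 _ ih => rw [h1, ih (fun a ha => h a (by simp [ha])), List.map_cons]

theorem _root_.SparseInterp.sum_map_le {α : Type*} {l : List α} {f : α → ℕ} {c : ℕ} (h : ∀ a ∈ l, f a ≤ c) :
    (l.map f).sum ≤ l.length * c := by
  have := List.sum_le_card_nsmul (l.map f) c (by simpa using h)
  simpa using this

theorem map_eq_const {f : α → Cost β} {l : List α} {g : α → β} {r b : ℕ}
    (h : ∀ a ∈ l, (f a).Sat (· = g a) r b) :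
    (Cost.map f l).Sat (· = l.map g) (l.length * r) (l.length * (b + 1) + 1) := by
  refine (map_eq (r := fun _ => r) (b := fun _ => b) h).mono_cost ?_ ?_ <;> simp [mul_add]

theorem map_const {f : α → Cost β} {l : List α} {P : α → β → Prop} {r b : ℕ}
    (h : ∀ a ∈ l, (f a).Sat (P a) r b) :
    (Cost.map f l).Sat (fun bs => List.Forall₂ P l bs) (l.length * r)
      (l.length * (b + 1) + 1) := by
  refine (map (r := fun _ => r) (b := fun _ => b) h).mono_cost ?_ ?_ <;> simp [mul_add]

/-- Loops with an invariant that may depend on the part of the list that has been processed. -/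
theorem fold_aux {f : β → α → Cost β} {Inv : List α → β → Prop} {r b : α → ℕ} (l : List α) :
    ∀ (pre : List α) (c : β), Inv pre c →
    (∀ pre' a post, pre ++ l = pre' ++ a :: post → ∀ c, Inv pre' c →
      (f c a).Sat (Inv (pre' ++ [a])) (r a) (b a)) →
    (Cost.fold f c l).Sat (Inv (pre ++ l)) (l.map r).sum ((l.map b).sum + l.length + 1) := by
  induction l with
  | nil => exact fun pre c h _ => ⟨by simpa [Cost.fold] using h, le_rfl, le_rfl⟩
  | cons a l ih =>
    intro pre c hc h
    refine ((h pre a l rfl c hc).bind fun d hd => (ih (pre ++ [a]) d hd (fun pre' a' post he =>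
      h pre' a' post (by rw [← he]; simp))).bind fun e he =>
      mk (P := Inv (pre ++ a :: l)) (by simpa using he)).mono_cost ?_ ?_ <;>
      simp only [List.map_cons, List.sum_cons, List.length_cons] <;> omega

theorem fold {f : β → α → Cost β} {l : List α} {c : β} (Inv : List α → β → Prop) {r b : α → ℕ}
    (h0 : Inv [] c) (h : ∀ pre a post, l = pre ++ a :: post → ∀ c, Inv pre c →
      (f c a).Sat (Inv (pre ++ [a])) (r a) (b a)) :
    (Cost.fold f c l).Sat (Inv l) (l.map r).sum ((l.map b).sum + l.length + 1) :=
  fold_aux l [] c h0 fun pre' a post he => h pre' a post (by simpa using he)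

theorem fold_const {f : β → α → Cost β} {l : List α} {c : β} (Inv : List α → β → Prop) {r b : ℕ}
    (h0 : Inv [] c) (h : ∀ pre a post, l = pre ++ a :: post → ∀ c, Inv pre c →
      (f c a).Sat (Inv (pre ++ [a])) r b) :
    (Cost.fold f c l).Sat (Inv l) (l.length * r) (l.length * (b + 1) + 1) := by
  refine (fold Inv (r := fun _ => r) (b := fun _ => b) h0 h).mono_cost ?_ ?_ <;> simp [mul_add]

theorem mapOption {f : α → Cost (Option β)} {l : List α} {P : α → Option β → Prop} {r b : ℕ}
    (h : ∀ a ∈ l, (f a).Sat (P a) r b) :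
    (Cost.mapOption f l).Sat (fun o => (∀ bs, o = some bs → List.Forall₂ (fun a b => P a (some b)) l bs) ∧
      (o = none → ∃ a ∈ l, P a none)) (l.length * r) (l.length * (b + 2) + 1) := by
  induction l with
  | nil => exact ⟨⟨by rintro _ ⟨⟩; exact .nil, by rintro ⟨⟩⟩, by simp [Cost.mapOption], by simp [Cost.mapOption]⟩
  | cons a l ih =>
    have h1 := h a (by simp)
    have h2 := ih fun a ha => h a (by simp [ha])
    refine (h1.bind (r' := l.length * r) (b' := l.length * (b + 2) + 1 + 1) fun o ho => ?_).mono_cost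
      (by rw [List.length_cons]; ring_nf; rfl) (by rw [List.length_cons]; ring_nf; omega)
    cases o with
    | none =>
      exact mk' ⟨by rintro _ ⟨⟩, fun _ => ⟨a, by simp, ho⟩⟩ (Nat.zero_le _) (by omega)
    | some c =>
      refine (h2.bind (r' := 0) (b' := 1) fun o' ho' => ?_)
      cases o' with
      | none =>
        obtain ⟨a', ha', hP⟩ := ho'.2 rfl
        exact mk ⟨by rintro _ ⟨⟩, fun _ => ⟨a', by simp [ha'], hP⟩⟩
      | some cs => exact mk ⟨by rintro _ ⟨⟩; exact .cons ho (ho'.1 cs rfl), by rintro ⟨⟩⟩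

end Cost.Sat

/-! ### Lengths of integers -/

section Length

theorem one_le_len (a : ℕ) : 1 ≤ len a := by simp [len]

theorem len_mono {a b : ℕ} (h : a ≤ b) : len a ≤ len b := by
  have := Nat.size_le_size h; simp only [len]; omega

theorem len_le_iff {a k : ℕ} : len a ≤ k + 1 ↔ a < 2 ^ k := by
  rw [len, Nat.add_le_add_iff_right, Nat.size_le]

theorem lt_two_pow_len (a : ℕ) : 2 * a < 2 ^ len a := by
  rw [len, pow_succ']
  have := Nat.lt_size_self a
  omega

theorem len_mul (a b : ℕ) : len (a * b) ≤ len a + len b := by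
  have : len (a * b) ≤ (Nat.size a + Nat.size b) + 1 := by
    rw [len_le_iff, pow_add]
    exact Nat.mul_lt_mul'' (Nat.lt_size_self a) (Nat.lt_size_self b)
  simp only [len] at *; omega

theorem len_add (a b : ℕ) : len (a + b) ≤ len a + len b := by
  have h1 := Nat.lt_size_self a
  have h2 := Nat.lt_size_self b
  have : len (a + b) ≤ (Nat.size a + Nat.size b + 1) + 1 := by
    rw [len_le_iff, pow_add, pow_add]
    have := Nat.one_le_two_pow (n := Nat.size a)
    have := Nat.one_le_two_pow (n := Nat.size b)
    nlinarith
  simp only [len] at *; omega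

theorem len_pow (D m : ℕ) : len (D ^ m) ≤ m * len D + 2 := by
  induction m with
  | zero => rw [pow_zero, zero_mul, len, Nat.size_one]
  | succ m ih =>
    rw [pow_succ]
    have : len (D ^ m * D) ≤ len (D ^ m) + len D := len_mul _ _
    rw [Nat.succ_mul]; omega

theorem len_two_mul (a : ℕ) : len (2 * a) ≤ len a + 1 := by
  rw [len_le_iff]; exact lt_two_pow_len a

theorem size_le_of_lt {a k : ℕ} (h : a < 2 ^ k) : Nat.size a ≤ k := Nat.size_le.2 h

/-- The fixed parameter `l` dominates the logarithm of every length that occurs; from here on the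
factor log² of a multiplication is simply `l ^ 2`. -/
theorem mulBits_le {a b A l : ℕ} (h : len a + len b ≤ A) (hA : A < 2 ^ l) :
    mulBits a b ≤ A * l ^ 2 := by
  rw [mulBits]
  exact Nat.mul_le_mul h (Nat.pow_le_pow_left (size_le_of_lt (by omega)) 2)

/-- Constants are absorbed by powers of `l`. -/
theorem absorb {l : ℕ} (hl : 100 ≤ l) (A i j : ℕ) (h : i < j := by omega) :
    100 * (A * l ^ i) ≤ A * l ^ j := by
  calc 100 * (A * l ^ i) = A * (l ^ i * 100) := by ring
    _ ≤ A * (l ^ i * l) := Nat.mul_le_mul_left _ (Nat.mul_le_mul_left _ hl)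
    _ = A * l ^ (i + 1) := by rw [pow_succ]
    _ ≤ A * l ^ j := Nat.mul_le_mul_left _ (Nat.pow_le_pow_right (by omega) h)

theorem le_mul_pow {l : ℕ} (hl : 100 ≤ l) (A i : ℕ) : A ≤ A * l ^ i :=
  Nat.le_mul_of_pos_right _ (by positivity)

theorem mul_pow_mono {l : ℕ} (hl : 100 ≤ l) (A : ℕ) {i j : ℕ} (h : i ≤ j) :
    A * l ^ i ≤ A * l ^ j := Nat.mul_le_mul_left _ (Nat.pow_le_pow_right (by omega) h)

end Length

/-! ### Integer arithmetic -/

section Integers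

variable {l : ℕ}

theorem addN_sat (a b : ℕ) : (addN a b).Sat (· = a + b) 0 (len a + len b) := .mk rfl
theorem subN_sat (a b : ℕ) : (subN a b).Sat (· = a - b) 0 (len a + len b) := .mk rfl
theorem leN_sat (a b : ℕ) : (leN a b).Sat (· = decide (a ≤ b)) 0 (len a + len b) := .mk rfl

theorem mulN_sat {a b A : ℕ} (h : len a + len b ≤ A) (hA : A < 2 ^ l) :
    (mulN a b).Sat (· = a * b) 0 (A * l ^ 2) := .mk' rfl le_rfl (mulBits_le h hA)
theorem divN_sat {a b A : ℕ} (h : len a + len b ≤ A) (hA : A < 2 ^ l) :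
    (divN a b).Sat (· = a / b) 0 (A * l ^ 2) := .mk' rfl le_rfl (mulBits_le h hA)
theorem modN_sat {a b A : ℕ} (h : len a + len b ≤ A) (hA : A < 2 ^ l) :
    (modN a b).Sat (· = a % b) 0 (A * l ^ 2) := .mk' rfl le_rfl (mulBits_le h hA)

theorem takeN_sat {α : Type*} (m : ℕ) (L : List α) :
    (takeN m L).Sat (· = L.take m) 0 (L.length + len m) := .mk rfl


theorem len_small {x A l : ℕ} (hx : x ≤ A) (hA : 4 * A < 2 ^ l) (hl : 100 ≤ l) : len x ≤ l := by
  have : len x ≤ (l - 1) + 1 := by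
    rw [len_le_iff]
    have : 2 ^ l = 2 * 2 ^ (l - 1) := by rw [← pow_succ']; congr 1; omega
    omega
  omega

theorem two_mul_lt (hl : 100 ≤ l) : 2 * l < 2 ^ l := by
  have h1 : l - 2 < 2 ^ (l - 2) := Nat.lt_two_pow_self
  have h2 : 2 ^ l = 4 * 2 ^ (l - 2) := by
    rw [show l = 2 + (l - 2) by omega, pow_add]; simp
  omega

theorem len_two_pow_le (hl : 100 ≤ l) {m : ℕ} (hm : m < 2 ^ l) : len m ≤ 2 * l :=
  (len_le_iff.2 hm).trans (by omega)

theorem powN_sat (hl : 100 ≤ l) (D m d A : ℕ) (hm : m < 2 ^ d) (hd : d ≤ l)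
    (hA : m * len D + len D ≤ A) (hA' : 4 * A < 2 ^ l) :
    (powN D m).Sat (· = D ^ m) 0 (1 + d * (A * l ^ 3)) := by
  induction d generalizing m with
  | zero =>
    obtain rfl : m = 0 := by simpa using hm
    rw [powN]; exact .mk' rfl le_rfl (by omega)
  | succ d ih =>
    by_cases h : m = 0
    · rw [powN, dif_pos h]; exact .mk' (by simp [h]) le_rfl (by omega)
    rw [powN, dif_neg h]
    have h1 := ih (m / 2) (by rw [pow_succ] at hm; omega) (by omega)
      (le_trans (Nat.add_le_add_right (Nat.mul_le_mul_right _ (Nat.div_le_self _ _)) _) hA)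
    have hD := one_le_len D
    have e0 : m / 2 * len D + m / 2 * len D ≤ m * len D := by
      rw [← add_mul]; exact Nat.mul_le_mul_right _ (by omega)
    have e1 := len_pow D (m / 2)
    have e1' : 1 * len D ≤ m * len D := Nat.mul_le_mul_right _ (by omega)
    have e2 := len_mul (D ^ (m / 2)) (D ^ (m / 2))
    have e3 : len m ≤ 2 * l := len_two_pow_le hl
      (hm.trans_le (Nat.pow_le_pow_right (by norm_num) hd))
    have e4 : 1 ≤ A := by omega
    obtain ⟨F, hF⟩ : ∃ F, F = 4 * A := ⟨_, rfl⟩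
    have hF2 : F * l ^ 2 = 4 * (A * l ^ 2) := by rw [hF, mul_assoc]
    have h2 : (mulN (D ^ (m / 2)) (D ^ (m / 2))).Sat (· = D ^ (m / 2) * D ^ (m / 2)) 0
        (F * l ^ 2) := mulN_sat (by omega) (by omega)
    have h3 : (mulN (D ^ (m / 2) * D ^ (m / 2)) D).Sat
        (· = D ^ (m / 2) * D ^ (m / 2) * D) 0 (F * l ^ 2) := mulN_sat (by omega) (by omega)
    have a1 := absorb hl A 1 2
    have a2 := absorb hl A 2 3
    have a3 : l ≤ A * l ^ 1 := by rw [pow_one]; exact Nat.le_mul_of_pos_left _ e4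
    refine Sat.mono_cost (h1.bind_eq (h2.bind_eq (Q := (· = D ^ m)) (r' := 0)
      (b' := F * l ^ 2 + 2 * l) ?_)) le_rfl ?_
    · by_cases hpar : m % 2 = 0
      · rw [if_pos hpar]
        refine .mk' ?_ le_rfl (by omega)
        rw [← pow_add]; congr 1; omega
      · rw [if_neg hpar]
        refine Sat.mono_cost (h3.bind_eq (Sat.mk (P := (· = D ^ m)) ?_)) le_rfl (by omega)
        rw [← pow_add, ← pow_succ]; congr 1; omega
    · rw [Nat.succ_mul d]; omega

theorem ceilMulLog_sat (hl : 100 ≤ l) (m D A : ℕ) (hm : m < 2 ^ l)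
    (hA : m * len D + len D ≤ A) (hA' : 4 * A < 2 ^ l) :
    (ceilMulLog m D).Sat (· = Nat.clog 2 (D ^ m)) 0 (A * l ^ 5) := by
  refine Sat.mono_cost ((powN_sat hl D m l A hm le_rfl hA hA').bind_eq (.mk rfl)) le_rfl ?_
  have := len_pow D m
  have := one_le_len D
  have a1 : l * (A * l ^ 3) = A * l ^ 4 := by ring
  have a2 := absorb hl A 4 5
  have a3 := le_mul_pow hl A 4
  omega

/-- The three bounds that the algorithms work with. -/
def boundsVal (n T D : ℕ) : ℕ × ℕ × ℕ :=
  (max 1 (Nat.clog 2 (D ^ (n * (T - 1)))), Nat.clog 2 (D ^ (n * T)),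
    max (4 * max 1 (Nat.clog 2 (D ^ (n * (T - 1)))))
      (max 1 (Nat.clog 2 (D ^ (n * (T - 1)))) + Nat.clog 2 (D ^ (n * T)) - 1))

theorem clog_pow_le (D m : ℕ) : Nat.clog 2 (D ^ m) ≤ m * len D := by
  rw [Nat.clog_le_iff_le_pow (by norm_num), mul_comm, pow_mul]
  refine Nat.pow_le_pow_left ?_ _
  have := lt_two_pow_len D; omega

theorem boundsVal_le {n T D : ℕ} (hn : 1 ≤ n) (hT : 1 ≤ T) :
    (boundsVal n T D).1 ≤ n * T * len D ∧ (boundsVal n T D).2.1 ≤ n * T * len D ∧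
      (boundsVal n T D).2.2 ≤ 4 * (n * T * len D) := by
  have h1 : Nat.clog 2 (D ^ (n * (T - 1))) ≤ n * T * len D := (clog_pow_le _ _).trans
    (Nat.mul_le_mul_right _ (Nat.mul_le_mul_left _ (Nat.sub_le _ _)))
  have h2 := clog_pow_le D (n * T)
  have h3 : 1 ≤ n * T * len D := Nat.mul_pos (Nat.mul_pos hn hT) (one_le_len D)
  simp only [boundsVal]
  omega

theorem bounds_sat (hl : 100 ≤ l) {n T D A : ℕ} (hn : n ≤ A) (hT : T ≤ A)
    (hA : n * T * len D + len D ≤ A) (hA' : 4 * A < 2 ^ l) :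
    (bounds n T D).Sat (· = boundsVal n T D) 0 (A * l ^ 6) := by
  have hD := one_le_len D
  have e0 : n * (T - 1) ≤ n * T := Nat.mul_le_mul_left _ (Nat.sub_le _ _)
  have e5 : n * T ≤ n * T * len D := Nat.le_mul_of_pos_right _ hD
  have e6 : n * (T - 1) * len D ≤ n * T * len D := Nat.mul_le_mul_right _ e0
  have c1 := (clog_pow_le D (n * (T - 1))).trans e6
  have c2 := clog_pow_le D (n * T)
  have s1 := len_small hn hA' hl
  have s2 := len_small hT hA' hl
  have s3 := len_small ((Nat.sub_le T 1).trans hT) hA' hl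
  have s4 := len_small (x := Nat.clog 2 (D ^ (n * (T - 1)))) (by omega) hA' hl
  have s5 := len_small (x := Nat.clog 2 (D ^ (n * T))) (by omega) hA' hl
  have hll := two_mul_lt hl
  rw [bounds]
  refine Sat.mono_cost (Sat.bind_eq (mulN_sat (A := 2 * l) (by omega) hll) (Sat.bind_eq
    (mulN_sat (A := 2 * l) (by omega) hll) (Sat.bind_eq
    (ceilMulLog_sat hl _ D A (by omega) (by omega) hA') (Sat.bind_eq
    (ceilMulLog_sat hl _ D A (by omega) (by omega) hA') (Sat.mk rfl))))) le_rfl ?_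
  have a5 := absorb hl A 5 6
  have a4 := absorb hl A 4 5
  have a3 := absorb hl A 3 4
  have a2 := absorb hl A 2 3
  have a1 := absorb hl A 1 2
  have hA1 : 1 ≤ A := by omega
  have b1 : 2 * l * l ^ 2 ≤ 2 * (A * l ^ 3) := by
    rw [show 2 * (A * l ^ 3) = A * (2 * l * l ^ 2) by ring]
    exact Nat.le_mul_of_pos_left _ hA1
  have b2 : l ≤ A * l ^ 1 := by rw [pow_one]; exact Nat.le_mul_of_pos_left _ hA1
  omega

theorem length_le_sum_len (ms : List ℕ) : ms.length ≤ (ms.map len).sum := by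
  have := List.card_nsmul_le_sum (ms.map len) 1 (by simp [one_le_len])
  simpa using this

theorem len_mul_pred (a b : ℕ) : len (a * b) + 1 ≤ len a + len b := by
  have h : len (a * b) ≤ (len a - 1 + (len b - 1)) + 1 := by
    rw [len_le_iff, pow_add]
    exact Nat.mul_lt_mul'' (Nat.lt_size_self a) (Nat.lt_size_self b)
  have := one_le_len a; have := one_le_len b
  omega

theorem len_one : len 1 = 2 := by simp [len, Nat.size_one]

theorem len_prod_le (ms : List ℕ) (h : ms ≠ []) : len ms.prod ≤ (ms.map len).sum := by
  induction ms with
  | nil => exact absurd rfl h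
  | cons m ms ih =>
    rw [List.prod_cons, List.map_cons, List.sum_cons]
    by_cases h0 : ms = []
    · simp [h0]
    · have := len_mul_pred m ms.prod; have := ih h0; omega

/-- On each of the at most `d` levels of the tree the operands have total length at most that of the
whole list. -/
theorem prodTree_sat (hl : 100 ≤ l) (ms : List ℕ) (d : ℕ) (hd : ms.length ≤ 2 ^ d)
    (hA : 4 * (ms.map len).sum < 2 ^ l) :
    (prodTree ms).Sat (· = ms.prod) 0 (1 + d * ((ms.map len).sum * l ^ 3)) := by
  have base : ∀ (d : ℕ) (ms : List ℕ) (h : ms.length ≤ 1),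
      (prodTree ms).Sat (· = ms.prod) 0 (1 + d * ((ms.map len).sum * l ^ 3)) := by
    intro d ms h
    rw [prodTree, dif_pos h]
    refine .mk' ?_ le_rfl (by omega)
    match ms, h with
    | [], _ => rfl
    | [m], _ => simp
  induction d generalizing ms with
  | zero => exact base 0 ms (by simpa using hd)
  | succ d ih =>
    by_cases h : ms.length ≤ 1
    · exact base _ ms h
    rw [prodTree, dif_neg h]
    rw [pow_succ] at hd
    have hms := (List.take_append_drop (ms.length / 2) ms).symm
    have l1 : (ms.take (ms.length / 2)).length = ms.length / 2 := by rw [List.length_take]; omega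
    have l2 : (ms.drop (ms.length / 2)).length = ms.length - ms.length / 2 := List.length_drop
    generalize ms.take (ms.length / 2) = m1 at hms l1 ⊢
    generalize ms.drop (ms.length / 2) = m2 at hms l2 ⊢
    have hsum : (ms.map len).sum = (m1.map len).sum + (m2.map len).sum := by
      rw [hms, List.map_append, List.sum_append]
    have hprod : ms.prod = m1.prod * m2.prod := by rw [hms, List.prod_append]
    have p0 := length_le_sum_len ms
    have n1 := len_prod_le m1 (by rintro rfl; simp at l1; omega)
    have n2 := len_prod_le m2 (by rintro rfl; simp at l2; omega)
    rw [hsum] at hA ⊢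
    refine Sat.mono_cost (Sat.bind_eq (ih m1 (by omega) (by omega)) (Sat.bind_eq
      (ih m2 (by omega) (by omega)) (Sat.bind_eq
      (mulN_sat (A := (m1.map len).sum + (m2.map len).sum) (l := l) (by omega) (by omega))
      (Sat.mk hprod.symm)))) le_rfl ?_
    rw [hsum] at p0
    generalize (m1.map len).sum = S1 at *
    generalize (m2.map len).sum = S2 at *
    have a2 := absorb hl (S1 + S2) 2 3
    have a1 := le_mul_pow hl (S1 + S2) 2
    have e : d * (S1 * l ^ 3) + d * (S2 * l ^ 3) = d * ((S1 + S2) * l ^ 3) := by ring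
    rw [Nat.succ_mul]
    omega

theorem len_mod_le {x a : ℕ} (ha : 0 < a) : len (x % a) ≤ len a := len_mono (Nat.mod_lt _ ha).le
theorem len_mod_le' (x a : ℕ) : len (x % a) ≤ len x := len_mono (Nat.mod_le _ _)
theorem len_div_le (x a : ℕ) : len (x / a) ≤ len x := len_mono (Nat.div_le_self _ _)
theorem len_sub_le (x a : ℕ) : len (x - a) ≤ len x := len_mono (Nat.sub_le _ _)

/-- The full length of `x` is paid only at the root. Below it every number is a residue modulo the
product of the moduli in its subtree, so a level costs no more than the total length of the moduli.
Residues are preserved since each modulus divides the product of its subtree. -/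
theorem multiMod_sat (hl : 100 ≤ l) (x : ℕ) (ms : List ℕ) (d : ℕ) (hd : ms.length ≤ 2 ^ d)
    (hdl : d ≤ l) (hpos : ∀ m ∈ ms, 0 < m) (hA : 4 * (len x + (ms.map len).sum) < 2 ^ l) :
    (multiMod x ms).Sat (· = ms.map (x % ·)) 0
      (len x * l ^ 3 + 1 + (d + 1) * ((ms.map len).sum * l ^ 6)) := by
  have base : ∀ (d x : ℕ) (ms : List ℕ) (_ : ms.length ≤ 1),
      4 * (len x + (ms.map len).sum) < 2 ^ l →
      (multiMod x ms).Sat (· = ms.map (x % ·)) 0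
      (len x * l ^ 3 + 1 + (d + 1) * ((ms.map len).sum * l ^ 6)) := by
    intro d x ms h hA
    rw [multiMod, dif_pos h]
    refine Sat.mono_cost (Sat.map_eq_const (r := 0) (g := (x % ·))
      (b := (len x + (ms.map len).sum) * l ^ 2)
      fun m hm => modN_sat ?_ (by omega)) (by omega) ?_
    · have := List.single_le_sum (l := ms.map len) (by simp) (len m) (List.mem_map_of_mem hm)
      omega
    · match ms, h with
      | [], _ => simp
      | [m], _ =>
        have a1 := absorb hl (len x) 2 3
        have a2 : len m * l ^ 2 ≤ len m * l ^ 5 := mul_pow_mono hl _ (by omega)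
        have a3 := absorb hl (len m) 5 6
        have a5 : len m * l ^ 6 ≤ (d + 1) * (len m * l ^ 6) := Nat.le_mul_of_pos_left _ d.succ_pos
        have a6 := le_mul_pow hl (len m) 5
        have := one_le_len m
        simp only [List.map_cons, List.map_nil, List.sum_cons, List.sum_nil, List.length_cons,
          List.length_nil, add_zero, zero_add, one_mul]
        rw [add_mul]
        omega
  induction d generalizing ms x with
  | zero =>
    exact base 0 x ms (by simpa using hd) hA
  | succ d ih =>
    by_cases h : ms.length ≤ 1
    · exact base _ x ms h hA
    rw [multiMod, dif_neg h]
    rw [pow_succ] at hd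
    have hms := (List.take_append_drop (ms.length / 2) ms).symm
    have l1 : (ms.take (ms.length / 2)).length = ms.length / 2 := by rw [List.length_take]; omega
    have l2 : (ms.drop (ms.length / 2)).length = ms.length - ms.length / 2 := List.length_drop
    generalize ms.take (ms.length / 2) = m1 at hms l1 ⊢
    generalize ms.drop (ms.length / 2) = m2 at hms l2 ⊢
    have hsum : (ms.map len).sum = (m1.map len).sum + (m2.map len).sum := by
      rw [hms, List.map_append, List.sum_append]
    have p0 := length_le_sum_len ms
    have q1 : ∀ m ∈ m1, 0 < m := fun m hm => hpos m (by rw [hms]; simp [hm])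
    have q2 : ∀ m ∈ m2, 0 < m := fun m hm => hpos m (by rw [hms]; simp [hm])
    have n1 := len_prod_le m1 (by rintro rfl; simp at l1; omega)
    have n2 := len_prod_le m2 (by rintro rfl; simp at l2; omega)
    have r1 : len (x % m1.prod) ≤ (m1.map len).sum :=
      (len_mod_le (List.prod_pos q1)).trans n1
    have r2 : len (x % m2.prod) ≤ (m2.map len).sum :=
      (len_mod_le (List.prod_pos q2)).trans n2
    have r3 := len_mod_le' x m1.prod
    have r4 := len_mod_le' x m2.prod
    rw [hsum] at hA ⊢
    refine Sat.mono_cost (Sat.bind_eq (prodTree_sat hl m1 d (by omega) (by omega)) (Sat.bind_eq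
      (modN_sat (A := len x + (m1.map len).sum) (l := l) (by omega) (by omega)) (Sat.bind_eq
      (prodTree_sat hl m2 d (by omega) (by omega)) (Sat.bind_eq
      (modN_sat (A := len x + (m2.map len).sum) (l := l) (by omega) (by omega)) (Sat.bind_eq
      (ih _ m1 (by omega) (by omega) q1 (by omega)) (Sat.bind_eq
      (ih _ m2 (by omega) (by omega) q2 (by omega))
      (Sat.mk ?_))))))) le_rfl ?_
    · have e1 : m1.map (x % m1.prod % ·) = m1.map (x % ·) :=
        List.map_congr_left fun m hm => Nat.mod_mod_of_dvd _ (List.dvd_prod hm)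
      have e2 : m2.map (x % m2.prod % ·) = m2.map (x % ·) :=
        List.map_congr_left fun m hm => Nat.mod_mod_of_dvd _ (List.dvd_prod hm)
      rw [e1, e2, hms, List.map_append]
    · have t1 := Nat.mul_le_mul_right (l ^ 3) r1
      have t2 := Nat.mul_le_mul_right (l ^ 3) r2
      rw [hsum] at p0
      have t0 := one_le_len x
      generalize (m1.map len).sum = S1 at *
      generalize (m2.map len).sum = S2 at *
      generalize len (x % m1.prod) * l ^ 3 = Y at *
      generalize len (x % m2.prod) * l ^ 3 = Z at *
      have e : (d + 1) * (S1 * l ^ 6) + (d + 1) * (S2 * l ^ 6) =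
        (d + 1) * ((S1 + S2) * l ^ 6) := by ring
      have e' : d * (S1 * l ^ 3) + d * (S2 * l ^ 3) ≤ (S1 + S2) * l ^ 4 := by
        rw [show (S1 + S2) * l ^ 4 = l * (S1 * l ^ 3) + l * (S2 * l ^ 3) by ring]
        exact Nat.add_le_add (Nat.mul_le_mul_right _ (by omega))
          (Nat.mul_le_mul_right _ (by omega))
      have a2 := absorb hl (S1 + S2) 2 3
      have a3 := absorb hl (S1 + S2) 3 4
      have a4 := absorb hl (S1 + S2) 4 6
      have b2 := absorb hl (len x) 2 3
      have a1 := le_mul_pow hl (S1 + S2) 2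
      have e3 : S1 * l ^ 3 + S2 * l ^ 3 = (S1 + S2) * l ^ 3 := by ring
      have e4 : (len x + S1) * l ^ 2 + (len x + S2) * l ^ 2 =
        2 * (len x * l ^ 2) + (S1 + S2) * l ^ 2 := by ring
      rw [Nat.succ_mul (d + 1)]
      omega

end Integers

end SparseInterp

namespace SparseInterp

open Cost

/-! ### Digits, powers modulo p, Chinese remaindering -/

section Integers

variable {l : ℕ}

theorem mul_lt_two_pow (hl : 100 ≤ l) : 90 * l < 2 ^ l := by
  have h1 : l - 7 < 2 ^ (l - 7) := Nat.lt_two_pow_self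
  have h2 : 2 ^ l = 128 * 2 ^ (l - 7) := by
    rw [show l = 7 + (l - 7) by omega, pow_add]; simp
  omega

theorem evalDigits_sat (hl : 100 ≤ l) {D : ℕ} (hD : 2 ≤ D) (es : List ℕ) (d : ℕ)
    (hd : es.length ≤ 2 ^ d) (hes : ∀ e ∈ es, e < D) (hA : 8 * (es.length * len D) < 2 ^ l) :
    (evalDigits D es).Sat (· = (Nat.ofDigits D es, D ^ es.length)) 0
      (1 + d * (es.length * len D * l ^ 3)) := by
  have base : ∀ (d : ℕ) (es : List ℕ) (h : es.length ≤ 1),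
      (evalDigits D es).Sat (· = (Nat.ofDigits D es, D ^ es.length)) 0
        (1 + d * (es.length * len D * l ^ 3)) := by
    intro d es h
    rw [evalDigits, dif_pos h]
    refine .mk' ?_ le_rfl (by omega)
    match es, h with
    | [], _ => simp [Nat.ofDigits]
    | [m], _ => simp [Nat.ofDigits]
  induction d generalizing es with
  | zero => exact base 0 es (by simpa using hd)
  | succ d ih =>
    by_cases h : es.length ≤ 1
    · exact base _ es h
    rw [evalDigits, dif_neg h]
    rw [pow_succ] at hd
    have hms := (List.take_append_drop (es.length / 2) es).symm
    have l1 : (es.take (es.length / 2)).length = es.length / 2 := by rw [List.length_take]; omega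
    have l2 : (es.drop (es.length / 2)).length = es.length - es.length / 2 := List.length_drop
    generalize es.take (es.length / 2) = m1 at hms l1 ⊢
    generalize es.drop (es.length / 2) = m2 at hms l2 ⊢
    have q1 : ∀ m ∈ m1, m < D := fun m hm => hes m (by rw [hms]; simp [hm])
    have q2 : ∀ m ∈ m2, m < D := fun m hm => hes m (by rw [hms]; simp [hm])
    have hsum : es.length = m1.length + m2.length := by rw [hms, List.length_append]
    have hv : Nat.ofDigits D es = Nat.ofDigits D m1 + D ^ m1.length * Nat.ofDigits D m2 := by
      rw [hms, Nat.ofDigits_append]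
    have k1 : len (Nat.ofDigits D m1) ≤ m1.length * len D + 2 :=
      (len_mono (Nat.ofDigits_lt_base_pow_length (by omega) q1).le).trans (len_pow _ _)
    have k2 : len (Nat.ofDigits D m2) ≤ m2.length * len D + 2 :=
      (len_mono (Nat.ofDigits_lt_base_pow_length (by omega) q2).le).trans (len_pow _ _)
    have k3 := len_pow D m1.length
    have k4 := len_pow D m2.length
    have k5 := len_mul (D ^ m1.length) (Nat.ofDigits D m2)
    have hD1 := one_le_len D
    have j1 : m1.length ≤ m1.length * len D := Nat.le_mul_of_pos_right _ hD1
    have j2 : m2.length ≤ m2.length * len D := Nat.le_mul_of_pos_right _ hD1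
    have j3 : es.length * len D = m1.length * len D + m2.length * len D := by
      rw [hsum, add_mul]
    obtain ⟨F, hF⟩ : ∃ F, F = 4 * (es.length * len D) := ⟨_, rfl⟩
    have hF2 : F * l ^ 2 = 4 * (es.length * len D * l ^ 2) := by rw [hF, mul_assoc]
    refine Sat.mono_cost (Sat.bind_eq (ih m1 (by omega) q1 (by omega)) (Sat.bind_eq
      (ih m2 (by omega) q2 (by omega)) (Sat.bind_eq
      (mulN_sat (A := F) (l := l) (by simp only; omega) (by omega)) (Sat.bind_eq (addN_sat _ _)
        (Sat.bind_eq (mulN_sat (A := F) (l := l) (by simp only; omega) (by omega))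
      (Sat.mk ?_)))))) le_rfl ?_
    · rw [hv, ← pow_add, ← hsum]
    · have a2 := absorb hl (es.length * len D) 2 3
      have a1 := le_mul_pow hl (es.length * len D) 2
      have e : d * (m1.length * len D * l ^ 3) + d * (m2.length * len D * l ^ 3) =
        d * (es.length * len D * l ^ 3) := by rw [j3]; ring
      rw [Nat.succ_mul d]
      simp only
      omega

/-- The value of `digitsN`. -/
def digitsVal (D : ℕ) : ℕ → ℕ → List ℕ × ℕ
  | 0, d => ([], d)
  | m + 1, d => (d % D :: (digitsVal D m (d / D)).1, (digitsVal D m (d / D)).2)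

theorem digitsVal_spec {D : ℕ} (hD : 0 < D) (m d : ℕ) :
    (digitsVal D m d).1.length = m ∧ (∀ e ∈ (digitsVal D m d).1, e < D) ∧
      Nat.ofDigits D (digitsVal D m d).1 + D ^ m * (digitsVal D m d).2 = d := by
  induction m generalizing d with
  | zero => simp [digitsVal]
  | succ m ih =>
    obtain ⟨h1, h2, h3⟩ := ih (d / D)
    refine ⟨by simp [digitsVal, h1], ?_, ?_⟩
    · intro e he
      rcases List.mem_cons.1 he with rfl | he
      · exact Nat.mod_lt _ hD
      · exact h2 e he
    · simp only [digitsVal, Nat.ofDigits_cons]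
      conv_rhs => rw [← Nat.mod_add_div d D, ← h3]
      ring

theorem digitsVal_ofDigits {D : ℕ} (es : List ℕ) (hes : ∀ e ∈ es, e < D) :
    digitsVal D es.length (Nat.ofDigits D es) = (es, 0) := by
  induction es with
  | nil => rfl
  | cons e es ih =>
    have he := hes e (by simp)
    have h1 : (e + D * Nat.ofDigits D es) % D = e := by
      rw [Nat.add_mul_mod_self_left, Nat.mod_eq_of_lt he]
    have h2 : (e + D * Nat.ofDigits D es) / D = Nat.ofDigits D es := by
      rw [Nat.add_mul_div_left _ _ (by omega), Nat.div_eq_of_lt he, zero_add]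
    rw [Nat.ofDigits_cons, List.length_cons, digitsVal]
    simp only [h1, h2, ih fun e he => hes e (by simp [he])]

theorem digitsN_sat (hl : 100 ≤ l) {D A : ℕ} (hA : A < 2 ^ l) (m d : ℕ)
    (hd : len d + len D ≤ A) :
    (digitsN D m d).Sat (· = digitsVal D m d) 0 (m * (A * l ^ 3)) := by
  induction m generalizing d with
  | zero => exact .mk' rfl le_rfl (by omega)
  | succ m ih =>
    rw [digitsN]
    have h1 := len_div_le d D
    refine Sat.mono_cost (Sat.bind_eq (modN_sat hd hA) (Sat.bind_eq (divN_sat hd hA)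
      (Sat.bind_eq (ih (d / D) (by omega)) (Sat.mk rfl)))) le_rfl ?_
    have a2 := absorb hl A 2 3
    have a1 := le_mul_pow hl A 2
    have := one_le_len d
    rw [Nat.succ_mul m]; omega

theorem powersMod_sat (hl : 100 ≤ l) {D p A : ℕ} (hp : 0 < p) (hA : A < 2 ^ l)
    (hA' : 2 * len p + len D ≤ A) (m w : ℕ) (hw : len w ≤ len p + len D) :
    (powersMod D p m w).Sat (· = (List.range m).map fun i => w * D ^ i % p) 0
      (m * (A * l ^ 3)) := by
  induction m generalizing w with
  | zero => exact .mk' rfl le_rfl (by omega)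
  | succ m ih =>
    rw [powersMod]
    have h1 := len_mod_le (x := w) hp
    have h2 := len_mul (w % p) D
    have := one_le_len p
    refine Sat.mono_cost (Sat.bind_eq (modN_sat (A := A) (l := l) (by omega) hA) (Sat.bind_eq
      (mulN_sat (A := A) (l := l) (by omega) hA)
      (Sat.bind_eq (ih _ (by omega)) (Sat.mk ?_)))) le_rfl ?_
    · rw [List.range_succ_eq_map, List.map_cons, List.map_map, pow_zero, mul_one]
      congr 1
      refine List.map_congr_left fun i _ => ?_
      simp only [Function.comp]
      rw [mul_assoc, ← pow_succ', Nat.mod_mul_mod]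
    · have a2 := absorb hl A 2 3
      have a1 := le_mul_pow hl A 2
      rw [Nat.succ_mul m]; omega

theorem findExp_sat (hl : 100 ≤ l) {D p A : ℕ} (hA : A < 2 ^ l)
    (hA' : 2 * len p + 2 * len D ≤ A) (fuel κ : ℕ) (h : p ≤ D ^ (κ + fuel))
    (hκ : ∀ i < κ, D ^ i < p) :
    (findExp D p fuel (D ^ κ) κ).Sat (fun r => p ≤ D ^ r ∧ (∀ i < r, D ^ i < p) ∧ r ≤ κ + fuel) 0
      (fuel * (A * l ^ 3)) := by
  -- The search has not stopped before κ, so D^(κ - 1) < p; the current power exceeds p by at most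
  -- one factor D.
  have hlen : len (D ^ κ) ≤ len p + len D + 1 := by
    rcases Nat.eq_zero_or_pos κ with rfl | h0
    · rw [pow_zero, len_one]; have := one_le_len p; have := one_le_len D; omega
    · obtain ⟨k, rfl⟩ := Nat.exists_eq_succ_of_ne_zero h0.ne'
      have h1 := hκ k (by omega)
      have h2 := len_mul (D ^ k) D
      have h3 := len_mono h1.le
      rw [Nat.succ_eq_add_one, pow_succ]; omega
  induction fuel generalizing κ with
  | zero => exact ⟨⟨h, hκ, le_rfl⟩, Nat.zero_le _, Nat.zero_le _⟩
  | succ fuel ih =>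
    have := one_le_len p
    have a2 := absorb hl A 2 3
    have a1 := le_mul_pow hl A 2
    rw [findExp]
    refine Sat.mono_cost (Sat.bind_eq (leN_sat _ _) (r' := 0) (b' := A * l ^ 2 + fuel * (A * l ^ 3))
      ?_) le_rfl (by rw [Nat.succ_mul fuel]; omega)
    by_cases hle : p ≤ D ^ κ
    · rw [decide_eq_true hle, if_pos rfl]
      exact Sat.mono_cost (Sat.ret (P := fun r => p ≤ D ^ r ∧ (∀ i < r, D ^ i < p) ∧
        r ≤ κ + (fuel + 1)) ⟨hle, hκ, by omega⟩) le_rfl (Nat.zero_le _)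
    · rw [decide_eq_false hle, if_neg (by simp)]
      have hlt : D ^ κ < p := by omega
      have h3 := len_mono hlt.le
      refine Sat.mono_cost (Sat.bind_eq (mulN_sat (A := A) (l := l) (by omega) hA)
        (Sat.mono_val (ih (κ + 1) ?_ ?_ ?_) ?_)) le_rfl le_rfl
      · rwa [show κ + 1 + fuel = κ + (fuel + 1) by omega]
      · intro i hi
        rcases Nat.lt_succ_iff_lt_or_eq.1 hi with h | rfl
        · exact hκ i h
        · exact hlt
      · have h2 := len_mul (D ^ κ) D
        rw [pow_succ]; omega
      · rintro r ⟨h1, h2, h3⟩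
        exact ⟨h1, h2, by omega⟩

theorem dotN_sat (hl : 100 ≤ l) {A : ℕ} (hA : A < 2 ^ l) (as bs : List ℕ)
    (h1 : len ((as.zip bs).map fun x => x.1 * x.2).sum ≤ A)
    (h2 : ∀ x ∈ as.zip bs, len x.1 + len x.2 ≤ A) :
    (dotN as bs).Sat (· = ((as.zip bs).map fun x => x.1 * x.2).sum) 0
      ((as.zip bs).length * (A * l ^ 3) + 1) := by
  rw [dotN]
  refine Sat.mono_cost (Sat.fold_const (r := 0) (b := A * l ^ 2 + 2 * A)
    (fun (pre : List (ℕ × ℕ)) s => s = (pre.map fun x => x.1 * x.2).sum)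
    rfl ?_) (by omega) ?_
  · rintro pre a post he c rfl
    have h3 : len (pre.map fun x => x.1 * x.2).sum ≤ A := by
      refine (len_mono ?_).trans h1
      rw [he, List.map_append, List.sum_append]; omega
    have h4 := h2 a (by simp [he])
    have h5 := len_mul a.1 a.2
    refine Sat.mono_cost (Sat.bind_eq (mulN_sat (A := A) (l := l) h4 hA)
      (Sat.mono_val (addN_sat _ _) ?_)) le_rfl (by omega)
    rintro _ rfl; simp
  · rw [Nat.add_le_add_iff_right]
    refine Nat.mul_le_mul_left _ ?_
    have a2 := absorb hl A 2 3
    have a1 := le_mul_pow hl A 2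
    rcases Nat.eq_zero_or_pos A with rfl | h0
    · have := one_le_len ((as.zip bs).map fun x => x.1 * x.2).sum
      omega
    · omega

/-- Exhaustive search is affordable because the moduli used for Chinese remaindering are the first
few primes. The conclusion is conditional because the search returns 0 when there is no solution. -/
theorem solveMod_sat (hl : 100 ≤ l) {r s e p : ℕ} (hp : 0 < p) (hpl : len p ≤ l)
    (hr : r < p) (hs : s < p) (he : e < p) :
    (solveMod r s e p).Sat (fun t => t < p ∧ ((∃ t₀ < p, (r + s * t₀) % p = e) →
      (r + s * t) % p = e)) 0 (p * l ^ 4) := by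
  rw [solveMod]
  have hll := mul_lt_two_pow hl
  have e1 := len_mono hr.le
  have e2 := len_mono hs.le
  have e3 := len_mono he.le
  refine Sat.mono (Sat.fold_const (r := 0) (b := 20 * (1 * l ^ 3)) (fun pre t => t < p ∧ ((∃ t₀ ∈ pre, (r + s * t₀) % p = e) →
      (r + s * t) % p = e)) ⟨hp, by simp⟩ ?_) ?_ (by omega) ?_
  · rintro pre a post hpre c ⟨hc, hc'⟩
    have ha : a < p := by
      have : a ∈ List.range p := by rw [hpre]; simp
      simpa using this
    have e4 := len_mono ha.le
    have e5 := len_mul s a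
    have e6 := len_add r (s * a)
    have e7 := len_mod_le (x := r + s * a) hp
    obtain ⟨F, hF⟩ : ∃ F, F = 2 * l := ⟨_, rfl⟩
    obtain ⟨G, hG⟩ : ∃ G, G = 4 * l := ⟨_, rfl⟩
    refine Sat.mono_cost (Sat.bind_eq (mulN_sat (A := F) (l := l) (by omega) (by omega))
      (Sat.bind_eq (addN_sat _ _) (Sat.bind_eq (modN_sat (A := G) (l := l) (by omega) (by omega))
      (Sat.mk ?_)))) le_rfl ?_
    · split_ifs with h
      · exact ⟨ha, fun _ => h⟩
      · refine ⟨hc, ?_⟩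
        rintro ⟨t₀, ht, h0⟩
        rw [List.mem_append, List.mem_singleton] at ht
        rcases ht with ht | rfl
        · exact hc' ⟨t₀, ht, h0⟩
        · exact absurd h0 h
    · have f1 : F * l ^ 2 = 2 * l ^ 3 := by rw [hF]; ring
      have f2 : G * l ^ 2 = 4 * l ^ 3 := by rw [hG]; ring
      have f3 : l ≤ l ^ 3 := Nat.le_self_pow (by norm_num) _
      have f4 : linBits ((r + s * a) % p) e ≤ 2 * l := by rw [linBits]; omega
      omega
  · rintro t ⟨h1, h2⟩
    refine ⟨h1, fun ⟨t₀, ht, h0⟩ => h2 ⟨t₀, by simpa using ht, h0⟩⟩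
  · rw [List.length_range]
    have a2 := absorb hl 1 3 4
    have a0 := absorb hl 1 0 4
    simp only [one_mul, pow_zero] at a0 a2 ⊢
    calc p * (20 * l ^ 3 + 1) + 1 ≤ p * (20 * l ^ 3 + 2) := by rw [mul_add, mul_add]; omega
      _ ≤ p * l ^ 4 := Nat.mul_le_mul_left _ (by omega)

/-- Incremental remaindering: the invariant is a solution x < M for the moduli treated so far, M
being their product. Adding a multiple of M leaves the old residues alone and, as M is a unit modulo
the next modulus, can produce any new one. Here `A` bounds the length of the full product and `Q`
the size of a single modulus. -/
theorem chineseRem_sat (hl : 100 ≤ l) {A Q : ℕ} (rs : List (ℕ × ℕ))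
    (hlt : ∀ x ∈ rs, x.1 < x.2) (hco : (rs.map Prod.snd).Pairwise Nat.Coprime)
    (hA : (rs.map fun x => len x.2).sum + 2 ≤ A) (hA' : 4 * A < 2 ^ l)
    (hQ : ∀ x ∈ rs, x.2 ≤ Q) (hQl : len Q ≤ l) :
    (chineseRem rs).Sat (fun x => x < (rs.map Prod.snd).prod ∧ ∀ y ∈ rs, x % y.2 = y.1) 0
      (rs.length * ((A + Q) * l ^ 5) + 1) := by
  rw [chineseRem]
  refine Sat.mono (r := _ + 0) (b := _ + 0) (Sat.bind (Sat.fold_const (r := 0) (b := (A + Q) * l ^ 4)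
    (fun pre st => st.2 = (pre.map Prod.snd).prod ∧ st.1 < st.2 ∧ ∀ y ∈ pre, st.1 % y.2 = y.1)
    (by simp) ?_) (fun st hst => Sat.ret (P := fun x => x < (rs.map Prod.snd).prod ∧
      ∀ y ∈ rs, x % y.2 = y.1) ⟨hst.1 ▸ hst.2.1, hst.2.2⟩)) (fun _ => id) (by omega) ?_
  · rintro pre ⟨e, p⟩ post hpre ⟨x, M⟩ ⟨hM, hx, hxy⟩
    simp only at hM hx hxy ⊢
    have hep : e < p := hlt (e, p) (by simp [hpre])
    have hp : 0 < p := by omega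
    have hpl : len p ≤ l := (len_mono (hQ (e, p) (by simp [hpre]))).trans hQl
    have hpQ : p ≤ Q := hQ (e, p) (by simp [hpre])
    have hsum : (rs.map fun x => len x.2).sum = (pre.map fun x => len x.2).sum + (len p +
        (post.map fun x => len x.2).sum) := by
      rw [hpre]; simp
    have hMl : len M ≤ (pre.map fun x => len x.2).sum + 2 := by
      rw [hM]
      by_cases h0 : pre = []
      · rw [h0]; simp [len, Nat.size_one]
      · have := len_prod_le (pre.map Prod.snd) (by simpa using h0)
        rw [List.map_map] at this
        exact this.trans (Nat.le_add_right _ _)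
    have hcop : Nat.Coprime M p := by
      rw [hM, Nat.coprime_list_prod_left_iff]
      intro q hq
      rw [hpre, List.map_append, List.pairwise_append] at hco
      exact hco.2.2 q hq p (by simp)
    have e1 := len_mono hx.le
    have e2 := len_mod_le (x := x) hp
    have e3 := len_mod_le (x := M) hp
    refine Sat.mono_cost (Sat.bind_eq (modN_sat (A := A) (l := l) (by omega) (by omega))
      (Sat.bind_eq (modN_sat (A := A) (l := l) (by omega) (by omega))
      (Sat.bind (solveMod_sat hl hp hpl (Nat.mod_lt _ hp) (Nat.mod_lt _ hp) hep)
      (r' := 0) (b' := 2 * (A * l ^ 2) + 2 * A) fun t ht => ?_))) le_rfl ?_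
    · have e4 := len_mono ht.1.le
      have e5 := len_mul M t
      refine Sat.mono_cost (Sat.bind_eq (mulN_sat (A := A) (l := l) (by omega) (by omega))
        (Sat.bind_eq (addN_sat _ _) (Sat.bind_eq (mulN_sat (A := A) (l := l) (by omega) (by omega))
        (Sat.ret ⟨?_, ?_, ?_⟩)))) le_rfl (by omega)
      · simp [hM]
      · simp only
        calc x + M * t < M + M * t := by omega
          _ = M * (t + 1) := by ring
          _ ≤ M * p := Nat.mul_le_mul_left _ ht.1
      · intro y hy
        rw [List.mem_append, List.mem_singleton] at hy
        rcases hy with hy | rfl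
        · have hd : y.2 ∣ M := by rw [hM]; exact List.dvd_prod (List.mem_map_of_mem hy)
          simp only
          rw [Nat.add_mod, (Nat.mod_eq_zero_of_dvd (hd.mul_right t)), add_zero, Nat.mod_mod,
            hxy y hy]
        -- Solvability: the wanted difference of residues is multiplied by an inverse of M modulo p.
        -- The modulus 1 is treated apart, since the inverse is provided only for p > 1.
        · have hsol : ∃ t₀ < p, (x % p + M % p * t₀) % p = e := by
            obtain ⟨m, hm, h1⟩ : ∃ m < p, M * m % p = (e + (p - x % p)) % p := by
              rcases Nat.lt_or_ge 1 p with h1p | h1p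
              · obtain ⟨m, hm, h1⟩ := Nat.exists_mul_mod_eq_one_of_coprime hcop h1p
                refine ⟨m * (e + (p - x % p)) % p, Nat.mod_lt _ hp, ?_⟩
                rw [Nat.mul_mod_mod, ← mul_assoc, ← Nat.mod_mul_mod, h1, one_mul]
              · exact ⟨0, hp, by rw [show p = 1 by omega]; simp [Nat.mod_one]⟩
            refine ⟨m, hm, ?_⟩
            have hxp := Nat.mod_lt x hp
            rw [Nat.add_mod, Nat.mod_mul_mod, h1, Nat.mod_mod, ← Nat.add_mod,
              show x + (e + (p - x % p)) = e + p * (x / p + 1) by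
                have := Nat.mod_add_div x p; rw [mul_add]; omega,
              Nat.add_mul_mod_self_left, Nat.mod_eq_of_lt hep]
          have h2 := ht.2 hsol
          rw [Nat.add_mod, Nat.mod_mod, Nat.mod_mul_mod, ← Nat.add_mod] at h2
          exact h2
    · have a2 := absorb hl A 2 4
      have a1 := le_mul_pow hl A 2
      have q1 : p * l ^ 4 ≤ Q * l ^ 4 := Nat.mul_le_mul_right _ hpQ
      have : (A + Q) * l ^ 4 = A * l ^ 4 + Q * l ^ 4 := add_mul _ _ _
      omega
  · rw [add_zero, Nat.add_le_add_iff_right]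
    refine Nat.mul_le_mul_left _ ?_
    have a2 := absorb hl (A + Q) 4 5
    have a1 := le_mul_pow hl (A + Q) 4
    omega

/-- Every prime at least doubles the product, so at most `k` of them are taken. A factor is appended
only while M < D, which bounds the length of M. -/
theorem prefixTo_sat (hl : 100 ≤ l) {D A : ℕ} (hA : A < 2 ^ l) (hA1 : len D + l ≤ A)
    (k M : ℕ) (ps : List ℕ) (hps : ∀ p ∈ ps, 2 ≤ p) (hpl : ∀ p ∈ ps, len p ≤ l)
    (hM : len M ≤ len D + l) (hD : D ≤ M * ps.prod) (hk : D ≤ M * 2 ^ k) :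
    (prefixTo D M ps).Sat (fun qs => (∃ j ≤ k, qs = ps.take j) ∧ D ≤ M * qs.prod) 0
      ((k + 1) * (A * l ^ 3)) := by
  have a2 := absorb hl A 2 3
  have a1 := le_mul_pow hl A 2
  induction ps generalizing k M with
  | nil => exact ⟨⟨⟨0, Nat.zero_le _, rfl⟩, by simpa [prefixTo, Cost.ret] using hD⟩, Nat.zero_le _,
    Nat.zero_le _⟩
  | cons p ps ih =>
    rw [prefixTo]
    refine Sat.mono_cost (Sat.bind_eq (leN_sat _ _) (r' := 0)
      (b' := A * l ^ 2 + k * (A * l ^ 3) + 1) ?_) le_rfl (by rw [Nat.succ_mul k]; omega)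
    by_cases hle : D ≤ M
    · rw [decide_eq_true hle, if_pos rfl]
      exact Sat.mono_cost (.ret ⟨⟨0, Nat.zero_le _, rfl⟩, by simpa using hle⟩) le_rfl
        (Nat.zero_le _)
    · rw [decide_eq_false hle, if_neg (by simp)]
      obtain ⟨k, rfl⟩ : ∃ k', k = k' + 1 :=
        ⟨k - 1, by rcases Nat.eq_zero_or_pos k with rfl | h0; (· simp at hk; omega); omega⟩
      have h2 := hps p (by simp)
      have h3 := hpl p (by simp)
      have h4 := len_mul M p
      have h5 := len_mono (show M ≤ D by omega)
      refine Sat.mono_cost (Sat.bind_eq (mulN_sat (A := A) (l := l) (by omega) hA)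
        (Sat.bind (ih k (M * p) (fun q hq => hps q (by simp [hq])) (fun q hq => hpl q (by simp [hq]))
          (by omega) (by rwa [List.prod_cons, ← mul_assoc] at hD) ?_)
          fun qs hqs => Sat.mk ⟨?_, ?_⟩)) le_rfl le_rfl
      · calc D ≤ M * 2 ^ (k + 1) := hk
          _ = M * 2 * 2 ^ k := by ring
          _ ≤ M * p * 2 ^ k := by gcongr
      · obtain ⟨j, hj, rfl⟩ := hqs.1
        exact ⟨j + 1, by omega, by simp⟩
      · rw [List.prod_cons, ← mul_assoc]; exact hqs.2

end Integers

end SparseInterp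

namespace SparseInterp

open Cost

/-! ### Size of the first N primes, and the sieve -/

section Primes

/-- Chebyshev's lower bound through the least common multiple of 1, …, n: it is at least 2^n / (n +
1), while each prime p ≤ n contributes to it a power of p not exceeding n. -/
theorem le_primeCounting_mul (n : ℕ) : n ≤ (Nat.primeCounting n + 1) * Nat.size (n + 1) := by
  have h1 := Chebyshev.two_pow_le_mul_lcmUpto n
  have h2 : n.lcmUpto ≤ (n + 1) ^ Nat.primeCounting n := by
    rw [Nat.lcmUpto_eq_prod_pow_log, ← Nat.primesLE_card_eq_primeCounting]
    refine Finset.prod_le_pow_card _ _ _ fun p hp => ?_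
    rcases Nat.eq_zero_or_pos n with rfl | hn
    · simp
    · exact (Nat.pow_log_le_self p hn.ne').trans (Nat.le_succ n)
  have h3 : 2 ^ n ≤ 2 ^ ((Nat.primeCounting n + 1) * Nat.size (n + 1)) := by
    calc 2 ^ n ≤ (n + 1) * (n + 1) ^ Nat.primeCounting n :=
          h1.trans (Nat.mul_le_mul_left _ h2)
      _ = (n + 1) ^ (Nat.primeCounting n + 1) := by rw [pow_succ']
      _ ≤ (2 ^ Nat.size (n + 1)) ^ (Nat.primeCounting n + 1) :=
          Nat.pow_le_pow_left (Nat.lt_size_self _).le _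
      _ = 2 ^ ((Nat.primeCounting n + 1) * Nat.size (n + 1)) := by rw [← pow_mul, mul_comm]
  exact (Nat.pow_le_pow_iff_right (by norm_num)).1 h3

/-- Inversion of the Chebyshev bound: if there are fewer than N primes up to n, then n is at most N
times its own binary length, so its length is bounded by that of N. -/
theorem size_le_of_primeCounting_lt {n N : ℕ} (h : Nat.primeCounting n < N) :
    Nat.size (n + 1) ≤ 2 * Nat.size N + 8 := by
  by_contra hc
  have h1 := le_primeCounting_mul n
  set s := Nat.size (n + 1) with hs
  have h2 : 2 ^ (s - 1) ≤ n + 1 := Nat.lt_size.1 (by omega)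
  have h3 : n ≤ N * s := h1.trans (Nat.mul_le_mul_right _ h)
  have h4 : N * s + 1 ≤ 2 ^ Nat.size N * s := by
    have := Nat.lt_size_self N
    calc N * s + 1 ≤ N * s + s := by omega
      _ = (N + 1) * s := by ring
      _ ≤ 2 ^ Nat.size N * s := Nat.mul_le_mul_right _ this
  -- The factor s costs only about half of the exponent s - 1, which leaves a linear inequality
  -- between s and the length of N.
  have h5 : s < 2 ^ ((s + 7) / 2) := by
    have h6 : (s + 7) / 2 - 1 < 2 ^ ((s + 7) / 2 - 1) := Nat.lt_two_pow_self
    have h7 : 2 ^ ((s + 7) / 2) = 2 * 2 ^ ((s + 7) / 2 - 1) := by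
      rw [← pow_succ']; congr 1; omega
    omega
  have h8 : 2 ^ (s - 1) < 2 ^ (Nat.size N + (s + 7) / 2) := by
    rw [pow_add]
    calc 2 ^ (s - 1) ≤ 2 ^ Nat.size N * s := by omega
      _ < _ := Nat.mul_lt_mul_of_pos_left h5 (by positivity)
  have h9 := (Nat.pow_lt_pow_iff_right (by norm_num)).1 h8
  omega

/-- By Bertrand's postulate each doubling of the bound brings a new prime. Hence the fuel N + 1 in
`firstPrimes` cannot run out too early. -/
theorem le_primeCounting_two_pow (j : ℕ) : j ≤ Nat.primeCounting (2 ^ j) := by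
  induction j with
  | zero => simp
  | succ j ih =>
    obtain ⟨p, hp, h1, h2⟩ := Nat.exists_prime_lt_and_le_two_mul (2 ^ j) (by positivity)
    have : Nat.primeCounting (2 ^ j) < Nat.primeCounting (2 ^ (j + 1)) := by
      rw [← Nat.primesLE_card_eq_primeCounting, ← Nat.primesLE_card_eq_primeCounting]
      refine Finset.card_lt_card (Finset.ssubset_iff_of_subset ?_ |>.2 ⟨p, ?_, ?_⟩)
      · intro q hq
        rw [Nat.mem_primesLE] at hq ⊢
        exact ⟨hq.1.trans (Nat.pow_le_pow_right (by norm_num) (by omega)), hq.2⟩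
      · rw [Nat.mem_primesLE, pow_succ']; exact ⟨h2, hp⟩
      · rw [Nat.mem_primesLE]; omega
    omega

/-- The harmonic sum in dyadic blocks: the indices between n / 2 and n together contribute at most
B. It counts the numbers crossed out by the sieve. -/
theorem sum_div_le (B n : ℕ) : ∑ i ∈ Finset.Ioc 0 n, B / i ≤ B * Nat.size n := by
  induction n using Nat.strong_induction_on with
  | _ n ih =>
    rcases Nat.eq_zero_or_pos n with rfl | hn
    · simp
    have h1 := ih (n / 2) (by omega)
    have hs : Nat.size (n / 2) + 1 ≤ Nat.size n := by
      have h1 : 0 < Nat.size n := Nat.size_pos.2 hn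
      have : Nat.size (n / 2) ≤ Nat.size n - 1 := by
        rw [Nat.size_le]
        have := Nat.lt_size_self n
        rw [Nat.div_lt_iff_lt_mul (by norm_num), ← pow_succ]
        rwa [Nat.sub_add_cancel h1]
      omega
    have h2 : ∑ i ∈ Finset.Ioc (n / 2) n, B / i ≤ B := by
      calc ∑ i ∈ Finset.Ioc (n / 2) n, B / i ≤ (Finset.Ioc (n / 2) n).card • (B / (n / 2 + 1)) := by
            refine Finset.sum_le_card_nsmul _ _ _ fun i hi => ?_
            exact Nat.div_le_div_left (Finset.mem_Ioc.1 hi).1 (by omega)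
        _ ≤ (n / 2 + 1) * (B / (n / 2 + 1)) := by
            rw [Nat.card_Ioc, smul_eq_mul]
            exact Nat.mul_le_mul_right _ (by omega)
        _ ≤ B := Nat.mul_div_le _ _
    rw [← Finset.sum_Ioc_consecutive _ (Nat.zero_le _) (Nat.div_le_self n 2)]
    calc _ ≤ B * Nat.size (n / 2) + B := Nat.add_le_add h1 h2
      _ = B * (Nat.size (n / 2) + 1) := by ring
      _ ≤ B * Nat.size n := Nat.mul_le_mul_left _ hs

theorem sum_map_range'_div_le (B n : ℕ) :
    ((List.range' 2 n).map fun i => B / i).sum ≤ B * Nat.size (n + 1) := by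
  refine le_trans ?_ (sum_div_le B (n + 1))
  induction n with
  | zero => simp
  | succ n ih =>
    rw [List.range'_1_concat, List.map_append, List.sum_append, Finset.sum_Ioc_succ_top (by omega)]
    simp only [List.map_cons, List.map_nil, List.sum_cons, List.sum_nil, add_zero]
    rw [show n + 1 + 1 = 2 + n by omega]
    exact Nat.add_le_add_right ih _

/-- The increasing list of the primes up to `B`. -/
def primesUpTo (B : ℕ) : List ℕ := (List.range' 2 (B - 1)).filter Nat.Prime

theorem mem_primesUpTo {B p : ℕ} : p ∈ primesUpTo B ↔ p.Prime ∧ p ≤ B := by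
  simp only [primesUpTo, List.mem_filter, List.mem_range'_1, decide_eq_true_eq]
  constructor
  · rintro ⟨h1, h2⟩; exact ⟨h2, by omega⟩
  · rintro ⟨h1, h2⟩; have := h1.two_le; exact ⟨by omega, h1⟩

theorem pairwise_primesUpTo (B : ℕ) : (primesUpTo B).Pairwise (· < ·) :=
  List.Pairwise.filter _ (List.pairwise_lt_range' ..)

theorem length_primesUpTo (B : ℕ) : (primesUpTo B).length = Nat.primeCounting B := by
  rw [← Nat.primesLE_card_eq_primeCounting]
  have h : (primesUpTo B).Nodup := (pairwise_primesUpTo B).imp fun h => h.ne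
  rw [← List.toFinset_card_of_nodup h]
  congr 1
  ext p
  rw [List.mem_toFinset, mem_primesUpTo, Nat.mem_primesLE, and_comm]

/-- All primes up to p precede or equal p in the increasing list, so there are at most m of them,
and the Chebyshev bound applies at p itself. -/
theorem le_of_mem_take_primesUpTo {B m p : ℕ} (h : p ∈ (primesUpTo B).take m) :
    p ≤ (m + 1) * Nat.size (p + 1) := by
  refine (le_primeCounting_mul p).trans (Nat.mul_le_mul_right _ (Nat.succ_le_succ ?_))
  rw [← Nat.primesLE_card_eq_primeCounting]
  have hsub : p.primesLE ⊆ ((primesUpTo B).take m).toFinset := by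
    intro q hq
    rw [Nat.mem_primesLE] at hq
    have hpB := (mem_primesUpTo.1 (List.mem_of_mem_take h)).2
    have hq' : q ∈ primesUpTo B := mem_primesUpTo.2 ⟨hq.2, hq.1.trans hpB⟩
    have hs := pairwise_primesUpTo B
    rw [← List.take_append_drop m (primesUpTo B)] at hq' hs
    rw [List.mem_toFinset]
    rcases List.mem_append.1 hq' with h1 | h1
    · exact h1
    · have := (List.pairwise_append.1 hs).2.2 p h q h1
      omega
  calc _ ≤ ((primesUpTo B).take m).toFinset.card := Finset.card_le_card hsub
    _ ≤ ((primesUpTo B).take m).length := List.toFinset_card_le _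
    _ ≤ m := List.length_take_le _ _

variable {l : ℕ}

theorem sieve_sat (hl : 100 ≤ l) {B : ℕ} (hB : 2 ≤ B) (hBl : len B ≤ l) :
    (sieve B).Sat (· = primesUpTo B) 0 (B * l ^ 6) := by
  have hll := mul_lt_two_pow hl
  obtain ⟨F, hF⟩ : ∃ F, F = 2 * l := ⟨_, rfl⟩
  have hF2 : F * l ^ 2 = 2 * l ^ 3 := by rw [hF]; ring
  have l34 := absorb hl 1 3 4
  have l03 := absorb hl 1 0 3
  have l13 := absorb hl 1 1 3
  simp only [one_mul, pow_zero, pow_one] at l34 l03 l13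
  have inner : ∀ i ∈ List.range' 2 (B - 1), ∀ s : Finset ℕ,
      (Cost.fold (fun s j => (mulN i j).bind fun m => ⟨insert m s, 0, len m⟩) s
        (List.range' 2 (B / i - 1))).Sat
        (fun s' => ∀ m, m ∈ s' ↔ m ∈ s ∨ ∃ j, 2 ≤ j ∧ j ≤ B / i ∧ m = i * j) 0
        (B / i * l ^ 4 + 1) := by
    intro i hi s
    rw [List.mem_range'_1] at hi
    refine Sat.mono (Sat.fold_const (r := 0) (b := 3 * l ^ 3)
      (fun (pre : List ℕ) (s' : Finset ℕ) => ∀ m, m ∈ s' ↔ m ∈ s ∨ ∃ j ∈ pre, m = i * j)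
      (by simp) ?_) ?_ (by omega) ?_
    · intro pre j post hpre c hc
      have hj : j ∈ List.range' 2 (B / i - 1) := by rw [hpre]; simp
      rw [List.mem_range'_1] at hj
      have hij : i * j ≤ B := (Nat.mul_le_mul_left _ (by omega)).trans (Nat.mul_div_le B i)
      have e1 : len i ≤ l := (len_mono (by omega)).trans hBl
      have e2 : len j ≤ l := (len_mono (by
        have := Nat.div_le_self B i; omega)).trans hBl
      have e3 : len (i * j) ≤ l := (len_mono hij).trans hBl
      refine Sat.mono_cost (Sat.bind_eq (mulN_sat (A := F) (l := l) (by omega) (by omega))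
        (Sat.mk ?_)) le_rfl (by omega)
      intro m
      rw [Finset.mem_insert, hc]
      simp only [List.mem_append, List.mem_singleton]
      constructor
      · rintro (rfl | h | ⟨j', h, rfl⟩)
        · exact Or.inr ⟨j, Or.inr rfl, rfl⟩
        · exact Or.inl h
        · exact Or.inr ⟨j', Or.inl h, rfl⟩
      · rintro (h | ⟨j', h | rfl, rfl⟩)
        · exact Or.inr (Or.inl h)
        · exact Or.inr (Or.inr ⟨j', h, rfl⟩)
        · exact Or.inl rfl
    · intro s' hs' m
      rw [hs']
      simp only [List.mem_range'_1]
      constructor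
      · rintro (h | ⟨j, h, rfl⟩)
        · exact Or.inl h
        · exact Or.inr ⟨j, by omega, by omega, rfl⟩
      · rintro (h | ⟨j, h1, h2, rfl⟩)
        · exact Or.inl h
        · exact Or.inr ⟨j, by omega, rfl⟩
    · rw [List.length_range', Nat.add_le_add_iff_right]
      exact Nat.mul_le_mul (Nat.sub_le _ _) (by omega)
  rw [sieve]
  refine Sat.mono (Sat.bind (Sat.fold (r := fun _ => 0) (b := fun i => 2 * l ^ 3 + (B / i * l ^ 4 + 1))
    (fun (pre : List ℕ) (s : Finset ℕ) => ∀ m, m ∈ s ↔ ∃ i ∈ pre, ∃ j, 2 ≤ j ∧ j ≤ B / i ∧ m = i * j)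
    (by simp) ?_) (fun s hs => Sat.mk (P := (· = primesUpTo B)) ?_)) (fun _ => id) (by simp) ?_
  · intro pre i post hpre s hs
    have hi : i ∈ List.range' 2 (B - 1) := by rw [hpre]; simp
    have hi' := List.mem_range'_1.1 hi
    have e1 : len i ≤ l := (len_mono (by omega)).trans hBl
    refine Sat.mono_cost (Sat.bind_eq (divN_sat (A := F) (l := l) (by omega) (by omega))
      (Sat.mono_val (inner i hi s) ?_)) le_rfl (by omega)
    intro s' hs' m
    rw [hs', hs]
    simp only [List.mem_append, List.mem_singleton]
    constructor
    · rintro (⟨i', h, j, h'⟩ | h)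
      · exact ⟨i', Or.inl h, j, h'⟩
      · exact ⟨i, Or.inr rfl, h⟩
    · rintro ⟨i', h | rfl, h'⟩
      · exact Or.inl ⟨i', h, h'⟩
      · exact Or.inr h'
  · rw [primesUpTo]
    refine List.filter_congr fun p hp => ?_
    rw [List.mem_range'_1] at hp
    rw [decide_eq_decide, hs]
    constructor
    · intro h
      rw [Nat.prime_def_lt']
      refine ⟨hp.1, fun m hm1 hm2 hdvd => h ?_⟩
      obtain ⟨c, hc⟩ := hdvd
      refine ⟨m, List.mem_range'_1.2 (by omega), c, ?_, ?_, hc⟩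
      · by_contra hc2
        have : c = 0 ∨ c = 1 := by omega
        rcases this with rfl | rfl <;> simp at hc <;> omega
      · rw [Nat.le_div_iff_mul_le (by omega), mul_comm, ← hc]; omega
    · rintro hpp ⟨i, hi, j, hj, _, rfl⟩
      rw [List.mem_range'_1] at hi
      exact Nat.not_prime_mul (by omega) (by omega) hpp
  · have h1 : ((List.range' 2 (B - 1)).map fun i => 2 * l ^ 3 + (B / i * l ^ 4 + 1)).sum =
        (B - 1) * (2 * l ^ 3 + 1) + ((List.range' 2 (B - 1)).map fun i => B / i).sum * l ^ 4 := by
      have : (fun i => 2 * l ^ 3 + (B / i * l ^ 4 + 1)) =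
          fun i => (2 * l ^ 3 + 1) + (B / i) * l ^ 4 := by funext i; ring
      rw [this, List.sum_map_add, List.sum_map_mul_right]
      simp
    have h2 := sum_map_range'_div_le B (B - 1)
    rw [show B - 1 + 1 = B by omega] at h2
    have h3 : B * Nat.size B ≤ B * l := Nat.mul_le_mul_left _ (by simp only [len] at hBl; omega)
    have h4 : ((List.range' 2 (B - 1)).map fun i => B / i).sum * l ^ 4 ≤ B * l ^ 5 := by
      calc _ ≤ B * l * l ^ 4 := Nat.mul_le_mul_right _ (h2.trans h3)
        _ = B * l ^ 5 := by ring
    have h5 : (B - 1) * (2 * l ^ 3 + 1) ≤ B * l ^ 4 := Nat.mul_le_mul (Nat.sub_le _ _) (by omega)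
    have h6 : (B + 1) * len B ≤ 2 * (B * l ^ 1) := by
      calc (B + 1) * len B ≤ (2 * B) * l := Nat.mul_le_mul (by omega) hBl
        _ = 2 * (B * l ^ 1) := by ring
    rw [h1, List.length_range']
    have a1 := absorb hl B 1 4
    have a4 := absorb hl B 4 5
    have a5 := absorb hl B 5 6
    have a0 := le_mul_pow hl B 4
    omega

/-- What is used about the list of the first `N` primes. -/
structure IsPrimeList (l N : ℕ) (ps : List ℕ) : Prop where
  length : ps.length = N
  pairwise : ps.Pairwise (· < ·)
  prime : ∀ p ∈ ps, p.Prime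
  len_le : ∀ p ∈ ps, len p ≤ l
  le : ∀ m, ∀ p ∈ ps.take m, p ≤ (m + 1) * l

theorem firstPrimes_sat (hl : 100 ≤ l) {N : ℕ} (hN : 1 ≤ N) (hNl : 2 * Nat.size N + 50 ≤ l) :
    (firstPrimes N).Sat (IsPrimeList l N) 0 (N * l ^ 10) := by
  -- The bound 2^k is reached only if 2^(k - 1) was too small, so 2^k ≤ 2 N l and every sieve costs
  -- little more than N. The factor l + 1 - k bounds the number of doublings still to come.
  have key : ∀ fuel k, 1 ≤ k → k ≤ l → (k = 1 ∨ Nat.primeCounting (2 ^ (k - 1)) < N) → N + 2 ≤ fuel + k →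
      (sieveFrom N fuel (2 ^ k)).Sat (IsPrimeList l N) 0 ((l + 1 - k) * (N * l ^ 8)) := by
    intro fuel
    induction fuel with
    | zero =>
      intro k hk1 _ hk hf
      rcases hk with rfl | hk
      · omega
      · have := le_primeCounting_two_pow (k - 1); omega
    | succ fuel ih =>
      intro k hk1 hkl hk hf
      have hB : 2 ^ k ≤ 2 * (N * l) ∧ Nat.size (2 ^ k + 1) ≤ 2 * Nat.size N + 9 := by
        rcases hk with rfl | hk
        · refine ⟨?_, ?_⟩
          · have : 1 * 1 ≤ N * l := Nat.mul_le_mul hN (by omega)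
            omega
          · have : Nat.size (2 ^ 1 + 1) ≤ 2 := Nat.size_le.2 (by norm_num)
            omega
        · have h1 := size_le_of_primeCounting_lt hk
          have h2 := le_primeCounting_mul (2 ^ (k - 1))
          have h3 : 2 ^ k = 2 * 2 ^ (k - 1) := by rw [← pow_succ']; congr 1; omega
          refine ⟨?_, ?_⟩
          · have : 2 ^ (k - 1) ≤ N * l := h2.trans (Nat.mul_le_mul hk (by omega))
            omega
          · rw [Nat.size_le] at h1 ⊢
            have h4 : 2 ^ (2 * Nat.size N + 9) = 2 * 2 ^ (2 * Nat.size N + 8) := pow_succ' _ _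
            omega
      have hsz : Nat.size (2 ^ k) ≤ Nat.size (2 ^ k + 1) := Nat.size_le_size (Nat.le_succ _)
      have hBl : len (2 ^ k) ≤ l := by simp only [len]; omega
      have h2k : 2 ≤ 2 ^ k := by
        calc 2 = 2 ^ 1 := rfl
          _ ≤ 2 ^ k := Nat.pow_le_pow_right (by norm_num) hk1
      have hkl' : k + 1 ≤ l := by
        have : k < Nat.size (2 ^ k) := Nat.lt_size.2 le_rfl
        omega
      have hbits : 2 ^ k * l ^ 6 ≤ 2 * (N * l ^ 7) := by
        calc 2 ^ k * l ^ 6 ≤ (2 * (N * l)) * l ^ 6 := Nat.mul_le_mul_right _ hB.1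
          _ = 2 * (N * l ^ 7) := by ring
      have hbits2 : 2 ^ k ≤ 2 ^ k * l ^ 6 := le_mul_pow hl _ 6
      have hlN : len N ≤ l := by simp only [len]; omega
      have hlb : l ≤ N * l ^ 7 := by
        calc l ≤ l ^ 7 := Nat.le_self_pow (by norm_num) _
          _ ≤ N * l ^ 7 := Nat.le_mul_of_pos_left _ hN
      have hlb3 : l ^ 3 ≤ N * l ^ 7 := by
        calc l ^ 3 ≤ l ^ 7 := Nat.pow_le_pow_right (by omega) (by norm_num)
          _ ≤ N * l ^ 7 := Nat.le_mul_of_pos_left _ hN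
      have a7 := absorb hl N 7 8
      rw [sieveFrom]
      refine Sat.mono_cost (Sat.bind_eq (sieve_sat hl h2k hBl) (r' := 0)
        (b' := (l - k) * (N * l ^ 8) + 10 * (N * l ^ 7)) ?_) le_rfl ?_
      · split_ifs with hle
        · refine Sat.mono (takeN_sat N _) ?_ le_rfl ?_
          · rintro _ rfl
            refine ⟨by rw [List.length_take]; omega, (pairwise_primesUpTo _).sublist (List.take_sublist _ _),
              fun p hp => (mem_primesUpTo.1 (List.mem_of_mem_take hp)).1,
              fun p hp => (len_mono (mem_primesUpTo.1 (List.mem_of_mem_take hp)).2).trans hBl, ?_⟩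
            intro m p hp
            rw [List.take_take] at hp
            have hpB := (mem_primesUpTo.1 (List.mem_of_mem_take hp)).2
            refine (le_of_mem_take_primesUpTo hp).trans (Nat.mul_le_mul (by omega) ?_)
            exact (Nat.size_le_size (Nat.add_le_add_right hpB 1)).trans (by omega)
          · have : (primesUpTo (2 ^ k)).length ≤ 2 ^ k := by
              rw [primesUpTo]
              refine (List.length_filter_le _ _).trans ?_
              rw [List.length_range']; omega
            omega
        · rw [length_primesUpTo] at hle
          obtain ⟨F, hF⟩ : ∃ F, F = 2 * l := ⟨_, rfl⟩
          have hF2 : F * l ^ 2 = 2 * l ^ 3 := by rw [hF]; ring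
          have hll := mul_lt_two_pow hl
          have hl2 : len 2 ≤ l := (len_mono h2k).trans hBl
          have h3 := ih (k + 1) (by omega) hkl' (Or.inr (by simpa using hle)) (by omega)
          rw [pow_succ'] at h3
          refine Sat.mono_cost (Sat.bind_eq (mulN_sat (A := F) (l := l) (by omega) (by omega)) h3)
            le_rfl ?_
          rw [show l + 1 - (k + 1) = l - k by omega]
          omega
      · rw [show l + 1 - k = (l - k) + 1 by omega, Nat.succ_mul (l - k)]
        omega
  have h := key (N + 1) 1 le_rfl (by omega) (Or.inl rfl) (by omega)
  rw [firstPrimes]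
  refine Sat.mono_cost h le_rfl ?_
  rw [show l + 1 - 1 = l by omega, show l * (N * l ^ 8) = N * l ^ 9 by ring]
  exact mul_pow_mono hl N (by omega)

end Primes

end SparseInterp

namespace SparseInterp

open Cost Polynomial

/-! ### Reduction modulo x^q - 1 as a motion of exponents -/

section Reduction

variable {R : Type*} [CommRing R]

/-- The polynomial `∑ m ∈ S, c m * X ^ u m`. -/
noncomputable def push {ι : Type*} (S : Finset ι) (u : ι → ℕ) (c : ι → R) : R[X] :=
  ∑ m ∈ S, monomial (u m) (c m)

theorem push_support (r : R[X]) : push r.support id r.coeff = r := r.as_sum_support.symm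

theorem monic_X_pow_sub_one {q : ℕ} (hq : 0 < q) : (X ^ q - 1 : R[X]).Monic := by
  simpa using monic_X_pow_sub_C (1 : R) hq.ne'

theorem redMod_eq_of_dvd {q : ℕ} (hq : 0 < q) {f g : R[X]} (h : X ^ q - 1 ∣ f - g) :
    redMod q f = redMod q g := modByMonic_eq_of_dvd_sub (monic_X_pow_sub_one hq) h

theorem dvd_sub_redMod (q : ℕ) (f : R[X]) : X ^ q - 1 ∣ f - redMod q f := by
  refine ⟨f /ₘ (X ^ q - 1), ?_⟩
  have := modByMonic_add_div f (X ^ q - 1)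
  rw [redMod]
  linear_combination -this

theorem redMod_add (q : ℕ) (f g : R[X]) : redMod q (f + g) = redMod q f + redMod q g :=
  add_modByMonic f g

theorem redMod_zero (q : ℕ) : redMod q (0 : R[X]) = 0 := zero_modByMonic _

theorem redMod_sub (q : ℕ) (f g : R[X]) : redMod q (f - g) = redMod q f - redMod q g :=
  sub_modByMonic f g _

theorem redMod_sum {ι : Type*} (q : ℕ) (S : Finset ι) (f : ι → R[X]) :
    redMod q (∑ i ∈ S, f i) = ∑ i ∈ S, redMod q (f i) :=
  map_sum (modByMonicHom (X ^ q - 1 : R[X])) f S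

theorem redMod_mul_redMod {q : ℕ} (hq : 0 < q) (f g : R[X]) :
    redMod q (redMod q f * redMod q g) = redMod q (f * g) := by
  refine (redMod_eq_of_dvd hq ?_).symm
  have h₁ := dvd_sub_redMod q f
  have h₂ := dvd_sub_redMod q g
  have : f * g - redMod q f * redMod q g =
      (f - redMod q f) * g + redMod q f * (g - redMod q g) := by ring
  rw [this]
  exact dvd_add (h₁.mul_right _) (h₂.mul_left _)

theorem redMod_redMod {q : ℕ} (hq : 0 < q) (f : R[X]) : redMod q (redMod q f) = redMod q f :=
  (redMod_eq_of_dvd hq (dvd_sub_redMod q f)).symm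

theorem redMod_monomial {q : ℕ} (hq : 0 < q) (e : ℕ) (c : R) :
    redMod q (monomial e c) = monomial (e % q) c := by
  nontriviality R
  have h : redMod q (monomial e c) = redMod q (monomial (e % q) c) := by
    apply redMod_eq_of_dvd hq
    have : (monomial e c : R[X]) - monomial (e % q) c =
        monomial (e % q) c * ((X ^ q) ^ (e / q) - 1 ^ (e / q)) := by
      rw [mul_sub, ← pow_mul, monomial_mul_X_pow, Nat.mod_add_div]
      simp
    rw [this]
    exact (sub_dvd_pow_sub_pow _ _ _).mul_left _
  rw [h, redMod, modByMonic_eq_self_iff (monic_X_pow_sub_one hq)]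
  refine (degree_monomial_le _ _).trans_lt ?_
  have : (X ^ q - 1 : R[X]).degree = q := by simpa using degree_X_pow_sub_C hq (1 : R)
  rw [this]
  exact_mod_cast Nat.mod_lt _ hq

theorem redMod_C {q : ℕ} (hq : 0 < q) (c : R) : redMod q (C c) = C c := by
  simpa using redMod_monomial hq 0 c

theorem redMod_push {ι : Type*} {q : ℕ} (hq : 0 < q) (S : Finset ι) (u : ι → ℕ) (c : ι → R) :
    redMod q (push S u c) = push S (fun m => u m % q) c := by
  simp [push, redMod_sum, redMod_monomial hq]

/-- In this form the reduction is a sum over the original exponents, so that collisions, and terms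
free of them, are visible. -/
theorem redMod_eq_push {q : ℕ} (hq : 0 < q) (r : R[X]) :
    redMod q r = push r.support (· % q) r.coeff := by
  conv_lhs => rw [← push_support r]
  exact redMod_push hq _ _ _

theorem coeff_push {ι : Type*} (S : Finset ι) (u : ι → ℕ) (c : ι → R) (x : ℕ) :
    (push S u c).coeff x = ∑ m ∈ S, if u m = x then c m else 0 := by
  simp [push, coeff_monomial]

theorem support_push_subset {ι : Type*} (S : Finset ι) (u : ι → ℕ) (c : ι → R) :
    (push S u c).support ⊆ S.image u := by
  intro x hx
  rw [mem_support_iff, coeff_push] at hx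
  obtain ⟨m, hm, h⟩ := Finset.exists_ne_zero_of_sum_ne_zero hx
  rw [Finset.mem_image]
  exact ⟨m, hm, by by_contra h'; simp [h'] at h⟩

theorem card_support_push_le {ι : Type*} (S : Finset ι) (u : ι → ℕ) (c : ι → R) :
    (push S u c).support.card ≤ S.card :=
  (Finset.card_le_card (support_push_subset S u c)).trans Finset.card_image_le

theorem coeff_push_of_unique {ι : Type*} {S : Finset ι} {u : ι → ℕ} (c : ι → R) {m₀ : ι}
    (h₀ : m₀ ∈ S) (h : ∀ m ∈ S, u m = u m₀ → m = m₀) : (push S u c).coeff (u m₀) = c m₀ := by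
  rw [coeff_push, Finset.sum_eq_single m₀]
  · simp
  · intro m hm hne
    rw [if_neg fun he => hne (h m hm he)]
  · exact fun h => absurd h₀ h

/-- A term that is alone in its residue class modulo `p` is found as the only term of the class. -/
theorem push_class {ι : Type*} {S : Finset ι} {u : ι → ℕ} {c : ι → R} {m₀ : ι} {p : ℕ}
    (h₀ : m₀ ∈ S) (hc : c m₀ ≠ 0) (h : ∀ m ∈ S, u m % p = u m₀ % p → m = m₀) :
    (push S u c).coeff (u m₀) = c m₀ ∧ u m₀ ∈ (push S u c).support ∧
      ∀ x ∈ (push S u c).support, x % p = u m₀ % p → x = u m₀ := by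
  have h1 : (push S u c).coeff (u m₀) = c m₀ :=
    coeff_push_of_unique c h₀ fun m hm he => h m hm (by rw [he])
  refine ⟨h1, by rwa [mem_support_iff, h1], fun x hx hxp => ?_⟩
  obtain ⟨m, hm, rfl⟩ := Finset.mem_image.1 (support_push_subset _ _ _ hx)
  rw [h m hm hxp]

theorem card_support_redMod_le {q : ℕ} (hq : 0 < q) (r : R[X]) :
    (redMod q r).support.card ≤ r.support.card := by
  rw [redMod_eq_push hq]
  exact card_support_push_le _ _ _

theorem lt_of_mem_support_redMod {q : ℕ} (hq : 0 < q) {r : R[X]} {e : ℕ}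
    (he : e ∈ (redMod q r).support) : e < q := by
  rw [redMod_eq_push hq] at he
  obtain ⟨m, -, rfl⟩ := Finset.mem_image.1 (support_push_subset _ _ _ he)
  exact Nat.mod_lt _ hq

/-- Subtraction of a monomial changes a single coefficient, so the number of terms can only drop if
this coefficient is cancelled exactly. The term test thereby becomes an equation between
coefficients. -/
theorem card_support_sub_monomial_lt_iff (g : R[X]) (d : ℕ) (c : R) :
    (g - monomial d c).support.card < g.support.card ↔ c ≠ 0 ∧ g.coeff d = c := by
  have key : ∀ x, x ≠ d → (g - monomial d c).coeff x = g.coeff x := by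
    intro x hx
    rw [coeff_sub, coeff_monomial, if_neg (Ne.symm hx), sub_zero]
  constructor
  · intro h
    by_contra hcon
    refine absurd h (not_lt.2 (Finset.card_le_card fun x hx => ?_))
    rw [mem_support_iff] at hx ⊢
    by_cases hxd : x = d
    · subst hxd
      rw [coeff_sub, coeff_monomial, if_pos rfl]
      intro h0
      have h1 : g.coeff x = c := sub_eq_zero.1 h0
      exact hcon ⟨h1 ▸ hx, h1⟩
    · rwa [key x hxd]
  · rintro ⟨hc, hd⟩
    refine Finset.card_lt_card (Finset.ssubset_iff_of_subset ?_ |>.2 ⟨d, ?_, ?_⟩)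
    · intro x hx
      rw [mem_support_iff] at hx ⊢
      by_cases hxd : x = d
      · subst hxd
        rwa [hd]
      · rwa [key x hxd] at hx
    · rwa [mem_support_iff, hd]
    · rw [notMem_support_iff, coeff_sub, coeff_monomial, if_pos rfl, hd, sub_self]

end Reduction

/-! ### Collisions of exponents modulo primes, and the term test -/

section Collisions

variable {R : Type*} [CommRing R]

/-- Few primes let `E` collide with an element of `S`. -/
theorem card_collision_lt {M T N E : ℕ} {S P : Finset ℕ} (hS : ∀ e ∈ S, e < M) (hE : E < M)
    (hES : E ∉ S) (hT : S.card ≤ T) (hN : 1 ≤ N) (hMN : M ^ T ≤ 2 ^ N)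
    (hP : ∀ p ∈ P, p.Prime) (hcol : ∀ p ∈ P, ∃ e ∈ S, e % p = E % p) : P.card < N := by
  rcases S.eq_empty_or_nonempty with rfl | hne
  · have : P = ∅ := by
      rw [Finset.eq_empty_iff_forall_notMem]
      intro p hp
      obtain ⟨e, he, -⟩ := hcol p hp
      simp at he
    simp [this]; omega
  -- With truncated subtraction this is the absolute value of E - e. Every colliding prime divides
  -- the product of these distances over `S`, which is positive and below M^T; a product of distinct
  -- primes is at least 2 to their number.
  · let dist : ℕ → ℕ := fun e => (E - e) + (e - E)
    have hdpos : ∀ e ∈ S, 0 < dist e := by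
      intro e he
      have : e ≠ E := fun h => hES (h ▸ he)
      simp only [dist]; omega
    have hdvd : ∏ p ∈ P, p ∣ ∏ e ∈ S, dist e := by
      refine Finset.prod_primes_dvd _ (fun p hp => (hP p hp).prime) fun p hp => ?_
      obtain ⟨e, he, hmod⟩ := hcol p hp
      refine dvd_trans ?_ (Finset.dvd_prod_of_mem dist he)
      simp only [dist]
      rcases le_total e E with h | h
      · rw [Nat.sub_eq_zero_of_le h, add_zero]
        exact (Nat.modEq_iff_dvd' h).1 hmod
      · rw [Nat.sub_eq_zero_of_le h, zero_add]
        exact (Nat.modEq_iff_dvd' h).1 hmod.symm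
    have h1 : 2 ^ P.card ≤ ∏ p ∈ P, p := by
      rw [← Finset.prod_const]
      exact Finset.prod_le_prod' fun p hp => (hP p hp).two_le
    have h2 : ∏ p ∈ P, p ≤ ∏ e ∈ S, dist e :=
      Nat.le_of_dvd (Finset.prod_pos hdpos) hdvd
    have h3 : ∏ e ∈ S, dist e < ∏ _e ∈ S, M := by
      refine Finset.prod_lt_prod_of_nonempty hdpos (fun e he => ?_) hne
      have := hS e he
      simp only [dist]; omega
    rw [Finset.prod_const] at h3
    have h4 : M ^ S.card ≤ M ^ T := Nat.pow_le_pow_right (by omega) hT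
    exact (Nat.pow_lt_pow_iff_right (by norm_num : 1 < 2)).1 (by omega)

/-- The exponents of `r` that are alone in their residue class modulo `p`. -/
def loneSet (r : R[X]) (p : ℕ) : Finset ℕ :=
  r.support.filter fun e => ∀ e' ∈ r.support, e' % p = e % p → e' = e

theorem mem_loneSet {r : R[X]} {p e : ℕ} : e ∈ loneSet r p ↔
    e ∈ r.support ∧ ∀ e' ∈ r.support, e' % p = e % p → e' = e := by
  simp only [loneSet, Finset.mem_filter]

theorem loneSet_subset (r : R[X]) (p : ℕ) : loneSet r p ⊆ r.support := Finset.filter_subset _ _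

theorem coeff_redMod_of_lone {r : R[X]} {p e : ℕ} (hp : 0 < p) (he : e ∈ loneSet r p) :
    (redMod p r).coeff (e % p) = r.coeff e := by
  rw [redMod_eq_push hp]
  rw [mem_loneSet] at he
  exact coeff_push_of_unique r.coeff he.1 he.2

theorem card_loneSet_le {r : R[X]} {p : ℕ} (hp : 0 < p) :
    (loneSet r p).card ≤ (redMod p r).support.card := by
  refine Finset.card_le_card_of_injOn (· % p) (fun e he => ?_) fun e he e' he' h => ?_
  · have he : e ∈ loneSet r p := he
    have h0 : (redMod p r).coeff (e % p) ≠ 0 := by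
      rw [coeff_redMod_of_lone hp he]
      exact mem_support_iff.1 (loneSet_subset r p he)
    exact mem_support_iff.2 h0
  · exact (mem_loneSet.1 he').2 e (loneSet_subset r p he) h

/-- Each residue class that occurs contributes at least 2 to the right-hand side: a lone exponent is
counted in both summands, and any other class has at least two exponents. -/
theorem two_mul_card_support_redMod_le {r : R[X]} {p : ℕ} (hp : 0 < p) :
    2 * (redMod p r).support.card ≤ (loneSet r p).card + r.support.card := by
  have h1 : (redMod p r).support ⊆ r.support.image (· % p) := by
    rw [redMod_eq_push hp]
    exact support_push_subset _ _ _
  have h2 : r.support.card = ∑ d ∈ r.support.image (· % p),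
      (r.support.filter fun e => e % p = d).card :=
    Finset.card_eq_sum_card_image _ _
  have h3 : (loneSet r p).card = ∑ d ∈ r.support.image (· % p),
      ((loneSet r p).filter fun e => e % p = d).card := by
    refine Finset.card_eq_sum_card_fiberwise fun e he => ?_
    exact Finset.mem_coe.2 (Finset.mem_image_of_mem _ (loneSet_subset r p he))
  rw [h2, h3, ← Finset.sum_add_distrib]
  refine (Nat.mul_le_mul_left 2 (Finset.card_le_card h1)).trans ?_
  rw [mul_comm, ← smul_eq_mul]
  refine Finset.card_nsmul_le_sum _ _ _ fun d hd => ?_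
  obtain ⟨e, he, rfl⟩ := Finset.mem_image.1 hd
  have hmem : e ∈ r.support.filter fun e' => e' % p = e % p := by
    exact Finset.mem_filter.2 ⟨he, rfl⟩
  by_cases hl : e ∈ loneSet r p
  · have h4 : 0 < (r.support.filter fun e' => e' % p = e % p).card :=
      Finset.card_pos.2 ⟨e, hmem⟩
    have h5 : 0 < ((loneSet r p).filter fun e' => e' % p = e % p).card :=
      Finset.card_pos.2 ⟨e, Finset.mem_filter.2 ⟨hl, rfl⟩⟩
    omega
  · have h6 : ∃ e' ∈ r.support, e' % p = e % p ∧ e' ≠ e := by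
      by_contra hcon
      push Not at hcon
      exact hl (mem_loneSet.2 ⟨he, hcon⟩)
    obtain ⟨e', he', hmod, hne⟩ := h6
    have : 1 < (r.support.filter fun e' => e' % p = e % p).card :=
      Finset.one_lt_card.2 ⟨e', by simp only [Finset.mem_filter]; exact ⟨he', hmod⟩, e, hmem, hne⟩
    omega

/-- The collision bound is applied to the other exponents of `r`; there is one fewer of them than
terms, hence T - 1 in the definition of N₁. -/
theorem card_not_lone_lt {r : R[X]} {M N₁ e : ℕ} {P : Finset ℕ} (hM : ∀ e ∈ r.support, e < M)
    (hN : 1 ≤ N₁) (hMN : M ^ (r.support.card - 1) ≤ 2 ^ N₁) (hP : ∀ p ∈ P, p.Prime)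
    (he : e ∈ r.support) : (P.filter fun p => e ∉ loneSet r p).card < N₁ := by
  refine card_collision_lt (S := r.support.erase e) (E := e) (T := r.support.card - 1)
    (fun e' h => hM e' (Finset.mem_of_mem_erase h)) (hM e he) (by simp)
    (Finset.card_erase_of_mem he).le hN hMN (fun p hp => hP p (Finset.mem_filter.1 hp).1) ?_
  intro p hp
  have := (Finset.mem_filter.1 hp).2
  rw [mem_loneSet] at this
  push Not at this
  obtain ⟨e', he', hmod, hne⟩ := this he
  exact ⟨e', Finset.mem_erase.2 ⟨hne, he'⟩, hmod⟩

/-- Averaging: each term is not alone for fewer than N₁ of at least 4 N₁ primes, so for some prime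
fewer than a quarter of the terms are not alone, and lone terms survive in the image. -/
theorem exists_prime_many_terms {r : R[X]} {M N₁ : ℕ} {P : Finset ℕ} (hM : ∀ e ∈ r.support, e < M)
    (hN : 1 ≤ N₁) (hMN : M ^ (r.support.card - 1) ≤ 2 ^ N₁) (hP : ∀ p ∈ P, p.Prime)
    (hcard : 4 * N₁ ≤ P.card) (hr : r ≠ 0) :
    ∃ p ∈ P, 3 * r.support.card ≤ 4 * (redMod p r).support.card := by
  classical
  by_contra hcon
  push Not at hcon
  have ht : 0 < r.support.card := Finset.card_pos.2 (support_nonempty.2 hr)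
  have h1 : ∀ p ∈ P, r.support.card + 1 ≤ 4 * (r.support.filter fun e => e ∉ loneSet r p).card := by
    intro p hp
    have a1 := hcon p hp
    have a2 := card_loneSet_le (r := r) (hP p hp).pos
    have a3 : (r.support.filter fun e => e ∈ loneSet r p).card +
        (r.support.filter fun e => e ∉ loneSet r p).card = r.support.card :=
      Finset.card_filter_add_card_filter_not _
    have a4 : r.support.filter (fun e => e ∈ loneSet r p) = loneSet r p := by
      ext e
      simp only [Finset.mem_filter]
      exact ⟨fun h => h.2, fun h => ⟨loneSet_subset r p h, h⟩⟩
    rw [a4] at a3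
    omega
  -- Double counting of the pairs of a prime and a term that is not alone modulo it.
  have h2 := Finset.sum_card_bipartiteAbove_eq_sum_card_bipartiteBelow
    (s := P) (t := r.support) (fun p e => e ∉ loneSet r p)
  have h3 : P.card * (r.support.card + 1) ≤
      ∑ p ∈ P, 4 * (r.support.filter fun e => e ∉ loneSet r p).card := by
    rw [← smul_eq_mul]; exact Finset.card_nsmul_le_sum _ _ _ h1
  have h4 : ∑ e ∈ r.support, (P.filter fun p => e ∉ loneSet r p).card ≤
      r.support.card * (N₁ - 1) := by
    rw [← smul_eq_mul]
    refine Finset.sum_le_card_nsmul _ _ _ fun e he => ?_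
    have := card_not_lone_lt hM hN hMN hP he
    omega
  simp only [Finset.bipartiteAbove, Finset.bipartiteBelow] at h2
  rw [← Finset.mul_sum, h2] at h3
  have h5 : P.card * (r.support.card + 1) ≤ 4 * (r.support.card * (N₁ - 1)) :=
    h3.trans (Nat.mul_le_mul_left 4 h4)
  have h6 : 4 * N₁ * (r.support.card + 1) ≤ P.card * (r.support.card + 1) :=
    Nat.mul_le_mul_right _ hcard
  have h7 : r.support.card * (N₁ - 1) ≤ r.support.card * N₁ := Nat.mul_le_mul_left _ (by omega)
  have h8 : 4 * N₁ * (r.support.card + 1) = 4 * (r.support.card * N₁) + 4 * N₁ := by ring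
  omega

/-- If t terms have at least 3t/4 images, then 3t/2 is at most t plus the number of lone terms. Only
the size of the image enters, so any prime with the maximal number of terms serves. -/
theorem card_le_two_mul_card_loneSet {r : R[X]} {p : ℕ} (hp : 0 < p)
    (h : 3 * r.support.card ≤ 4 * (redMod p r).support.card) :
    r.support.card ≤ 2 * (loneSet r p).card := by
  have := two_mul_card_support_redMod_le (r := r) hp
  omega

open scoped Classical in
/-- A term of `r` passes the term test. -/
theorem le_card_drops {r : R[X]} {M N₁ N₂ e : ℕ} {P : Finset ℕ} (hM : ∀ e ∈ r.support, e < M)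
    (hN : 1 ≤ N₁) (hMN : M ^ (r.support.card - 1) ≤ 2 ^ N₁) (hP : ∀ p ∈ P, p.Prime)
    (hcard : N₁ + N₂ - 1 ≤ P.card) (he : e ∈ r.support) :
    N₂ ≤ (P.filter fun p => r.coeff e ≠ 0 ∧ (redMod p r).coeff (e % p) = r.coeff e).card := by
  classical
  have h1 := card_not_lone_lt hM hN hMN hP he
  have h2 : (P.filter fun p => e ∈ loneSet r p).card + (P.filter fun p => e ∉ loneSet r p).card =
      P.card := Finset.card_filter_add_card_filter_not _
  have h3 : (P.filter fun p => e ∈ loneSet r p).card ≤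
      (P.filter fun p => r.coeff e ≠ 0 ∧ (redMod p r).coeff (e % p) = r.coeff e).card := by
    refine Finset.card_le_card fun p hp => ?_
    obtain ⟨hp1, hp2⟩ := Finset.mem_filter.1 hp
    exact Finset.mem_filter.2 ⟨hp1, mem_support_iff.1 he,
      coeff_redMod_of_lone (hP p hp1).pos hp2⟩
  omega

open scoped Classical in
/-- What passes the term test is a term of `r`. -/
theorem coeff_eq_of_le_card_drops {r : R[X]} {M T N₂ E : ℕ} {c : R} {P : Finset ℕ}
    (hM : ∀ e ∈ r.support, e < M) (hE : E < M) (hT : r.support.card ≤ T)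
    (hN : 1 ≤ N₂) (hMN : M ^ T ≤ 2 ^ N₂) (hP : ∀ p ∈ P, p.Prime)
    (hdrop : N₂ ≤ (P.filter fun p => c ≠ 0 ∧ (redMod p r).coeff (E % p) = c).card) :
    c ≠ 0 ∧ r.coeff E = c := by
  classical
  have hc : c ≠ 0 := by
    obtain ⟨p, hp⟩ := Finset.card_pos.1 (lt_of_lt_of_le hN hdrop)
    exact (Finset.mem_filter.1 hp).2.1
  refine ⟨hc, ?_⟩
  by_contra hne
  refine absurd hdrop (not_le.2 (card_collision_lt (S := r.support.erase E) (E := E) (M := M)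
    (T := T) (fun e h => hM e (Finset.mem_of_mem_erase h)) hE (by simp)
    ((Finset.card_le_card (Finset.erase_subset _ _)).trans hT) hN hMN
    (fun p hp => hP p (Finset.mem_filter.1 hp).1) fun p hp => ?_))
  obtain ⟨hp, -, hpc⟩ := Finset.mem_filter.1 hp
  -- If no other exponent collides with E modulo p, then the coefficient of the image at E mod p is
  -- that of r at E, also when the latter is 0. So a false candidate can pass at p only through a
  -- collision.
  by_contra hcol
  push Not at hcol
  rw [redMod_eq_push (hP p hp).pos, coeff_push] at hpc
  apply hne
  rw [← hpc]
  by_cases hEs : E ∈ r.support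
  · rw [Finset.sum_eq_single E]
    · simp
    · intro e he hne
      rw [if_neg (hcol e (Finset.mem_erase.2 ⟨hne, he⟩))]
    · exact fun h => absurd hEs h
  · rw [notMem_support_iff.1 hEs]
    symm
    refine Finset.sum_eq_zero fun e he => if_neg (hcol e (Finset.mem_erase.2 ⟨?_, he⟩))
    rintro rfl
    exact hEs he

end Collisions

end SparseInterp

namespace SparseInterp

open Cost Polynomial

/-! ### Operations on sparse polynomials and on lists of images -/

section SparsePolynomials

variable {R : Type*} [CommRing R] {l : ℕ}

theorem absorb_zero {l : ℕ} (hl : 100 ≤ l) (A j : ℕ) (h : 0 < j := by omega) :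
    100 * A ≤ A * l ^ j := by
  have := absorb hl A 0 j h
  rwa [pow_zero, mul_one] at this

/-- The polynomial with the given list of terms. -/
noncomputable def listPoly (h : List (ℕ × R)) : R[X] := (h.map fun t => monomial t.1 t.2).sum

theorem listPoly_nil : listPoly ([] : List (ℕ × R)) = 0 := rfl

theorem listPoly_cons (t : ℕ × R) (h : List (ℕ × R)) :
    listPoly (t :: h) = monomial t.1 t.2 + listPoly h := by simp [listPoly]

theorem listPoly_append (h h' : List (ℕ × R)) : listPoly (h ++ h') = listPoly h + listPoly h' := by
  simp [listPoly]

/-- The list holds the terms of `g`, each exactly once. -/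
def IsTermList (L : List (ℕ × R)) (g : R[X]) : Prop :=
  ∃ es : List ℕ, es.Nodup ∧ (∀ e, e ∈ es ↔ e ∈ g.support) ∧ L = es.map fun e => (e, g.coeff e)

theorem IsTermList.length {L : List (ℕ × R)} {g : R[X]} (h : IsTermList L g) :
    L.length = g.support.card := by
  obtain ⟨es, hn, hm, rfl⟩ := h
  rw [List.length_map, ← List.toFinset_card_of_nodup hn]
  congr 1
  ext e
  rw [List.mem_toFinset, hm]

theorem IsTermList.mem {L : List (ℕ × R)} {g : R[X]} (h : IsTermList L g) {t : ℕ × R}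
    (ht : t ∈ L) : t.1 ∈ g.support ∧ t.2 = g.coeff t.1 := by
  obtain ⟨es, hn, hm, rfl⟩ := h
  obtain ⟨e, he, rfl⟩ := List.mem_map.1 ht
  exact ⟨(hm e).1 he, rfl⟩

theorem filter_eq_singleton {α : Type*} {L : List α} {P : α → Bool} {a : α} (hn : L.Nodup)
    (ha : a ∈ L) (hP : P a) (h : ∀ b ∈ L, P b → b = a) : L.filter P = [a] := by
  rw [← List.perm_singleton]
  refine (List.perm_ext_iff_of_nodup (hn.filter _) (by simp)).2 fun b => ?_
  rw [List.mem_filter, List.mem_singleton]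
  exact ⟨fun hb => h b hb.1 hb.2, by rintro rfl; exact ⟨ha, hP⟩⟩

theorem IsTermList.class_eq {L : List (ℕ × R)} {g : R[X]} (h : IsTermList L g) {p u : ℕ}
    (hu : u ∈ g.support) (hlone : ∀ x ∈ g.support, x % p = u % p → x = u) :
    (L.filter fun t => t.1 % p = u % p) = [(u, g.coeff u)] := by
  obtain ⟨es, hn, hm, rfl⟩ := h
  rw [List.filter_map, filter_eq_singleton hn ((hm u).2 hu)]
  · rfl
  · simp
  · intro b hb hP
    exact hlone b ((hm b).1 hb) (by simpa using hP)

theorem termBits_le {g : R[X]} {A : ℕ} (h : ∀ e ∈ g.support, len e ≤ A) :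
    termBits g ≤ g.support.card * (A + 1) + 1 := by
  rw [termBits, add_comm, ← smul_eq_mul]
  exact Nat.add_le_add_right
    (Finset.sum_le_card_nsmul _ _ _ fun e he => Nat.add_le_add_right (h e he) 1) 1

theorem numTerms_sat (g : R[X]) :
    (numTerms g).Sat (· = g.support.card) 0 (len g.support.card) := .mk rfl

theorem termList_sat {g : R[X]} {A : ℕ} (h : ∀ e ∈ g.support, len e ≤ A) :
    (termList g).Sat (IsTermList · g) 0 (g.support.card * (A + 1) + 1) :=
  .mk' ⟨g.support.sort (· ≤ ·), Finset.sort_nodup _ _, fun _ => Finset.mem_sort _, rfl⟩ le_rfl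
    (termBits_le h)

theorem subTermsMod_sat {q A : ℕ} (hl : 100 ≤ l) (hq : 0 < q) (hA : A < 2 ^ l) (g : R[X])
    (h : List (ℕ × R)) (hlen : ∀ t ∈ h, len t.1 + len q ≤ A) :
    (subTermsMod q g h).Sat (· = g - redMod q (listPoly h)) (h.length * 2)
      (h.length * (A * l ^ 3) + 1) := by
  refine (Sat.fold_const (r := 2) (b := A * l ^ 2 + A)
    (fun pre (f : R[X]) => f = g - redMod q (listPoly pre)) ?_ ?_).mono_cost le_rfl ?_
  · simp [listPoly_nil, redMod_zero]
  · rintro pre t post he f rfl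
    have ht := hlen t (by simp [he])
    refine Sat.mono_cost (Sat.bind_eq (modN_sat ht hA) (Sat.mk ?_)) (by omega) ?_
    · rw [listPoly_append, listPoly_cons, listPoly_nil, redMod_add, add_zero,
        redMod_monomial hq, sub_sub]
    · have := len_mod_le' t.1 q
      omega
  · rcases h with _ | ⟨t, h⟩
    · simp
    · have ht := hlen t (by simp)
      have := one_le_len q
      refine Nat.add_le_add_right (Nat.mul_le_mul_left _ ?_) 1
      have a1 := absorb hl A 2 3
      have a2 := absorb_zero hl A 3
      omega

/-- The images of `r` for a list of primes. -/
noncomputable def images (ps : List ℕ) (r : R[X]) : List R[X] := ps.map (redMod · r)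

theorem length_images (ps : List ℕ) (r : R[X]) : (images ps r).length = ps.length := by
  simp [images]

theorem images_take (ps : List ℕ) (r : R[X]) (m : ℕ) :
    (images ps r).take m = images (ps.take m) r := by simp [images]

theorem zip_images (ps : List ℕ) (r : R[X]) {β : Type*} (f : ℕ → β) :
    (images ps r).zip (ps.map f) = ps.map fun p => (redMod p r, f p) := by
  rw [images, List.zip_map']

theorem sum_len_le {ps : List ℕ} {A : ℕ} (h : ∀ p ∈ ps, len p ≤ A) :
    (ps.map len).sum ≤ ps.length * A := sum_map_le h

theorem multiMod_sat' (hl : 100 ≤ l) {ps : List ℕ} {S : ℕ} (hps : ∀ p ∈ ps, p.Prime)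
    (hpl : ∀ p ∈ ps, len p ≤ l) (hS : ps.length ≤ S) (E : ℕ) (hE : len E ≤ S)
    (hSl : 8 * (S * l) < 2 ^ l) :
    (multiMod E ps).Sat (· = ps.map (E % ·)) 0 (S * l ^ 9) := by
  have s0 : S ≤ S * l := Nat.le_mul_of_pos_right _ (by omega)
  have s1 : (ps.map len).sum ≤ S * l := (sum_len_le hpl).trans (Nat.mul_le_mul_right _ hS)
  refine (multiMod_sat hl E ps l (by omega) le_rfl (fun p hp => (hps p hp).pos)
    (by omega)).mono_cost le_rfl ?_
  have h1 : (ps.map len).sum * l ^ 6 ≤ S * l * l ^ 6 := Nat.mul_le_mul_right _ s1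
  have h2 : (l + 1) * ((ps.map len).sum * l ^ 6) ≤ (l + 1) * (S * l * l ^ 6) :=
    Nat.mul_le_mul_left _ h1
  have h3 : (l + 1) * (S * l * l ^ 6) = S * l ^ 8 + S * l ^ 7 := by ring
  have h4 : len E * l ^ 3 ≤ S * l ^ 3 := Nat.mul_le_mul_right _ hE
  have a1 := absorb hl S 8 9
  have a2 := absorb hl S 7 9
  have a3 := absorb hl S 3 9
  have a4 := absorb_zero hl S 9
  have := one_le_len E
  omega

theorem subFromAll_sat (hl : 100 ≤ l) {ps : List ℕ} {S : ℕ} (hps : ∀ p ∈ ps, p.Prime)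
    (hpl : ∀ p ∈ ps, len p ≤ l) (hS : ps.length ≤ S) (r : R[X]) (t : ℕ × R) (hE : len t.1 ≤ S)
    (hSl : 8 * (S * l) < 2 ^ l) :
    (subFromAll ps (images ps r) t).Sat (· = images ps (r - monomial t.1 t.2))
      (S * 2) (S * l ^ 10) := by
  rw [subFromAll]
  refine Sat.mono_cost (Sat.bind_eq (multiMod_sat' hl hps hpl hS t.1 hE hSl)
    (r' := ps.length * 2) (b' := ps.length * (l + 1) + 1) ?_) (by omega) ?_
  · rw [zip_images]
    refine ((Sat.map_eq_const (r := 2) (b := l)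
      (g := fun ge : R[X] × ℕ => ge.1 - monomial ge.2 t.2) ?_).mono_val ?_).mono_cost
      (by simp) (by simp)
    · intro ge hge
      obtain ⟨p, hp, rfl⟩ := List.mem_map.1 hge
      exact .mk' rfl le_rfl ((len_mod_le (hps p hp).pos).trans (hpl p hp))
    · rintro _ rfl
      rw [List.map_map, images]
      refine List.map_congr_left fun p hp => ?_
      simp only [Function.comp]
      rw [redMod_sub, redMod_monomial (hps p hp).pos]
  · have a1 := absorb hl S 9 10
    have a2 := absorb hl S 1 10
    have a3 : ps.length * (l + 1) ≤ S * (l + 1) := Nat.mul_le_mul_right _ hS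
    have a4 : S * (l + 1) = S * l ^ 1 + S := by ring
    have a5 := absorb_zero hl S 10
    have := one_le_len t.1
    omega

theorem fold_subFromAll_sat (hl : 100 ≤ l) {ps : List ℕ} {S : ℕ} (hps : ∀ p ∈ ps, p.Prime)
    (hpl : ∀ p ∈ ps, len p ≤ l) (hS : ps.length ≤ S) (hSl : 8 * (S * l) < 2 ^ l) (r : R[X])
    (h : List (ℕ × R)) (hE : ∀ t ∈ h, len t.1 ≤ S) :
    (Cost.fold (subFromAll ps) (images ps r) h).Sat (· = images ps (r - listPoly h))
      (h.length * (S * 2)) (h.length * (S * l ^ 11) + 1) := by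
  refine (Sat.fold_const (r := S * 2) (b := S * l ^ 10)
    (fun pre fs => fs = images ps (r - listPoly pre)) ?_ ?_).mono_cost le_rfl ?_
  · simp [listPoly_nil]
  · rintro pre t post he fs rfl
    refine (subFromAll_sat hl hps hpl hS _ t (hE t (by simp [he])) hSl).mono_val ?_
    rintro _ rfl
    rw [listPoly_append, listPoly_cons, listPoly_nil, add_zero, sub_sub]
  · rcases h with _ | ⟨t, h⟩
    · simp
    · refine Nat.add_le_add_right (Nat.mul_le_mul_left _ ?_) 1
      have a1 := absorb hl S 10 11
      have a2 := absorb_zero hl S 11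
      have := hE t (by simp)
      have := one_le_len t.1
      omega

open scoped Classical in
theorem countDrops_sat (hl : 100 ≤ l) {ps : List ℕ} {S : ℕ} (hps : ∀ p ∈ ps, p.Prime)
    (hnd : ps.Nodup) (hpl : ∀ p ∈ ps, len p ≤ l) (hS : ps.length ≤ S) (r : R[X]) (t : ℕ × R)
    (hE : len t.1 ≤ S) (hSl : 8 * (S * l) < 2 ^ l) :
    (countDrops ps (images ps r) t).Sat
      (· = (ps.toFinset.filter fun p => t.2 ≠ 0 ∧ (redMod p r).coeff (t.1 % p) = t.2).card)
      (S * 2) (S * l ^ 10) := by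
  rw [countDrops]
  refine Sat.mono_cost (Sat.bind_eq (multiMod_sat' hl hps hpl hS t.1 hE hSl)
    (r' := ps.length * 2) (b' := ps.length * (3 * l + 1) + 1) ?_) (by omega) ?_
  · rw [zip_images]
    refine ((Sat.fold_const (r := 2) (b := 3 * l)
      (fun pre m => m = pre.countP fun ge : R[X] × ℕ => t.2 ≠ 0 ∧ ge.1.coeff ge.2 = t.2)
        ?_ ?_).mono_val ?_).mono_cost (by simp) (by simp)
    · rfl
    · rintro pre ge post he m rfl
      have hge : ge ∈ ps.map fun p => (redMod p r, t.1 % p) := by rw [he]; simp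
      obtain ⟨p, hp, rfl⟩ := List.mem_map.1 hge
      have hlen : pre.countP (fun ge : R[X] × ℕ => t.2 ≠ 0 ∧ ge.1.coeff ge.2 = t.2) ≤ S := by
        refine List.countP_le_length.trans (le_trans ?_ hS)
        have := congrArg List.length he
        rw [List.length_map, List.length_append] at this
        omega
      have s0 : S ≤ S * l := Nat.le_mul_of_pos_right _ (by omega)
      have hm := len_small hlen (by omega) hl
      refine Sat.mono_cost (Sat.bind (P := fun b => b = decide (t.2 ≠ 0 ∧
        (redMod p r).coeff (t.1 % p) = t.2)) (r := 2) (b := l) (r' := 0) (b' := l + 2)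
        (.mk' ?_ le_rfl ((len_mod_le (hps p hp).pos).trans (hpl p hp))) ?_) le_rfl (by omega)
      · exact decide_eq_decide.2 (card_support_sub_monomial_lt_iff _ _ _)
      · rintro b rfl
        rw [List.countP_append, List.countP_cons, List.countP_nil]
        by_cases hb : t.2 ≠ 0 ∧ (redMod p r).coeff (t.1 % p) = t.2
        · rw [if_pos (decide_eq_true hb)]
          refine Sat.mono_cost ((addN_sat _ _).mono_val ?_) le_rfl ?_
          · rintro _ rfl
            rw [if_pos (decide_eq_true hb)]
          · rw [len_one]; omega
        · rw [if_neg (by simpa using hb)]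
          refine Sat.mono_cost (Sat.ret ?_) le_rfl (Nat.zero_le _)
          rw [if_neg (by simpa using hb)]
          rfl
    · rintro _ rfl
      rw [List.countP_map, List.countP_eq_length_filter,
        ← List.toFinset_card_of_nodup (hnd.filter _), List.toFinset_filter]
      congr 1
      ext p
      simp
  · have a1 := absorb hl S 9 10
    have a2 := absorb hl S 1 10
    have a3 : ps.length * (3 * l + 1) ≤ S * (3 * l + 1) := Nat.mul_le_mul_right _ hS
    have a4 : S * (3 * l + 1) = 3 * (S * l ^ 1) + S := by ring
    have a5 := absorb_zero hl S 10
    have := one_le_len t.1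
    omega

/-- The second statement is conditional because the initial triple (1, 0, 0) does not come from the
list; it survives exactly when all images vanish. -/
theorem firstMax_sat {ps : List ℕ} {r : R[X]} (hpos : ∀ p ∈ ps, 0 < p)
    (hT : len r.support.card ≤ l) :
    (firstMax ps (images ps r)).Sat (fun best =>
      (∀ p ∈ ps, (redMod p r).support.card ≤ best.2.2) ∧
      (best.2.2 ≠ 0 → best.1 ∈ ps ∧ best.2.1 = redMod best.1 r ∧
        best.2.2 = (redMod best.1 r).support.card)) 0 (ps.length * (3 * l + 1) + 1) := by
  have hz : ps.zip (images ps r) = ps.map fun p => (p, redMod p r) := by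
    have := List.zip_map' (f := id) (g := (redMod · r)) (l := ps)
    rwa [List.map_id] at this
  rw [firstMax, hz]
  refine ((Sat.fold_const (r := 0) (b := 3 * l) (fun pre (b : ℕ × R[X] × ℕ) =>
    (∀ pg ∈ pre, pg.2.support.card ≤ b.2.2) ∧ b.2.2 ≤ r.support.card ∧
      (b.2.2 ≠ 0 → (b.1, b.2.1) ∈ pre ∧ b.2.2 = b.2.1.support.card)) ?_ ?_).mono_val
      ?_).mono_cost (by simp) (by simp)
  · simp
  · rintro pre pg post he b ⟨h1, h2, h3⟩
    have hpg : pg ∈ ps.map fun p => (p, redMod p r) := by rw [he]; simp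
    obtain ⟨p, hp, rfl⟩ := List.mem_map.1 hpg
    have hle : (redMod p r).support.card ≤ r.support.card := card_support_redMod_le (hpos p hp) r
    have l1 := len_mono hle
    have l2 := len_mono h2
    refine Sat.mono_cost (Sat.bind_eq (numTerms_sat _) (Sat.bind_eq (leN_sat _ _)
      (r' := 0) (b' := 0) ?_)) le_rfl (b := len (redMod p r).support.card +
        (len (redMod p r).support.card + len b.2.2 + 0)) (by omega)
    by_cases hb : (redMod p r).support.card ≤ b.2.2
    · rw [if_pos (decide_eq_true hb)]
      refine .ret ⟨?_, h2, fun hne => ⟨by simp [(h3 hne).1], (h3 hne).2⟩⟩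
      intro pg hpg
      rcases List.mem_append.1 hpg with h | h
      · exact h1 _ h
      · rw [List.mem_singleton.1 h]; exact hb
    · rw [if_neg (by simpa using hb)]
      refine .ret ⟨?_, hle, fun _ => ⟨by simp, rfl⟩⟩
      intro pg hpg
      rcases List.mem_append.1 hpg with h | h
      · exact (h1 _ h).trans (by simp only; omega)
      · rw [List.mem_singleton.1 h]
  · rintro best ⟨h1, -, h3⟩
    refine ⟨fun p hp => h1 _ (List.mem_map.2 ⟨p, hp, rfl⟩), fun hne => ?_⟩
    obtain ⟨hm, hc⟩ := h3 hne
    obtain ⟨p, hp, he⟩ := List.mem_map.1 hm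
    simp only [Prod.mk.injEq] at he
    obtain ⟨e1, e2⟩ := he
    rw [← e1]
    exact ⟨hp, e2.symm, by rw [e2, hc]⟩

theorem classes_sat {R : Type*} {p A : ℕ} (hl : 100 ≤ l) (hA : A < 2 ^ l) (F : List (ℕ × R))
    (h : ∀ t ∈ F, len t.1 + len p ≤ A) :
    (classes p F).Sat (· = fun d => F.filter fun t => t.1 % p = d) 0
      (F.length * (A * l ^ 3) + 1) := by
  refine .mk' rfl le_rfl ?_
  rw [add_comm]
  refine Nat.add_le_add_right (sum_map_le fun t ht => ?_) 1
  have a1 := mulBits_le (h t ht) hA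
  have a2 := absorb hl A 2 3
  have a3 := absorb_zero hl A 3
  have := h t ht
  omega

open scoped Classical in
theorem single_sat {R : Type*} (B : ℕ → List (ℕ × R)) (d : ℕ) (a : R) :
    (SparseInterp.single B d a).Sat (fun o =>
      (∀ u, o = some u → B d = [(u, a)]) ∧ (∀ u, B d = [(u, a)] → o = some u)) 1 (len d) := by
  refine .mk' ?_ le_rfl le_rfl
  rcases hB : B d with _ | ⟨t, _ | ⟨t', L⟩⟩
  · simp
  · by_cases h : t.2 = a
    · simp only [h, if_true]
      refine ⟨?_, ?_⟩
      · rintro u hu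
        rw [← Option.some.inj hu, ← h]
      · rintro u hu
        rw [(List.cons.inj hu).1]
    · simp only [h, if_false]
      refine ⟨by simp, ?_⟩
      rintro u hu
      rw [(List.cons.inj hu).1] at h
      exact absurd rfl h
  · simp

end SparsePolynomials

end SparseInterp

namespace SparseInterp

open Cost Polynomial

/-! ### Candidates in one variable -/

section Univariate

variable {R : Type*} [CommRing R] {l : ℕ}

theorem forall₂_map_eq {α β γ : Type*} {P : α → β → Prop} {f : α → γ} {g : β → γ} {L : List α}
    {L' : List β} (h : List.Forall₂ P L L') (hfg : ∀ a b, P a b → f a = g b) :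
    L.map f = L'.map g := by
  induction h with
  | nil => rfl
  | cons h1 _ ih => rw [List.map_cons, List.map_cons, hfg _ _ h1, ih]

theorem forall₂_right {α β : Type*} {P : α → β → Prop} {L : List α} {L' : List β}
    (h : List.Forall₂ P L L') {b : β} (hb : b ∈ L') : ∃ a ∈ L, P a b := by
  induction h with
  | nil => simp at hb
  | @cons a c _ _ h1 _ ih =>
    rcases List.mem_cons.1 hb with rfl | hb
    · exact ⟨a, by simp, h1⟩
    · obtain ⟨a', ha', h'⟩ := ih hb
      exact ⟨a', by simp [ha'], h'⟩

theorem forall₂_zip {α β : Type*} {P : α → β → Prop} {L : List α} {L' : List β}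
    (h : List.Forall₂ P L L') {x : α × β} (hx : x ∈ L.zip L') : P x.1 x.2 := by
  induction h with
  | nil => simp at hx
  | cons h1 _ ih =>
    rw [List.zip_cons_cons] at hx
    rcases List.mem_cons.1 hx with rfl | hx
    · exact h1
    · exact ih hx

theorem eq_of_mod_eq {ks : List ℕ} (hco : ks.Pairwise Nat.Coprime) {x y : ℕ} (hx : x < ks.prod)
    (hy : y < ks.prod) (h : ∀ k ∈ ks, x % k = y % k) : x = y :=
  Nat.ModEq.eq_of_lt_of_lt ((Nat.modEq_list_prod_iff hco).2 fun _ => h _ (List.getElem_mem _)) hx hy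

/-- Reduction modulo a multiple q of p preserves residues modulo p, so an exponent that was alone in
its class modulo p is still alone there after the reduction. -/
theorem lone_class {r : R[X]} {p q e : ℕ} {F : List (ℕ × R)} (hq : 0 < q) (hpq : p ∣ q)
    (hF : IsTermList F (redMod q r)) (he : e ∈ loneSet r p) :
    (F.filter fun t => t.1 % p = e % p) = [(e % q, r.coeff e)] := by
  rw [mem_loneSet] at he
  have h := push_class (R := R) (S := r.support) (u := (· % q)) (c := r.coeff) (p := p) he.1
    (mem_support_iff.1 he.1) (fun m hm h => he.2 m hm (by
      simpa only [Nat.mod_mod_of_dvd _ hpq] using h))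
  rw [← redMod_eq_push hq] at h
  have h2 := hF.class_eq h.2.1 h.2.2
  simp only [Nat.mod_mod_of_dvd _ hpq] at h2
  rw [h2, h.1]

theorem pairwise_coprime_of_primes {ks : List ℕ} (hk : ∀ k ∈ ks, k.Prime) (hnd : ks.Nodup) :
    ks.Pairwise Nat.Coprime := by
  refine List.Pairwise.imp_of_mem ?_ hnd
  intro a b ha hb hab
  exact (Nat.coprime_primes (hk a ha) (hk b hb)).2 hab

/-- A lone exponent e appears as e mod (p k) in each image, which gives e mod k; as e < D ≤ ∏ k, the
Chinese remainder is e itself. Nothing is claimed about the candidates from other classes apart from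
their number and the bound D. -/
theorem uTerms_sat (hl : 100 ≤ l) {r : R[X]} {p T K A Q D : ℕ} {ks : List ℕ} (hp : 0 < p)
    (hpl : len p ≤ l) (hk : ∀ k ∈ ks, k.Prime) (hnd : ks.Nodup) (hkQ : ∀ k ∈ ks, k ≤ Q)
    (hQl : len Q ≤ l) (hK : ks.length ≤ K) (hne : ks ≠ []) (hD : D ≤ ks.prod) (hDA : len D ≤ A)
    (hA : K * l + 2 ≤ A) (hA' : 4 * A < 2 ^ l) (hr : ∀ e ∈ r.support, e < D)
    (hT : r.support.card ≤ T) :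
    (uTerms (redMod p r) (ks.map fun k => redMod (p * k) r) p ks D).Sat
      (fun U => (∀ t ∈ U, t.1 < D) ∧ (∀ e ∈ loneSet r p, (e, r.coeff e) ∈ U) ∧ U.length ≤ T)
      (T * K) ((T + 1) * ((K + 1) * ((A + Q) * l ^ 8))) := by
  have hkl : ∀ k ∈ ks, len k ≤ l := fun k h => (len_mono (hkQ k h)).trans hQl
  have hml := mul_lt_two_pow hl
  have e1 : ∀ k ∈ ks, ∀ e ∈ (redMod (p * k) r).support, len e ≤ 2 * l := by
    intro k h e he
    have h1 := len_mono (lt_of_mem_support_redMod (Nat.mul_pos hp (hk k h).pos) he).le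
    have h2 := len_mul p k
    have h3 := hkl k h
    omega
  have e2 : ∀ q > 0, (redMod q r).support.card ≤ T :=
    fun q hq => (card_support_redMod_le hq r).trans hT
  have e3 : ∀ e ∈ (redMod p r).support, len e ≤ l := fun e he =>
    (len_mono (lt_of_mem_support_redMod hp he).le).trans hpl
  let Q₁ : R[X] → (ℕ → List (ℕ × R)) → Prop := fun g B =>
    ∃ F, IsTermList F g ∧ B = fun d => F.filter fun t => t.1 % p = d
  have step1 : (Cost.map (fun g : R[X] => (termList g).bind fun F => classes p F)
      (ks.map fun k => redMod (p * k) r)).Sat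
      (fun Bs => List.Forall₂ (fun B k => Q₁ (redMod (p * k) r) B) Bs ks) 0
      (K * (T * l ^ 5 + 3) + 1) := by
    refine ((Sat.map_const (P := Q₁) (r := 0) (b := T * l ^ 5 + 2) ?_).mono_val ?_).mono_cost
      (by simp) ?_
    · intro g hg
      obtain ⟨k, hkm, rfl⟩ := List.mem_map.1 hg
      refine Sat.mono_cost (Sat.bind (termList_sat (e1 k hkm)) fun F hF =>
        (classes_sat (A := 3 * l) (l := l) hl (by omega) F ?_).mono (fun B hB => ⟨F, hF, hB⟩)
          (le_refl 0) (b' := T * (3 * l * l ^ 3) + 1) ?_) le_rfl ?_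
      · intro t ht
        have := e1 k hkm _ (hF.mem ht).1
        omega
      · rw [hF.length]
        exact Nat.add_le_add_right (Nat.mul_le_mul_right _ (e2 _ (Nat.mul_pos hp (hk k hkm).pos))) 1
      · have h1 : (redMod (p * k) r).support.card * (2 * l + 1) ≤ T * (2 * l + 1) :=
          Nat.mul_le_mul_right _ (e2 _ (Nat.mul_pos hp (hk k hkm).pos))
        have h2 : T * (2 * l + 1) = 2 * (T * l ^ 1) + T := by ring
        have h3 : T * (3 * l * l ^ 3) = 3 * (T * l ^ 4) := by ring
        have a1 := absorb hl T 1 5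
        have a2 := absorb hl T 4 5
        have a3 := absorb_zero hl T 5
        omega
    · intro Bs hBs
      rw [List.forall₂_map_left_iff] at hBs
      exact hBs.flip
    · rw [List.length_map]
      exact Nat.add_le_add_right (Nat.mul_le_mul_right _ hK) 1
  rw [uTerms]
  refine Sat.mono_cost (Sat.bind step1 (r' := T * K)
    (b' := T * (l + 1) + 1 + (T * ((K + 1) * ((A + Q) * l ^ 6) + 1) + 1)) fun Bs hBs => ?_)
    (by omega) ?_
  · refine Sat.mono_cost (Sat.bind (termList_sat e3) fun ts hts => Sat.mono ?_ (fun U => id)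
      le_rfl le_rfl) (r := 0 + T * K)
      (b := (redMod p r).support.card * (l + 1) + 1 +
        (T * ((K + 1) * ((A + Q) * l ^ 6) + 1) + 1)) (by omega) ?_
    · have htlen : ts.length ≤ T := hts.length.trans_le (e2 p hp)
      have hzip : (Bs.zip ks).map Prod.snd = ks := by
        rw [List.map_snd_zip]
        exact hBs.length_eq.ge
      refine ((Sat.fold_const (r := K) (b := (K + 1) * ((A + Q) * l ^ 6)) (fun pre U =>
        (∀ t ∈ U, t.1 < D) ∧ (∀ e ∈ loneSet r p, (e % p, r.coeff e) ∈ pre → (e, r.coeff e) ∈ U) ∧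
          U.length ≤ pre.length) ?_ ?_).mono_val ?_).mono_cost (Nat.mul_le_mul_right _ htlen) ?_
      · simp
      · rintro pre t post he U ⟨hU1, hU2, hU3⟩
        have htm : t ∈ ts := by simp [he]
        have htd := e3 _ (hts.mem htm).1
        have htp : t.1 < p := lt_of_mem_support_redMod hp (hts.mem htm).1
        -- The predicate says that the image of a lone exponent e never leads to an abort and yields
        -- the residue of e; for other terms only the shape of the answer matters.
        refine Sat.mono_cost (Sat.bind (Sat.mapOption (r := 1) (b := 4 * l ^ 3)
          (P := fun Bk o => (∀ x, o = some x → x.2 = Bk.2 ∧ x.1 < x.2) ∧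
            ∀ e ∈ loneSet r p, t = (e % p, r.coeff e) → o = some (e % Bk.2, Bk.2)) ?_)
          (r' := 0) (b' := K * ((A + Q) * l ^ 5) + 1 + 4 * A) fun o ho => ?_)
          (r := (Bs.zip ks).length * 1 + 0) ?_ (b := (Bs.zip ks).length * (4 * l ^ 3 + 2) + 1 +
            (K * ((A + Q) * l ^ 5) + 1 + 4 * A)) ?_
        · rintro ⟨B, k⟩ hBk
          have hkm : k ∈ ks := (List.of_mem_zip hBk).2
          obtain ⟨F, hF, rfl⟩ := forall₂_zip hBs hBk
          have hkp := (hk k hkm).pos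
          refine Sat.mono_cost (Sat.bind (single_sat _ _ _) (r' := 0) (b' := 3 * l * l ^ 2)
            fun o ho => ?_) le_rfl ?_
          · cases o with
            | none =>
              refine Sat.mono_cost (.ret ⟨by simp, fun e he hte => ?_⟩) le_rfl (Nat.zero_le _)
              have hc := lone_class (Nat.mul_pos hp hkp) (dvd_mul_right p k) hF he
              have := ho.2 (e % (p * k)) (by rw [hte]; exact hc)
              simp at this
            | some b =>
              have hb := ho.1 b rfl
              have hbF : (b, t.2) ∈ F.filter fun t' => t'.1 % p = t.1 := by
                simp only at hb
                rw [hb]; simp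
              have hbF := (hF.mem (List.mem_filter.1 hbF).1).1
              have hbl := e1 k hkm b hbF
              have hkl' := hkl k hkm
              refine Sat.mono_cost (Sat.bind_eq (modN_sat (A := 3 * l) (l := l) (by simp only; omega)
                (by omega)) (Sat.ret ⟨?_, fun e he hte => ?_⟩)) le_rfl (by simp)
              · rintro x hx
                rw [← Option.some.inj hx]
                exact ⟨rfl, Nat.mod_lt _ hkp⟩
              · have hc := lone_class (Nat.mul_pos hp hkp) (dvd_mul_right p k) hF he
                have := ho.2 (e % (p * k)) (by rw [hte]; exact hc)
                rw [Option.some.inj this]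
                simp only
                rw [Nat.mod_mul_left_mod]
          · have : 3 * l * l ^ 2 = 3 * l ^ 3 := by ring
            have a1 := absorb hl 1 1 3
            simp only [one_mul, pow_one] at a1
            omega
        · cases o with
          | none =>
            refine Sat.mono_cost (.ret ⟨hU1, ?_, ?_⟩) le_rfl (Nat.zero_le _)
            · intro e he hmem
              rcases List.mem_append.1 hmem with h | h
              · exact hU2 e he h
              · obtain ⟨Bk, hBk, hP⟩ := ho.2 rfl
                have := hP.2 e he (List.mem_singleton.1 h).symm
                simp at this
            · rw [List.length_append]; omega
          | some rs =>
            have hrs := ho.1 rs rfl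
            have hsnd : rs.map Prod.snd = ks := by
              rw [← hzip]
              refine (forall₂_map_eq hrs fun a b hab => ?_).symm
              exact (hab.1 b rfl).1.symm
            have hlt : ∀ x ∈ rs, x.1 < x.2 := by
              intro x hx
              obtain ⟨a, -, ha⟩ := forall₂_right hrs hx
              exact (ha.1 x rfl).2
            have hrlen : rs.length = ks.length := by rw [← hsnd, List.length_map]
            have hsum : (rs.map fun x => len x.2).sum + 2 ≤ A := by
              have : (rs.map fun x => len x.2) = ks.map len := by
                rw [← hsnd, List.map_map]; rfl
              rw [this]
              have := sum_len_le hkl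
              have h2 : ks.length * l ≤ K * l := Nat.mul_le_mul_right _ hK
              omega
            refine Sat.mono_cost (Sat.bind (chineseRem_sat hl (A := A) (Q := Q) rs hlt ?_ hsum hA'
              ?_ hQl) (r' := 0) (b' := 4 * A) fun β hβ => ?_) le_rfl
              (b := rs.length * ((A + Q) * l ^ 5) + 1 + 4 * A) ?_
            · rw [hsnd]; exact pairwise_coprime_of_primes hk hnd
            · intro x hx
              have : x.2 ∈ ks := by rw [← hsnd]; exact List.mem_map_of_mem hx
              exact hkQ _ this
            · rw [hsnd] at hβ
              have hβl : len β ≤ A := by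
                have h1 := len_mono hβ.1.le
                have h2 := len_prod_le ks hne
                have h3 := sum_len_le hkl
                have h4 : ks.length * l ≤ K * l := Nat.mul_le_mul_right _ hK
                omega
              -- Uniqueness in the Chinese remainder theorem: both numbers are below the product of
              -- the moduli and have the same residues.
              have hβe : ∀ e ∈ loneSet r p, t = (e % p, r.coeff e) → β = e := by
                intro e he hte
                refine eq_of_mod_eq (pairwise_coprime_of_primes hk hnd) hβ.1
                  ((hr e (loneSet_subset r p he)).trans_le hD) fun k hkm => ?_
                rw [← hsnd] at hkm
                obtain ⟨x, hx, rfl⟩ := List.mem_map.1 hkm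
                rw [hβ.2 x hx]
                obtain ⟨a, -, ha⟩ := forall₂_right hrs hx
                have h1 := Option.some.inj (ha.2 e he hte)
                have h2 := (ha.1 x rfl).1
                rw [h1]
              refine Sat.mono_cost (Sat.bind_eq (leN_sat _ _) (r' := 0) (b' := len β) ?_) le_rfl
                (by omega)
              by_cases hbig : D ≤ β
              · rw [decide_eq_true hbig, if_pos rfl]
                refine Sat.mono_cost (.ret ⟨hU1, ?_, ?_⟩) le_rfl (Nat.zero_le _)
                · intro e he hmem
                  rcases List.mem_append.1 hmem with h | h
                  · exact hU2 e he h
                  · have := hβe e he (List.mem_singleton.1 h).symm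
                    have := hr e (loneSet_subset r p he)
                    omega
                · rw [List.length_append]; omega
              · rw [decide_eq_false hbig, if_neg (by simp)]
                refine Sat.mk ⟨?_, ?_, ?_⟩
                · intro t' ht'
                  rcases List.mem_append.1 ht' with h | h
                  · exact hU1 _ h
                  · rw [List.mem_singleton.1 h]; simp only; omega
                · intro e he hmem
                  rcases List.mem_append.1 hmem with h | h
                  · exact List.mem_append_left _ (hU2 e he h)
                  · have h1 := (List.mem_singleton.1 h).symm
                    rw [hβe e he h1, h1]
                    simp
                · simp only [List.length_append, List.length_cons, List.length_nil]; omega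
            · rw [hrlen]
              have := Nat.mul_le_mul_right ((A + Q) * l ^ 5) hK
              omega
        · rw [mul_one, ← List.length_map Prod.snd, hzip]; omega
        · rw [← List.length_map (as := Bs.zip ks) Prod.snd, hzip]
          have h1 : ks.length * (4 * l ^ 3 + 2) ≤ K * (4 * l ^ 3 + 2) := Nat.mul_le_mul_right _ hK
          have h2 : 4 * l ^ 3 + 2 ≤ (A + Q) * l ^ 5 := by
            have a1 := absorb hl 1 3 5
            have a2 := absorb_zero hl 1 5
            have a3 : 1 * l ^ 5 ≤ (A + Q) * l ^ 5 := Nat.mul_le_mul_right _ (by omega)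
            omega
          have h3 : K * (4 * l ^ 3 + 2) ≤ K * ((A + Q) * l ^ 5) := Nat.mul_le_mul_left _ h2
          have h4 : (K + 1) * ((A + Q) * l ^ 6) = K * ((A + Q) * l ^ 6) + (A + Q) * l ^ 6 := by ring
          have h5 : 2 * (K * ((A + Q) * l ^ 5)) ≤ K * ((A + Q) * l ^ 6) := by
            have a1 := absorb hl (A + Q) 5 6
            have := Nat.mul_le_mul_left K (show 2 * ((A + Q) * l ^ 5) ≤ (A + Q) * l ^ 6 by omega)
            calc _ = K * (2 * ((A + Q) * l ^ 5)) := by ring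
              _ ≤ _ := this
          have h6 := absorb_zero hl (A + Q) 6
          omega
      · rintro U ⟨h1, h2, h3⟩
        refine ⟨h1, fun e he => h2 e he ?_, h3.trans htlen⟩
        have hF : IsTermList ts (redMod p r) := hts
        have hc := lone_class hp (dvd_refl p) hF he
        have : (e % p, r.coeff e) ∈ ts.filter fun t => t.1 % p = e % p := by rw [hc]; simp
        exact (List.mem_filter.1 this).1
      · exact Nat.add_le_add_right (Nat.mul_le_mul_right _ htlen) 1
    · have := Nat.mul_le_mul_right (l + 1) (e2 p hp)
      omega
  · obtain ⟨B, hB⟩ : ∃ B, B = A + Q := ⟨_, rfl⟩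
    rw [← hB]
    have hB1 : 1 ≤ B := by omega
    have h0 : l ^ 5 ≤ B * l ^ 5 := Nat.le_mul_of_pos_left _ hB1
    have hp5 : 1 ≤ l ^ 5 := Nat.one_le_pow _ _ (by omega)
    have g1 : K * (T * l ^ 5 + 3) ≤ (T + 1) * (K * (3 * (B * l ^ 5))) := by
      calc K * (T * l ^ 5 + 3) ≤ K * (T * (3 * (B * l ^ 5)) + 3 * (B * l ^ 5)) := by
            refine Nat.mul_le_mul_left _ (Nat.add_le_add (Nat.mul_le_mul_left _ (by omega)) (by omega))
        _ = _ := by ring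
    have g2 : T * (l + 1) ≤ T * (B * l ^ 5) := by
      refine Nat.mul_le_mul_left _ (le_trans ?_ h0)
      have := absorb hl 1 1 5
      simp only [one_mul, pow_one] at this
      omega
    have g3 : T * ((K + 1) * (B * l ^ 6) + 1) + 1 ≤ (T + 1) * ((K + 1) * (B * l ^ 6) + 1) := by
      rw [Nat.succ_mul T]; omega
    have g4 : (T + 1) * ((K + 1) * (B * l ^ 8)) ≥ (T + 1) * (100 * ((K + 1) * (B * l ^ 6))) := by
      refine Nat.mul_le_mul_left _ ?_
      have := Nat.mul_le_mul_left (K + 1) (absorb hl B 6 8)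
      linarith
    have g5 : B * l ^ 5 ≤ B * l ^ 6 := by have := absorb hl B 5 6; omega
    have g6 : 1 ≤ B * l ^ 5 := by omega
    have g7 : (T + 1) * (K * (3 * (B * l ^ 5))) ≤ (T + 1) * (3 * ((K + 1) * (B * l ^ 6))) := by
      refine Nat.mul_le_mul_left _ ?_
      have : K * (B * l ^ 5) ≤ (K + 1) * (B * l ^ 6) := Nat.mul_le_mul (by omega) g5
      linarith
    have g8 : B * l ^ 6 ≤ (K + 1) * (B * l ^ 6) := Nat.le_mul_of_pos_left _ (by omega)
    obtain ⟨V, hV⟩ : ∃ V, V = (K + 1) * (B * l ^ 6) := ⟨_, rfl⟩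
    rw [← hV] at g3 g4 g7 g8 ⊢
    have g9 : T * (B * l ^ 5) ≤ T * V := Nat.mul_le_mul_left _ (by omega)
    have g10 : (T + 1) * (V + 1) = T * V + V + T + 1 := by ring
    have g11 : (T + 1) * (100 * V) = 100 * (T * V) + 100 * V := by ring
    have g12 : (T + 1) * (3 * V) = 3 * (T * V) + 3 * V := by ring
    have g13 : T ≤ T * V := Nat.le_mul_of_pos_right _ (by omega)
    omega

end Univariate

end SparseInterp

namespace SparseInterp

open Cost Polynomial

/-! ### Lists of terms that have been found -/

section PartialTerms

variable {R : Type*} [CommRing R] {l : ℕ}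

/-- The list holds some of the terms of `f`, each at most once. -/
def IsPartialTermList (h : List (ℕ × R)) (f : R[X]) : Prop :=
  ∃ es : List ℕ, es.Nodup ∧ (∀ e ∈ es, e ∈ f.support) ∧ h = es.map fun e => (e, f.coeff e)

theorem IsPartialTermList.nil (f : R[X]) : IsPartialTermList [] f := ⟨[], by simp⟩

theorem coeff_sub_listPoly (f : R[X]) {es : List ℕ} (hn : es.Nodup) (x : ℕ) :
    (f - listPoly (es.map fun e => (e, f.coeff e))).coeff x = if x ∈ es then 0 else f.coeff x := by
  induction es with
  | nil => simp [listPoly_nil]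
  | cons e es ih =>
    rw [List.nodup_cons] at hn
    have h := ih hn.2
    rw [coeff_sub] at h
    rw [List.map_cons, listPoly_cons, coeff_sub, coeff_add, coeff_monomial]
    by_cases hx : e = x
    · subst hx
      rw [if_neg hn.1] at h
      rw [if_pos rfl, if_pos (by simp)]
      linear_combination h
    · rw [if_neg hx, zero_add, h]
      simp [Ne.symm hx]

theorem support_sub_listPoly (f : R[X]) {es : List ℕ} (hn : es.Nodup) :
    (f - listPoly (es.map fun e => (e, f.coeff e))).support = f.support \ es.toFinset := by
  ext x
  rw [mem_support_iff, coeff_sub_listPoly f hn, Finset.mem_sdiff, mem_support_iff, List.mem_toFinset]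
  by_cases hx : x ∈ es <;> simp [hx]

theorem IsPartialTermList.support_subset {h : List (ℕ × R)} {f : R[X]}
    (hh : IsPartialTermList h f) : (f - listPoly h).support ⊆ f.support := by
  obtain ⟨es, hn, hs, rfl⟩ := hh
  rw [support_sub_listPoly f hn]
  exact Finset.sdiff_subset

theorem IsPartialTermList.card_add {h : List (ℕ × R)} {f : R[X]} (hh : IsPartialTermList h f) :
    (f - listPoly h).support.card + h.length = f.support.card := by
  obtain ⟨es, hn, hs, rfl⟩ := hh
  rw [support_sub_listPoly f hn, List.length_map, ← List.toFinset_card_of_nodup hn]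
  exact Finset.card_sdiff_add_card_eq_card fun e he => hs e (List.mem_toFinset.1 he)

/-- The terms of the remainder f - h are exactly the terms of f missing from h, with unchanged
coefficients, so no repetition can arise. -/
theorem IsPartialTermList.append {h s : List (ℕ × R)} {f : R[X]} (hh : IsPartialTermList h f)
    (hs : IsPartialTermList s (f - listPoly h)) : IsPartialTermList (h ++ s) f := by
  obtain ⟨es, hn, hsub, rfl⟩ := hh
  obtain ⟨es', hn', hsub', rfl⟩ := hs
  have hmem : ∀ e ∈ es', e ∈ f.support ∧ e ∉ es := fun e he => by
    have := hsub' e he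
    rw [support_sub_listPoly f hn, Finset.mem_sdiff, List.mem_toFinset] at this
    exact this
  refine ⟨es ++ es', List.nodup_append'.2 ⟨hn, hn', fun e he he' => (hmem e he').2 he⟩, ?_, ?_⟩
  · intro e he
    rcases List.mem_append.1 he with h | h
    · exact hsub e h
    · exact (hmem e h).1
  · rw [List.map_append]
    congr 1
    refine List.map_congr_left fun e he => ?_
    rw [coeff_sub_listPoly f hn, if_neg (hmem e he).2]

theorem IsPartialTermList.isTermList {h : List (ℕ × R)} {f : R[X]} (hh : IsPartialTermList h f)
    (h0 : f - listPoly h = 0) : IsTermList h f := by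
  obtain ⟨es, hn, hs, rfl⟩ := hh
  refine ⟨es, hn, fun e => ⟨hs e, fun he => ?_⟩, rfl⟩
  by_contra hne
  have : e ∈ (f - listPoly (es.map fun e => (e, f.coeff e))).support := by
    rw [support_sub_listPoly f hn, Finset.mem_sdiff, List.mem_toFinset]
    exact ⟨he, hne⟩
  rw [h0] at this
  simp at this

theorem IsPartialTermList.mem {h : List (ℕ × R)} {f : R[X]} (hh : IsPartialTermList h f)
    {t : ℕ × R} (ht : t ∈ h) : t.1 ∈ f.support ∧ t.2 = f.coeff t.1 := by
  obtain ⟨es, hn, hs, rfl⟩ := hh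
  obtain ⟨e, he, rfl⟩ := List.mem_map.1 ht
  exact ⟨hs e he, rfl⟩

theorem IsPartialTermList.snoc {h : List (ℕ × R)} {f : R[X]} (hh : IsPartialTermList h f)
    {t : ℕ × R} (ht : t.2 ≠ 0) (htf : f.coeff t.1 = t.2) (hn : t.1 ∉ h.map Prod.fst) :
    IsPartialTermList (h ++ [t]) f := by
  obtain ⟨es, hnd, hs, rfl⟩ := hh
  have hfst : (es.map fun e => (e, f.coeff e)).map Prod.fst = es := by
    rw [List.map_map]; exact List.map_id es
  rw [hfst] at hn
  refine ⟨es ++ [t.1], List.nodup_append'.2 ⟨hnd, by simp, by simpa using hn⟩, ?_, ?_⟩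
  · intro e he
    rcases List.mem_append.1 he with h | h
    · exact hs e h
    · rw [List.mem_singleton.1 h, mem_support_iff, htf]; exact ht
  · rw [List.map_append, List.map_singleton, htf]

/-- If all terms that are alone modulo `p` are found, then half of the terms are found. -/
theorem card_le_two_mul_length {s : List (ℕ × R)} {r : R[X]} {p : ℕ}
    (hl : ∀ e ∈ loneSet r p, e ∈ s.map Prod.fst)
    (hc : r.support.card ≤ 2 * (loneSet r p).card) : r.support.card ≤ 2 * s.length := by
  have : (loneSet r p).card ≤ (s.map Prod.fst).toFinset.card :=
    Finset.card_le_card fun e he => List.mem_toFinset.2 (hl e he)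
  have h2 := List.toFinset_card_le (s.map Prod.fst)
  rw [List.length_map] at h2
  omega

end PartialTerms

/-! ### The term test with the bounds N₁, N₂, N -/

section Test

variable {R : Type*} [CommRing R] {l : ℕ}

theorem boundsVal_spec {n T D : ℕ} (hn : 1 ≤ n) (hT : 1 ≤ T) (hD : 2 ≤ D) :
    1 ≤ (boundsVal n T D).1 ∧ 1 ≤ (boundsVal n T D).2.1 ∧
    (D ^ n) ^ (T - 1) ≤ 2 ^ (boundsVal n T D).1 ∧ (D ^ n) ^ T ≤ 2 ^ (boundsVal n T D).2.1 ∧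
    4 * (boundsVal n T D).1 ≤ (boundsVal n T D).2.2 ∧
    (boundsVal n T D).1 + (boundsVal n T D).2.1 - 1 ≤ (boundsVal n T D).2.2 := by
  refine ⟨le_max_left _ _, ?_, ?_, ?_, le_max_left _ _, le_max_right _ _⟩
  · refine Nat.clog_pos (by norm_num) ?_
    calc 2 ≤ D := hD
      _ ≤ D ^ (n * T) := Nat.le_self_pow (Nat.mul_pos hn hT).ne' D
  · rw [← pow_mul]
    exact (Nat.le_pow_clog (by norm_num) _).trans
      (Nat.pow_le_pow_right (by norm_num) (le_max_right _ _))
  · rw [← pow_mul]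
    exact Nat.le_pow_clog (by norm_num) _

theorem boundsVal_mono {n T T' D : ℕ} (hD : 2 ≤ D) (h : T ≤ T') :
    (boundsVal n T D).1 ≤ (boundsVal n T' D).1 ∧ (boundsVal n T D).2.1 ≤ (boundsVal n T' D).2.1 ∧
    (boundsVal n T D).2.2 ≤ (boundsVal n T' D).2.2 := by
  have h1 : Nat.clog 2 (D ^ (n * (T - 1))) ≤ Nat.clog 2 (D ^ (n * (T' - 1))) :=
    Nat.clog_mono_right _ (Nat.pow_le_pow_right (by omega) (Nat.mul_le_mul_left _ (by omega)))
  have h2 : Nat.clog 2 (D ^ (n * T)) ≤ Nat.clog 2 (D ^ (n * T')) :=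
    Nat.clog_mono_right _ (Nat.pow_le_pow_right (by omega) (Nat.mul_le_mul_left _ h))
  simp only [boundsVal]
  omega

open scoped Classical in
-- With N₁ + N₂ - 1 primes a true term fails for at most N₁ - 1 of them, and hence passes for N₂; a
-- false candidate passes for fewer than N₂. That r is nonzero makes T positive.
theorem term_test_iff {r : R[X]} {n T D E : ℕ} {c : R} {ps : List ℕ} (hn : 1 ≤ n) (hD : 2 ≤ D)
    (hr0 : r ≠ 0) (hr : ∀ e ∈ r.support, e < D ^ n) (hT : r.support.card ≤ T)
    (hps : ∀ p ∈ ps, p.Prime) (hnd : ps.Nodup)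
    (hcard : (boundsVal n T D).1 + (boundsVal n T D).2.1 - 1 ≤ ps.length) (hE : E < D ^ n) :
    (boundsVal n T D).2.1 ≤
      (ps.toFinset.filter fun p => c ≠ 0 ∧ (redMod p r).coeff (E % p) = c).card ↔
    c ≠ 0 ∧ r.coeff E = c := by
  have ht : 0 < r.support.card := Finset.card_pos.2 (support_nonempty.2 hr0)
  obtain ⟨h1, h2, h3, h4, -, -⟩ := boundsVal_spec hn (show 1 ≤ T by omega) hD
  have hps' : ∀ p ∈ ps.toFinset, p.Prime := fun p hp => hps p (List.mem_toFinset.1 hp)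
  constructor
  · exact coeff_eq_of_le_card_drops hr hE hT h2 h4 hps'
  · rintro ⟨hc, rfl⟩
    refine le_card_drops hr h1 (le_trans ?_ h3) hps' ?_ (mem_support_iff.2 hc)
    · exact Nat.pow_le_pow_right (Nat.pow_pos (by omega)) (by omega)
    · rwa [List.toFinset_card_of_nodup hnd]

/-- The maximum over all primes is at least the value at the good prime supplied by the averaging
argument. -/
theorem firstMax_many {r : R[X]} {n T D m : ℕ} {ps : List ℕ} (hn : 1 ≤ n) (hD : 2 ≤ D)
    (hr0 : r ≠ 0) (hr : ∀ e ∈ r.support, e < D ^ n) (hT : r.support.card ≤ T)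
    (hps : ∀ p ∈ ps, p.Prime) (hnd : ps.Nodup) (hcard : (boundsVal n T D).2.2 ≤ ps.length)
    (hm : ∀ p ∈ ps, (redMod p r).support.card ≤ m) : 3 * r.support.card ≤ 4 * m := by
  have ht : 0 < r.support.card := Finset.card_pos.2 (support_nonempty.2 hr0)
  obtain ⟨h1, h2, h3, h4, h5, -⟩ := boundsVal_spec hn (show 1 ≤ T by omega) hD
  obtain ⟨p, hp, h⟩ := exists_prime_many_terms hr h1
    ((Nat.pow_le_pow_right (Nat.pow_pos (by omega)) (by omega)).trans h3)
    (P := ps.toFinset) (fun p hp => hps p (List.mem_toFinset.1 hp))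
    (by rw [List.toFinset_card_of_nodup hnd]; omega) hr0
  have := hm p (List.mem_toFinset.1 hp)
  omega

/-- Two classes may give the same β, since its residue modulo p is not compared with the class.
Passing over repetitions keeps the accepted list free of duplicates. -/
theorem pickU_sat (hl : 100 ≤ l) {r : R[X]} {T D S : ℕ} {ps : List ℕ} (hD : 2 ≤ D)
    (hr0 : r ≠ 0) (hr : ∀ e ∈ r.support, e < D) (hT : r.support.card ≤ T)
    (hps : ∀ p ∈ ps, p.Prime) (hnd : ps.Nodup) (hpl : ∀ p ∈ ps, len p ≤ l)
    (hcard : (boundsVal 1 T D).1 + (boundsVal 1 T D).2.1 - 1 ≤ ps.length)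
    (hS : ps.length ≤ S) (hSl : 8 * (S * l) < 2 ^ l) (hDS : len D ≤ S) (U : List (ℕ × R))
    (hN2 : (boundsVal 1 T D).2.1 ≤ S)
    (hU : ∀ t ∈ U, t.1 < D) :
    (pickU ps (images ps r) (boundsVal 1 T D).2.1 U).Sat
      (fun s => IsPartialTermList s r ∧
        ∀ t ∈ U, t.2 ≠ 0 → r.coeff t.1 = t.2 → t.1 ∈ s.map Prod.fst)
      (U.length * (S * 2)) (U.length * (S * l ^ 11) + 1) := by
  classical
  rw [pickU]
  have hr' : ∀ e ∈ r.support, e < D ^ 1 := by simpa using hr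
  have s0 : S ≤ S * l := Nat.le_mul_of_pos_right _ (by omega)
  have a1 := absorb hl S 10 11
  have a2 := absorb_zero hl S 11
  have lD := one_le_len D
  have hN2l := len_mono hN2
  have hN2s := len_small hN2 (by omega) hl
  refine ((Sat.fold_const (r := S * 2) (b := S * l ^ 10 + 4 * l + S) (fun (pre : List (ℕ × R)) s =>
    IsPartialTermList s r ∧
      ∀ t ∈ pre, t.2 ≠ 0 → r.coeff t.1 = t.2 → t.1 ∈ s.map Prod.fst) ?_ ?_)).mono_cost le_rfl ?_
  · exact ⟨.nil r, by simp⟩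
  · rintro pre t post he s ⟨h1, h2⟩
    have htU : t ∈ U := by simp [he]
    have htD := hU t htU
    have htl : len t.1 ≤ S := (len_mono htD.le).trans hDS
    by_cases hmem : t.1 ∈ s.map Prod.fst
    · rw [if_pos hmem]
      refine .mk' ⟨h1, ?_⟩ (Nat.zero_le _) (by omega)
      intro t' ht' hne hco
      rcases List.mem_append.1 ht' with h | h
      · exact h2 t' h hne hco
      · rw [List.mem_singleton.1 h]; exact hmem
    · rw [if_neg hmem]
      have htest := term_test_iff (c := t.2) le_rfl hD hr0 hr' hT hps hnd hcard
        (E := t.1) (by simpa using htD)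
      refine Sat.mono_cost (Sat.bind_eq (countDrops_sat hl hps hnd hpl hS r t htl hSl)
        (Sat.bind_eq (leN_sat _ _) (r' := 0) (b' := len t.1) ?_)) (by omega) ?_
      · by_cases hpass : t.2 ≠ 0 ∧ r.coeff t.1 = t.2
        · rw [decide_eq_true (htest.2 hpass), if_pos rfl]
          refine .mk ⟨h1.snoc hpass.1 hpass.2 hmem, ?_⟩
          intro t' ht' hne hco
          rw [List.map_append, List.mem_append]
          rcases List.mem_append.1 ht' with h | h
          · exact .inl (h2 t' h hne hco)
          · rw [List.mem_singleton.1 h]; simp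
        · rw [decide_eq_false (mt htest.1 hpass), if_neg (by simp)]
          refine .mk ⟨h1, ?_⟩
          intro t' ht' hne hco
          rcases List.mem_append.1 ht' with h | h
          · exact h2 t' h hne hco
          · rw [List.mem_singleton.1 h] at hne hco
            exact absurd ⟨hne, hco⟩ hpass
      · have hc : (ps.toFinset.filter fun p => t.2 ≠ 0 ∧
            (redMod p r).coeff (t.1 % p) = t.2).card ≤ S :=
          (Finset.card_filter_le _ _).trans ((List.toFinset_card_le _).trans hS)
        have := len_small hc (by omega) hl
        omega
  · refine Nat.add_le_add_right (Nat.mul_le_mul_left _ ?_) 1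
    have a3 := absorb hl 1 1 11
    simp only [one_mul, pow_one] at a3
    have : l ^ 11 ≤ S * l ^ 11 := Nat.le_mul_of_pos_left _ (by omega)
    omega

end Test

end SparseInterp

namespace SparseInterp

open Cost Polynomial

/-! ### The univariate algorithm: rounds, loop, total cost -/

section Univariate

variable {R : Type*} [CommRing R] {l : ℕ}

/-- Size conditions for the univariate algorithm: at most `T` terms, lengths of exponents at
most `Λ`; powers of `l` absorb all logarithms. -/
structure USize (l T Λ : ℕ) : Prop where
  hl : 100 ≤ l
  one_le : 1 ≤ T
  le : l ≤ Λ
  small : 100 * (T * Λ * l) < 2 ^ l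
  primes : 2 * Nat.size (4 * (T * Λ)) + 50 ≤ l

/-- A round is treated with an arbitrary continuation, into which the recursive call of the loop is
plugged later. The bound `2 * T` on `h₀` leaves room for the given list followed by the terms found
so far. The main cost is at most Λ probes of modulus p k ≤ 5 T Λ l · 2 Λ l. -/
theorem uiStep_sat {T Λ T₁ D ρ₁ ρ₂ β : ℕ} (hs : USize l T Λ) {P : ℕ → Cost R[X]} {g : R[X]}
    (hP : ∀ q > 0, len q ≤ 2 * l → (P q).Sat (· = redMod q g) (ρ₁ + ρ₂ * q) β)
    {h₀ : List (ℕ × R)} (hh₀ : h₀.length ≤ 2 * T) (hh₀' : ∀ t ∈ h₀, len t.1 ≤ Λ)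
    (hD : 2 ≤ D) (hDΛ : len D ≤ Λ) {ks : List ℕ} (hk : ∀ k ∈ ks, k.Prime) (hknd : ks.Nodup)
    (hkQ : ∀ k ∈ ks, k ≤ 2 * (Λ * l)) (hkK : ks.length ≤ Λ) (hne : ks ≠ []) (hkD : D ≤ ks.prod)
    {ps : List ℕ} (hps : ∀ p ∈ ps, p.Prime) (hnd : ps.Nodup)
    (hpl : ∀ p ∈ ps, len p ≤ l) (hpB : ∀ p ∈ ps, p ≤ 5 * (T * Λ * l))
    (hpν : ps.length ≤ 4 * (T * Λ)) (hN : (boundsVal 1 T₁ D).2.2 ≤ ps.length)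
    {r : R[X]} (hrg : r = g - listPoly h₀) (hr0 : r ≠ 0) (hr : ∀ e ∈ r.support, e < D)
    (hrT : r.support.card ≤ T₁) (hT₁ : T₁ ≤ T) {p : ℕ} (hp : p ∈ ps)
    (hmany : 3 * r.support.card ≤ 4 * (redMod p r).support.card)
    {γ : Type*} {Q : γ → Prop} {r' b' : ℕ} (kont : ℕ → List R[X] → List (ℕ × R) → Cost γ)
    (hkont : ∀ s, IsPartialTermList s r → r.support.card ≤ 2 * s.length →
      (kont (T₁ - s.length) (images ps (r - listPoly s)) s).Sat Q r' b') :
    ((Cost.map (fun r => (mulN p r).bind fun q => (P q).bind fun g =>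
        subTermsMod q g h₀) ks).bind fun gs =>
      (uTerms (redMod p r) gs p ks D).bind fun U =>
      (takeN ((boundsVal 1 T₁ D).1 + (boundsVal 1 T₁ D).2.1 - 1) (images ps r)).bind fun fs₁ =>
      (takeN ((boundsVal 1 T₁ D).1 + (boundsVal 1 T₁ D).2.1 - 1) ps).bind fun ps₁ =>
      (pickU ps₁ fs₁ (boundsVal 1 T₁ D).2.1 U).bind fun s =>
      (subN T₁ s.length).bind fun T₂ =>
      (fold (subFromAll ps) (images ps r) s).bind fun fs₂ => kont T₂ fs₂ s).Sat Q
      (Λ * (ρ₁ + ρ₂ * (10 * (T * Λ * l) * (Λ * l))) + 30 * (T * Λ * (T + Λ)) + r')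
      (Λ * β + T * Λ * (T + Λ) * l ^ 12 + b') := by
  obtain ⟨hl, hT1, hlΛ, hsmall, -⟩ := hs
  have hmul := mul_lt_two_pow hl
  obtain ⟨W, hW⟩ : ∃ W, W = T * Λ := ⟨_, rfl⟩
  obtain ⟨Y, hY⟩ : ∃ Y, Y = T * Λ * (T + Λ) := ⟨_, rfl⟩
  have hTW : T ≤ W := hW ▸ Nat.le_mul_of_pos_right _ (by omega)
  have hΛW : Λ ≤ W := hW ▸ Nat.le_mul_of_pos_left _ (by omega)
  have hWl : W ≤ W * l := Nat.le_mul_of_pos_right _ (by omega)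
  have hΛl : Λ * l ≤ W * l := Nat.mul_le_mul_right _ hΛW
  have hΛl' : Λ ≤ Λ * l := Nat.le_mul_of_pos_right _ (by omega)
  have hl2 : 100 * l ≤ Λ * l := Nat.mul_le_mul_right _ (by omega)
  rw [← hY]
  rw [← hW] at hpB hpν hsmall ⊢
  have hY1 : Y = T * W + W * Λ := by rw [hY, hW]; ring
  have hYW : 100 * W ≤ Y := by
    have : W * 100 ≤ W * Λ := Nat.mul_le_mul_left _ (by omega)
    omega
  have hp0 := (hps p hp).pos
  have hT₁D : T₁ * len D ≤ W := hW ▸ Nat.mul_le_mul hT₁ hDΛ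
  have hNν := hN.trans hpν
  obtain ⟨-, -, -, -, -, hN12⟩ := boundsVal_spec (n := 1) le_rfl
    (show 1 ≤ T₁ by
      have : 0 < r.support.card := Finset.card_pos.2 (support_nonempty.2 hr0)
      omega) hD
  obtain ⟨N₁, hN₁⟩ : ∃ N₁, N₁ = (boundsVal 1 T₁ D).1 + (boundsVal 1 T₁ D).2.1 - 1 := ⟨_, rfl⟩
  have hN₁l := len_small (A := 4 * W) (x := N₁) (by omega) (by omega) hl
  have hN₁len : (ps.take N₁).length = N₁ := by rw [List.length_take]; omega
  have hNpos : (boundsVal 1 T₁ D).1 ≥ 1 := le_max_left _ _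
  rw [← hN₁]
  have hkl : ∀ k ∈ ks, len k ≤ l := fun k h => len_small (hkQ k h) (by omega) hl
  have hgs : (Cost.map (fun r => (mulN p r).bind fun q => (P q).bind fun g =>
        subTermsMod q g h₀) ks).Sat (· = ks.map fun k => redMod (p * k) r)
      (Λ * (ρ₁ + ρ₂ * (10 * (W * l) * (Λ * l)) + 4 * T))
      (Λ * (β + 2 * T * (3 * Λ * l ^ 3) + 2 * l ^ 3 + 2) + 1) := by
    refine (Sat.map_eq_const (r := ρ₁ + ρ₂ * (10 * (W * l) * (Λ * l)) + 4 * T)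
      (b := β + 2 * T * (3 * Λ * l ^ 3) + 2 * l ^ 3 + 1) fun k hkm => ?_).mono_cost
      (Nat.mul_le_mul_right _ hkK) (Nat.add_le_add_right (Nat.mul_le_mul_right _ hkK) 1)
    have h1 := hkl k hkm
    have h2 := hpl p hp
    have hq := Nat.mul_pos hp0 (hk k hkm).pos
    have hql : len (p * k) ≤ 2 * l := (len_mul p k).trans (by omega)
    refine Sat.mono_cost (Sat.bind_eq (mulN_sat (A := 2 * l) (l := l) (by omega) (by omega))
      (Sat.bind_eq (hP _ hq hql) ((subTermsMod_sat (A := 3 * Λ) hl hq (by omega) _ h₀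
        fun t ht => ?_).mono_val ?_))) ?_ ?_
    · have := hh₀' t ht
      omega
    · rintro _ rfl
      rw [hrg, redMod_sub]
    · have h3 : p * k ≤ 10 * (W * l) * (Λ * l) := by
        calc p * k ≤ 5 * (W * l) * (2 * (Λ * l)) := Nat.mul_le_mul (hpB p hp) (hkQ k hkm)
          _ = _ := by ring
      have h4 := Nat.mul_le_mul_left ρ₂ h3
      omega
    · have h3 : h₀.length * (3 * Λ * l ^ 3) ≤ 2 * T * (3 * Λ * l ^ 3) := Nat.mul_le_mul_right _ hh₀
      have h4 : 2 * l * l ^ 2 = 2 * l ^ 3 := by ring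
      omega
  -- At most Λ moduli of length at most l have a product of length at most Λ l; the moduli
  -- themselves are bounded by 2 Λ l.
  have hU := uTerms_sat (T := T) (K := Λ) (A := 2 * (Λ * l)) (Q := 2 * (Λ * l)) hl hp0 (hpl p hp) hk
    hknd hkQ (len_small le_rfl (by omega) hl) hkK hne hkD (by omega) (by omega) (by omega) hr
    (hrT.trans hT₁)
  refine Sat.mono_cost (Sat.bind_eq hgs (Sat.bind hU
    (r' := 20 * (T * W) + r') (b' := 2 * (4 * W + l) + 2 * (T * (5 * W * l ^ 11) + 1) + 2 * l + b')
    fun U hU => Sat.mono_cost (Sat.bind_eq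
    (takeN_sat _ _) (Sat.bind_eq (takeN_sat _ _)
    (r' := 20 * (T * W) + r') (b' := 2 * (T * (5 * W * l ^ 11) + 1) + 2 * l + b') ?_)) (by omega) ?_))
    ?_ ?_
  · rw [images_take]
    have hUlen : ∀ X, U.length * X ≤ T * X := fun X => Nat.mul_le_mul_right _ hU.2.2
    have hpick := pickU_sat (S := 5 * W) (ps := ps.take N₁) hl hD hr0 hr hrT
      (fun p hp => hps p (List.mem_of_mem_take hp)) (hnd.sublist (List.take_sublist _ _))
      (fun p hp => hpl p (List.mem_of_mem_take hp)) (by omega) (by omega)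
      (by rw [mul_assoc]; omega) (by omega) U (by omega) hU.1
    refine Sat.mono_cost (Sat.bind hpick (r' := 10 * (T * W) + r')
      (b' := T * (5 * W * l ^ 11) + 1 + 2 * l + b') fun s hs => ?_) ?_ ?_
    · have hslen : s.length ≤ T := by
        have := hs.1.card_add
        omega
      refine Sat.mono_cost (Sat.bind_eq (subN_sat _ _) (Sat.bind_eq (fold_subFromAll_sat hl
        (S := 5 * W) hps hpl (by omega) (by rw [mul_assoc]; omega) r s fun t ht => ?_)
        (hkont s hs.1 (card_le_two_mul_length (fun e he => ?_) (card_le_two_mul_card_loneSet hp0 hmany)))))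
        ?_ ?_
      · have := len_mono (hr _ (hs.1.mem ht).1).le
        omega
      · exact hs.2 _ (hU.2.1 e he) (mem_support_iff.1 (loneSet_subset r p he)) rfl
      · have := Nat.mul_le_mul_right (5 * W * 2) hslen
        have h2 : T * (5 * W * 2) = 10 * (T * W) := by ring
        omega
      · have h1 := Nat.mul_le_mul_right (5 * W * l ^ 11) hslen
        have h2 := len_small (x := T₁) (A := W) (by omega) (by omega) hl
        have h3 := len_small (x := s.length) (A := W) (by omega) (by omega) hl
        omega
    · have h1 := hUlen (5 * W * 2)
      have h2 : T * (5 * W * 2) = 10 * (T * W) := by ring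
      omega
    · have h1 := hUlen (5 * W * l ^ 11)
      omega
  · rw [length_images]
    omega
  · have h1 : Λ * (ρ₁ + ρ₂ * (10 * (W * l) * (Λ * l)) + 4 * T) =
      Λ * (ρ₁ + ρ₂ * (10 * (W * l) * (Λ * l))) + 4 * W := by rw [hW]; ring
    omega
  · have h1 : Λ * (β + 2 * T * (3 * Λ * l ^ 3) + 2 * l ^ 3 + 2) + 1 =
        Λ * β + 6 * (W * Λ * l ^ 3) + 2 * (Λ * l ^ 3) + 2 * Λ + 1 := by rw [hW]; ring
    have h2 : (T + 1) * ((Λ + 1) * ((2 * (Λ * l) + 2 * (Λ * l)) * l ^ 8)) ≤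
        16 * (W * Λ * l ^ 9) := by
      calc _ ≤ (2 * T) * ((2 * Λ) * ((2 * (Λ * l) + 2 * (Λ * l)) * l ^ 8)) :=
            Nat.mul_le_mul (by omega) (Nat.mul_le_mul_right _ (by omega))
        _ = _ := by rw [hW]; ring
    have h3 : T * (5 * W * l ^ 11) = 5 * (T * W * l ^ 11) := by ring
    have a1 := absorb hl (W * Λ) 3 12
    have a2 := absorb hl Λ 3 12
    have a3 := absorb hl (W * Λ) 9 12
    have a4 := absorb hl (T * W) 11 12
    have a5 := absorb_zero hl W 12
    have a6 : W ≤ W * Λ := Nat.le_mul_of_pos_right _ (by omega)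
    have a7 : W * l ^ 12 ≤ W * Λ * l ^ 12 := Nat.mul_le_mul_right _ a6
    have a8 : Λ * l ^ 12 ≤ W * l ^ 12 := Nat.mul_le_mul_right _ hΛW
    have a9 : Y * l ^ 12 = T * W * l ^ 12 + W * Λ * l ^ 12 := by rw [hY1]; ring
    omega

/-- Halving a number removes a binary digit, so `Nat.size` of the number of remaining terms counts
the rounds. -/
theorem size_add_one_le {a b : ℕ} (hb : 0 < b) (h : 2 * a ≤ b) : Nat.size a + 1 ≤ Nat.size b := by
  have h1 : 0 < Nat.size b := Nat.size_pos.2 hb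
  have h2 := Nat.lt_size_self b
  obtain ⟨k, hk⟩ : ∃ k, Nat.size b = k + 1 := ⟨_, (Nat.succ_pred_eq_of_pos h1).symm⟩
  rw [hk, pow_succ] at h2
  rw [hk]
  exact Nat.add_le_add_right (Nat.size_le.2 (by omega)) 1

/-- Each round finds at least half of the remaining terms. The summand 1 in the number of rounds is
for the last pass, which finds all images zero; and since at least one term disappears per round,
fuel equal to the number of terms is enough. The lists of primes and images shrink with T,
consistently because the bounds are monotone in T. -/
theorem uiLoop_sat {T₀ Λ D ρ₁ ρ₂ β : ℕ} (hs : USize l T₀ Λ) {P : ℕ → Cost R[X]} {g : R[X]}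
    (hP : ∀ q > 0, len q ≤ 2 * l → (P q).Sat (· = redMod q g) (ρ₁ + ρ₂ * q) β)
    {h₀ : List (ℕ × R)} (hh₀ : h₀.length ≤ T₀) (hh₀' : ∀ t ∈ h₀, len t.1 ≤ Λ)
    (hD : 2 ≤ D) (hDΛ : len D ≤ Λ) {ks : List ℕ} (hk : ∀ k ∈ ks, k.Prime) (hknd : ks.Nodup)
    (hkQ : ∀ k ∈ ks, k ≤ 2 * (Λ * l)) (hkK : ks.length ≤ Λ) (hne : ks ≠ []) (hkD : D ≤ ks.prod)
    {f : R[X]} (hfg : f = g - listPoly h₀) (hf : ∀ e ∈ f.support, e < D)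
    (hf' : f.support.card ≤ T₀)
    (fuel T : ℕ) (ps : List ℕ) (hps : ∀ p ∈ ps, p.Prime) (hnd : ps.Nodup)
    (hpl : ∀ p ∈ ps, len p ≤ l) (hpB : ∀ p ∈ ps, p ≤ 5 * (T₀ * Λ * l))
    (hpν : ps.length ≤ 4 * (T₀ * Λ)) (h : List (ℕ × R))
    (hh : IsPartialTermList h f) (hT₀ : T ≤ T₀) {r : R[X]} (hrf : r = f - listPoly h)
    (hT : r.support.card ≤ T) (hfuel : r.support.card ≤ fuel)
    (hN : (boundsVal 1 T D).2.2 ≤ ps.length) :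
    (uiLoop P h₀ D ks ps fuel T (images ps r) h).Sat (IsTermList · f)
      ((Nat.size r.support.card + 1) *
        (Λ * (ρ₁ + ρ₂ * (10 * (T₀ * Λ * l) * (Λ * l))) + 30 * (T₀ * Λ * (T₀ + Λ))))
      ((Nat.size r.support.card + 1) * (Λ * β + T₀ * Λ * (T₀ + Λ) * l ^ 13)) := by
  obtain ⟨V₁, hV₁⟩ : ∃ V, V = Λ * (ρ₁ + ρ₂ * (10 * (T₀ * Λ * l) * (Λ * l))) +
    30 * (T₀ * Λ * (T₀ + Λ)) := ⟨_, rfl⟩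
  obtain ⟨V₂, hV₂⟩ : ∃ V, V = Λ * β + T₀ * Λ * (T₀ + Λ) * l ^ 13 := ⟨_, rfl⟩
  rw [← hV₁, ← hV₂]
  induction fuel generalizing T ps h r with
  | zero =>
    have h0 : r = 0 := by
      rw [← Polynomial.card_support_eq_zero]; omega
    rw [uiLoop]
    exact Sat.mono_cost (.ret (hh.isTermList (hrf ▸ h0))) (Nat.zero_le _) (Nat.zero_le _)
  | succ fuel ih =>
    have hs' := hs
    obtain ⟨hl, hT1, hlΛ, hsmall, -⟩ := hs
    have hmul := mul_lt_two_pow hl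
    obtain ⟨W, hW⟩ : ∃ W, W = T₀ * Λ := ⟨_, rfl⟩
    obtain ⟨Y, hY⟩ : ∃ Y, Y = T₀ * Λ * (T₀ + Λ) := ⟨_, rfl⟩
    have hTW : T₀ ≤ W := hW ▸ Nat.le_mul_of_pos_right _ (by omega)
    have hΛW : Λ ≤ W := hW ▸ Nat.le_mul_of_pos_left _ (by omega)
    have hWl : W ≤ W * l := Nat.le_mul_of_pos_right _ (by omega)
    have hrT₀ : r.support.card ≤ T₀ := hT.trans hT₀
    have hrD : ∀ e ∈ r.support, e < D := fun e he => hf e (hh.support_subset (hrf ▸ he))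
    have hTD : T * len D ≤ W := hW ▸ Nat.mul_le_mul hT₀ hDΛ
    obtain ⟨N, hNdef⟩ : ∃ N, N = boundsVal 1 T D := ⟨_, rfl⟩
    have hNl := len_small (A := 4 * W) (x := N.2.2)
      (by rw [hNdef, hW]; exact hN.trans hpν) (by rw [hW]; rw [hW] at hWl; omega) hl
    have hrl := len_small (A := W) (hrT₀.trans hTW) (by rw [← hW] at hsmall; omega) hl
    have hsub : ∀ p ∈ ps.take N.2.2, p ∈ ps := fun p hp => List.mem_of_mem_take hp
    have hlen' : (ps.take N.2.2).length = N.2.2 := by rw [List.length_take, hNdef]; omega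
    have hps' : ∀ p ∈ ps.take N.2.2, p.Prime := fun p hp => hps p (hsub p hp)
    have hnd' : (ps.take N.2.2).Nodup := hnd.sublist (List.take_sublist _ _)
    have hN' : (boundsVal 1 T D).2.2 ≤ (ps.take N.2.2).length := by rw [hlen', hNdef]
    have hpν' : (ps.take N.2.2).length ≤ 4 * (T₀ * Λ) := by rw [hlen', hNdef]; omega
    have hpν'' : (ps.take N.2.2).length ≤ 4 * W := by rw [hW]; exact hpν'
    have hV : Λ * β + Y * l ^ 12 + 2 * W * l ^ 6 + 30 * (W * l) ≤ V₂ := by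
      have a1 := absorb hl Y 12 13
      have a2 := absorb hl W 6 13
      have a3 := absorb hl W 1 13
      have a4 : 100 * W ≤ Y := by
        have h1 : W * 100 ≤ W * Λ := Nat.mul_le_mul_left _ (by omega)
        have h2 : W * Λ ≤ W * (T₀ + Λ) := Nat.mul_le_mul_left _ (by omega)
        rw [hY, ← hW]; omega
      have a5 : W * l ^ 13 ≤ Y * l ^ 13 := Nat.mul_le_mul_right _ (by omega)
      rw [pow_one] at a3
      rw [hV₂, ← hY]
      have a6 : 2 * W * l ^ 6 = 2 * (W * l ^ 6) := by ring
      omega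
    obtain ⟨A, hA⟩ : ∃ A, A = 2 * W := ⟨_, rfl⟩
    rw [← hA] at hV
    rw [uiLoop]
    refine Sat.mono_cost (Sat.bind_eq (bounds_sat hl (n := 1) (T := T) (D := D) (A := A)
      (by omega) (by omega) (by rw [one_mul]; omega) (by rw [← hW] at hsmall; omega))
      (Sat.bind_eq (takeN_sat _ _) (Sat.bind_eq (takeN_sat _ _)
      (r' := (Nat.size r.support.card + 1) * V₁)
      (b' := 16 * (W * l) + (Nat.size r.support.card * V₂ + (Λ * β + Y * l ^ 12))) ?_)))
      (by omega) ?_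
    · rw [← hNdef, images_take]
      refine Sat.mono_cost (Sat.bind (firstMax_sat (fun p hp => (hps' p hp).pos) hrl)
        (r' := (Nat.size r.support.card + 1) * V₁)
        (b' := Nat.size r.support.card * V₂ + (Λ * β + Y * l ^ 12)) ?_) (by omega) ?_
      · rintro ⟨p, gp, m⟩ ⟨hm1, hm2⟩
        simp only at hm1 hm2 ⊢
        have hmany : r ≠ 0 → 3 * r.support.card ≤ 4 * m := fun hr0 =>
          firstMax_many le_rfl hD hr0 (by simpa using hrD) hT hps' hnd' hN' hm1
        by_cases hm0 : m = 0
        · rw [if_pos hm0]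
          -- If all images vanish then so does r: otherwise the maximal number of terms would be at
          -- least three quarters of a positive number.
          refine Sat.mono_cost (.ret (hh.isTermList ?_)) (Nat.zero_le _) (Nat.zero_le _)
          rw [← hrf]
          by_contra hr0
          have h1 := hmany hr0
          have : r.support.card ≠ 0 := by rwa [Ne, Polynomial.card_support_eq_zero]
          omega
        · rw [if_neg hm0]
          obtain ⟨hp, rfl, hmp⟩ := hm2 hm0
          have hr0 : r ≠ 0 := by
            rintro rfl
            rw [redMod_zero] at hmp
            exact hm0 (by simpa using hmp)
          have hcpos : 0 < r.support.card := Finset.card_pos.2 (support_nonempty.2 hr0)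
          have hhlen : (h₀ ++ h).length ≤ 2 * T₀ := by
            have := hh.card_add
            rw [List.length_append]; omega
          have hrec := uiStep_sat hs' hP hhlen (fun t ht => by
              rcases List.mem_append.1 ht with h1 | h1
              · exact hh₀' t h1
              · exact (len_mono (hf _ (hh.mem h1).1).le).trans hDΛ) hD hDΛ hk hknd hkQ hkK hne hkD
            hps' hnd' (fun p hp => hpl p (hsub p hp)) (fun p hp => hpB p (hsub p hp)) hpν' hN'
            (r := r) (by rw [hrf, hfg, listPoly_append, sub_sub]) hr0 hrD hT hT₀ hp
            (hmp ▸ hmany hr0) (Q := (IsTermList · f)) (r' := Nat.size r.support.card * V₁)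
            (b' := Nat.size r.support.card * V₂)
            (fun T₂ fs₂ s => uiLoop P h₀ D ks (ps.take N.2.2) fuel T₂ fs₂ (h ++ s))
            (fun s hs hsc => by
              have hc := hs.card_add
              have hle := size_add_one_le (a := (r - listPoly s).support.card) hcpos (by omega)
              refine (ih (T - s.length) (ps.take N.2.2) hps' hnd' (fun p hp => hpl p (hsub p hp))
                (fun p hp => hpB p (hsub p hp)) hpν' (h ++ s) (hh.append (hrf ▸ hs)) (by omega)
                (r := r - listPoly s) ?_ (by omega) (by omega) ?_).mono_cost
                (Nat.mul_le_mul_right _ hle) (Nat.mul_le_mul_right _ hle)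
              · rw [hrf, listPoly_append, sub_sub]
              · exact (boundsVal_mono hD (Nat.sub_le _ _)).2.2.trans hN')
          rw [hNdef] at hrec ⊢
          refine hrec.mono_cost ?_ ?_
          · rw [← hV₁, Nat.succ_mul]; omega
          · rw [← hY]; omega
      · have h1 := Nat.mul_le_mul_right (3 * l + 1) hpν''
        have h2 : 4 * W * (3 * l + 1) = 12 * (W * l) + 4 * W := by ring
        have h3 : 100 * W ≤ W * l := by rw [mul_comm]; exact Nat.mul_le_mul_left _ hl
        have : 0 < W := hW ▸ Nat.mul_pos hT1 (by omega)
        omega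
    · rw [length_images, Nat.succ_mul (Nat.size _)]
      have h1 : ps.length ≤ 4 * W := by rw [hW]; exact hpν
      have h3 : 100 * W ≤ W * l := by rw [mul_comm]; exact Nat.mul_le_mul_left _ hl
      have h4 : l ≤ W * l := Nat.le_mul_of_pos_left _ (hW ▸ Nat.mul_pos hT1 (by omega))
      rw [← hNdef]
      omega

theorem two_pow_length_le_prod {ps : List ℕ} (h : ∀ p ∈ ps, 2 ≤ p) : 2 ^ ps.length ≤ ps.prod :=
  List.pow_card_le_prod ps 2 h

theorem uiPoly_ring_arith {T Λ W Y ρ₁ ρ₂ : ℕ} (hl : 100 ≤ l) (hΛW : Λ ≤ W) (hW : W = T * Λ)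
    (hY1 : Y = T * W + W * Λ) :
    4 * W * (ρ₁ + ρ₂ * (5 * (W * l))) + T * (5 * W * 2) +
        l * (Λ * (ρ₁ + ρ₂ * (10 * (W * l) * (Λ * l))) + 30 * Y) ≤
      (W * ρ₁ + ρ₂ * (Λ * Y) + Y) * l ^ 4 := by
  have e1 : 4 * W * (ρ₁ + ρ₂ * (5 * (W * l))) + T * (5 * W * 2) +
      l * (Λ * (ρ₁ + ρ₂ * (10 * (W * l) * (Λ * l))) + 30 * Y) =
      4 * (W * ρ₁) + l * (Λ * ρ₁) + 20 * (ρ₂ * (W * W) * l) + 10 * (ρ₂ * (W * Λ * Λ) * l ^ 3) +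
      10 * (T * W) + 30 * (Y * l) := by ring
  have e2 : ρ₂ * (Λ * Y) = ρ₂ * (W * W) + ρ₂ * (W * Λ * Λ) := by rw [hY1, hW]; ring
  rw [e1, e2]
  have e3 : (W * ρ₁ + (ρ₂ * (W * W) + ρ₂ * (W * Λ * Λ)) + Y) * l ^ 4 =
    W * ρ₁ * l ^ 4 + ρ₂ * (W * W) * l ^ 4 + ρ₂ * (W * Λ * Λ) * l ^ 4 + Y * l ^ 4 := by ring
  rw [e3]
  have a1 := absorb_zero hl (W * ρ₁) 4
  have a2 := absorb hl (W * ρ₁) 1 4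
  have a3 := absorb hl (ρ₂ * (W * W)) 1 4
  have a4 := absorb hl (ρ₂ * (W * Λ * Λ)) 3 4
  have a5 := absorb hl Y 1 4
  have a6 := absorb_zero hl Y 4
  have a7 : l * (Λ * ρ₁) ≤ W * ρ₁ * l ^ 1 := by
    calc l * (Λ * ρ₁) ≤ l * (W * ρ₁) := by gcongr
      _ = _ := by ring
  rw [pow_one] at a3 a5
  linarith [Nat.zero_le (W * Λ), Nat.zero_le (T * W), Nat.zero_le (W * ρ₁), Nat.zero_le (W * ρ₁ * l),
    Nat.zero_le (ρ₂ * (W * W) * l), Nat.zero_le (ρ₂ * (W * Λ * Λ) * l ^ 3), Nat.zero_le (Y * l)]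

theorem uiPoly_bits_arith {T Λ W Y A N d β : ℕ} (hl : 100 ≤ l) (hlΛ : l ≤ Λ) (hd : d ≤ Λ)
    (hΛW : Λ ≤ W) (hYW : 100 * W ≤ Y) (hA : A = 2 * W) (hN4 : N ≤ 4 * W)
    (hY1 : Y = T * W + W * Λ) :
    A * l ^ 6 + (N * l ^ 10 + ((d + 1) * (2 * Λ * l ^ 3) + (4 * W * (β + 1) + 1 +
      (T * (5 * W * l ^ 11) + 1 + l * (Λ * β + Y * l ^ 13))))) ≤ W * β * l ^ 2 + Y * l ^ 15 := by
  have e1 : (d + 1) * (2 * Λ * l ^ 3) ≤ 4 * (W * Λ * l ^ 3) := by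
    calc _ ≤ (2 * Λ) * (2 * Λ * l ^ 3) := Nat.mul_le_mul_right _ (by omega)
      _ = 4 * (Λ * Λ * l ^ 3) := by ring
      _ ≤ 4 * (W * Λ * l ^ 3) := by gcongr
  have e2 : N * l ^ 10 ≤ 4 * (W * l ^ 10) := by
    calc N * l ^ 10 ≤ 4 * W * l ^ 10 := Nat.mul_le_mul_right _ hN4
      _ = _ := by ring
  have e3 : 4 * W * (β + 1) = 4 * (W * β) + 4 * W := by ring
  have e4 : T * (5 * W * l ^ 11) = 5 * (T * W * l ^ 11) := by ring
  have e5 : l * (Λ * β + Y * l ^ 13) ≤ W * β * l ^ 1 + Y * l ^ 14 := by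
    calc _ ≤ l * (W * β + Y * l ^ 13) := by gcongr
      _ = _ := by ring
  have e6 : A * l ^ 6 = 2 * (W * l ^ 6) := by rw [hA, mul_assoc]
  have b1 : W * l ^ 15 ≤ Y * l ^ 15 := Nat.mul_le_mul_right _ (by omega)
  have b2 : T * W * l ^ 15 ≤ Y * l ^ 15 := Nat.mul_le_mul_right _ (by omega)
  have b3 : W * Λ * l ^ 15 ≤ Y * l ^ 15 := Nat.mul_le_mul_right _ (by omega)
  have a1 := absorb hl (W * Λ) 3 15
  have a2 := absorb hl W 10 15
  have a3 := absorb hl (T * W) 11 15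
  have a4 := absorb hl (W * β) 1 2
  have a5 := absorb_zero hl (W * β) 2
  have a6 := absorb hl Y 14 15
  have a7 := absorb hl W 6 15
  have a8 := absorb_zero hl W 15
  linarith [Nat.zero_le (W * Λ * l ^ 3), Nat.zero_le (W * l ^ 10), Nat.zero_le (T * W * l ^ 11),
    Nat.zero_le (W * β * l), Nat.zero_le (W * β), Nat.zero_le (Y * l ^ 14), Nat.zero_le (W * l ^ 6)]

/-- The charge of a probe is modelled as ρ₁ + ρ₂ q. The initial images need at most 4 T₀ Λ probes of
modulus at most 5 T₀ Λ l, and there are at most l rounds; together this is ρ₂ (T₀² Λ² + T₀ Λ³) up to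
powers of l. -/
theorem uiPoly_sat {T₀ T Λ D ρ₁ ρ₂ β : ℕ} (hs : USize l T₀ Λ) {P : ℕ → Cost R[X]} {g : R[X]}
    (hP : ∀ q > 0, len q ≤ 2 * l → (P q).Sat (· = redMod q g) (ρ₁ + ρ₂ * q) β)
    {h₀ : List (ℕ × R)} (hh₀ : h₀.length ≤ T₀) (hh₀' : ∀ t ∈ h₀, len t.1 ≤ Λ)
    (hD : 2 ≤ D) (hDΛ : len D ≤ Λ) {f : R[X]} (hfg : f = g - listPoly h₀)
    (hf : ∀ e ∈ f.support, e < D) (hT : 1 ≤ T) (hTT : T ≤ T₀) (hf' : f.support.card ≤ T) :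
    (uiPoly P h₀ T D).Sat (IsTermList · f)
      ((T₀ * Λ * ρ₁ + ρ₂ * (Λ * (T₀ * Λ * (T₀ + Λ))) + T₀ * Λ * (T₀ + Λ)) * l ^ 4)
      (T₀ * Λ * β * l ^ 2 + T₀ * Λ * (T₀ + Λ) * l ^ 15) := by
  have hs' := hs
  obtain ⟨hl, hT1, hlΛ, hsmall, hprimes⟩ := hs
  have hmul := mul_lt_two_pow hl
  obtain ⟨W, hW⟩ : ∃ W, W = T₀ * Λ := ⟨_, rfl⟩
  obtain ⟨Y, hY⟩ : ∃ Y, Y = T₀ * Λ * (T₀ + Λ) := ⟨_, rfl⟩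
  have hTW : T₀ ≤ W := hW ▸ Nat.le_mul_of_pos_right _ (by omega)
  have hΛW : Λ ≤ W := hW ▸ Nat.le_mul_of_pos_left _ (by omega)
  have hWl : 100 * W ≤ W * l := by rw [mul_comm]; exact Nat.mul_le_mul_left _ hl
  have hΛl : Λ * l ≤ W * l := Nat.mul_le_mul_right _ hΛW
  have hΛl2 : 100 * Λ ≤ Λ * l := by rw [mul_comm]; exact Nat.mul_le_mul_left _ hl
  have hY1 : Y = T₀ * W + W * Λ := by rw [hY, hW]; ring
  have hYW : 100 * W ≤ Y := by
    have : W * 100 ≤ W * Λ := Nat.mul_le_mul_left _ (by omega)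
    omega
  have hTD : T * len D ≤ W := hW ▸ Nat.mul_le_mul hTT hDΛ
  obtain ⟨N, hNdef⟩ : ∃ N, N = boundsVal 1 T D := ⟨_, rfl⟩
  obtain ⟨s1, s2, s3, s4, s5, s6⟩ := boundsVal_spec (n := 1) le_rfl hT hD
  have hN4 : N.2.2 ≤ 4 * W := by
    have := (boundsVal_le (n := 1) (D := D) le_rfl hT).2.2
    rw [one_mul] at this
    rw [hNdef]; omega
  rw [← hNdef] at s1 s2 s3 s4 s5 s6
  have hsize : Nat.size N.2.2 ≤ Nat.size (4 * (T₀ * Λ)) :=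
    Nat.size_le_size (by rw [← hW]; exact hN4)
  obtain ⟨A, hA⟩ : ∃ A, A = 2 * W := ⟨_, rfl⟩
  rw [uiPoly]
  refine Sat.mono_cost (Sat.bind_eq (bounds_sat hl (n := 1) (T := T) (D := D) (A := A)
    (by omega) (by omega) (by rw [one_mul]; omega) (by rw [← hW] at hsmall; omega))
    (Sat.bind (firstPrimes_sat hl (N := (boundsVal 1 T D).2.2) (by rw [← hNdef]; omega)
      (by rw [← hNdef]; omega))
    (r' := 4 * W * (ρ₁ + ρ₂ * (5 * (W * l))) + T₀ * (5 * W * 2) +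
      l * (Λ * (ρ₁ + ρ₂ * (10 * (W * l) * (Λ * l))) + 30 * Y))
    (b' := (len D + 1) * (2 * Λ * l ^ 3) + (4 * W * (β + 1) + 1 + (T₀ * (5 * W * l ^ 11) + 1 +
      l * (Λ * β + Y * l ^ 13)))) fun ps hps => ?_)) (r := 0 + (0 + _)) ?_ ?_
  · rw [← hNdef] at hps
    have hnd : ps.Nodup := hps.pairwise.imp fun h => h.ne
    have hpB : ∀ p ∈ ps, p ≤ 5 * (W * l) := by
      intro p hp
      have h1 := hps.le N.2.2 p (by rwa [List.take_of_length_le hps.length.le])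
      have h2 : (N.2.2 + 1) * l ≤ (4 * W + 1) * l := Nat.mul_le_mul_right _ (by omega)
      have h3 : (4 * W + 1) * l = 4 * (W * l) + l := by ring
      have h4 : l ≤ W * l := Nat.le_mul_of_pos_left _ (hW ▸ Nat.mul_pos hT1 (by omega))
      omega
    -- The primes at hand are numerous enough for Chinese remaindering: there are at least N₂ of
    -- them, and 2^N₂ ≥ D^T ≥ D.
    have hprod : D ≤ 1 * ps.prod := by
      rw [one_mul]
      calc D ≤ (D ^ 1) ^ T := by rw [pow_one]; exact Nat.le_self_pow (by omega) D
        _ ≤ 2 ^ N.2.1 := s4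
        _ ≤ 2 ^ ps.length := Nat.pow_le_pow_right (by norm_num) (by rw [hps.length]; omega)
        _ ≤ ps.prod := two_pow_length_le_prod fun p hp => (hps.prime p hp).two_le
    refine Sat.mono_cost (Sat.bind (prefixTo_sat hl (D := D) (A := 2 * Λ)
      (by rw [← hW] at hsmall; omega) (by omega) (len D) 1 ps (fun p hp => (hps.prime p hp).two_le)
      hps.len_le (by rw [len_one]; omega) hprod
      (by have := lt_two_pow_len D; omega)) (r' := 4 * W * (ρ₁ + ρ₂ * (5 * (W * l))) +
        T₀ * (5 * W * 2) + l * (Λ * (ρ₁ + ρ₂ * (10 * (W * l) * (Λ * l))) + 30 * Y))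
        fun ks hks => ?_) (by omega) le_rfl
    obtain ⟨⟨j, hj, rfl⟩, hkD⟩ := hks
    rw [one_mul] at hkD
    have hsub : ∀ p ∈ ps.take j, p ∈ ps := fun p hp => List.mem_of_mem_take hp
    have hkQ : ∀ k ∈ ps.take j, k ≤ 2 * (Λ * l) := by
      intro k hk
      have h1 := hps.le j k hk
      have h2 : (j + 1) * l ≤ (Λ + 1) * l := Nat.mul_le_mul_right _ (by omega)
      have h3 : (Λ + 1) * l = Λ * l + l := by ring
      omega
    have hkne : ps.take j ≠ [] := by
      intro h
      rw [h] at hkD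
      simp only [List.prod_nil] at hkD
      omega
    have hfs : (Cost.map P ps).Sat (· = images ps g) (4 * W * (ρ₁ + ρ₂ * (5 * (W * l))))
        (4 * W * (β + 1) + 1) := by
      refine (Sat.map_eq_const (r := ρ₁ + ρ₂ * (5 * (W * l))) (b := β) fun p hp => ?_).mono_cost
        (Nat.mul_le_mul_right _ (by rw [hps.length]; exact hN4))
        (Nat.add_le_add_right (Nat.mul_le_mul_right _ (by rw [hps.length]; exact hN4)) 1)
      have h1 := hps.len_le p hp
      have h2 := Nat.mul_le_mul_left ρ₂ (hpB p hp)
      exact (hP p (hps.prime p hp).pos (by omega)).mono_cost (by omega) le_rfl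
    have hloop := uiLoop_sat hs' hP hh₀ hh₀' hD hDΛ (ks := ps.take j)
      (fun k hk => hps.prime k (hsub k hk)) (hnd.sublist (List.take_sublist _ _)) hkQ
      ((List.length_take_le _ _).trans (by omega)) hkne hkD hfg hf (hf'.trans hTT) T T ps
      hps.prime hnd hps.len_le (by rw [← hW]; exact hpB) (by rw [← hW, hps.length]; exact hN4) []
      (.nil f) hTT (r := f) (by rw [listPoly_nil, sub_zero]) hf' hf'
      (by rw [hps.length, hNdef])
    -- The number of rounds is at most l, so the whole loop costs one more factor l than a round.
    have hsz : Nat.size f.support.card + 1 ≤ l :=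
      len_small (A := W) (x := f.support.card) (by omega) (by rw [← hW] at hsmall; omega) hl
    have hfold := fold_subFromAll_sat hl (S := 5 * W) hps.prime hps.len_le
      (by rw [hps.length]; omega) (by rw [← hW] at hsmall; rw [mul_assoc]; omega) g h₀
      fun t ht => (hh₀' t ht).trans (by omega)
    rw [← hfg] at hfold
    refine Sat.mono_cost (Sat.bind_eq hfs (Sat.bind_eq hfold hloop)) ?_ ?_
    · have h1 := Nat.mul_le_mul_right (5 * W * 2) hh₀
      have h2 := Nat.mul_le_mul_right (Λ * (ρ₁ + ρ₂ * (10 * (W * l) * (Λ * l))) + 30 * Y) hsz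
      rw [← hY, ← hW]
      omega
    · have h1 := Nat.mul_le_mul_right (5 * W * l ^ 11) hh₀
      have h2 := Nat.mul_le_mul_right (Λ * β + Y * l ^ 13) hsz
      rw [← hY]
      omega
  · rw [zero_add, zero_add, ← hY, ← hW]
    exact uiPoly_ring_arith hl hΛW hW hY1
  · rw [← hY, ← hW, ← hNdef]
    exact uiPoly_bits_arith hl hlΛ hDΛ hΛW hYW hA hN4 hY1

end Univariate

end SparseInterp

namespace SparseInterp

open Cost Polynomial

/-! ### Correctness and cost of a probe -/

section Probes

variable {R : Type*} [CommRing R] {n l : ℕ}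

/-- The image of `f` under `xᵢ ↦ x ^ a i`. -/
noncomputable def subst (a : Fin n → ℕ) : MvPolynomial (Fin n) R →+* R[X] :=
  MvPolynomial.eval₂Hom C fun i => X ^ a i

theorem subst_eq_push (a : Fin n → ℕ) (f : MvPolynomial (Fin n) R) :
    subst a f = push f.support (fun m => ∑ i, a i * m i) fun m => f.coeff m := by
  rw [subst, MvPolynomial.coe_eval₂Hom, MvPolynomial.eval₂_eq', push]
  refine Finset.sum_congr rfl fun m _ => ?_
  rw [← C_mul_X_pow_eq_monomial]
  congr 1
  rw [← Finset.prod_pow_eq_pow_sum]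
  exact Finset.prod_congr rfl fun i _ => (pow_mul _ _ _).symm

/-- Substitution and reduction are compatible with the ring operations, so reducing after each
instruction gives the reduced images of all intermediate results. References to missing results
agree too, both defaults being 0. -/
theorem run_redMod {q : ℕ} (hq : 0 < q) (a : Fin n → ℕ) (Γ : SLP R (Fin n)) :
    Γ.run (redMod q) C (fun i => redMod q (X ^ a i)) =
      (Γ.run id MvPolynomial.C MvPolynomial.X).map fun f => redMod q (subst a f) := by
  have hop : ∀ (o : Operand R (Fin n)) (vals : List (MvPolynomial (Fin n) R)),
      o.eval C (fun i => redMod q (X ^ a i)) (vals.map fun f => redMod q (subst a f)) =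
        redMod q (subst a (o.eval MvPolynomial.C MvPolynomial.X vals)) := by
    intro o vals
    cases o with
    | const c => simp [Operand.eval, subst, redMod_C hq]
    | input i => simp [Operand.eval, subst]
    | prev j =>
      simp only [Operand.eval, List.getD_eq_getElem?_getD, List.getElem?_map]
      cases vals[j]? <;> simp [redMod_zero]
  have harith : ∀ (o : ArithOp) (f g : MvPolynomial (Fin n) R),
      redMod q (o.eval (redMod q (subst a f)) (redMod q (subst a g))) =
        redMod q (subst a (o.eval f g)) := by
    intro o f g
    cases o
    · simp only [ArithOp.eval, map_add, redMod_add, redMod_redMod hq]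
    · simp only [ArithOp.eval, map_sub, redMod_sub, redMod_redMod hq]
    · simp only [ArithOp.eval, map_mul, redMod_mul_redMod hq]
  have key : ∀ (Γ : SLP R (Fin n)) (vals : List (MvPolynomial (Fin n) R)),
      Γ.foldl (fun vals g => vals ++ [redMod q (g.op.eval
        (g.lhs.eval C (fun i => redMod q (X ^ a i)) vals)
        (g.rhs.eval C (fun i => redMod q (X ^ a i)) vals))])
        (vals.map fun f => redMod q (subst a f)) =
      (Γ.foldl (fun vals g => vals ++ [id (g.op.eval (g.lhs.eval MvPolynomial.C MvPolynomial.X vals)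
        (g.rhs.eval MvPolynomial.C MvPolynomial.X vals))]) vals).map
          fun f => redMod q (subst a f) := by
    intro Γ
    induction Γ with
    | nil => exact fun _ => rfl
    | cons g Γ ih =>
      intro vals
      rw [List.foldl_cons, List.foldl_cons, ← ih, List.map_append, List.map_singleton, hop, hop,
        harith]
      rfl
  exact key Γ []

theorem probe_val {q : ℕ} (hq : 0 < q) (a : Fin n → ℕ) (Γ : SLP R (Fin n)) :
    (probe Γ a q).val = redMod q (subst a Γ.poly) := by
  simp only [probe, SLP.poly, run_redMod hq]
  generalize Γ.run id MvPolynomial.C MvPolynomial.X = vals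
  rw [List.getLastD_eq_getLast?, List.getLastD_eq_getLast?, List.getLast?_map]
  cases vals.getLast? <;> simp [redMod_zero]

/-- The constant of the multiplication bound is taken to be l itself, which is why l has to be at
least 3^13. The exponent is 40 = 2 + 2 · 19. -/
theorem cyclicMulCost_le_pow (hl : 1594323 ≤ l) {q : ℕ} (hq : 0 < q) (hql : len q ≤ 2 * l) :
    cyclicMulCost q ≤ q * l ^ 40 := by
  have h1 : Nat.size q + 3 ≤ l ^ 2 := by
    have : Nat.size q + 1 ≤ 2 * l := hql
    have : 100 * l ≤ l * l := Nat.mul_le_mul_right _ (by omega)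
    rw [pow_two]; omega
  have h2 := CyclicMul.cyclicMulCost_le hl hq (W := q * (l ^ 2) ^ 19)
    (Nat.mul_le_mul_left _ (Nat.pow_le_pow_left h1 _))
  calc cyclicMulCost q ≤ 101 * l * (q * (l ^ 2) ^ 19) := h2
    _ ≤ l * l * (q * (l ^ 2) ^ 19) := by gcongr; omega
    _ = q * l ^ 40 := by ring

theorem probe_sat (hl : 1594323 ≤ l) {q T : ℕ} (hq : 0 < q) (hql : len q ≤ 2 * l) (a : Fin n → ℕ)
    {Γ : SLP R (Fin n)} (hΓ : Γ ≠ []) (hT : Γ.poly.support.card ≤ T) :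
    (probe Γ a q).Sat (· = redMod q (subst a Γ.poly)) (n + Γ.length * l ^ 41 * q)
      (T * (2 * l + 1) + 2 * l + 1) := by
  have hv := probe_val hq a Γ
  refine ⟨hv, ?_, ?_⟩
  · have hL : 1 ≤ Γ.length := List.length_pos_iff.2 hΓ
    have h1 : (Γ.map fun s => s.op.cyclicCost q).sum ≤ Γ.length * (q * l ^ 40) := by
      refine sum_map_le fun s _ => ?_
      have hc := cyclicMulCost_le_pow hl hq hql
      have : q ≤ q * l ^ 40 := le_mul_pow (by omega) q 40
      cases s.op <;> simp only [ArithOp.cyclicCost] <;> assumption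
    have h2 : Γ.length * l ^ 41 * q = (Γ.length * q) * l ^ 41 := by ring
    have h3 : Γ.length * (q * l ^ 40) = (Γ.length * q) * l ^ 40 := by ring
    have h4 := absorb (l := l) (by omega) (Γ.length * q) 40 41
    have h5 : q ≤ Γ.length * q := Nat.le_mul_of_pos_left _ hL
    have h6 : Γ.length * q ≤ Γ.length * q * l ^ 40 := le_mul_pow (by omega) _ 40
    change n + (Γ.map fun s => s.op.cyclicCost q).sum + q ≤ _
    omega
  · have h1 : (redMod q (subst a Γ.poly)).support.card ≤ T := by
      rw [subst_eq_push]
      exact (card_support_redMod_le hq _).trans ((card_support_push_le _ _ _).trans hT)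
    have h2 := termBits_le (g := redMod q (subst a Γ.poly)) (A := 2 * l) fun e he =>
      (len_mono (lt_of_mem_support_redMod hq he).le).trans hql
    have h3 := Nat.mul_le_mul_right (2 * l + 1) h1
    have h4 : (probe Γ a q).bits = len q + termBits (probe Γ a q).val := rfl
    rw [h4, hv]
    omega

end Probes

/-! ### The Kronecker image and its D-adic digits -/

section Kronecker

variable {R : Type*} [CommRing R] {n : ℕ}

/-- The `D`-adic digits of `e`. -/
def digs (D n e : ℕ) : List ℕ := (digitsVal D n e).1

/-- The sum of the products of corresponding entries. -/
def dotVal (as bs : List ℕ) : ℕ := ((as.zip bs).map fun x => x.1 * x.2).sum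

theorem dotVal_cons (a b : ℕ) (as bs : List ℕ) :
    dotVal (a :: as) (b :: bs) = a * b + dotVal as bs := by simp [dotVal]

theorem dotVal_nil (bs : List ℕ) : dotVal [] bs = 0 := by simp [dotVal]

theorem dotVal_ofFn (m a : Fin n → ℕ) :
    dotVal (List.ofFn m) (List.ofFn a) = ∑ i, a i * m i := by
  induction n with
  | zero => simp [dotVal]
  | succ n ih =>
    rw [List.ofFn_succ, List.ofFn_succ, dotVal_cons, ih, Fin.sum_univ_succ, mul_comm]

theorem ofDigits_ofFn (D : ℕ) (m : Fin n → ℕ) :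
    Nat.ofDigits D (List.ofFn m) = ∑ i, D ^ i.val * m i := by
  induction n with
  | zero => simp
  | succ n ih =>
    rw [List.ofFn_succ, Nat.ofDigits_cons, ih, Fin.sum_univ_succ, Finset.mul_sum]
    simp [pow_succ, mul_comm, mul_left_comm]

theorem digs_ofDigits {D : ℕ} (es : List ℕ) (hes : ∀ e ∈ es, e < D) :
    digs D es.length (Nat.ofDigits D es) = es := by
  rw [digs, digitsVal_ofDigits es hes]

theorem digs_ofFn {D : ℕ} {m : Fin n → ℕ} (h : ∀ i, m i < D) :
    digs D n (∑ i, D ^ i.val * m i) = List.ofFn m := by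
  have := digs_ofDigits (D := D) (List.ofFn m) (by
    intro e he
    obtain ⟨i, rfl⟩ := List.mem_ofFn.1 he
    exact h i)
  rwa [List.length_ofFn, ofDigits_ofFn] at this

/-- The Kronecker image of `f`. -/
noncomputable def kron (D : ℕ) (f : MvPolynomial (Fin n) R) : R[X] :=
  subst (fun i => D ^ i.val) f

variable {D : ℕ} {f : MvPolynomial (Fin n) R}

theorem kron_injOn (hf : ∀ m ∈ f.support, ∀ i, m i < D) {m m' : Fin n →₀ ℕ} (hm : m ∈ f.support)
    (hm' : m' ∈ f.support) (h : ∑ i : Fin n, D ^ i.val * m i = ∑ i : Fin n, D ^ i.val * m' i) :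
    m = m' := by
  have h1 := digs_ofFn (hf m hm)
  rw [h, digs_ofFn (hf m' hm')] at h1
  exact DFunLike.coe_injective (List.ofFn_injective h1).symm

theorem coeff_kron (hf : ∀ m ∈ f.support, ∀ i, m i < D) {m : Fin n →₀ ℕ} (hm : m ∈ f.support) :
    (kron D f).coeff (∑ i : Fin n, D ^ i.val * m i) = f.coeff m := by
  rw [kron, subst_eq_push]
  exact coeff_push_of_unique (u := fun m : Fin n →₀ ℕ => ∑ i : Fin n, D ^ i.val * m i)
    (fun m => f.coeff m) hm fun m' hm' h => kron_injOn hf hm' hm h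

theorem support_kron (hf : ∀ m ∈ f.support, ∀ i, m i < D) :
    (kron D f).support = f.support.image fun m => ∑ i : Fin n, D ^ i.val * m i := by
  refine Finset.Subset.antisymm ?_ ?_
  · rw [kron, subst_eq_push]
    exact support_push_subset _ _ _
  · intro e he
    obtain ⟨m, hm, rfl⟩ := Finset.mem_image.1 he
    rw [mem_support_iff, coeff_kron hf hm]
    exact MvPolynomial.mem_support_iff.1 hm

theorem card_support_kron_le : (kron D f).support.card ≤ f.support.card := by
  rw [kron, subst_eq_push]
  exact card_support_push_le _ _ _

/-- All substitutions can be read off from the Kronecker image. -/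
theorem subst_eq_push_kron (hf : ∀ m ∈ f.support, ∀ i, m i < D) (a : Fin n → ℕ) :
    subst a f = push (kron D f).support (fun e => dotVal (digs D n e) (List.ofFn a))
      (kron D f).coeff := by
  rw [subst_eq_push, push, push, support_kron hf,
    Finset.sum_image fun m hm m' hm' h => kron_injOn hf hm hm' h]
  refine Finset.sum_congr rfl fun m hm => ?_
  rw [digs_ofFn (hf m hm), dotVal_ofFn, coeff_kron hf hm]

theorem listPoly_map {es : List ℕ} (hn : es.Nodup) (U : ℕ → ℕ) (c : ℕ → R) :
    listPoly (es.map fun e => (U e, c e)) = push es.toFinset U c := by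
  rw [listPoly, List.map_map, push, List.sum_toFinset _ hn]
  rfl

/-- The map `U` may identify exponents; still, subtracting the images of found terms yields the
image of the remainder, because both sides are sums over the original exponents. -/
theorem push_sub_listPoly (F : R[X]) {es : List ℕ} (hn : es.Nodup) (hs : ∀ e ∈ es, e ∈ F.support)
    (U : ℕ → ℕ) :
    push F.support U F.coeff - listPoly (es.map fun e => (U e, F.coeff e)) =
      push (F - listPoly (es.map fun e => (e, F.coeff e))).support U
        (F - listPoly (es.map fun e => (e, F.coeff e))).coeff := by
  rw [listPoly_map hn, support_sub_listPoly F hn, push, push, push,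
    ← Finset.sum_sdiff (show es.toFinset ⊆ F.support from fun e he => hs e (List.mem_toFinset.1 he)),
    add_sub_cancel_right]
  refine Finset.sum_congr rfl fun e he => ?_
  rw [Finset.mem_sdiff, List.mem_toFinset] at he
  rw [coeff_sub_listPoly F hn, if_neg he.2]

theorem isSparseForm_of_kron (hf : ∀ m ∈ f.support, ∀ i, m i < D) {L : List (ℕ × R)}
    (hL : IsTermList L (kron D f)) : IsSparseForm (L.map fun t => (digs D n t.1, t.2)) f := by
  obtain ⟨es, hn, hm, rfl⟩ := hL
  have hperm : es.Perm (f.support.toList.map fun m => ∑ i : Fin n, D ^ i.val * m i) := by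
    refine (List.perm_ext_iff_of_nodup hn ?_).2 fun e => ?_
    · refine List.Nodup.map_on ?_ f.support.nodup_toList
      intro m hm m' hm' h
      exact kron_injOn hf (Finset.mem_toList.1 hm) (Finset.mem_toList.1 hm') h
    · rw [hm, support_kron hf]
      simp
  rw [IsSparseForm, List.map_map]
  refine (hperm.map _).trans ?_
  rw [List.map_map]
  refine List.Perm.of_eq (List.map_congr_left fun m hm => ?_)
  have hm := Finset.mem_toList.1 hm
  simp only [Function.comp]
  rw [digs_ofFn (hf m hm), coeff_kron hf hm]

end Kronecker

end SparseInterp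

namespace SparseInterp

open Cost Polynomial

/-! ### Exponents after the substitutions modulo p -/

section Weights

variable {D p n : ℕ}

/-- The exponents `D ^ i mod p` of the substitution. -/
def weights (D p n : ℕ) : List ℕ := (List.range n).map fun i => D ^ i % p

/-- The exponents of the modified substitution for the variable with index `k`. -/
def weightsAt (D p k n : ℕ) : List ℕ :=
  (List.range n).map fun i => if i = k then D ^ i % p + p else D ^ i % p

theorem ofFn_eq_map_range {α : Type*} (g : ℕ → α) :
    (List.ofFn fun i : Fin n => g i.val) = (List.range n).map g := by
  refine List.ext_getElem (by simp) fun i h1 h2 => by simp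

theorem dotVal_le {as bs : List ℕ} {B : ℕ} (h : ∀ b ∈ bs, b ≤ B) : dotVal as bs ≤ as.sum * B := by
  induction as generalizing bs with
  | nil => simp [dotVal_nil]
  | cons a as ih =>
    cases bs with
    | nil => simp [dotVal]
    | cons b bs =>
      rw [dotVal_cons, List.sum_cons, add_mul]
      exact Nat.add_le_add (Nat.mul_le_mul_left _ (h b (by simp)))
        (ih fun b' hb => h b' (by simp [hb]))

theorem dotVal_append {as as' bs bs' : List ℕ} (h : as.length = bs.length) :
    dotVal (as ++ as') (bs ++ bs') = dotVal as bs + dotVal as' bs' := by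
  rw [dotVal, List.zip_append h, List.map_append, List.sum_append]
  rfl

theorem dotVal_pow_mod (es : List ℕ) (κ m : ℕ) (h : es.length ≤ m) :
    dotVal es ((List.range' κ m).map fun i => D ^ i % p) ≡ D ^ κ * Nat.ofDigits D es [MOD p] := by
  induction es generalizing κ m with
  | nil => simp [dotVal_nil]; rfl
  | cons e es ih =>
    obtain ⟨m, rfl⟩ : ∃ m', m = m' + 1 := ⟨m - 1, by simp at h; omega⟩
    rw [List.range'_succ, List.map_cons, dotVal_cons, Nat.ofDigits_cons]
    have h1 := ih (κ + 1) m (by simpa using h)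
    have h2 : e * (D ^ κ % p) ≡ e * D ^ κ [MOD p] := (Nat.mod_modEq _ _).mul_left _
    have h3 : D ^ κ * (e + D * Nat.ofDigits D es) =
        e * D ^ κ + D ^ (κ + 1) * Nat.ofDigits D es := by ring
    rw [h3]
    exact h2.add h1

theorem dotVal_pow (es : List ℕ) (κ m : ℕ) (h : es.length ≤ m) :
    dotVal es ((List.range' κ m).map fun i => D ^ i) = D ^ κ * Nat.ofDigits D es := by
  induction es generalizing κ m with
  | nil => simp [dotVal_nil]
  | cons e es ih =>
    obtain ⟨m, rfl⟩ : ∃ m', m = m' + 1 := ⟨m - 1, by simp at h; omega⟩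
    rw [List.range'_succ, List.map_cons, dotVal_cons, Nat.ofDigits_cons,
      ih (κ + 1) m (by simpa using h)]
    ring

theorem drop_weights (κ : ℕ) :
    (weights D p n).drop κ = (List.range' κ (n - κ)).map fun i => D ^ i % p := by
  rw [weights, List.range_eq_range', ← List.map_drop, List.drop_range']
  simp

/-- Powers D^i below p are not changed by reduction modulo p. Hence the first κ digits enter the
exponent in plain D-adic form and can be read off directly. -/
theorem take_weights {κ : ℕ} (hκn : κ ≤ n) (hκ : ∀ i < κ, D ^ i < p) :
    (weights D p n).take κ = (List.range' 0 κ).map fun i => D ^ i := by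
  rw [weights, ← List.map_take, List.take_range, min_eq_left hκn, List.range_eq_range']
  refine List.map_congr_left fun i hi => Nat.mod_eq_of_lt (hκ i ?_)
  simp at hi
  omega

/-- Raising one weight by p raises the exponent by p times the corresponding digit, so the digit is
a difference of exponents divided by p, and residues modulo p are unchanged. -/
theorem dotVal_weightsAt (ds : List ℕ) {k : ℕ} (hlen : ds.length = n) :
    dotVal ds (weightsAt D p k n) = dotVal ds (weights D p n) + p * ds.getD k 0 := by
  have key : ∀ (ds : List ℕ) (s : ℕ), dotVal ds ((List.range' s ds.length).map
      fun i => if i = s + k then D ^ i % p + p else D ^ i % p) =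
      dotVal ds ((List.range' s ds.length).map fun i => D ^ i % p) + p * ds.getD k 0 := by
    clear hlen
    induction k with
    | zero =>
      intro ds s
      cases ds with
      | nil => simp [dotVal_nil]
      | cons d ds =>
        rw [List.length_cons, List.range'_succ, List.map_cons, List.map_cons, dotVal_cons,
          dotVal_cons]
        have : (List.range' (s + 1) ds.length).map
            (fun i => if i = s + 0 then D ^ i % p + p else D ^ i % p) =
            (List.range' (s + 1) ds.length).map fun i => D ^ i % p := by
          refine List.map_congr_left fun i hi => if_neg ?_
          rw [List.mem_range'_1] at hi
          omega
        rw [this]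
        simp only [add_zero, if_true, List.getD_cons_zero]
        ring
    | succ k ih =>
      intro ds s
      cases ds with
      | nil => simp [dotVal_nil]
      | cons d ds =>
        rw [List.length_cons, List.range'_succ, List.map_cons, List.map_cons, dotVal_cons,
          dotVal_cons, List.getD_cons_succ, if_neg (by omega), add_assoc, ← ih ds (s + 1)]
        simp only [add_assoc, add_comm 1 k]
  have := key ds 0
  rw [hlen, zero_add, ← List.range_eq_range'] at this
  exact this

theorem length_digs (hD : 0 < D) (e : ℕ) : (digs D n e).length = n := (digitsVal_spec hD n e).1

theorem digs_lt (hD : 0 < D) (e : ℕ) : ∀ d ∈ digs D n e, d < D := (digitsVal_spec hD n e).2.1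

theorem ofDigits_digs (hD : 0 < D) {e : ℕ} (he : e < D ^ n) : Nat.ofDigits D (digs D n e) = e := by
  obtain ⟨h1, h2, h3⟩ := digitsVal_spec hD n e
  have : (digitsVal D n e).2 = 0 := by
    by_contra h
    have := Nat.le_mul_of_pos_right (D ^ n) (Nat.pos_of_ne_zero h)
    omega
  rw [this, mul_zero, add_zero] at h3
  exact h3

/-- The weights are congruent to the powers D^i, so the substitution preserves Kronecker exponents
modulo p. This links the classes of F to those of the image modulo x^p - 1. -/
theorem dotVal_weights_mod (hD : 0 < D) {e : ℕ} (he : e < D ^ n) :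
    dotVal (digs D n e) (weights D p n) % p = e % p := by
  have h := dotVal_pow_mod (D := D) (p := p) (digs D n e) 0 n (length_digs hD e).le
  rw [ofDigits_digs hD he, pow_zero, one_mul, ← List.range_eq_range'] at h
  exact h

end Weights

/-! ### Candidates in several variables -/

section Candidates

variable {R : Type*} [CommRing R] {l n : ℕ}

theorem forall₂_trans {α β γ : Type*} {P : α → β → Prop} {Q : β → γ → Prop} {S : α → γ → Prop}
    {L : List α} {L' : List β} {L'' : List γ} (h : List.Forall₂ P L L')
    (h' : List.Forall₂ Q L' L'') (hS : ∀ a ∈ L, ∀ b c, P a b → Q b c → S a c) :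
    List.Forall₂ S L L'' := by
  induction h generalizing L'' with
  | nil => cases h'; exact .nil
  | cons h1 _ ih =>
    cases h' with
    | cons h2 h3 =>
      exact .cons (hS _ (by simp) _ _ h1 h2) (ih h3 fun a ha => hS a (by simp [ha]))

theorem lone_class_push {r : R[X]} {p e : ℕ} {U : ℕ → ℕ} {F : List (ℕ × R)}
    (hU : ∀ x ∈ r.support, U x % p = x % p) (hF : IsTermList F (push r.support U r.coeff))
    (he : e ∈ loneSet r p) :
    (F.filter fun t => t.1 % p = e % p) = [(U e, r.coeff e)] := by
  rw [mem_loneSet] at he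
  have h := push_class (R := R) (S := r.support) (u := U) (c := r.coeff) (p := p) he.1
    (mem_support_iff.1 he.1) fun m hm h => he.2 m hm (by rwa [hU m hm, hU e he.1] at h)
  have h2 := hF.class_eq h.2.1 h.2.2
  rw [hU e he.1] at h2
  rw [h2, h.1]

/-- Size conditions for one round of the multivariate algorithm. -/
structure MSize (l n T Λ D p : ℕ) : Prop where
  hl : 100 ≤ l
  hD : 2 ≤ D
  hn : 1 ≤ n
  hT : 1 ≤ T
  hp : 0 < p
  hpl : len p ≤ l
  hnl : len n ≤ l
  hΛ : len D + 3 * l ≤ Λ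
  small : 8 * Λ < 2 ^ l

theorem mTerms_cost_arith {T Λ : ℕ} (hl : 100 ≤ l) (hn : 1 ≤ n) (hT : 1 ≤ T) (hΛ : 3 * l ≤ Λ) :
    T * (2 * Λ * l ^ 3) + 1 + (n * (T * (2 * Λ * l ^ 3) + 2) + 1 + (T * (l + 1) + 1 +
      (T * (n * (Λ * l ^ 4) + 1) + 1))) ≤ T * n * Λ * l ^ 5 := by
  have e1 : T * (2 * Λ * l ^ 3) ≤ 2 * (T * n * Λ * l ^ 3) := by
    calc T * (2 * Λ * l ^ 3) = 2 * (T * 1 * Λ * l ^ 3) := by ring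
      _ ≤ _ := by gcongr
  have e2 : n * (T * (2 * Λ * l ^ 3) + 2) = 2 * (T * n * Λ * l ^ 3) + 2 * n := by ring
  have e3 : T * (n * (Λ * l ^ 4) + 1) = T * n * Λ * l ^ 4 + T := by ring
  have h1 : n ≤ T * n := Nat.le_mul_of_pos_left _ hT
  have h2 : T * n * 1 ≤ T * n * Λ := Nat.mul_le_mul_left _ (by omega)
  have h3 : T ≤ T * n := Nat.le_mul_of_pos_right _ hn
  have h4 : T * (l + 1) ≤ T * n * Λ := Nat.mul_le_mul h3 (by omega)
  have a1 := absorb hl (T * n * Λ) 3 5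
  have a2 := absorb hl (T * n * Λ) 4 5
  have a3 := absorb_zero hl (T * n * Λ) 5
  omega

/-- For a lone exponent e the class in F holds the single exponent u, and that in Gₖ the exponent u
+ p eₖ, which gives the digits from index κ on. Subtracting their contribution leaves a number whose
κ digits are the low ones. Distinctness comes for free: the Kronecker exponent of a candidate is
congruent modulo p to its class, and the classes are distinct. -/
theorem mTerms_sat {T Λ D p κ : ℕ} (hs : MSize l n T Λ D p) {r : R[X]}
    (hr : ∀ e ∈ r.support, e < D ^ n) (hdeg : ∀ e ∈ r.support, (digs D n e).sum < D)
    (hT : r.support.card ≤ T) (hκn : κ ≤ n) (hκ : ∀ i < κ, D ^ i < p)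
    {F : List (ℕ × R)} {Fs : List (List (ℕ × R))}
    (hF : IsTermList F (push r.support (fun e => dotVal (digs D n e) (weights D p n)) r.coeff))
    (hFs : List.Forall₂ (fun k F => IsTermList F
      (push r.support (fun e => dotVal (digs D n e) (weightsAt D p k n)) r.coeff))
      (List.range' κ (n - κ)) Fs) :
    (mTerms (redMod p r) F Fs p D κ (weights D p n)).Sat
      (fun M => (∀ t ∈ M, t.1.length = n ∧ ∀ d ∈ t.1, d < D) ∧
        (∀ e ∈ loneSet r p, (digs D n e, r.coeff e) ∈ M) ∧
        (M.map fun t => Nat.ofDigits D t.1).Nodup ∧ M.length ≤ T)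
      (2 * (n * T)) (T * n * Λ * l ^ 5) := by
  obtain ⟨hl, hD, hn, hT1, hp, hpl, hnl, hΛ, hsmall⟩ := hs
  have hD0 : 0 < D := by omega
  have lD := one_le_len D
  -- Here the total degree matters: the digits of e sum to less than D and each weight is at most p.
  -- This justifies the degree bound D p.
  have hUlt : ∀ e ∈ r.support, dotVal (digs D n e) (weights D p n) < D * p := by
    intro e he
    refine (dotVal_le (B := p) fun w hw => ?_).trans_lt
      (Nat.mul_lt_mul_of_pos_right (hdeg e he) hp)
    obtain ⟨i, -, rfl⟩ := List.mem_map.1 hw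
    exact (Nat.mod_lt _ hp).le
  have hU : ∀ e ∈ r.support, dotVal (digs D n e) (weights D p n) % p = e % p := fun e he =>
    dotVal_weights_mod hD0 (hr e he)
  have hUk : ∀ k e, dotVal (digs D n e) (weightsAt D p k n) =
      dotVal (digs D n e) (weights D p n) + p * (digs D n e).getD k 0 := fun k e =>
    dotVal_weightsAt _ (length_digs hD0 e)
  have hdig : ∀ e k, k < n → (digs D n e).getD k 0 < D := by
    intro e k hk
    rw [List.getD_eq_getElem _ _ (by rwa [length_digs hD0])]
    exact digs_lt hD0 e _ (List.getElem_mem _)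
  have hFlen : ∀ t ∈ F, len t.1 ≤ Λ := by
    intro t ht
    obtain ⟨e, he, hte⟩ := Finset.mem_image.1 (support_push_subset _ _ _ (hF.mem ht).1)
    have h1 := len_mono (hUlt e he).le
    have h2 := len_mul D p
    rw [← hte]
    omega
  have hFslen : ∀ F ∈ Fs, F.length ≤ T ∧ ∀ t ∈ F, len t.1 ≤ Λ := by
    intro F' hF'
    obtain ⟨k, hk, hFk⟩ := forall₂_right hFs hF'
    have hkn : k < n := by rw [List.mem_range'_1] at hk; omega
    refine ⟨hFk.length.trans_le ((card_support_push_le _ _ _).trans hT), fun t ht => ?_⟩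
    obtain ⟨e, he, hte⟩ := Finset.mem_image.1 (support_push_subset _ _ _ (hFk.mem ht).1)
    rw [hUk k e] at hte
    have h0 : p * (digs D n e).getD k 0 ≤ p * D := Nat.mul_le_mul_left _ (hdig e k hkn).le
    have h1 : t.1 ≤ 2 * (D * p) := by
      have := hUlt e he
      rw [mul_comm p D] at h0
      omega
    have h2 := len_mul D p
    have h3 := len_two_mul (D * p)
    have h4 := len_mono h1
    omega
  have e3 : ∀ e ∈ (redMod p r).support, len e ≤ l := fun e he =>
    (len_mono (lt_of_mem_support_redMod hp he).le).trans hpl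
  have hcard : (redMod p r).support.card ≤ T := (card_support_redMod_le hp r).trans hT
  rw [mTerms]
  refine Sat.mono_cost (Sat.bind_eq ((classes_sat (A := 2 * Λ) hl (by omega) F fun t ht => by
      have := hFlen t ht; omega).mono_cost le_rfl (b' := T * (2 * Λ * l ^ 3) + 1) ?_)
    (Sat.bind_eq ((Sat.map_eq_const (g := fun F d => F.filter fun t => t.1 % p = d)
      (r := 0) (b := T * (2 * Λ * l ^ 3) + 1) fun F' hF' => ?_).mono_cost le_rfl
        (b' := n * (T * (2 * Λ * l ^ 3) + 2) + 1) ?_)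
    (Sat.bind (termList_sat e3) (r' := T * (1 + n)) (b' := T * (n * (Λ * l ^ 4) + 1) + 1)
      fun ts hts => ?_))) ?_ ?_
  · have := hF.length.trans_le ((card_support_push_le _ _ _).trans hT)
    exact Nat.add_le_add_right (Nat.mul_le_mul_right _ this) 1
  · obtain ⟨h1, h2⟩ := hFslen F' hF'
    refine (classes_sat (A := 2 * Λ) hl (by omega) F' fun t ht => by
      have := h2 t ht; omega).mono_cost le_rfl ?_
    exact Nat.add_le_add_right (Nat.mul_le_mul_right _ h1) 1
  · have : Fs.length ≤ n := by rw [← hFs.length_eq, List.length_range']; omega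
    exact Nat.add_le_add_right (Nat.mul_le_mul_right _ this) 1
  · have htlen : ts.length ≤ T := hts.length.trans_le hcard
    have hFslen' : Fs.length = n - κ := by rw [← hFs.length_eq, List.length_range']
    refine ((Sat.fold_const (r := 1 + n) (b := n * (Λ * l ^ 4))
      (fun (pre : List (ℕ × R)) (S : List (List ℕ × R)) =>
        (∀ t ∈ S, t.1.length = n ∧ ∀ d ∈ t.1, d < D) ∧
        (∀ e ∈ loneSet r p, (e % p, r.coeff e) ∈ pre → (digs D n e, r.coeff e) ∈ S) ∧
        (S.map fun t => Nat.ofDigits D t.1 % p).Sublist (pre.map Prod.fst)) ?_ ?_).mono_val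
        ?_).mono_cost (Nat.mul_le_mul_right _ htlen)
        (Nat.add_le_add_right (Nat.mul_le_mul_right _ htlen) 1)
    · simp
    · rintro pre t post he S ⟨hS1, hS2, hS3⟩
      have htm : t ∈ ts := by simp [he]
      have htd := e3 _ (hts.mem htm).1
      -- what happens if the class of `t` yields no candidate
      have hskip : (∀ e ∈ loneSet r p, t ≠ (e % p, r.coeff e)) →
          (∀ t ∈ S, t.1.length = n ∧ ∀ d ∈ t.1, d < D) ∧
          (∀ e ∈ loneSet r p, (e % p, r.coeff e) ∈ pre ++ [t] → (digs D n e, r.coeff e) ∈ S) ∧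
          (S.map fun t => Nat.ofDigits D t.1 % p).Sublist ((pre ++ [t]).map Prod.fst) := by
        intro hno
        refine ⟨hS1, fun e he hmem => ?_, hS3.trans ?_⟩
        · rcases List.mem_append.1 hmem with h | h
          · exact hS2 e he h
          · exact absurd (List.mem_singleton.1 h).symm (hno e he)
        · rw [List.map_append]; exact List.sublist_append_left _ _
      refine Sat.mono_cost (Sat.bind (single_sat _ _ _) (r' := n)
        (b' := n * (Λ * l ^ 3 + 2) + 1 + (n * (4 * (Λ * l ^ 3)) + 6 * Λ + 2 * (n * Λ) + 2))
        fun o ho => ?_) le_rfl ?_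
      · cases o with
        | none =>
          refine Sat.mono_cost (.ret (hskip fun e he hte => ?_)) (Nat.zero_le _) (Nat.zero_le _)
          have := ho.2 _ (by rw [hte]; exact lone_class_push hU hF he)
          simp at this
        | some u =>
          have hB := ho.1 u rfl
          have hu : (u, t.2) ∈ F.filter fun t' => t'.1 % p = t.1 := by
            rw [hB]; simp
          obtain ⟨huF, hup⟩ := List.mem_filter.1 hu
          have hup : u % p = t.1 := by simpa using hup
          have hul : len u ≤ Λ := hFlen _ huF
          have hue : ∀ e ∈ loneSet r p, t = (e % p, r.coeff e) →
              u = dotVal (digs D n e) (weights D p n) := by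
            intro e he hte
            exact Option.some.inj (ho.2 _ (by rw [hte]; exact lone_class_push hU hF he))
          refine Sat.mono_cost (Sat.bind (Sat.mapOption (r := 1) (b := Λ * l ^ 3)
            (P := fun (B : ℕ → List (ℕ × R)) o => (∀ x, o = some x → x < D) ∧
              ∀ e ∈ loneSet r p, t = (e % p, r.coeff e) → ∀ k < n, ∀ F', IsTermList F'
                (push r.support (fun e => dotVal (digs D n e) (weightsAt D p k n)) r.coeff) →
                (B = fun d => F'.filter fun t => t.1 % p = d) → o = some ((digs D n e).getD k 0))
              fun B hB' => ?_) (r' := 0)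
            (b' := n * (4 * (Λ * l ^ 3)) + 6 * Λ + 2 * (n * Λ) + 2) fun o ho' => ?_)
            ?_ ?_
          · obtain ⟨F', hF', rfl⟩ := List.mem_map.1 hB'
            have hlone : ∀ e ∈ loneSet r p, t = (e % p, r.coeff e) → ∀ k < n, ∀ F'' : List (ℕ × R),
                IsTermList F''
                (push r.support (fun e => dotVal (digs D n e) (weightsAt D p k n)) r.coeff) →
                ((fun d => F'.filter fun t => t.1 % p = d) =
                  fun d => F''.filter fun t => t.1 % p = d) →
                (F'.filter fun t' => t'.1 % p = t.1) = [(u + p * (digs D n e).getD k 0, t.2)] := by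
              intro e he hte k hk F'' hF'' hBB
              have h1 := congrFun hBB t.1
              rw [h1, hue e he hte, ← hUk k e]
              rw [hte]
              refine lone_class_push (fun x hx => ?_) hF'' he
              rw [hUk k x, Nat.add_mul_mod_self_left, hU x hx]
            refine Sat.mono_cost (Sat.bind (single_sat _ _ _) (r' := 0)
              (b' := 6 * Λ + 2 * (2 * Λ * l ^ 2)) fun o ho'' => ?_) le_rfl ?_
            · cases o with
              | none =>
                refine Sat.mono_cost (.ret ⟨by simp, fun e he hte k hk F'' hF'' hBB => ?_⟩) le_rfl
                  (Nat.zero_le _)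
                have := ho''.2 _ (hlone e he hte k hk F'' hF'' hBB)
                simp at this
              | some b =>
                have hb := ho''.1 b rfl
                have hbF : (b, t.2) ∈ F'.filter fun t' => t'.1 % p = t.1 := by
                  rw [hb]; simp
                have hbl : len b ≤ Λ := (hFslen F' hF').2 _ (List.mem_filter.1 hbF).1
                have h5 := len_sub_le b u
                have h6 := len_div_le (b - u) p
                refine Sat.mono_cost (Sat.bind_eq (leN_sat _ _) (Sat.bind_eq (subN_sat _ _)
                  (Sat.bind_eq (modN_sat (A := 2 * Λ) (l := l) (by omega) (by omega))
                  (Sat.bind_eq (divN_sat (A := 2 * Λ) (l := l) (by omega) (by omega))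
                  (Sat.bind_eq (leN_sat _ _) (r' := 0) (b' := 0) ?_))))) (by omega) (by omega)
                split_ifs with hc
                · refine .ret ⟨?_, ?_⟩
                  · rintro x hx
                    rw [← Option.some.inj hx]
                    have := hc.2.2
                    simpa using this
                  · intro e he hte k hk F'' hF'' hBB
                    have := Option.some.inj (ho''.2 _ (hlone e he hte k hk F'' hF'' hBB))
                    rw [this, Nat.add_sub_cancel_left, Nat.mul_div_cancel_left _ hp]
                · refine .ret ⟨by simp, ?_⟩
                  intro e he hte k hk F'' hF'' hBB
                  have := Option.some.inj (ho''.2 _ (hlone e he hte k hk F'' hF'' hBB))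
                  refine absurd ⟨?_, ?_, ?_⟩ hc
                  · rw [this]; simp
                  · rw [this, Nat.add_sub_cancel_left, Nat.mul_mod_right]
                  · rw [this, Nat.add_sub_cancel_left, Nat.mul_div_cancel_left _ hp]
                    exact decide_eq_false (not_le.2 (hdig e k hk))
            · have h3 : 2 * (2 * Λ * l ^ 2) = 4 * (Λ * l ^ 2) := by ring
              have a1 := absorb hl Λ 2 3
              have a2 := absorb_zero hl Λ 3
              omega
          · -- the list of the high digits
            cases o with
            | none =>
              refine Sat.mono_cost (.ret (hskip fun e he hte => ?_)) le_rfl (Nat.zero_le _)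
              obtain ⟨B, hB', hP⟩ := ho'.2 rfl
              obtain ⟨F', hF', rfl⟩ := List.mem_map.1 hB'
              obtain ⟨k, hk, hFk⟩ := forall₂_right hFs hF'
              have hkn : k < n := by rw [List.mem_range'_1] at hk; omega
              have := hP.2 e he hte k hkn F' hFk rfl
              simp at this
            | some es =>
              have hes := ho'.1 es rfl
              have hesD : ∀ x ∈ es, x < D := by
                intro x hx
                obtain ⟨B, -, hB'⟩ := forall₂_right hes hx
                exact hB'.1 x rfl
              have heslen : es.length = n - κ := by
                rw [← hes.length_eq, List.length_map, hFslen']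
              -- For a lone term the quotients by p are exactly the digits of e with index at least
              -- κ.
              have hese : ∀ e ∈ loneSet r p, t = (e % p, r.coeff e) → es = (digs D n e).drop κ := by
                intro e he hte
                rw [List.forall₂_map_left_iff] at hes
                have h1 := forall₂_trans (S := fun k x => (digs D n e).getD k 0 = x) hFs hes
                  (fun k hk F' x hF' hx => by
                    have hkn : k < n := by rw [List.mem_range'_1] at hk; omega
                    exact (Option.some.inj (hx.2 e he hte k hkn F' hF' rfl)).symm)
                have h2 := forall₂_map_eq h1 (f := fun k => (digs D n e).getD k 0) (g := id)
                  fun a b h => h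
                rw [List.map_id] at h2
                rw [← h2]
                refine List.ext_getElem ?_ fun i h3 h4 => ?_
                · rw [List.length_map, List.length_range', List.length_drop, length_digs hD0]
                · rw [List.getElem_map, List.getElem_range', List.getElem_drop, one_mul,
                    List.getD_eq_getElem]
              have hzl : (es.zip ((weights D p n).drop κ)).length ≤ n := by
                rw [List.length_zip]; omega
              have hsum : es.sum ≤ n * D := by
                have := List.sum_le_card_nsmul es D fun x hx => (hesD x hx).le
                rw [smul_eq_mul] at this
                exact this.trans (Nat.mul_le_mul_right _ (by omega))
              have hwp : ∀ w ∈ (weights D p n).drop κ, w ≤ p := by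
                intro w hw
                obtain ⟨i, -, rfl⟩ := List.mem_map.1 (List.mem_of_mem_drop hw)
                exact (Nat.mod_lt _ hp).le
              have hvl : len (dotVal es ((weights D p n).drop κ)) ≤ Λ := by
                have h1 := len_mono ((dotVal_le (as := es) hwp).trans (Nat.mul_le_mul_right p hsum))
                have h2 := len_mul (n * D) p
                have h3 := len_mul n D
                omega
              have hpair : ∀ x ∈ es.zip ((weights D p n).drop κ), len x.1 + len x.2 ≤ Λ := by
                rintro ⟨x, w⟩ hx
                have h1 := len_mono (hesD x (List.of_mem_zip hx).1).le
                have h2 := len_mono (hwp w (List.of_mem_zip hx).2)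
                simp only
                omega
              have hdot := dotN_sat hl (A := Λ) (by omega) es ((weights D p n).drop κ) hvl hpair
              change (dotN es ((weights D p n).drop κ)).Sat
                (· = dotVal es ((weights D p n).drop κ)) _ _ at hdot
              have hvmod := dotVal_pow_mod (D := D) (p := p) es κ (n - κ) heslen.le
              rw [← drop_weights] at hvmod
              obtain ⟨v, hv⟩ : ∃ v, v = dotVal es ((weights D p n).drop κ) := ⟨_, rfl⟩
              rw [← hv] at hdot hvl hvmod
              have hbl := len_sub_le u v
              have hlow := digitsVal_spec hD0 κ (u - v)
              -- Splitting digits and weights at κ, u is the D-adic value of the low digits plus the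
              -- contribution v of the high ones; so the subtraction is exact and nothing is left
              -- after κ digits.
              have hve : ∀ e ∈ loneSet r p, t = (e % p, r.coeff e) →
                  v ≤ u ∧ digitsVal D κ (u - v) = ((digs D n e).take κ, 0) := by
                intro e he hte
                have h1 : u = Nat.ofDigits D ((digs D n e).take κ) + v := by
                  rw [hue e he hte, hv, hese e he hte]
                  conv_lhs => rw [← List.take_append_drop κ (digs D n e),
                    ← List.take_append_drop κ (weights D p n)]
                  rw [dotVal_append, take_weights hκn hκ, dotVal_pow, pow_zero, one_mul]
                  · exact List.length_take_le _ _
                  · rw [List.length_take, List.length_take, length_digs hD0, weights,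
                      List.length_map, List.length_range]
                have h2 : ((digs D n e).take κ).length = κ := by
                  rw [List.length_take, length_digs hD0]; omega
                refine ⟨by omega, ?_⟩
                have h3 := digitsVal_ofDigits (D := D) ((digs D n e).take κ) fun d hd =>
                  digs_lt hD0 e d (List.mem_of_mem_take hd)
                rw [h2] at h3
                rw [h1, Nat.add_sub_cancel, h3]
              refine Sat.mono_cost (Sat.bind_eq hdot (Sat.bind_eq (leN_sat _ _)
                (Sat.bind_eq (subN_sat _ _) (Sat.bind_eq (digitsN_sat hl (A := 2 * Λ) (by omega)
                κ (u - v) (by omega)) (r' := 0) (b' := 2 * (n * Λ) + 1) ?_)))) le_rfl ?_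
              · split_ifs with hc
                · obtain ⟨hc1, hc2⟩ := hc
                  have hvu : v ≤ u := by simpa using hc1
                  rw [hc2, mul_zero, add_zero] at hlow
                  refine .mk' ⟨?_, ?_, ?_⟩ le_rfl ?_
                  · intro t' ht'
                    rcases List.mem_append.1 ht' with h | h
                    · exact hS1 t' h
                    · rw [List.mem_singleton.1 h]
                      refine ⟨by rw [List.length_append, hlow.1, heslen]; omega, ?_⟩
                      intro d hd
                      rcases List.mem_append.1 hd with h | h
                      · exact hlow.2.1 d h
                      · exact hesD d h
                  · intro e he hmem
                    rcases List.mem_append.1 hmem with h | h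
                    · exact List.mem_append_left _ (hS2 e he h)
                    · have hte := (List.mem_singleton.1 h).symm
                      refine List.mem_append_right _ ?_
                      rw [(hve e he hte).2, hese e he hte, List.take_append_drop, hte]
                      simp
                  -- The accepted digits represent a number congruent to u modulo p, hence to the
                  -- class of t, whether or not the candidate is a true term.
                  · rw [List.map_append, List.map_append]
                    refine hS3.append ?_
                    rw [List.map_singleton, List.map_singleton]
                    refine List.singleton_sublist.2 (List.mem_singleton.2 ?_)
                    simp only
                    rw [Nat.ofDigits_append, hlow.1, hlow.2.2, ← hup]
                    have h1 : u - v + D ^ κ * Nat.ofDigits D es ≡ u - v + v [MOD p] :=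
                      (Nat.ModEq.refl _).add hvmod.symm
                    rw [Nat.sub_add_cancel hvu] at h1
                    rw [h1]
                  · have h1 := sum_map_le (l := (digitsVal D κ (u - v)).1) (f := len) (c := Λ)
                      fun d hd => (len_mono (hlow.2.1 d hd).le).trans (by omega)
                    have h2 := sum_map_le (l := es) (f := len) (c := Λ)
                      fun d hd => (len_mono (hesD d hd).le).trans (by omega)
                    have h3 : (digitsVal D κ (u - v)).1.length * Λ ≤ n * Λ :=
                      Nat.mul_le_mul_right _ (by omega)
                    have h4 : es.length * Λ ≤ n * Λ := Nat.mul_le_mul_right _ (by omega)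
                    omega
                · refine Sat.mono_cost (.ret (hskip fun e he hte => hc ?_)) le_rfl (Nat.zero_le _)
                  obtain ⟨h1, h2⟩ := hve e he hte
                  exact ⟨decide_eq_true h1, by rw [h2]⟩
              · have h1 := Nat.mul_le_mul_right (Λ * l ^ 3) hzl
                have h2 : κ * (2 * Λ * l ^ 3) ≤ n * (2 * (Λ * l ^ 3)) := by
                  rw [← mul_assoc 2]; exact Nat.mul_le_mul_right _ hκn
                have h3 : n * (4 * (Λ * l ^ 3)) = n * (Λ * l ^ 3) + n * (2 * (Λ * l ^ 3)) +
                  n * (Λ * l ^ 3) := by ring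
                omega
          · rw [List.length_map]; omega
          · rw [List.length_map]
            have := Nat.mul_le_mul_right (Λ * l ^ 3 + 2) (show Fs.length ≤ n by omega)
            omega
      · have a1 := absorb hl (n * Λ) 3 4
        have a2 := absorb_zero hl (n * Λ) 4
        have h1 : Λ ≤ n * Λ := Nat.le_mul_of_pos_left _ hn
        have h2 : n * (Λ * l ^ 3 + 2) = n * Λ * l ^ 3 + 2 * n := by ring
        have h3 : n * (4 * (Λ * l ^ 3)) = 4 * (n * Λ * l ^ 3) := by ring
        have h4 : n * (Λ * l ^ 4) = n * Λ * l ^ 4 := by ring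
        have h5 : n * 1 ≤ n * Λ := Nat.mul_le_mul_left _ (by omega)
        omega
    · rintro M ⟨h1, h2, h3⟩
      have hnd : (ts.map Prod.fst).Nodup := by
        obtain ⟨es, hn, -, rfl⟩ := hts
        rw [List.map_map]
        exact (List.map_id es).symm ▸ hn
      refine ⟨h1, fun e he => h2 e he ?_, ?_, ?_⟩
      · have hc := lone_class hp (dvd_refl p) hts he
        have : (e % p, r.coeff e) ∈ ts.filter fun t => t.1 % p = e % p := by rw [hc]; simp
        exact (List.mem_filter.1 this).1
      · have h4 := hnd.sublist h3
        refine List.Nodup.of_map (f := (· % p)) ?_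
        rw [List.map_map]
        exact h4
      · have := h3.length_le
        rw [List.length_map, List.length_map] at this
        exact this.trans htlen
  · have : T * (1 + n) ≤ T * (2 * n) := Nat.mul_le_mul_left _ (by omega)
    have h2 : T * (2 * n) = 2 * (n * T) := by ring
    omega
  · have h1 := mTerms_cost_arith (T := T) hl hn hT1 (show 3 * l ≤ Λ by omega)
    have h2 := Nat.mul_le_mul_right (l + 1) hcard
    omega

end Candidates

end SparseInterp

namespace SparseInterp

open Cost Polynomial

/-! ### Applying the term test to multivariate candidates -/

section Picking

variable {R : Type*} [CommRing R] {l n : ℕ}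

theorem kronTerm_sat {R : Type*} (hl : 100 ≤ l) {D S : ℕ} (hD : 2 ≤ D) (hS : n * len D ≤ S)
    (hSl : 8 * (S * l) < 2 ^ l) {t : List ℕ × R} (ht : t.1.length = n) (ht' : ∀ d ∈ t.1, d < D) :
    (kronTerm D t).Sat (· = (Nat.ofDigits D t.1, t.2)) 0 (S * l ^ 4 + 1) := by
  have s0 : S ≤ S * l := Nat.le_mul_of_pos_right _ (by omega)
  have h1 : n ≤ n * len D := Nat.le_mul_of_pos_right _ (one_le_len D)
  refine Sat.mono_cost (Sat.bind_eq (evalDigits_sat hl hD t.1 l (by omega) ht' (by rw [ht]; omega))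
    (.ret rfl)) le_rfl ?_
  have h2 : l * (t.1.length * len D * l ^ 3) ≤ S * l ^ 4 := by
    rw [ht]
    calc l * (n * len D * l ^ 3) ≤ l * (S * l ^ 3) := by gcongr
      _ = S * l ^ 4 := by ring
  omega

/-- Unlike in one variable, no comparison with accepted candidates is needed, because all candidates
have distinct Kronecker exponents. The last clause of the loop invariant, that accepted exponents
come from processed candidates, serves to exploit this. -/
theorem pickM_sat (hl : 100 ≤ l) {r : R[X]} {T D S : ℕ} {ps : List ℕ} (hn : 1 ≤ n) (hD : 2 ≤ D)
    (hr0 : r ≠ 0) (hr : ∀ e ∈ r.support, e < D ^ n) (hT : r.support.card ≤ T)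
    (hps : ∀ p ∈ ps, p.Prime) (hnd : ps.Nodup) (hpl : ∀ p ∈ ps, len p ≤ l)
    (hcard : (boundsVal n T D).1 + (boundsVal n T D).2.1 - 1 ≤ ps.length)
    (hS : ps.length ≤ S) (hSl : 8 * (S * l) < 2 ^ l) (hDS : n * len D + 2 ≤ S)
    (hN2 : (boundsVal n T D).2.1 ≤ S) (M : List (List ℕ × R))
    (hM : ∀ t ∈ M, t.1.length = n ∧ ∀ d ∈ t.1, d < D)
    (hMnd : (M.map fun t => Nat.ofDigits D t.1).Nodup) :
    (pickM D ps (images ps r) (boundsVal n T D).2.1 M).Sat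
      (fun s => ∃ es : List ℕ, es.Nodup ∧ (∀ e ∈ es, e ∈ r.support) ∧
        s = es.map (fun e => (digs D n e, r.coeff e)) ∧
        ∀ t ∈ M, t.2 ≠ 0 → r.coeff (Nat.ofDigits D t.1) = t.2 → Nat.ofDigits D t.1 ∈ es)
      (M.length * (S * 2)) (M.length * (S * l ^ 11) + 1) := by
  classical
  rw [pickM]
  have s0 : S ≤ S * l := Nat.le_mul_of_pos_right _ (by omega)
  have a1 := absorb hl S 10 11
  have a2 := absorb_zero hl S 11
  have a4 := absorb hl S 4 11
  have hN2l := len_mono hN2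
  have hN2s := len_small hN2 (by omega) hl
  refine ((Sat.fold_const (r := S * 2) (b := S * l ^ 4 + 1 + (S * l ^ 10 + (2 * l + (S + 1))))
    (fun (pre : List (List ℕ × R)) s =>
      ∃ es : List ℕ, es.Nodup ∧ (∀ e ∈ es, e ∈ r.support) ∧
        s = es.map (fun e => (digs D n e, r.coeff e)) ∧
        (∀ t ∈ pre, t.2 ≠ 0 → r.coeff (Nat.ofDigits D t.1) = t.2 → Nat.ofDigits D t.1 ∈ es) ∧
        ∀ e ∈ es, e ∈ pre.map fun t => Nat.ofDigits D t.1) ?_ ?_).mono_val ?_).mono_cost le_rfl ?_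
  · exact ⟨[], by simp⟩
  · rintro pre t post he s ⟨es, h1, h2, rfl, h3, h4⟩
    obtain ⟨htn, htD⟩ := hM t (by simp [he])
    have hE : Nat.ofDigits D t.1 < D ^ n := by
      rw [← htn]
      exact Nat.ofDigits_lt_base_pow_length (by omega) htD
    have hEl : len (Nat.ofDigits D t.1) ≤ S :=
      ((len_mono hE.le).trans (len_pow D n)).trans hDS
    have htest := term_test_iff (c := t.2) hn hD hr0 hr hT hps hnd hcard hE
    refine Sat.mono_cost (Sat.bind_eq (kronTerm_sat hl hD (by omega) hSl htn htD)
      (Sat.bind_eq (countDrops_sat hl hps hnd hpl hS r (Nat.ofDigits D t.1, t.2) hEl hSl)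
      (Sat.bind_eq (leN_sat _ _) (r' := 0) (b' := S + 1) ?_))) (by omega) ?_
    · by_cases hpass : t.2 ≠ 0 ∧ r.coeff (Nat.ofDigits D t.1) = t.2
      · rw [decide_eq_true (htest.2 hpass), if_pos rfl]
        -- An equal accepted exponent would belong to an earlier candidate, contradicting
        -- distinctness.
        have hnew : Nat.ofDigits D t.1 ∉ es := by
          intro hmem
          have h5 := h4 _ hmem
          rw [he, List.map_append, List.map_cons, List.nodup_append] at hMnd
          exact hMnd.2.2 _ h5 _ (by simp) rfl
        refine .mk' ⟨es ++ [Nat.ofDigits D t.1],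
          List.nodup_append'.2 ⟨h1, by simp, by simpa using hnew⟩, ?_, ?_, ?_, ?_⟩ le_rfl ?_
        · intro e he'
          rcases List.mem_append.1 he' with h | h
          · exact h2 e h
          · rw [List.mem_singleton.1 h, mem_support_iff, hpass.2]
            exact hpass.1
        · have := digs_ofDigits t.1 htD
          rw [htn] at this
          rw [List.map_append, List.map_singleton, this, hpass.2]
        · intro t' ht' hne hco
          rcases List.mem_append.1 ht' with h | h
          · exact List.mem_append_left _ (h3 t' h hne hco)
          · rw [List.mem_singleton.1 h]; simp
        · intro e he'
          rw [List.map_append, List.mem_append]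
          rcases List.mem_append.1 he' with h | h
          · exact .inl (h4 e h)
          · rw [List.mem_singleton.1 h]; simp
        · have := sum_map_le (l := t.1) (f := len) (c := len D) fun d hd => len_mono (htD d hd).le
          rw [htn] at this
          omega
      · rw [decide_eq_false (mt htest.1 hpass), if_neg (by simp)]
        refine Sat.mono_cost (.ret ⟨es, h1, h2, rfl, ?_, ?_⟩) le_rfl (Nat.zero_le _)
        · intro t' ht' hne hco
          rcases List.mem_append.1 ht' with h | h
          · exact h3 t' h hne hco
          · rw [List.mem_singleton.1 h] at hne hco
            exact absurd ⟨hne, hco⟩ hpass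
        · intro e he'
          rw [List.map_append, List.mem_append]
          exact .inl (h4 e he')
    · have hc : (ps.toFinset.filter fun p => t.2 ≠ 0 ∧
          (redMod p r).coeff (Nat.ofDigits D t.1 % p) = t.2).card ≤ S :=
        (Finset.card_filter_le _ _).trans ((List.toFinset_card_le _).trans hS)
      have := len_small hc (by omega) hl
      simp only
      omega
  · rintro s ⟨es, h1, h2, rfl, h3, -⟩
    exact ⟨es, h1, h2, rfl, h3⟩
  · refine Nat.add_le_add_right (Nat.mul_le_mul_left _ ?_) 1
    have a3 := absorb hl 1 1 11
    simp only [one_mul, pow_one] at a3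
    have : l ^ 11 ≤ S * l ^ 11 := Nat.le_mul_of_pos_left _ (by omega)
    omega

end Picking

/-! ### Arithmetic of the cost of one multivariate round -/

section Step

variable {R : Type*} [CommRing R] {l n : ℕ}

/-- W = n T Λ bounds the number of primes up to a constant, and Y = T Λ (T + Λ) is the size of one
univariate call. The factor 1 + n counts these calls; everything else, such as the T W operations of
the term test, is at most n Y. -/
theorem mStep_ring_arith {T Λ W Y L : ℕ} (hl : 100 ≤ l) (hn : 1 ≤ n) (hL : 1 ≤ L) (hΛ : 1 ≤ Λ)
    (hW : W = n * (T * Λ)) (hY : Y = T * Λ * (T + Λ)) :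
    (1 + n) * ((T * Λ * n + L * l ^ 41 * (Λ * Y) + Y) * l ^ 4) + 2 * (n * T) + 20 * (T * W) ≤
      n * ((n * (T * Λ) + L * (Λ * Y)) * l ^ 47) := by
  have h1 : Y ≤ L * (Λ * Y) :=
    (Nat.le_mul_of_pos_left _ hΛ).trans (Nat.le_mul_of_pos_left _ hL)
  have h2 : T * W ≤ n * Y := by
    rw [hW, hY]
    calc T * (n * (T * Λ)) = n * (T * Λ * T) := by ring
      _ ≤ _ := by gcongr; omega
  obtain ⟨A, hA⟩ : ∃ A, A = n * (T * Λ) := ⟨_, rfl⟩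
  obtain ⟨B, hB⟩ : ∃ B, B = L * (Λ * Y) := ⟨_, rfl⟩
  have h3 : T * Λ * n = A := by rw [hA]; ring
  have h4 : L * l ^ 41 * (Λ * Y) = B * l ^ 41 := by rw [hB]; ring
  have h5 : 2 * (n * T) ≤ 2 * A := by
    rw [hA]; gcongr; exact Nat.le_mul_of_pos_right _ hΛ
  rw [h3, h4, ← hA, ← hB]
  rw [← hB] at h1
  have h6 : n * Y ≤ n * B := Nat.mul_le_mul_left _ h1
  have h7 : A ≤ n * A := Nat.le_mul_of_pos_left _ hn
  have a1 := absorb hl A 4 47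
  have a2 := absorb hl B 45 47
  have a3 := absorb hl B 4 47
  have a4 := absorb_zero hl A 47
  have a5 := absorb_zero hl B 47
  have e1 : (A + B * l ^ 41 + Y) * l ^ 4 ≤ A * l ^ 4 + B * l ^ 45 + B * l ^ 4 := by
    calc (A + B * l ^ 41 + Y) * l ^ 4 ≤ (A + B * l ^ 41 + B) * l ^ 4 := by gcongr
      _ = _ := by ring
  have e2 : 100 * ((A + B * l ^ 41 + Y) * l ^ 4) ≤ 3 * ((A + B) * l ^ 47) := by
    have : (A + B) * l ^ 47 = A * l ^ 47 + B * l ^ 47 := by ring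
    omega
  have e3 : (1 + n) * ((A + B * l ^ 41 + Y) * l ^ 4) ≤ 2 * n * ((A + B * l ^ 41 + Y) * l ^ 4) :=
    Nat.mul_le_mul_right _ (by omega)
  have e4 : 100 * (n * (A + B)) ≤ n * ((A + B) * l ^ 47) := by
    have : 100 * (A + B) ≤ (A + B) * l ^ 47 := absorb_zero hl _ 47
    calc _ = n * (100 * (A + B)) := by ring
      _ ≤ _ := by gcongr
  have e5 : 100 * (n * ((A + B * l ^ 41 + Y) * l ^ 4)) ≤ 3 * (n * ((A + B) * l ^ 47)) := by
    calc _ = n * (100 * ((A + B * l ^ 41 + Y) * l ^ 4)) := by ring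
      _ ≤ n * (3 * ((A + B) * l ^ 47)) := by gcongr
      _ = _ := by ring
  have e6 : n * (A + B) = n * A + n * B := by ring
  have e7 : 2 * n * ((A + B * l ^ 41 + Y) * l ^ 4) = 2 * (n * ((A + B * l ^ 41 + Y) * l ^ 4)) := by
    ring
  omega

theorem mStep_bits_arith {T Λ W Y B : ℕ} (hl : 100 ≤ l) (hn : 1 ≤ n) (hT : 1 ≤ T) (hΛ : 3 * l ≤ Λ)
    (hW : W = n * (T * Λ)) (hY : Y = T * Λ * (T + Λ))
    (hB : B ≤ T * Λ * ((T + Λ) * l ^ 2) * l ^ 2 + Y * l ^ 15) :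
    n * (Λ * l ^ 3) + (n * (2 * Λ * l ^ 3) + (3 * (Λ * l ^ 2) + (T * (n * (Λ * l ^ 3) + 2) + 1 +
      (B + ((n * (T * (Λ * l ^ 2 + 2 * Λ + l + 1) + 1 + B + 1) + 1) + (T * n * Λ * l ^ 5 +
      (2 * (4 * W + l) + 2 * (T * (5 * W * l ^ 11) + 1) + 2 * l + (T * (5 * W * l ^ 4 + 2) + 1)))))))) ≤
      n * (Y * l ^ 17) := by
  have hW1 : T * n * Λ = W := by rw [hW]; ring
  have hnΛ : n * Λ ≤ W := by
    rw [hW]; gcongr; exact Nat.le_mul_of_pos_left _ hT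
  have hTW : T * W ≤ n * Y := by
    rw [hW, hY]
    calc T * (n * (T * Λ)) = n * (T * Λ * T) := by ring
      _ ≤ _ := by gcongr; omega
  have hW2 : W ≤ T * W := Nat.le_mul_of_pos_left _ hT
  have hB2 : B ≤ 2 * (Y * l ^ 15) := by
    have : T * Λ * ((T + Λ) * l ^ 2) * l ^ 2 = Y * l ^ 4 := by rw [hY]; ring
    have a := absorb hl Y 4 15
    omega
  obtain ⟨Z, hZ⟩ : ∃ Z, Z = n * Y := ⟨_, rfl⟩
  rw [← hZ] at hTW
  have hnB : n * B ≤ 2 * (Z * l ^ 15) := by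
    calc n * B ≤ n * (2 * (Y * l ^ 15)) := by gcongr
      _ = _ := by rw [hZ]; ring
  have hBn : B ≤ n * B := Nat.le_mul_of_pos_left _ hn
  have hΛ1 : Λ ≤ n * Λ := Nat.le_mul_of_pos_left _ hn
  have hnn : n ≤ n * Λ := Nat.le_mul_of_pos_right _ (by omega)
  have hTn : n * T ≤ W := by
    rw [hW]; gcongr; exact Nat.le_mul_of_pos_right _ (by omega)
  have hT2 : T ≤ n * T := Nat.le_mul_of_pos_left _ hn
  have mono : ∀ X j, X ≤ Z → X * l ^ j ≤ Z * l ^ j := fun X j h => Nat.mul_le_mul_right _ h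
  have e1 : n * (Λ * l ^ 3) ≤ Z * l ^ 3 := by
    rw [← mul_assoc]; exact mono _ _ (by omega)
  have e2 : n * (2 * Λ * l ^ 3) = 2 * (n * (Λ * l ^ 3)) := by ring
  have e3 : Λ * l ^ 2 ≤ Z * l ^ 2 := mono _ _ (by omega)
  have e4 : T * (n * (Λ * l ^ 3) + 2) = W * l ^ 3 + 2 * T := by rw [hW]; ring
  have e5 : n * (T * (Λ * l ^ 2 + 2 * Λ + l + 1) + 1 + B + 1) =
      W * l ^ 2 + 2 * W + n * T * l + n * T + 2 * n + n * B := by rw [hW]; ring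
  have e6 : T * n * Λ * l ^ 5 ≤ Z * l ^ 5 := by rw [hW1]; exact mono _ _ (by omega)
  have e7 : T * (5 * W * l ^ 11) = 5 * (T * W * l ^ 11) := by ring
  have e8 : T * (5 * W * l ^ 4 + 2) = 5 * (T * W * l ^ 4) + 2 * T := by ring
  have e9 : n * T * l ≤ W := by
    rw [hW, mul_assoc]; gcongr; omega
  have m1 := mono W 3 (by omega)
  have m2 := mono W 2 (by omega)
  have m3 := mono (T * W) 11 hTW
  have m4 := mono (T * W) 4 hTW
  have e10 : n * (Y * l ^ 17) = Z * l ^ 17 := by rw [hZ]; ring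
  rw [e2, e4, e5, e7, e8, e10]
  have a2 := absorb hl Z 2 17
  have a3 := absorb hl Z 3 17
  have a4 := absorb hl Z 4 17
  have a5 := absorb hl Z 5 17
  have a11 := absorb hl Z 11 17
  have a15 := absorb hl Z 15 17
  have a0 := absorb_zero hl (100 * Z) 16
  have a17 : 100 * Z * l ^ 16 ≤ Z * l ^ 17 := by
    calc 100 * Z * l ^ 16 = 100 * (Z * l ^ 16) := by ring
      _ ≤ _ := absorb hl Z 16 17
  have b1 : W ≤ Z := by omega
  have b2 : l ≤ Z := by omega
  have b3 : n ≤ Z := by omega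
  have b4 : T ≤ Z := by omega
  clear hB hY hW hZ hW1 hB2 e2 e4 e5 e7 e8 e10 mono
  linarith [Nat.zero_le (Z * l ^ 17)]

end Step

end SparseInterp

namespace SparseInterp

open Cost Polynomial

/-! ### One round of the multivariate algorithm -/

section Multivariate

variable {R : Type*} [CommRing R] {l n : ℕ}

/-- Hypotheses of the multivariate algorithm, with powers of `l` absorbing logarithms. -/
structure MContext (l n T Λ D : ℕ) (Γ : SLP R (Fin n)) : Prop where
  hl : 1594323 ≤ l
  hn : 1 ≤ n
  hT : 1 ≤ T
  hD : 2 ≤ D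
  hΓ : Γ ≠ []
  card : Γ.poly.support.card ≤ T
  degree : Γ.poly.totalDegree < D
  hΛ : len D + 3 * l ≤ Λ
  hnl : len n ≤ l
  small : 100 * (n * (T * Λ) * l) < 2 ^ l
  primes : 2 * Nat.size (4 * (n * (T * Λ))) + 50 ≤ l

namespace MContext

variable {T Λ D : ℕ} {Γ : SLP R (Fin n)} (hs : MContext l n T Λ D Γ)
include hs

theorem uSize : USize l T Λ where
  hl := by have := hs.hl; omega
  one_le := hs.hT
  le := by have := hs.hΛ; omega
  small := by
    refine lt_of_le_of_lt ?_ hs.small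
    exact Nat.mul_le_mul_left 100 (Nat.mul_le_mul_right l (Nat.le_mul_of_pos_left _ hs.hn))
  primes := by
    refine le_trans ?_ hs.primes
    gcongr
    exact Nat.size_le_size (Nat.mul_le_mul_left _ (Nat.le_mul_of_pos_left _ hs.hn))

theorem sum_le {m : Fin n →₀ ℕ} (hm : m ∈ Γ.poly.support) : ∑ i, m i < D := by
  have := MvPolynomial.le_totalDegree hm
  rw [Finsupp.sum_fintype _ _ fun _ => rfl] at this
  exact this.trans_lt hs.degree

theorem lt {m : Fin n →₀ ℕ} (hm : m ∈ Γ.poly.support) (i : Fin n) : m i < D :=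
  (Finset.single_le_sum (f := fun i => m i) (fun _ _ => Nat.zero_le _)
    (Finset.mem_univ i)).trans_lt (hs.sum_le hm)

theorem kron_lt : ∀ e ∈ (kron D Γ.poly).support, e < D ^ n := by
  intro e he
  rw [support_kron fun m hm i => hs.lt hm i] at he
  obtain ⟨m, hm, rfl⟩ := Finset.mem_image.1 he
  rw [← ofDigits_ofFn]
  have := Nat.ofDigits_lt_base_pow_length (b := D) (l := List.ofFn m) (by have := hs.hD; omega)
    (fun d hd => by
      obtain ⟨i, rfl⟩ := List.mem_ofFn.1 hd
      exact hs.lt hm i)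
  rwa [List.length_ofFn] at this

theorem kron_sum : ∀ e ∈ (kron D Γ.poly).support, (digs D n e).sum < D := by
  intro e he
  rw [support_kron fun m hm i => hs.lt hm i] at he
  obtain ⟨m, hm, rfl⟩ := Finset.mem_image.1 he
  rw [digs_ofFn fun i => hs.lt hm i, List.sum_ofFn]
  exact hs.sum_le hm

theorem kron_card : (kron D Γ.poly).support.card ≤ T := card_support_kron_le.trans hs.card

/-- The weights are arbitrary, so that this covers all three kinds of probes; x stands for the
charge for the additional parameters. -/
theorem probe_push_sat {q : ℕ} (a : ℕ → ℕ) (hq : 0 < q) (hql : len q ≤ 2 * l)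
    {x : ℕ} (hx : x ≤ len D + 2 * l) :
    ((probe Γ (fun i => a i.val) q).bind fun g => (⟨g, 0, x⟩ : Cost R[X])).Sat
      (· = redMod q (push (kron D Γ.poly).support
        (fun e => dotVal (digs D n e) ((List.range n).map a)) (kron D Γ.poly).coeff))
      (n + Γ.length * l ^ 41 * q) ((T + Λ) * l ^ 2) := by
  have hl := hs.hl
  refine Sat.mono_cost (Sat.bind_eq (probe_sat hl hq hql _ hs.hΓ hs.card) (.mk ?_)) le_rfl ?_
  · rw [subst_eq_push_kron fun m hm i => hs.lt hm i, ofFn_eq_map_range]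
  · have := hs.hΛ
    have h1 : T * (2 * l + 1) = 2 * (T * l ^ 1) + T := by ring
    have h2 : (T + Λ) * l ^ 2 = T * l ^ 2 + Λ * l ^ 2 := by ring
    have a1 := absorb (l := l) (by omega) T 1 2
    have a2 := absorb_zero (l := l) (by omega) T 2
    have a3 := absorb_zero (l := l) (by omega) Λ 2
    omega

/-- The state is described by the Kronecker exponents `es` of the terms found so far. The
continuation is arbitrary, as in the univariate round. The hypothesis p ≤ D^n guarantees that the
search for κ ends within n steps. -/
theorem step_sat {T₁ : ℕ} {ps : List ℕ} (hps : ∀ p ∈ ps, p.Prime) (hnd : ps.Nodup)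
    (hpl : ∀ p ∈ ps, len p ≤ l) (hpν : ps.length ≤ 4 * (n * (T * Λ)))
    (hN : (boundsVal n T₁ D).2.2 ≤ ps.length) {es : List ℕ} (hes : es.Nodup)
    (hes' : ∀ e ∈ es, e ∈ (kron D Γ.poly).support) {r : R[X]}
    (hrk : r = kron D Γ.poly - listPoly (es.map fun e => (e, (kron D Γ.poly).coeff e)))
    (hr0 : r ≠ 0) (hrT : r.support.card ≤ T₁) (hT₁ : T₁ ≤ T) {p : ℕ} (hp : p ∈ ps)
    (hpD : p ≤ D ^ n) (hmany : 3 * r.support.card ≤ 4 * (redMod p r).support.card)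
    {γ : Type*} {Q : γ → Prop} {r' b' : ℕ}
    (kont : ℕ → List R[X] → List (List ℕ × R) → Cost γ)
    (hkont : ∀ es' : List ℕ, es'.Nodup → (∀ e ∈ es', e ∈ r.support) →
      r.support.card ≤ 2 * es'.length →
      (kont (T₁ - es'.length) (images ps (r - listPoly (es'.map fun e => (e, r.coeff e))))
        (es'.map fun e => (digs D n e, r.coeff e))).Sat Q r' b') :
    ((powersMod D p n 1).bind fun ws =>
      (findExp D p n 1 0).bind fun κ =>
      (mulN D p).bind fun Dp => (mulN 2 Dp).bind fun Dp₂ =>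
      (Cost.map (fun (t : List ℕ × R) => (dotN t.1 ws).bind fun E => Cost.ret (E, t))
        (es.map fun e => (digs D n e, (kron D Γ.poly).coeff e))).bind fun hE =>
      (uiPoly (probeSub Γ D p) (hE.map fun t => (t.1, t.2.2)) T₁ Dp).bind fun F =>
      (Cost.map (fun k =>
        (Cost.map (fun (t : ℕ × (List ℕ × R)) => (mulN p (t.2.1.getD k 0)).bind fun v =>
          (addN t.1 v).bind fun E => ⟨(E, t.2.2), 0, len k⟩) hE).bind fun hk =>
        uiPoly (probeSubAt Γ D p k) hk T₁ Dp₂) (List.range' κ (n - κ))).bind fun Fs =>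
      (mTerms (redMod p r) F Fs p D κ ws).bind fun M =>
      (takeN ((boundsVal n T₁ D).1 + (boundsVal n T₁ D).2.1 - 1) (images ps r)).bind fun fs₁ =>
      (takeN ((boundsVal n T₁ D).1 + (boundsVal n T₁ D).2.1 - 1) ps).bind fun ps₁ =>
      (pickM D ps₁ fs₁ (boundsVal n T₁ D).2.1 M).bind fun s =>
      (subN T₁ s.length).bind fun T₂ =>
      (Cost.map (kronTerm D) s).bind fun sE =>
      (fold (subFromAll ps) (images ps r) sE).bind fun fs₂ => kont T₂ fs₂ s).Sat Q
      (n * ((n * (T * Λ) + Γ.length * (Λ * (T * Λ * (T + Λ)))) * l ^ 47) + r')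
      (n * (T * Λ * (T + Λ) * l ^ 17) + b') := by
  have hu := hs.uSize
  have hps2 := fun q a hq hql x hx => hs.probe_push_sat (q := q) a hq hql (x := x) hx
  have hklt := hs.kron_lt
  have hksum := hs.kron_sum
  have hkcard := hs.kron_card
  obtain ⟨hl', hn, hT, hD, hΓ, -, -, hΛ, hnl, hsmall, -⟩ := hs
  have hl : 100 ≤ l := by omega
  have hmul := mul_lt_two_pow hl
  obtain ⟨W, hW⟩ : ∃ W, W = n * (T * Λ) := ⟨_, rfl⟩
  obtain ⟨Y, hY⟩ : ∃ Y, Y = T * Λ * (T + Λ) := ⟨_, rfl⟩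
  obtain ⟨F₀, hF₀⟩ : ∃ F₀, F₀ = kron D Γ.poly := ⟨_, rfl⟩
  rw [← hW] at hsmall hpν
  rw [← hF₀] at hklt hksum hkcard hes' hrk hps2 ⊢
  have hL : 1 ≤ Γ.length := List.length_pos_iff.2 hΓ
  have hp0 := (hps p hp).pos
  have hppl := hpl p hp
  have lD := one_le_len D
  have hTΛW : T * Λ ≤ W := hW ▸ Nat.le_mul_of_pos_left _ hn
  have hTW : T ≤ W := le_trans (Nat.le_mul_of_pos_right _ (by omega)) hTΛW
  have hΛW : Λ ≤ W := le_trans (Nat.le_mul_of_pos_left _ hT) hTΛW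
  have hWl : W ≤ W * l := Nat.le_mul_of_pos_right _ (by omega)
  have hnΛ : n * len D ≤ n * Λ := Nat.mul_le_mul_left _ (by omega)
  have hnΛW : n * Λ ≤ W := by
    rw [hW]; gcongr; exact Nat.le_mul_of_pos_left _ hT
  have hD0 : 0 < D := by omega
  have hpart : IsPartialTermList (es.map fun e => (e, F₀.coeff e)) F₀ := ⟨es, hes, hes', rfl⟩
  have hrsub : r.support ⊆ F₀.support := hrk ▸ hpart.support_subset
  have hr : ∀ e ∈ r.support, e < D ^ n := fun e he => hklt e (hrsub he)
  have hrsum : ∀ e ∈ r.support, (digs D n e).sum < D := fun e he => hksum e (hrsub he)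
  have heslen : es.length ≤ T := by
    have := hpart.card_add
    rw [List.length_map] at this
    omega
  have hDp : len (D * p) ≤ len D + l := (len_mul D p).trans (by omega)
  have hDp2 : len (2 * (D * p)) ≤ len D + l + 1 := (len_two_mul _).trans (by omega)
  have hDp1 : 2 ≤ D * p := hD.trans (Nat.le_mul_of_pos_right _ hp0)
  -- exponents of the images
  have hUlt : ∀ e ∈ F₀.support, dotVal (digs D n e) (weights D p n) < D * p := by
    intro e he
    refine (dotVal_le (B := p) fun w hw => ?_).trans_lt
      (Nat.mul_lt_mul_of_pos_right (hksum e he) hp0)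
    obtain ⟨i, -, rfl⟩ := List.mem_map.1 hw
    exact (Nat.mod_lt _ hp0).le
  have hUk : ∀ k e, dotVal (digs D n e) (weightsAt D p k n) =
      dotVal (digs D n e) (weights D p n) + p * (digs D n e).getD k 0 := fun k e =>
    dotVal_weightsAt _ (length_digs hD0 e)
  have hdig : ∀ e k, (digs D n e).getD k 0 < D := by
    intro e k
    by_cases hk : k < n
    · rw [List.getD_eq_getElem _ _ (by rwa [length_digs hD0])]
      exact digs_lt hD0 e _ (List.getElem_mem _)
    · rw [List.getD_eq_default _ _ (by rw [length_digs hD0]; omega)]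
      exact hD0
  have hUklt : ∀ k, ∀ e ∈ F₀.support,
      dotVal (digs D n e) (weightsAt D p k n) < 2 * (D * p) := by
    intro k e he
    have h0 : p * (digs D n e).getD k 0 ≤ p * D := Nat.mul_le_mul_left _ (hdig e k).le
    have := hUlt e he
    rw [mul_comm p D] at h0
    rw [hUk]
    omega
  have hT1 : 1 ≤ T₁ := by
    have : 0 < r.support.card := Finset.card_pos.2 (support_nonempty.2 hr0)
    omega
  obtain ⟨-, -, -, -, -, hN12⟩ := boundsVal_spec hn hT1 hD
  have hNpos : (boundsVal n T₁ D).1 ≥ 1 := le_max_left _ _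
  obtain ⟨N₁, hN₁⟩ : ∃ N₁, N₁ = (boundsVal n T₁ D).1 + (boundsVal n T₁ D).2.1 - 1 := ⟨_, rfl⟩
  have hN₁l := len_small (A := 4 * W) (x := N₁) (by omega) (by omega) hl
  have hN₁len : (ps.take N₁).length = N₁ := by rw [List.length_take]; omega
  rw [← hN₁]
  obtain ⟨U, hU⟩ : ∃ U : ℕ → ℕ, U = fun e => dotVal (digs D n e) (weights D p n) := ⟨_, rfl⟩
  obtain ⟨ρ, hρ⟩ : ∃ ρ, ρ = Γ.length * l ^ 41 := ⟨_, rfl⟩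
  rw [← hρ] at hps2
  -- The univariate calls therefore return the images of the remainder r, although the probes see
  -- the whole polynomial f.
  have hsub : ∀ U : ℕ → ℕ, push r.support U r.coeff =
      push F₀.support U F₀.coeff - listPoly (es.map fun e => (U e, F₀.coeff e)) := by
    intro U
    rw [push_sub_listPoly F₀ hes hes', ← hrk]
  -- the univariate calls
  obtain ⟨B, hB⟩ : ∃ B, B = T * Λ * ((T + Λ) * l ^ 2) * l ^ 2 + Y * l ^ 15 := ⟨_, rfl⟩
  obtain ⟨RU, hRU⟩ : ∃ RU, RU = (T * Λ * n + ρ * (Λ * Y) + Y) * l ^ 4 := ⟨_, rfl⟩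
  have hcallF : (uiPoly (probeSub Γ D p) (es.map fun e => (U e, F₀.coeff e)) T₁ (D * p)).Sat
      (IsTermList · (push r.support U r.coeff)) RU B := by
    rw [hRU, hB, hY]
    refine uiPoly_sat hu (g := push F₀.support U F₀.coeff) (fun q hq hql => ?_)
      (by rwa [List.length_map]) ?_ hDp1 (by omega) (hsub U) ?_ hT1 hT₁
      ((card_support_push_le _ _ _).trans hrT)
    · rw [hU]
      exact hps2 q (fun i => D ^ i % p) hq hql _ (by omega)
    · intro t ht
      obtain ⟨e, he, rfl⟩ := List.mem_map.1 ht
      have := len_mono (hUlt e (hes' e he)).le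
      rw [hU]; simp only; omega
    · intro x hx
      obtain ⟨e, he, rfl⟩ := Finset.mem_image.1 (support_push_subset _ _ _ hx)
      rw [hU]
      exact hUlt e (hrsub he)
  have hcallk : ∀ k < n, (uiPoly (probeSubAt Γ D p k) (es.map fun e =>
      (U e + p * (digs D n e).getD k 0, F₀.coeff e)) T₁ (2 * (D * p))).Sat
      (IsTermList · (push r.support (fun e => dotVal (digs D n e) (weightsAt D p k n)) r.coeff))
      RU B := by
    intro k hk
    have hkl := (len_mono hk.le).trans hnl
    have hUk' : (fun e => (U e + p * (digs D n e).getD k 0, F₀.coeff e)) =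
        fun e => (dotVal (digs D n e) (weightsAt D p k n), F₀.coeff e) := by
      funext e
      rw [hUk, hU]
    rw [hRU, hB, hY, hUk']
    refine uiPoly_sat hu (g := push F₀.support (fun e => dotVal (digs D n e) (weightsAt D p k n))
      F₀.coeff) (fun q hq hql => ?_)
      (by rwa [List.length_map]) ?_ (by omega) (by omega) (hsub _) ?_ hT1 hT₁
      ((card_support_push_le _ _ _).trans hrT)
    · exact hps2 q (fun i => if i = k then D ^ i % p + p else D ^ i % p) hq hql _ (by omega)
    · intro t ht
      obtain ⟨e, he, rfl⟩ := List.mem_map.1 ht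
      have := len_mono (hUklt k e (hes' e he)).le
      simp only
      omega
    · intro x hx
      obtain ⟨e, he, rfl⟩ := Finset.mem_image.1 (support_push_subset _ _ _ hx)
      exact hUklt k e (hrsub he)
  have hTl := len_small (A := W) (x := T₁) (by omega) (by omega) hl
  -- selection of the candidates
  have htail : ∀ M : List (List ℕ × R), (∀ t ∈ M, t.1.length = n ∧ ∀ d ∈ t.1, d < D) →
      (∀ e ∈ loneSet r p, (digs D n e, r.coeff e) ∈ M) →
      (M.map fun t => Nat.ofDigits D t.1).Nodup → M.length ≤ T →
      ((takeN N₁ (images ps r)).bind fun fs₁ => (takeN N₁ ps).bind fun ps₁ =>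
      (pickM D ps₁ fs₁ (boundsVal n T₁ D).2.1 M).bind fun s =>
      (subN T₁ s.length).bind fun T₂ =>
      (Cost.map (kronTerm D) s).bind fun sE =>
      (fold (subFromAll ps) (images ps r) sE).bind fun fs₂ => kont T₂ fs₂ s).Sat Q
      (20 * (T * W) + r')
      (2 * (4 * W + l) + 2 * (T * (5 * W * l ^ 11) + 1) + 2 * l + (T * (5 * W * l ^ 4 + 2) + 1) +
        b') := by
    intro M hM1 hM2 hM3 hM4
    have hMr := Nat.mul_le_mul_right (5 * W * 2) hM4
    have hMb := Nat.mul_le_mul_right (5 * W * l ^ 11) hM4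
    have hTr : T * (5 * W * 2) = 10 * (T * W) := by ring
    refine Sat.mono_cost (Sat.bind_eq (takeN_sat _ _) (Sat.bind_eq (takeN_sat _ _)
      (r' := 20 * (T * W) + r') (b' := 2 * (T * (5 * W * l ^ 11) + 1) + 2 * l +
        (T * (5 * W * l ^ 4 + 2) + 1) + b') ?_)) (by omega) ?_
    · rw [images_take]
      refine Sat.mono_cost (Sat.bind (pickM_sat hl (S := 5 * W) hn hD hr0 hr hrT
        (fun q hq => hps q (List.mem_of_mem_take hq)) (hnd.sublist (List.take_sublist _ _))
        (fun q hq => hpl q (List.mem_of_mem_take hq)) (by rw [hN₁len, hN₁]) (by omega)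
        (by rw [show 5 * W * l = 5 * (W * l) by ring]; omega) (by omega) (by omega) M hM1 hM3)
        (r' := 10 * (T * W) + r') (b' := T * (5 * W * l ^ 11) + 1 + 2 * l +
          (T * (5 * W * l ^ 4 + 2) + 1) + b') ?_) (by omega) (by omega)
      rintro s ⟨es', hes1, hes2, rfl, hes3⟩
      -- Every lone exponent gives a candidate that is a true term, and so it is accepted; hence at
      -- least half of the terms are found.
      have hlone : loneSet r p ⊆ es'.toFinset := by
        intro e he
        have he1 := (mem_loneSet.1 he).1
        have := hes3 _ (hM2 e he) (mem_support_iff.1 he1)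
        rw [ofDigits_digs hD0 (hr e he1)] at this
        exact List.mem_toFinset.2 (this rfl)
      have hcard2 : r.support.card ≤ 2 * es'.length :=
        (card_le_two_mul_card_loneSet hp0 hmany).trans (Nat.mul_le_mul_left _
          ((Finset.card_le_card hlone).trans (List.toFinset_card_le _)))
      have hlen : es'.length ≤ T := by
        rw [← List.toFinset_card_of_nodup hes1]
        exact (Finset.card_le_card fun e he => hes2 e (List.mem_toFinset.1 he)).trans
          (hrT.trans hT₁)
      have hsr := Nat.mul_le_mul_right (5 * W * 2) hlen
      have hsb := Nat.mul_le_mul_right (5 * W * l ^ 11) hlen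
      have hsk : es'.length * (5 * W * l ^ 4 + 1 + 1) ≤ T * (5 * W * l ^ 4 + 2) :=
        Nat.mul_le_mul_right _ hlen
      have hlenl := len_small (A := W) (x := es'.length) (by omega) (by omega) hl
      have hk := hkont es' hes1 hes2 hcard2
      have hmapE : (es'.map fun e => (digs D n e, r.coeff e)).map
          (fun t => (Nat.ofDigits D t.1, t.2)) = es'.map fun e => (e, r.coeff e) := by
        rw [List.map_map]
        refine List.map_congr_left fun e he => ?_
        simp only [Function.comp_apply, ofDigits_digs hD0 (hr e (hes2 e he))]
      refine Sat.mono_cost (Sat.bind_eq (subN_sat _ _) (Sat.bind_eq (Sat.map_eq_const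
        (g := fun t => (Nat.ofDigits D t.1, t.2)) (r := 0) (b := 5 * W * l ^ 4 + 1) ?_)
        (r' := 10 * (T * W) + r') (b' := T * (5 * W * l ^ 11) + 1 + b') ?_)) (by omega) ?_
      · intro t ht
        obtain ⟨e, he, rfl⟩ := List.mem_map.1 ht
        exact kronTerm_sat hl hD (n := n) (by omega)
          (by rw [show 5 * W * l = 5 * (W * l) by ring]; omega) (length_digs hD0 e) (digs_lt hD0 e)
      · rw [hmapE]
        refine Sat.mono_cost (Sat.bind_eq (fold_subFromAll_sat hl hps hpl (S := 5 * W) (by omega)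
          (by rw [show 5 * W * l = 5 * (W * l) by ring]; omega) r _ ?_)
          (by rw [List.length_map]; exact hk)) ?_ ?_
        · intro t ht
          obtain ⟨e, he, rfl⟩ := List.mem_map.1 ht
          have := (len_mono (hr e (hes2 e he)).le).trans (len_pow D n)
          simp only
          omega
        · rw [List.length_map]; omega
        · rw [List.length_map]; omega
      · rw [List.length_map]; omega
    · rw [length_images]; omega
  have hlenw : ∀ e ∈ F₀.support, len (U e) ≤ Λ := fun e he => by
    have := len_mono (hUlt e he).le
    rw [hU]; simp only; omega
  have hlen2 : len 2 ≤ 3 := by decide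
  have hΛl : Λ ≤ Λ * l := Nat.le_mul_of_pos_right _ (by omega)
  have hwl : ∀ w ∈ weights D p n, len w ≤ l := by
    intro w hw
    obtain ⟨i, -, rfl⟩ := List.mem_map.1 hw
    exact (len_mono (Nat.mod_lt _ hp0).le).trans hppl
  have hdl : ∀ e, ∀ d ∈ digs D n e, len d ≤ len D := fun e d hd =>
    len_mono (digs_lt hD0 e d hd).le
  have hring := mStep_ring_arith (L := Γ.length) hl hn hL (by omega) hW hY
  have hbits := mStep_bits_arith (B := B) hl hn hT (by omega) hW hY hB.le
  rw [← hρ, ← hRU] at hring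
  have hms : MSize l n T Λ D p := ⟨hl, hD, hn, hT, hp0, hppl, hnl, hΛ, by omega⟩
  have hnκ : ∀ κ, n - κ ≤ n := fun κ => Nat.sub_le _ _
  -- first the work on integers
  refine Sat.mono_cost (Sat.bind_eq (powersMod_sat hl (A := Λ) hp0 (by omega) (by omega) n 1
      (by have := one_le_len p; rw [show len 1 = 2 by decide]; omega))
    (r' := (1 + n) * RU + 2 * (n * T) + 20 * (T * W) + r')
    (b' := n * (2 * Λ * l ^ 3) + (3 * (Λ * l ^ 2) + (T * (n * (Λ * l ^ 3) + 2) + 1 +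
      (B + ((n * (T * (Λ * l ^ 2 + 2 * Λ + l + 1) + 1 + B + 1) + 1) + (T * n * Λ * l ^ 5 +
      (2 * (4 * W + l) + 2 * (T * (5 * W * l ^ 11) + 1) + 2 * l +
        (T * (5 * W * l ^ 4 + 2) + 1))))))) + b') ?_)
    (by rw [← hY]; omega) (by rw [← hY]; omega)
  have hws : ((List.range n).map fun i => 1 * D ^ i % p) = weights D p n := by
    simp only [one_mul, weights]
  rw [hws]
  refine Sat.mono_cost (Sat.bind (findExp_sat hl (A := 2 * Λ) (by omega) (by omega) n 0
      (by rwa [zero_add]) (by simp))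
    (r' := (1 + n) * RU + 2 * (n * T) + 20 * (T * W) + r')
    (b' := 3 * (Λ * l ^ 2) + (T * (n * (Λ * l ^ 3) + 2) + 1 +
      (B + ((n * (T * (Λ * l ^ 2 + 2 * Λ + l + 1) + 1 + B + 1) + 1) + (T * n * Λ * l ^ 5 +
      (2 * (4 * W + l) + 2 * (T * (5 * W * l ^ 11) + 1) + 2 * l +
        (T * (5 * W * l ^ 4 + 2) + 1)))))) + b') ?_) (by omega) (by omega)
  rintro κ ⟨-, hκ, hκn⟩
  rw [zero_add] at hκn
  have hhE : ∀ t ∈ es.map (fun e => (digs D n e, F₀.coeff e)),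
      ((dotN t.1 (weights D p n)).bind fun E => Cost.ret (E, t)).Sat
        (· = (dotVal t.1 (weights D p n), t)) 0 (n * (Λ * l ^ 3) + 1) := by
    intro t ht
    obtain ⟨e, he, rfl⟩ := List.mem_map.1 ht
    have h1 : ((digs D n e).zip (weights D p n)).length ≤ n := by
      rw [List.length_zip, length_digs hD0]; exact min_le_left _ _
    refine Sat.mono_cost (Sat.bind_eq (dotN_sat hl (A := Λ) (by omega) _ _ ?_ ?_) (.ret rfl))
      le_rfl (Nat.add_le_add_right (Nat.mul_le_mul_right _ h1) 1)
    · have := hlenw e (hes' e he)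
      rw [hU] at this
      exact this
    · intro x hx
      have h2 := hdl e _ (List.of_mem_zip hx).1
      have h3 := hwl _ (List.of_mem_zip hx).2
      omega
  have hmapE : (es.map fun e => (digs D n e, F₀.coeff e)).map
      (fun t => (dotVal t.1 (weights D p n), t)) =
      es.map fun e => (U e, (digs D n e, F₀.coeff e)) := by
    rw [List.map_map, hU]; rfl
  have hTmap : es.length * (n * (Λ * l ^ 3) + 1 + 1) ≤ T * (n * (Λ * l ^ 3) + 2) :=
    Nat.mul_le_mul_right _ heslen
  refine Sat.mono_cost (Sat.bind_eq (mulN_sat (l := l) (A := Λ) (by omega) (by omega))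
    (Sat.bind_eq (mulN_sat (l := l) (A := Λ) (by omega) (by omega))
    (Sat.bind_eq (Sat.map_eq_const hhE)
    (r' := (1 + n) * RU + 2 * (n * T) + 20 * (T * W) + r')
    (b' := B + ((n * (T * (Λ * l ^ 2 + 2 * Λ + l + 1) + 1 + B + 1) + 1) + (T * n * Λ * l ^ 5 +
      (2 * (4 * W + l) + 2 * (T * (5 * W * l ^ 11) + 1) + 2 * l +
        (T * (5 * W * l ^ 4 + 2) + 1)))) + b') ?_))) (by rw [List.length_map]; omega)
    (by rw [List.length_map]; omega)
  have hmapF : (es.map fun e => (U e, (digs D n e, F₀.coeff e))).map (fun t => (t.1, t.2.2)) =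
      es.map fun e => (U e, F₀.coeff e) := by
    rw [List.map_map]; rfl
  rw [hmapE, hmapF]
  have hrn : (1 + n) * RU = RU + n * RU := by ring
  refine Sat.mono_cost (Sat.bind hcallF (r' := n * RU + 2 * (n * T) + 20 * (T * W) + r')
    (b' := (n * (T * (Λ * l ^ 2 + 2 * Λ + l + 1) + 1 + B + 1) + 1) + (T * n * Λ * l ^ 5 +
      (2 * (4 * W + l) + 2 * (T * (5 * W * l ^ 11) + 1) + 2 * l +
        (T * (5 * W * l ^ 4 + 2) + 1))) + b') ?_) (by omega) (by omega)
  intro F hF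
  have hcalls : ∀ k ∈ List.range' κ (n - κ),
      ((Cost.map (fun (t : ℕ × (List ℕ × R)) => (mulN p (t.2.1.getD k 0)).bind fun v =>
          (addN t.1 v).bind fun E => ⟨(E, t.2.2), 0, len k⟩)
          (es.map fun e => (U e, (digs D n e, F₀.coeff e)))).bind fun hk =>
        uiPoly (probeSubAt Γ D p k) hk T₁ (2 * (D * p))).Sat
      (fun F => IsTermList F
        (push r.support (fun e => dotVal (digs D n e) (weightsAt D p k n)) r.coeff))
      RU (T * (Λ * l ^ 2 + 2 * Λ + l + 1) + 1 + B) := by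
    intro k hk
    rw [List.mem_range'_1] at hk
    have hkn : k < n := by omega
    have hkl := (len_mono hkn.le).trans hnl
    have h1 : ∀ t ∈ es.map (fun e => (U e, (digs D n e, F₀.coeff e))),
        ((mulN p (t.2.1.getD k 0)).bind fun v =>
          (addN t.1 v).bind fun E => (⟨(E, t.2.2), 0, len k⟩ : Cost (ℕ × R))).Sat
          (· = (t.1 + p * t.2.1.getD k 0, t.2.2)) 0 (Λ * l ^ 2 + (2 * Λ + l)) := by
      intro t ht
      obtain ⟨e, he, rfl⟩ := List.mem_map.1 ht
      have h2 := len_mono (hdig e k).le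
      have h3 := hlenw e (hes' e he)
      have h4 := len_mul p ((digs D n e).getD k 0)
      refine Sat.mono_cost (Sat.bind_eq (mulN_sat (l := l) (A := Λ) ?_ (by omega))
        (Sat.bind_eq (addN_sat _ _) (.mk rfl))) le_rfl ?_
      · simp only; omega
      · simp only; omega
    have h2 : (es.map fun e => (U e, (digs D n e, F₀.coeff e))).map
        (fun t => (t.1 + p * t.2.1.getD k 0, t.2.2)) =
        es.map fun e => (U e + p * (digs D n e).getD k 0, F₀.coeff e) := by
      rw [List.map_map]; rfl
    have h4 : Λ * l ^ 2 + (2 * Λ + l) + 1 = Λ * l ^ 2 + 2 * Λ + l + 1 := by omega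
    have h3 := Nat.mul_le_mul_right (Λ * l ^ 2 + 2 * Λ + l + 1) heslen
    refine Sat.mono_cost (Sat.bind_eq (Sat.map_eq_const h1) (h2 ▸ hcallk k hkn)) ?_ ?_
    · rw [List.length_map]; omega
    · rw [List.length_map, h4]; omega
  have hr1 := Nat.mul_le_mul_right RU (hnκ κ)
  have hr2 := Nat.mul_le_mul_right (T * (Λ * l ^ 2 + 2 * Λ + l + 1) + 1 + B + 1) (hnκ κ)
  refine Sat.mono_cost (Sat.bind (Sat.map_const hcalls)
    (r' := 2 * (n * T) + 20 * (T * W) + r')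
    (b' := T * n * Λ * l ^ 5 +
      (2 * (4 * W + l) + 2 * (T * (5 * W * l ^ 11) + 1) + 2 * l +
        (T * (5 * W * l ^ 4 + 2) + 1)) + b') ?_)
    (by rw [List.length_range']; omega) (by rw [List.length_range']; omega)
  intro Fs hFs
  refine Sat.mono_cost (Sat.bind (mTerms_sat hms hr hrsum (hrT.trans hT₁) hκn hκ (hU ▸ hF) hFs)
    (fun M hM => htail M hM.1 hM.2.1 hM.2.2.1 hM.2.2.2)) (by omega) (by omega)

end MContext

end Multivariate

end SparseInterp

namespace SparseInterp

open Cost Polynomial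

/-! ### The loop of the multivariate algorithm -/

section MultivariateLoop

variable {R : Type*} [CommRing R] {l n T Λ D : ℕ} {Γ : SLP R (Fin n)}

/-- As in one variable, halving bounds the rounds by the binary length of the number of remaining
terms, plus the final pass. The answer is described through a term list of the Kronecker image,
whose exponents are expanded into digits. -/
theorem MContext.mLoop_sat (hs : MContext l n T Λ D Γ) (fuel T₁ : ℕ) (ps : List ℕ)
    (hps : ∀ p ∈ ps, p.Prime) (hnd : ps.Nodup) (hpl : ∀ p ∈ ps, len p ≤ l)
    (hpD : ∀ p ∈ ps, p ≤ D ^ n) (hpν : ps.length ≤ 4 * (n * (T * Λ)))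
    {es : List ℕ} (hes : es.Nodup) (hes' : ∀ e ∈ es, e ∈ (kron D Γ.poly).support) (hT₁ : T₁ ≤ T)
    {r : R[X]}
    (hrk : r = kron D Γ.poly - listPoly (es.map fun e => (e, (kron D Γ.poly).coeff e)))
    (hrT : r.support.card ≤ T₁) (hfuel : r.support.card ≤ fuel)
    (hN : (boundsVal n T₁ D).2.2 ≤ ps.length) :
    (mLoop Γ D ps fuel T₁ (images ps r)
      (es.map fun e => (digs D n e, (kron D Γ.poly).coeff e))).Sat
      (fun s => ∃ L, IsTermList L (kron D Γ.poly) ∧ s = L.map fun t => (digs D n t.1, t.2))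
      ((Nat.size r.support.card + 1) *
        (n * ((n * (T * Λ) + Γ.length * (Λ * (T * Λ * (T + Λ)))) * l ^ 47)))
      ((Nat.size r.support.card + 1) * (n * (T * Λ * (T + Λ) * l ^ 18))) := by
  obtain ⟨V₁, hV₁⟩ : ∃ V, V =
    n * ((n * (T * Λ) + Γ.length * (Λ * (T * Λ * (T + Λ)))) * l ^ 47) := ⟨_, rfl⟩
  obtain ⟨V₂, hV₂⟩ : ∃ V, V = n * (T * Λ * (T + Λ) * l ^ 18) := ⟨_, rfl⟩
  rw [← hV₁, ← hV₂]
  have hdone : ∀ es : List ℕ, es.Nodup → (∀ e ∈ es, e ∈ (kron D Γ.poly).support) →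
      kron D Γ.poly - listPoly (es.map fun e => (e, (kron D Γ.poly).coeff e)) = 0 →
      ∃ L, IsTermList L (kron D Γ.poly) ∧
        (es.map fun e => (digs D n e, (kron D Γ.poly).coeff e)) =
          L.map fun t => (digs D n t.1, t.2) := by
    intro es h1 h2 h3
    refine ⟨_, IsPartialTermList.isTermList ⟨es, h1, h2, rfl⟩ h3, ?_⟩
    rw [List.map_map]
    rfl
  induction fuel generalizing T₁ ps es r with
  | zero =>
    have h0 : r = 0 := by
      rw [← Polynomial.card_support_eq_zero]; omega
    rw [mLoop]
    exact Sat.mono_cost (.ret (hdone es hes hes' (hrk ▸ h0))) (Nat.zero_le _) (Nat.zero_le _)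
  | succ fuel ih =>
    have hl : 100 ≤ l := by have := hs.hl; omega
    have hn := hs.hn
    have hD := hs.hD
    have hΛ := hs.hΛ
    have hT := hs.hT
    have hmul := mul_lt_two_pow hl
    have hpart : IsPartialTermList (es.map fun e => (e, (kron D Γ.poly).coeff e))
      (kron D Γ.poly) := ⟨es, hes, hes', rfl⟩
    obtain ⟨W, hW⟩ : ∃ W, W = n * (T * Λ) := ⟨_, rfl⟩
    obtain ⟨Y, hY⟩ : ∃ Y, Y = T * Λ * (T + Λ) := ⟨_, rfl⟩
    have hsmall := hs.small
    rw [← hW] at hsmall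
    have hTΛW : T * Λ ≤ W := hW ▸ Nat.le_mul_of_pos_left _ hn
    have hTW : T ≤ W := le_trans (Nat.le_mul_of_pos_right _ (by omega)) hTΛW
    have hΛW : Λ ≤ W := le_trans (Nat.le_mul_of_pos_left _ hT) hTΛW
    have hnW : n ≤ W := hW ▸ Nat.le_mul_of_pos_right _ (Nat.mul_pos hT (by omega))
    have hWl : 100 * W ≤ W * l := by rw [mul_comm]; exact Nat.mul_le_mul_left _ hl
    have hTD : n * T₁ * len D ≤ W := by
      rw [hW, mul_assoc]; exact Nat.mul_le_mul_left _ (Nat.mul_le_mul hT₁ (by omega))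
    have hrT₀ : r.support.card ≤ T := hrT.trans hT₁
    have hr : ∀ e ∈ r.support, e < D ^ n :=
      fun e he => hs.kron_lt e (hpart.support_subset (hrk ▸ he))
    obtain ⟨N, hNdef⟩ : ∃ N, N = boundsVal n T₁ D := ⟨_, rfl⟩
    have hNl := len_small (A := 4 * W) (x := N.2.2)
      (by rw [hNdef, hW]; exact hN.trans hpν) (by omega) hl
    have hrl := len_small (A := W) (hrT₀.trans hTW) (by omega) hl
    have hsub : ∀ p ∈ ps.take N.2.2, p ∈ ps := fun p hp => List.mem_of_mem_take hp
    have hlen' : (ps.take N.2.2).length = N.2.2 := by rw [List.length_take, hNdef]; omega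
    have hps' : ∀ p ∈ ps.take N.2.2, p.Prime := fun p hp => hps p (hsub p hp)
    have hnd' : (ps.take N.2.2).Nodup := hnd.sublist (List.take_sublist _ _)
    have hN' : (boundsVal n T₁ D).2.2 ≤ (ps.take N.2.2).length := by rw [hlen', hNdef]
    have hpν' : (ps.take N.2.2).length ≤ 4 * (n * (T * Λ)) := by rw [hlen', hNdef]; omega
    have hpν'' : (ps.take N.2.2).length ≤ 4 * W := by rw [hW]; exact hpν'
    have hV : n * (Y * l ^ 17) + 2 * W * l ^ 6 + 30 * (W * l) ≤ V₂ := by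
      have a4 : W ≤ n * Y := by
        rw [hW, hY]
        exact Nat.mul_le_mul_left _ (Nat.le_mul_of_pos_right _ (by omega))
      have a1 := absorb hl (n * Y) 17 18
      have a2 := absorb hl (n * Y) 6 18
      have a3 := absorb hl (n * Y) 1 18
      have m1 : W * l ^ 6 ≤ n * Y * l ^ 6 := Nat.mul_le_mul_right _ a4
      have m2 : W * l ≤ n * Y * l := Nat.mul_le_mul_right _ a4
      have e1 : 2 * W * l ^ 6 = 2 * (W * l ^ 6) := by ring
      have e2 : n * (Y * l ^ 17) = n * Y * l ^ 17 := by ring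
      have e3 : n * (Y * l ^ 18) = n * Y * l ^ 18 := by ring
      rw [pow_one] at a3
      rw [hV₂, ← hY, e1, e2, e3]
      omega
    obtain ⟨A, hA⟩ : ∃ A, A = 2 * W := ⟨_, rfl⟩
    rw [← hA] at hV
    rw [mLoop]
    refine Sat.mono_cost (Sat.bind_eq (bounds_sat hl (n := n) (T := T₁) (D := D) (A := A)
      (by omega) (by omega) (by omega) (by omega))
      (Sat.bind_eq (takeN_sat _ _) (Sat.bind_eq (takeN_sat _ _)
      (r' := (Nat.size r.support.card + 1) * V₁)
      (b' := 16 * (W * l) + (Nat.size r.support.card * V₂ + n * (Y * l ^ 17))) ?_)))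
      (by omega) ?_
    · rw [← hNdef, images_take]
      refine Sat.mono_cost (Sat.bind (firstMax_sat (fun p hp => (hps' p hp).pos) hrl)
        (r' := (Nat.size r.support.card + 1) * V₁)
        (b' := Nat.size r.support.card * V₂ + n * (Y * l ^ 17)) ?_) (by omega) ?_
      · rintro ⟨p, gp, m⟩ ⟨hm1, hm2⟩
        simp only at hm1 hm2 ⊢
        have hmany : r ≠ 0 → 3 * r.support.card ≤ 4 * m := fun hr0 =>
          firstMax_many hn hD hr0 hr hrT hps' hnd' hN' hm1
        by_cases hm0 : m = 0
        · rw [if_pos hm0]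
          -- Vanishing of all images forces r = 0, by the lower bound on the maximal number of
          -- terms.
          refine Sat.mono_cost (.ret (hdone es hes hes' ?_)) (Nat.zero_le _) (Nat.zero_le _)
          rw [← hrk]
          by_contra hr0
          have h1 := hmany hr0
          have : r.support.card ≠ 0 := by rwa [Ne, Polynomial.card_support_eq_zero]
          omega
        · rw [if_neg hm0]
          obtain ⟨hp, rfl, hmp⟩ := hm2 hm0
          have hr0 : r ≠ 0 := by
            rintro rfl
            rw [redMod_zero] at hmp
            exact hm0 (by simpa using hmp)
          have hcpos : 0 < r.support.card := Finset.card_pos.2 (support_nonempty.2 hr0)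
          have hrec := hs.step_sat hps' hnd' (fun p hp => hpl p (hsub p hp)) hpν' hN' hes hes'
            hrk hr0 hrT hT₁ hp (hpD p (hsub p hp)) (hmp ▸ hmany hr0)
            (Q := fun s => ∃ L, IsTermList L (kron D Γ.poly) ∧
              s = L.map fun t => (digs D n t.1, t.2))
            (r' := Nat.size r.support.card * V₁) (b' := Nat.size r.support.card * V₂)
            (fun T₂ fs₂ s => mLoop Γ D (ps.take N.2.2) fuel T₂ fs₂
              ((es.map fun e => (digs D n e, (kron D Γ.poly).coeff e)) ++ s))
            (fun es' hn' hm' hc2 => by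
              have hc := IsPartialTermList.card_add (f := r) ⟨es', hn', hm', rfl⟩
              rw [List.length_map] at hc
              have hle := size_add_one_le
                (a := (r - listPoly (es'.map fun e => (e, r.coeff e))).support.card)
                hcpos (by omega)
              -- A term of the remainder has not been found before, and its coefficient there is its
              -- coefficient in the Kronecker image.
              have hnot : ∀ e ∈ es', e ∉ es ∧ r.coeff e = (kron D Γ.poly).coeff e := by
                intro e he
                have h1 := mem_support_iff.1 (hm' e he)
                have h2 : r.coeff e = if e ∈ es then 0 else (kron D Γ.poly).coeff e := by
                  rw [hrk]; exact coeff_sub_listPoly _ hes e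
                by_cases h3 : e ∈ es
                · rw [if_pos h3] at h2; exact absurd h2 h1
                · rw [if_neg h3] at h2; exact ⟨h3, h2⟩
              have hm1 : (es'.map fun e => (digs D n e, r.coeff e)) =
                  es'.map fun e => (digs D n e, (kron D Γ.poly).coeff e) :=
                List.map_congr_left fun e he => by rw [(hnot e he).2]
              have hm2 : (es'.map fun e => (e, r.coeff e)) =
                  es'.map fun e => (e, (kron D Γ.poly).coeff e) :=
                List.map_congr_left fun e he => by rw [(hnot e he).2]
              rw [hm1, ← List.map_append]
              refine (ih (T₁ - es'.length) (ps.take N.2.2) hps' hnd'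
                (fun p hp => hpl p (hsub p hp)) (fun p hp => hpD p (hsub p hp)) hpν'
                (es := es ++ es') (List.nodup_append'.2 ⟨hes, hn', fun e h1 h2 =>
                  (hnot e h2).1 h1⟩) ?_ (by omega)
                (r := r - listPoly (es'.map fun e => (e, r.coeff e))) ?_ (by omega) (by omega)
                ?_).mono_cost (Nat.mul_le_mul_right _ hle) (Nat.mul_le_mul_right _ hle)
              · intro e he
                rcases List.mem_append.1 he with h | h
                · exact hes' e h
                · exact hpart.support_subset (hrk ▸ hm' e h)
              · rw [hm2, List.map_append, listPoly_append, hrk, sub_sub]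
              · exact (boundsVal_mono hD (Nat.sub_le _ _)).2.2.trans hN')
          rw [hNdef] at hrec ⊢
          refine hrec.mono_cost ?_ ?_
          · rw [← hV₁, Nat.succ_mul]; omega
          · rw [← hY]; omega
      · have h1 := Nat.mul_le_mul_right (3 * l + 1) hpν''
        have h2 : 4 * W * (3 * l + 1) = 12 * (W * l) + 4 * W := by ring
        omega
    · rw [length_images, Nat.succ_mul (Nat.size _)]
      have h1 : ps.length ≤ 4 * W := by rw [hW]; exact hpν
      have h4 : l ≤ W * l := Nat.le_mul_of_pos_left _ (by omega)
      rw [← hNdef]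
      omega

end MultivariateLoop

end SparseInterp

namespace SparseInterp

open Cost Polynomial

/-! ### Total cost and correctness of the algorithm -/

section MPolySI

variable {R : Type*} [CommRing R] {l n T Λ D : ℕ} {Γ : SLP R (Fin n)}

/-- The initial probes give L W² up to powers of l. The rounds give n L Λ · T Λ (T + Λ) = L n T² Λ²
+ L n T Λ³, of which the first part is at most L W². -/
theorem mPolySI_ring_arith {T Λ L W : ℕ} (hl : 100 ≤ l) (hn : 1 ≤ n) (hT : 1 ≤ T) (hΛ : 1 ≤ Λ)
    (hL : 1 ≤ L) (hW : W = n * (T * Λ)) :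
    4 * W * (n + L * l ^ 41 * (5 * (W * l))) +
      l * (n * ((n * (T * Λ) + L * (Λ * (T * Λ * (T + Λ)))) * l ^ 47)) ≤
      (L * W ^ 2 + L * (n * (T * Λ ^ 3))) * l ^ 49 := by
  obtain ⟨X, hX⟩ : ∃ X, X = L * W ^ 2 + L * (n * (T * Λ ^ 3)) := ⟨_, rfl⟩
  have hnW : n ≤ W := hW ▸ Nat.le_mul_of_pos_right _ (Nat.mul_pos hT (by omega))
  have hWX : L * W ^ 2 ≤ X := by omega
  have h1 : n * W ≤ L * W ^ 2 := by
    calc n * W ≤ W * W := by gcongr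
      _ = 1 * W ^ 2 := by ring
      _ ≤ _ := by gcongr
  have h2 : n * (L * (Λ * (T * Λ * (T + Λ)))) ≤ X := by
    have : n * (L * (Λ * (T * Λ * (T + Λ)))) =
      L * (1 * (n * (T * Λ) * (T * Λ))) + L * (n * (T * Λ ^ 3)) := by ring
    rw [this, hX, hW, pow_two]
    gcongr L * ?_ + _
    calc 1 * (n * (T * Λ) * (T * Λ)) ≤ n * (n * (T * Λ) * (T * Λ)) := by gcongr
      _ = _ := by ring
  have e1 : 4 * W * (n + L * l ^ 41 * (5 * (W * l))) =
      4 * (n * W) + 20 * (L * W ^ 2 * l ^ 42) := by ring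
  have e2 : l * (n * ((n * (T * Λ) + L * (Λ * (T * Λ * (T + Λ)))) * l ^ 47)) =
      (n * W + n * (L * (Λ * (T * Λ * (T + Λ))))) * l ^ 48 := by rw [hW]; ring
  have h3 : (n * W + n * (L * (Λ * (T * Λ * (T + Λ))))) * l ^ 48 ≤ 2 * (X * l ^ 48) := by
    rw [← mul_assoc 2]
    exact Nat.mul_le_mul_right _ (by omega)
  have h4 : L * W ^ 2 * l ^ 42 ≤ X * l ^ 42 := by gcongr
  have a1 := absorb hl X 48 49
  have a2 := absorb hl X 42 49
  have a3 := absorb_zero hl X 49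
  rw [e1, e2, ← hX]
  omega

theorem mPolySI_bits_arith {T Λ W Y : ℕ} (hl : 100 ≤ l) (hn : 1 ≤ n) (hT : 1 ≤ T)
    (hΛ : 3 * l ≤ Λ) (hW : W = n * (T * Λ)) (hY : Y = T * Λ * (T + Λ)) :
    2 * W * l ^ 6 + (4 * W * l ^ 10 + (1 + l * (2 * W * l ^ 3) + (2 * W + l +
      (4 * W * ((T + Λ) * l ^ 2 + 1) + 1 + T * (l + 1) + 1 + (T * (n * (Λ * l ^ 3) + 1) + 1) +
        l * (n * (Y * l ^ 18)))))) ≤ n * (Y * l ^ 20) := by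
  obtain ⟨Z, hZ⟩ : ∃ Z, Z = n * Y := ⟨_, rfl⟩
  have hWT : W * (T + Λ) = Z := by rw [hW, hZ, hY]; ring
  have hWZ : W ≤ Z := hWT ▸ Nat.le_mul_of_pos_right _ (by omega)
  have hTW : T * Λ ≤ W := hW ▸ Nat.le_mul_of_pos_left _ hn
  have hTl : T * (3 * l) ≤ T * Λ := Nat.mul_le_mul_left _ hΛ
  have hl1 : l ≤ T * l := Nat.le_mul_of_pos_left _ hT
  have hT1 : T ≤ T * l := Nat.le_mul_of_pos_right _ (by omega)
  have e0 : T * (3 * l) = 3 * (T * l) := by ring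
  have e1 : 4 * W * ((T + Λ) * l ^ 2 + 1) = 4 * (Z * l ^ 2) + 4 * W := by rw [← hWT]; ring
  have e2 : T * (l + 1) = T * l + T := by ring
  have e3 : T * (n * (Λ * l ^ 3) + 1) = W * l ^ 3 + T := by rw [hW]; ring
  have e4 : l * (n * (Y * l ^ 18)) = Z * l ^ 19 := by rw [hZ]; ring
  have e5 : n * (Y * l ^ 20) = Z * l ^ 20 := by rw [hZ]; ring
  have e6 : l * (2 * W * l ^ 3) = 2 * (W * l ^ 4) := by ring
  have mono : ∀ j, W * l ^ j ≤ Z * l ^ j := fun j => Nat.mul_le_mul_right _ hWZ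
  have m3 := mono 3
  have m4 := mono 4
  have m6 := mono 6
  have m10 := mono 10
  have a0 := absorb_zero hl Z 20
  have a2 := absorb hl Z 2 20
  have a3 := absorb hl Z 3 20
  have a4 := absorb hl Z 4 20
  have a6 := absorb hl Z 6 20
  have a10 := absorb hl Z 10 20
  have a19 := absorb hl Z 19 20
  rw [e1, e2, e3, e4, e5, e6, mul_assoc 2 W, mul_assoc 4 W]
  clear e1 e2 e3 e4 e5 e6 mono hW hY hZ hWT
  omega

/-- With the unreduced weights D^i the new exponent of e is the D-adic value of its digits, that is,
e itself. -/
theorem MContext.probeMod_sat (hs : MContext l n T Λ D Γ) {q : ℕ} (hq : 0 < q)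
    (hql : len q ≤ l) :
    (probeMod Γ D q).Sat (· = redMod q (kron D Γ.poly)) (n + Γ.length * l ^ 41 * q)
      ((T + Λ) * l ^ 2) := by
  have hD : 0 < D := by have := hs.hD; omega
  refine (hs.probe_push_sat (D ^ ·) hq (by omega) (x := len D) (by omega)).mono_val ?_
  rintro _ rfl
  have : push (kron D Γ.poly).support
      (fun e => dotVal (digs D n e) ((List.range n).map fun i => D ^ i)) (kron D Γ.poly).coeff =
      push (kron D Γ.poly).support id (kron D Γ.poly).coeff := by
    refine Finset.sum_congr rfl fun e he => ?_
    have h := dotVal_pow (D := D) (digs D n e) 0 n (length_digs hD e).le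
    rw [ofDigits_digs hD (hs.kron_lt e he), pow_zero, one_mul, ← List.range_eq_range'] at h
    simp only [h, id]
  rw [this, push_support]

theorem MContext.mPolySI_sat (hs : MContext l n T Λ D Γ) :
    (mPolySI Γ T D).Sat (IsSparseForm · Γ.poly)
      ((Γ.length * (n * (T * Λ)) ^ 2 + Γ.length * (n * (T * Λ ^ 3))) * l ^ 49)
      (n * (T * Λ * (T + Λ) * l ^ 20)) := by
  have hl : 100 ≤ l := by have := hs.hl; omega
  have hn := hs.hn
  have hD := hs.hD
  have hΛ := hs.hΛ
  have hT := hs.hT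
  have hmul := mul_lt_two_pow hl
  have hL : 1 ≤ Γ.length := List.length_pos_iff.2 hs.hΓ
  obtain ⟨W, hW⟩ : ∃ W, W = n * (T * Λ) := ⟨_, rfl⟩
  obtain ⟨Y, hY⟩ : ∃ Y, Y = T * Λ * (T + Λ) := ⟨_, rfl⟩
  have hring := mPolySI_ring_arith (L := Γ.length) hl hn hT (by omega) hL hW
  have hbits := mPolySI_bits_arith hl hn hT (by omega) hW hY
  have hsmall := hs.small
  have hprimes := hs.primes
  rw [← hW] at hsmall hprimes
  have hTΛW : T * Λ ≤ W := hW ▸ Nat.le_mul_of_pos_left _ hn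
  have hTW : T ≤ W := le_trans (Nat.le_mul_of_pos_right _ (by omega)) hTΛW
  have hΛW : Λ ≤ W := le_trans (Nat.le_mul_of_pos_left _ hT) hTΛW
  have hnW : n ≤ W := hW ▸ Nat.le_mul_of_pos_right _ (Nat.mul_pos hT (by omega))
  have hWl : 100 * W ≤ W * l := by rw [mul_comm]; exact Nat.mul_le_mul_left _ hl
  have hTD : n * T * len D ≤ W := by
    rw [hW, mul_assoc]; exact Nat.mul_le_mul_left _ (Nat.mul_le_mul_left _ (by omega))
  have hnD : n * len D ≤ W := by
    refine le_trans (Nat.mul_le_mul_right _ ?_) hTD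
    exact Nat.le_mul_of_pos_right _ hT
  obtain ⟨F₀, hF₀⟩ : ∃ F₀, F₀ = kron D Γ.poly := ⟨_, rfl⟩
  have hsparse : ∀ L, IsTermList L (kron D Γ.poly) →
      IsSparseForm (L.map fun t => (digs D n t.1, t.2)) Γ.poly :=
    fun L hL => isSparseForm_of_kron (fun m hm i => hs.lt hm i) hL
  obtain ⟨b1, -, -, -, b2, -⟩ := boundsVal_spec hn hT hD
  obtain ⟨-, -, b3⟩ := boundsVal_le (D := D) hn hT
  obtain ⟨N, hN⟩ : ∃ N, N = (boundsVal n T D).2.2 := ⟨_, rfl⟩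
  rw [← hN] at b2 b3
  obtain ⟨A, hA⟩ : ∃ A, A = 2 * W := ⟨_, rfl⟩
  obtain ⟨ρ, hρ⟩ : ∃ ρ, ρ = Γ.length * l ^ 41 := ⟨_, rfl⟩
  obtain ⟨V₁, hV₁⟩ : ∃ V, V =
    n * ((n * (T * Λ) + Γ.length * (Λ * (T * Λ * (T + Λ)))) * l ^ 47) := ⟨_, rfl⟩
  rw [mPolySI]
  rw [← hρ, ← hV₁] at hring
  refine Sat.mono_cost (Sat.bind_eq (bounds_sat hl (A := A) (by omega) (by omega) (by omega)
    (by omega)) (r' := 4 * W * (n + ρ * (5 * (W * l))) + l * V₁)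
    (b' := N * l ^ 10 + (1 + l * (A * l ^ 3) + (2 * W + l +
      (4 * W * ((T + Λ) * l ^ 2 + 1) + 1 + T * (l + 1) + 1 + (T * (n * (Λ * l ^ 3) + 1) + 1) +
        l * (n * (Y * l ^ 18)))))) ?_) (by rw [← hW]; omega) ?_
  rw [← hN]
  refine Sat.mono_cost (Sat.bind (firstPrimes_sat hl (N := N) (by omega) ?_)
    (r' := 4 * W * (n + ρ * (5 * (W * l))) + l * V₁)
    (b' := 1 + l * (A * l ^ 3) + (2 * W + l +
      (4 * W * ((T + Λ) * l ^ 2 + 1) + 1 + T * (l + 1) + 1 + (T * (n * (Λ * l ^ 3) + 1) + 1) +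
        l * (n * (Y * l ^ 18))))) ?_) (by omega) le_rfl
  · refine le_trans ?_ hprimes
    have := Nat.size_le_size (show N ≤ 4 * W by omega)
    omega
  · intro ps hps
    have hne : ps ≠ [] := by
      rintro rfl
      have := hps.length
      simp at this
      omega
    obtain ⟨q, hq⟩ : ∃ q, q = ps.getLastD 0 := ⟨_, rfl⟩
    have hqm : q ∈ ps := by
      rw [hq, List.getLastD_eq_getLast?, List.getLast?_eq_getLast_of_ne_nil hne]
      exact List.getLast_mem hne
    -- The list is increasing, so its last entry is the largest prime; in the second branch all
    -- primes are therefore below D^n, as the rounds require.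
    have hqmax : ∀ p ∈ ps, p ≤ q := by
      intro p hp
      rw [hq, List.getLastD_eq_getLast?, List.getLast?_eq_getLast_of_ne_nil hne]
      have h1 := hps.pairwise
      rw [← List.dropLast_append_getLast hne, List.pairwise_append] at h1
      rw [← List.dropLast_append_getLast hne] at hp
      rcases List.mem_append.1 hp with h | h
      · exact (h1.2.2 p h _ (by simp)).le
      · exact (List.mem_singleton.1 h).le
    have hpB : ∀ p ∈ ps, p ≤ 5 * (W * l) := by
      intro p hp
      have h1 := hps.le N p (by rwa [List.take_of_length_le hps.length.le])
      have h2 : (N + 1) * l ≤ 5 * W * l := Nat.mul_le_mul_right _ (by omega)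
      rw [mul_assoc] at h2
      omega
    have hDn := len_pow D n
    have hql := hps.len_le q hqm
    have hnl : n < 2 ^ l := by omega
    rw [← hq]
    refine Sat.mono_cost (Sat.bind_eq (powN_sat hl D n l A hnl le_rfl (by omega) (by omega))
      (Sat.bind_eq (leN_sat _ _)
      (r' := 4 * W * (n + ρ * (5 * (W * l))) + l * V₁)
      (b' := 4 * W * ((T + Λ) * l ^ 2 + 1) + 1 + T * (l + 1) + 1 +
        (T * (n * (Λ * l ^ 3) + 1) + 1) + l * (n * (Y * l ^ 18))) ?_)) (by omega) (by omega)
    have hprobe : ∀ p ∈ ps, (probeMod Γ D p).Sat (· = redMod p F₀) (n + ρ * (5 * (W * l)))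
        ((T + Λ) * l ^ 2) := fun p hp => by
      rw [hF₀]
      refine (hs.probeMod_sat (hps.prime p hp).pos (hps.len_le p hp)).mono_cost ?_ le_rfl
      rw [hρ]
      exact Nat.add_le_add_left (Nat.mul_le_mul_left _ (hpB p hp)) _
    have hcard := hs.kron_card
    rw [← hF₀] at hcard
    have h4W : 1 ≤ 4 * W := by omega
    by_cases hbig : D ^ n ≤ q
    · rw [decide_eq_true hbig, if_pos rfl]
      -- All Kronecker exponents are already below D^n ≤ q, so a single probe shows the complete
      -- polynomial.
      have hred : redMod q F₀ = F₀ := by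
        rw [redMod_eq_push (hps.prime q hqm).pos]
        conv_rhs => rw [← push_support F₀]
        refine Finset.sum_congr rfl fun e he => ?_
        rw [hF₀] at he
        simp only [Nat.mod_eq_of_lt ((hs.kron_lt e he).trans_le hbig), id]
      have hel : ∀ e ∈ F₀.support, len e ≤ l := fun e he => by
        rw [hF₀] at he
        exact (len_mono ((hs.kron_lt e he).le.trans hbig)).trans hql
      have hp1 := hprobe q hqm
      rw [hred] at hp1
      have hr1 : 1 * (n + ρ * (5 * (W * l))) ≤ 4 * W * (n + ρ * (5 * (W * l))) :=
        Nat.mul_le_mul_right _ h4W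
      have hb1 : 1 * ((T + Λ) * l ^ 2 + 1) ≤ 4 * W * ((T + Λ) * l ^ 2 + 1) :=
        Nat.mul_le_mul_right _ h4W
      have hc1 := Nat.mul_le_mul_right (l + 1) hcard
      have hc2 := Nat.mul_le_mul_right (n * (Λ * l ^ 3) + 1) hcard
      refine Sat.mono_cost (Sat.bind_eq hp1 (Sat.bind (termList_sat hel)
        (r' := 0) (b' := T * (n * (Λ * l ^ 3) + 1) + 1) fun L hL => ?_)) (by omega) (by omega)
      have hlen := hL.length
      have hmem : ∀ t ∈ L, len t.1 ≤ l := by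
        obtain ⟨es, -, h2, rfl⟩ := hL
        intro t ht
        obtain ⟨e, he, rfl⟩ := List.mem_map.1 ht
        exact hel e ((h2 e).1 he)
      refine (Sat.mono_cost (Sat.map_eq_const (g := fun t => (digs D n t.1, t.2)) (r := 0)
        (b := n * (Λ * l ^ 3)) fun t ht => ?_) (by omega) (by rw [hlen]; omega)).mono_val ?_
      · have := hmem t ht
        exact Sat.mono_cost (Sat.bind_eq (digitsN_sat hl (A := Λ) (by omega) _ _ (by omega))
          (.ret rfl)) le_rfl le_rfl
      · rintro _ rfl
        exact hsparse L (hF₀ ▸ hL)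
    · rw [decide_eq_false hbig, if_neg (by simp)]
      have hlenps : ps.length ≤ 4 * W := by rw [hps.length]; omega
      have hr1 := Nat.mul_le_mul_right (n + ρ * (5 * (W * l))) hlenps
      have hb1 := Nat.mul_le_mul_right ((T + Λ) * l ^ 2 + 1) hlenps
      have hszl : Nat.size F₀.support.card + 1 ≤ l := len_small (A := W) (by omega) (by omega) hl
      have hloop := hs.mLoop_sat T T ps hps.prime (hps.pairwise.imp ne_of_lt) hps.len_le
        (fun p hp => (hqmax p hp).trans (by omega)) (by rw [← hW]; exact hlenps) (es := [])
        List.nodup_nil (by simp) le_rfl (r := F₀) (by rw [List.map_nil, listPoly_nil, sub_zero, hF₀])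
        hcard hcard (by rw [hps.length, hN])
      rw [← hV₁, ← hY] at hloop
      have hv1 := Nat.mul_le_mul_right V₁ hszl
      have hv2 := Nat.mul_le_mul_right (n * (Y * l ^ 18)) hszl
      refine (Sat.mono_cost (Sat.bind_eq (Sat.map_eq_const hprobe) hloop) (by omega)
        (by omega)).mono_val ?_
      rintro _ ⟨L, hL, rfl⟩
      exact hsparse L hL
  · have hNl := Nat.mul_le_mul_right (l ^ 10) (show N ≤ 4 * W by omega)
    rw [← hY]
    rw [← hA] at hbits
    omega

end MPolySI

end SparseInterp

namespace SparseInterp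

open Cost Polynomial

/-! ### Choice of the parameter l, and passage to real logarithms -/

section Parameters

theorem mul_sq_lt_two_pow {s l M : ℕ} (hM : M < 2 ^ s) (hl : 4 * s + 100 ≤ l) :
    400 * (M * l ^ 2) < 2 ^ l := by
  obtain ⟨m, hm⟩ : ∃ m, m = l / 4 := ⟨_, rfl⟩
  have h1 : l ≤ 2 ^ (m + 3) := by
    have : m < 2 ^ m := Nat.lt_two_pow_self
    rw [pow_add]
    omega
  calc 400 * (M * l ^ 2) < 400 * (2 ^ s * l ^ 2) := by
        have : 0 < l ^ 2 := Nat.pow_pos (by omega)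
        gcongr
    _ ≤ 2 ^ 9 * (2 ^ m * (2 ^ (m + 3)) ^ 2) := by gcongr <;> omega
    _ = 2 ^ (3 * m + 15) := by ring
    _ ≤ 2 ^ l := Nat.pow_le_pow_right (by omega) (by omega)

theorem two_mul_size_le {s l M : ℕ} (hM : M < 2 ^ s) (hl : 4 * s + 1000 ≤ l) :
    2 * Nat.size (16 * (M * l)) + 50 ≤ l := by
  obtain ⟨m, hm⟩ : ∃ m, m = l / 16 := ⟨_, rfl⟩
  have h1 : l ≤ 2 ^ (m + 5) := by
    have : m < 2 ^ m := Nat.lt_two_pow_self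
    rw [pow_add]
    omega
  have h2 : Nat.size (16 * (M * l)) ≤ 4 + s + (m + 5) := by
    rw [Nat.size_le]
    calc 16 * (M * l) < 16 * (2 ^ s * l) := by
          have : 0 < l := by omega
          gcongr
      _ ≤ 2 ^ 4 * (2 ^ s * 2 ^ (m + 5)) := by gcongr; omega
      _ = 2 ^ (4 + s + (m + 5)) := by ring
  omega

/-- The parameter l is four times the binary length of n T len D plus 3^13. The factor 4 leaves room
for the factors l that multiply n T len D in the size conditions, and the additive constant serves
the bound for cyclic multiplication and the absorption of constants. -/
theorem MContext.of_size {R : Type*} [CommRing R] {n T D l : ℕ} {Γ : SLP R (Fin n)}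
    (hn : 1 ≤ n) (hΓ : Γ ≠ []) (hT : 1 ≤ T) (hD : 2 ≤ D) (hcard : Γ.poly.support.card ≤ T)
    (hdeg : Γ.poly.totalDegree < D) (hl : l = 4 * Nat.size (n * T * len D) + 1594323) :
    MContext l n T (len D + 3 * l) D Γ := by
  have hM : n * T * len D < 2 ^ Nat.size (n * T * len D) := Nat.lt_size_self _
  have hW : n * (T * (len D + 3 * l)) ≤ 4 * (n * T * len D * l) := by
    have h1 : len D + 3 * l ≤ 4 * (len D * l) := by
      have h2 : len D ≤ len D * l := Nat.le_mul_of_pos_right _ (by omega)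
      have h3 : l ≤ len D * l := Nat.le_mul_of_pos_left _ (one_le_len D)
      omega
    calc n * (T * (len D + 3 * l)) ≤ n * (T * (4 * (len D * l))) := by gcongr
      _ = _ := by ring
  refine ⟨by omega, hn, hT, hD, hΓ, hcard, hdeg, le_rfl, ?_, ?_, ?_⟩
  · have : n ≤ n * T * len D := by
      rw [mul_assoc]
      exact Nat.le_mul_of_pos_right _ (Nat.mul_pos hT (one_le_len D))
    have := Nat.size_le_size this
    rw [len]
    omega
  · refine lt_of_le_of_lt ?_ (mul_sq_lt_two_pow (l := l) hM (by omega))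
    calc 100 * (n * (T * (len D + 3 * l)) * l) ≤ 100 * (4 * (n * T * len D * l) * l) := by gcongr
      _ = _ := by ring
  · refine le_trans ?_ (two_mul_size_le (l := l) hM (by omega))
    have := Nat.size_le_size (show 4 * (n * (T * (len D + 3 * l))) ≤ 16 * (n * T * len D * l) by
      omega)
    omega

theorem size_le_logb {m : ℕ} (hm : 1 ≤ m) : (Nat.size m : ℝ) ≤ Real.logb 2 m + 1 := by
  have h1 : 2 ^ (Nat.size m - 1) ≤ m := by
    have : 0 < Nat.size m := Nat.size_pos.2 hm
    rw [← Nat.lt_size]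
    omega
  have h2 : ((Nat.size m - 1 : ℕ) : ℝ) ≤ Real.logb 2 m := by
    rw [Real.le_logb_iff_rpow_le (by norm_num) (by exact_mod_cast hm), Real.rpow_natCast]
    exact_mod_cast h1
  have h3 : (Nat.size m : ℝ) ≤ ((Nat.size m - 1 : ℕ) : ℝ) + 1 := by
    exact_mod_cast (by omega : Nat.size m ≤ Nat.size m - 1 + 1)
  linarith

theorem one_le_logb {D : ℕ} (hD : 2 ≤ D) : 1 ≤ Real.logb 2 D := by
  rw [Real.le_logb_iff_rpow_le (by norm_num) (by positivity), Real.rpow_one]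
  exact_mod_cast hD

theorem len_le_logb {D : ℕ} (hD : 2 ≤ D) : (len D : ℝ) ≤ 3 * Real.logb 2 D := by
  have h1 := size_le_logb (m := D) (by omega)
  have h2 := one_le_logb hD
  rw [len]
  push_cast
  linarith

theorem half_lt_log {x : ℝ} (hx : 0 ≤ x) : 1 / 2 ≤ Real.log (x + 2) := by
  have h1 : Real.log 2 ≤ Real.log (x + 2) := Real.log_le_log (by norm_num) (by linarith)
  have := Real.log_two_gt_d9
  linarith

/-- The length of n T len D is logarithmic in x, and log (x + 2) ≥ 1/2 turns the additive constants
into multiples of the logarithm: 16 + 2 (1594323 + 4) is less than 3188690. -/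
theorem param_le_log {n T D l : ℕ} (hn : 1 ≤ n) (hT : 1 ≤ T) (hD : 2 ≤ D)
    (hl : l = 4 * Nat.size (n * T * len D) + 1594323) {x : ℝ}
    (hx : n * T * Real.logb 2 D ≤ x) : (l : ℝ) ≤ 3188690 * Real.log (x + 2) := by
  have hd := one_le_logb hD
  have hM1 : 1 ≤ n * T * len D := Nat.mul_pos (Nat.mul_pos hn hT) (one_le_len D)
  have hM : ((n * T * len D : ℕ) : ℝ) ≤ 3 * x := by
    push_cast
    calc (n : ℝ) * T * len D ≤ n * T * (3 * Real.logb 2 D) := by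
          gcongr; exact len_le_logb hD
      _ ≤ 3 * x := by linarith
  have hx0 : 0 ≤ x := le_trans (by positivity) hx
  have hlog := half_lt_log hx0
  have h1 := size_le_logb hM1
  have h2 : Real.logb 2 ((n * T * len D : ℕ) : ℝ) ≤ 4 * Real.log (x + 2) := by
    have h3 : Real.log ((n * T * len D : ℕ) : ℝ) ≤ 2 * Real.log (x + 2) := by
      have : 2 * Real.log (x + 2) = Real.log ((x + 2) ^ 2) := by rw [Real.log_pow]; norm_num
      rw [this]
      refine Real.log_le_log (by exact_mod_cast hM1) (hM.trans ?_)
      nlinarith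
    rw [Real.logb, div_le_iff₀ (by have := Real.log_two_gt_d9; linarith)]
    have := Real.log_two_gt_d9
    nlinarith
  have h4 : (l : ℝ) = 4 * (Nat.size (n * T * len D) : ℝ) + 1594323 := by
    rw [hl]; push_cast; ring
  rw [h4]
  linarith

theorem bits_le_bitBound {n T D l : ℕ} (hD : 2 ≤ D) (hl : 1 ≤ l) :
    ((n * (T * (len D + 3 * l) * (T + (len D + 3 * l)) * l ^ 20) : ℕ) : ℝ) ≤
      216 * bitBound n T D * (l : ℝ) ^ 52 := by
  have hd := one_le_logb hD
  have hl1 : (1 : ℝ) ≤ l := by exact_mod_cast hl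
  have hlen := len_le_logb hD
  rw [bitBound]
  push_cast
  generalize Real.logb 2 D = d at *
  have hΛ : (len D : ℝ) + 3 * l ≤ 6 * (d * l) := by nlinarith
  have h2 : (T : ℝ) ≤ T * l := le_mul_of_one_le_right (by positivity) hl1
  calc (n : ℝ) * (T * (len D + 3 * l) * (T + (len D + 3 * l)) * (l : ℝ) ^ 20)
      ≤ n * (T * (6 * (d * l)) * (6 * (T * l) + 6 * (d * l)) * (l : ℝ) ^ 20) := by
        gcongr
        nlinarith
    _ = 36 * (n * T ^ 2 * d + n * T * d ^ 2) * (l : ℝ) ^ 22 := by ring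
    _ ≤ 216 * (n * T ^ 2 * d + n * T * d ^ 2) * (l : ℝ) ^ 52 := by
        gcongr
        · norm_num
        · norm_num

/-- Since Λ = len D + 3 l ≤ 6 l log D, the three factors Λ give 6^3 = 216 and raise the power of l
from 49 to 52. The bit bound is weakened to the same constants. -/
theorem ring_le_ringBound {L n T D l : ℕ} (hD : 2 ≤ D) (hl : 1 ≤ l) :
    (((L * (n * (T * (len D + 3 * l))) ^ 2 + L * (n * (T * (len D + 3 * l) ^ 3))) * l ^ 49 : ℕ) : ℝ)
      ≤ 216 * ringBound L n T D * (l : ℝ) ^ 52 := by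
  have hd := one_le_logb hD
  have hl1 : (1 : ℝ) ≤ l := by exact_mod_cast hl
  have hlen := len_le_logb hD
  rw [ringBound]
  push_cast
  generalize Real.logb 2 D = d at *
  have hΛ : (len D : ℝ) + 3 * l ≤ 6 * (d * l) := by nlinarith
  calc ((L : ℝ) * (n * (T * (len D + 3 * l))) ^ 2 + L * (n * (T * (len D + 3 * l) ^ 3))) *
        (l : ℝ) ^ 49
      ≤ (L * (n * (T * (6 * (d * l)))) ^ 2 + L * (n * (T * (6 * (d * l)) ^ 3))) * (l : ℝ) ^ 49 := by
        gcongr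
    _ = 36 * (L * n ^ 2 * T ^ 2 * d ^ 2) * (l : ℝ) ^ 51 +
        216 * (L * n * T * d ^ 3) * (l : ℝ) ^ 52 := by ring
    _ ≤ 216 * (L * n ^ 2 * T ^ 2 * d ^ 2) * (l : ℝ) ^ 52 +
        216 * (L * n * T * d ^ 3) * (l : ℝ) ^ 52 := by
        gcongr
        · norm_num
        · norm_num
    _ = _ := by ring

theorem le_bitBound {n T D : ℕ} (hT : 1 ≤ T) (hD : 2 ≤ D) :
    n * T * Real.logb 2 D ≤ bitBound n T D := by
  have hd := one_le_logb hD
  have hT1 : (1 : ℝ) ≤ T := by exact_mod_cast hT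
  have h1 : (0 : ℝ) ≤ n * T * Real.logb 2 D ^ 2 := by positivity
  rw [bitBound]
  have h2 : n * T * Real.logb 2 D * 1 ≤ n * T * Real.logb 2 D * T := by gcongr
  nlinarith

theorem le_ringBound {L n T D : ℕ} (hL : 1 ≤ L) (hD : 2 ≤ D) :
    n * T * Real.logb 2 D ≤ ringBound L n T D := by
  have hd := one_le_logb hD
  have hL1 : (1 : ℝ) ≤ L := by exact_mod_cast hL
  rw [ringBound]
  generalize Real.logb 2 D = d at *
  calc (n : ℝ) * T * d = 1 * (n * T * d ^ 1) := by ring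
    _ ≤ L * (n * T * d ^ 3) := by gcongr; norm_num
    _ = 0 + L * n * T * d ^ 3 := by ring
    _ ≤ _ := by gcongr; positivity

end Parameters

end SparseInterp

theorem theorem5p3 :
    ∃ (C : ℝ) (k : ℕ), ∀ {R : Type*} [CommRing R] {n : ℕ} (Γ : SparseInterp.SLP R (Fin n))
      (T D : ℕ), 1 ≤ n → Γ ≠ [] → 1 ≤ T → 2 ≤ D →
      Γ.poly.support.card ≤ T → Γ.poly.totalDegree < D →
      SparseInterp.IsSparseForm (SparseInterp.mPolySI Γ T D).val Γ.poly ∧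
      ((SparseInterp.mPolySI Γ T D).ring : ℝ) ≤
        C * SparseInterp.ringBound Γ.length n T D *
          Real.log (SparseInterp.ringBound Γ.length n T D + 2) ^ k ∧
      ((SparseInterp.mPolySI Γ T D).bits : ℝ) ≤
        C * SparseInterp.bitBound n T D * Real.log (SparseInterp.bitBound n T D + 2) ^ k := by
  obtain ⟨K, hK⟩ : ∃ K : ℝ, K = 3188690 := ⟨_, rfl⟩
  refine ⟨216 * K ^ 52, 52, ?_⟩
  intro R _ n Γ T D hn hΓ hT hD hcard hdeg
  obtain ⟨l, hl⟩ : ∃ l, l = 4 * Nat.size (n * T * SparseInterp.len D) + 1594323 := ⟨_, rfl⟩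
  obtain ⟨h1, h2, h3⟩ := (SparseInterp.MContext.of_size hn hΓ hT hD hcard hdeg hl).mPolySI_sat
  have hl1 : 1 ≤ l := by omega
  have hd := SparseInterp.one_le_logb hD
  -- Both bounds dominate n T log D, so l is at most K log (x + 2) with x either of them; the power
  -- of l thus becomes the logarithmic factor, with constants independent of all data.
  have key : ∀ x : ℝ, n * T * Real.logb 2 D ≤ x →
      216 * x * (l : ℝ) ^ 52 ≤ 216 * K ^ 52 * x * Real.log (x + 2) ^ 52 := by
    intro x hx
    have hx0 : 0 ≤ x := le_trans (by positivity) hx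
    have h := SparseInterp.param_le_log hn hT hD hl hx
    rw [← hK] at h
    calc 216 * x * (l : ℝ) ^ 52 ≤ 216 * x * (K * Real.log (x + 2)) ^ 52 := by gcongr
      _ = _ := by rw [mul_pow]; ring
  exact ⟨h1,
    ((Nat.cast_le.2 h2).trans (SparseInterp.ring_le_ringBound hD hl1)).trans
      (key _ (SparseInterp.le_ringBound (List.length_pos_iff.2 hΓ) hD)),
    ((Nat.cast_le.2 h3).trans (SparseInterp.bits_le_bitBound hD hl1)).trans
      (key _ (SparseInterp.le_bitBound hT hD))⟩
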